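/- Let $\Bbbk$ be a field of characteristic different from $2$ and let $n\ge 0$. All gradings are by $\mathbb Z\times\mathbb Z/2$ (degree, parity), and $\varphi(y)=(-1)^{|y|}y$ on homogeneous elements. \emph{Algebras.} Let $\mathrm{ONH}_k$ be the odd nilHecke algebra: the graded superalgebra with odd generators $x_1,\dots,x_k$ of degree $2$ and $\tau_1,\dots,\tau_{k-1}$ of degree $-2$, and relations $\tau_i^2=0$, $\tau_i\tau_{i+1}\tau_i=\tau_{i+1}\tau_i\tau_{i+1}$, $x_i\tau_i+\tau_ix_{i+1}=1$, $\tau_ix_i+x_{i+1}\tau_i=1$, $x_ix_j+x_jx_i=0$ ($i\neq j$), $\tau_i\tau_j+\tau_j\tau_i=0$ ($|i-j|>1$), $x_i\tau_j+\tau_jx_i=0$ ($i\neq j,j+1$). Let $A_n$ be the supercommutative graded superalgebra generated by even elements $\chi_1,\dots,\chi_{\lfloor n/2\rfloor}$ with $\chi_j$ of degree $4j$ and an odd element $d$ of degree $2$, with $d^2=0$ and, if $n$ is even, $d\chi_{n/2}=0$ (where $\chi_0=1$). Put $c_{2j}=\chi_j$, $c_{2j+1}=d\chi_j$, $a^n(t)=\sum_{\ell=0}^n(-1)^\ell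 t^\ell c_{n-\ell}$, and define the deformed cyclotomic quotient $\mathrm{ONH}_k^n=(\mathrm{ONH}_k\otimes A_n)/(a^n(x_1))$ (tensor product of superalgebras; $\mathrm{ONH}_0^n=A_n$). \emph{Categories.} For a graded superalgebra $A$ let $\mathrm{sProj}(A)$ be the supercategory of graded left $A$-supermodules that are projective, with all homogeneous morphisms ($f(am)=(-1)^{|f||a|}af(m)$); it is a graded $(Q,\Pi)$-supercategory, with $(QM)_i=M_{i-1}$, with $\Pi$ the parity shift with action twisted by $\varphi$, and with the identity maps $QM\to M$, $Q^{-1}M\to M$, $\Pi M\to M$ of degrees $-1$, $1$, $0$, the last one being odd. (The statement holds both for all projective supermodules and for the finitely generated ones.) Let $\mathcal L(n)$ assign to a weight $\lambda\in\mathbb Z$ the category $\mathrm{sProj}(\mathrm{ONH}_k^n)$ if $\lambda=2k-n$ with $0\le k\le n$, and the zero category otherwise. \emph{Functors.} Along the homomorphisms $\mathrm{ONH}_k^n\to\mathrm{ONH}_{k+1}^n$, $x_i\mapsto x_i$, $\tau_i\mapsto\tau_i$, $\chi_j\mapsto \chi_j$, $d\mapsto d$, let $E_n$ be induction and $F_n$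 restriction. Let $x\colon E_n\Rightarrow E_n$ (odd, of degree $2$) be induced by $h\mapsto\varphi(h)x_{k+1}$ on $\mathrm{ONH}_{k+1}^n$ and let $\tau\colon E_nE_n\Rightarrow E_nE_n$ (odd, of degree $-2$) be induced by $h\mapsto-\varphi(h)\tau_{k+1}$ on $\mathrm{ONH}_{k+2}^n$. \emph{The odd 2-category.} Let $\mathfrak U=\mathfrak U(\mathfrak{sl}_2)$ be the strict graded 2-supercategory with objects $\lambda\in\mathbb Z$, generating 1-morphisms $\mathcal E1_\lambda\colon\lambda\to\lambda+2$, $\mathcal F1_\lambda\colon\lambda\to\lambda-2$, and generating 2-morphisms $x\colon\mathcal E1_\lambda\Rightarrow\mathcal E1_\lambda$ (odd, degree $2$), $\tau\colon\mathcal E\mathcal E1_\lambda\Rightarrow\mathcal E\mathcal E1_\lambda$ (odd, degree $-2$), $\eta\colon1_\lambda\Rightarrow\mathcal F\mathcal E1_\lambda$ (even, degree $1+\lambda$), $\varepsilon\colon\mathcal E\mathcal F1_\lambda\Rightarrow1_\lambda$ (even, degree $1-\lambda$), subject to: the odd nilHecke relations for $x,\tau$; the zigzag relations making $\mathcal F1_{\lambda+2}$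 right dual to $\mathcal E1_\lambda$ with unit $\eta$ and counit $\varepsilon$; and, with $\sigma=(\mathcal F\mathcal E\varepsilon)(\mathcal F\tau\mathcal F)(\eta\mathcal E\mathcal F)\colon\mathcal E\mathcal F1_\lambda\Rightarrow\mathcal F\mathcal E1_\lambda$, the requirement (inverses being adjoined) that $\sigma$ together with the maps $\varepsilon\circ(x^j\mathcal F)$, $0\le j<\lambda$, is an isomorphism $\mathcal E\mathcal F1_\lambda\to\mathcal F\mathcal E1_\lambda\oplus1_\lambda^{\oplus\lambda}$ if $\lambda\ge0$, and $\sigma$ together with the maps $(\mathcal Fx^j)\circ\eta$, $0\le j<-\lambda$, is an isomorphism $\mathcal E\mathcal F1_\lambda\oplus1_\lambda^{\oplus-\lambda}\to\mathcal F\mathcal E1_\lambda$ if $\lambda\le0$. Let $\mathfrak U_{q,\pi}$ be its $(Q,\Pi)$-envelope: its 1-morphisms are the $Q^m\Pi^aG$ with $G$ a 1-morphism of $\mathfrak U$, and its 2-morphisms $Q^m\Pi^aG\Rightarrow Q^{m'}\Pi^{a'}G'$ of degree $(i,b)$ are the 2-morphisms $G\Rightarrow G'$ of $\mathfrak U$ of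 degree $(i+m-m',\,b+a-a')$. \textbf{Theorem.} (1) $\mathrm{ONH}_k^n=0$ for $k>n$. (2) $E_n$ and $F_n$ preserve projective supermodules, so they restrict to superendofunctors of $\mathcal L(n)$, and $(E_n,F_n)$ is an adjoint pair with unit $m\mapsto1\otimes m$ and counit $b\otimes m\mapsto bm$. (3) These data define a 2-representation of $\mathfrak U_{q,\pi}$ on $\mathcal L(n)$: there is a graded 2-superfunctor (pseudofunctor) $\Phi$ from $\mathfrak U_{q,\pi}$ to the graded 2-supercategory of graded $(Q,\Pi)$-supercategories, superfunctors and supernatural transformations which sends the object $\lambda$ to the component of $\mathcal L(n)$ of weight $\lambda$, together with even degree-$0$ isomorphisms $\Phi(\mathcal E1_\lambda)\cong E_n$ and $\Phi(\mathcal F1_{\lambda+2})\cong Q^{1+\lambda}F_n$ under which $\Phi(x)$, $\Phi(\tau)$, $\Phi(\eta)$, $\Phi(\varepsilon)$ become the transformations $x$, $\tau$ above and the unit $1\Rightarrow Q^{1+\lambda}F_nE_n$, $m\mapsto1\otimes m$, and the counit $E_nQ^{1+\lambda}F_n\Rightarrow1$, $b\otimes m\mapsto bm$. -/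

import Mathlib

open CategoryTheory

universe u v w v' w'

namespace OddCat

/-! ## Signs and degrees -/

/-- Degrees are pairs (`ℤ`-degree, parity). -/
abbrev Deg := ℤ × ZMod 2

/-- The sign `(-1)^a`. -/
def sgn (k : Type u) [Field k] (a : ZMod 2) : k := if a = 0 then 1 else -1

theorem sgn_zero (k : Type u) [Field k] : sgn k 0 = 1 := if_pos rfl

theorem sgn_add (k : Type u) [Field k] (a b : ZMod 2) : sgn k (a + b) = sgn k a * sgn k b := by
  have h : ∀ a b : ZMod 2, (a + b = 0 ↔ (a = 0 ↔ b = 0)) := by decide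
  unfold sgn
  by_cases ha : a = 0 <;> by_cases hb : b = 0 <;> simp [h a b, ha, hb]

theorem sgn_mul_self (k : Type u) [Field k] (a : ZMod 2) : sgn k a * sgn k a = 1 := by
  rw [← sgn_add, CharTwo.add_self_eq_zero, sgn_zero]

/-! ## Graded 2-supercategories

A graded superspace is given by the family of its homogeneous components `V_(i,a)`, so that a
category enriched in graded superspaces has morphism spaces `Hom p X Y`, `p : Deg`, and bilinear
compositions `Hom p X Y × Hom q Y Z → Hom (p + q) X Z`.  The operations take the equation between
the degrees as an argument, so that no transport along equalities is needed. -/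

/-- The structure of a strict graded 2-supercategory over `k` on a category `B` of objects and
1-morphisms (compositions are written in diagrammatic order). `Hom2 p f g` is the space of
2-morphisms `f ⇒ g` that are homogeneous of degree and parity `p`; `comp2` is the vertical
composition; `whL f α` and `whR α g` are the horizontal compositions of `α` with the identity of a
1-morphism, applied before, respectively after, the 1-morphisms of `α`. -/
class TwoSupercat (k : Type u) [Field k] (B : Type v) [Category.{w} B] where
  Hom2 : Deg → ∀ {a b : B}, (a ⟶ b) → (a ⟶ b) → Type v'
  [grp : ∀ (p : Deg) {a b : B} (f g : a ⟶ b), AddCommGroup (Hom2 p f g)]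
  [mod : ∀ (p : Deg) {a b : B} (f g : a ⟶ b), Module k (Hom2 p f g)]
  id2 : ∀ {a b : B} (f : a ⟶ b), Hom2 0 f f
  comp2 : ∀ {p q r : Deg} {a b : B} {f g h : a ⟶ b}, p + q = r →
    Hom2 p f g → Hom2 q g h → Hom2 r f h
  whL : ∀ {p : Deg} {a b c : B} (f : a ⟶ b) {g h : b ⟶ c} {s t : a ⟶ c},
    Hom2 p g h → s = f ≫ g → t = f ≫ h → Hom2 p s t
  whR : ∀ {p : Deg} {a b c : B} {f g : a ⟶ b} {s t : a ⟶ c},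
    Hom2 p f g → ∀ h : b ⟶ c, s = f ≫ h → t = g ≫ h → Hom2 p s t
  add_comp2 : ∀ {p q r : Deg} {a b : B} {f g h : a ⟶ b} (e : p + q = r)
    (α β : Hom2 p f g) (γ : Hom2 q g h), comp2 e (α + β) γ = comp2 e α γ + comp2 e β γ
  comp2_add : ∀ {p q r : Deg} {a b : B} {f g h : a ⟶ b} (e : p + q = r)
    (α : Hom2 p f g) (β γ : Hom2 q g h), comp2 e α (β + γ) = comp2 e α β + comp2 e α γ
  smul_comp2 : ∀ {p q r : Deg} {a b : B} {f g h : a ⟶ b} (e : p + q = r) (c : k)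
    (α : Hom2 p f g) (β : Hom2 q g h), comp2 e (c • α) β = c • comp2 e α β
  comp2_smul : ∀ {p q r : Deg} {a b : B} {f g h : a ⟶ b} (e : p + q = r) (c : k)
    (α : Hom2 p f g) (β : Hom2 q g h), comp2 e α (c • β) = c • comp2 e α β
  id2_comp2 : ∀ {p : Deg} {a b : B} {f g : a ⟶ b} (e : 0 + p = p) (α : Hom2 p f g),
    comp2 e (id2 f) α = α
  comp2_id2 : ∀ {p : Deg} {a b : B} {f g : a ⟶ b} (e : p + 0 = p) (α : Hom2 p f g),
    comp2 e α (id2 g) = α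
  assoc2 : ∀ {p q r pq qr s : Deg} {a b : B} {f g h i : a ⟶ b} (e₁ : p + q = pq)
    (e₂ : pq + r = s) (e₃ : q + r = qr) (e₄ : p + qr = s)
    (α : Hom2 p f g) (β : Hom2 q g h) (γ : Hom2 r h i),
    comp2 e₂ (comp2 e₁ α β) γ = comp2 e₄ α (comp2 e₃ β γ)
  whL_add : ∀ {p : Deg} {a b c : B} (f : a ⟶ b) {g h : b ⟶ c} {s t : a ⟶ c} (α β : Hom2 p g h)
    (hs : s = f ≫ g) (ht : t = f ≫ h), whL f (α + β) hs ht = whL f α hs ht + whL f β hs ht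
  whL_smul : ∀ {p : Deg} {a b c : B} (f : a ⟶ b) {g h : b ⟶ c} {s t : a ⟶ c} (x : k)
    (α : Hom2 p g h) (hs : s = f ≫ g) (ht : t = f ≫ h), whL f (x • α) hs ht = x • whL f α hs ht
  whL_id2 : ∀ {a b c : B} (f : a ⟶ b) (g : b ⟶ c) {s : a ⟶ c} (hs : s = f ≫ g),
    whL f (id2 g) hs hs = id2 s
  whL_comp2 : ∀ {p q r : Deg} {a b c : B} (f : a ⟶ b) {g h i : b ⟶ c} {s t z : a ⟶ c}
    (e : p + q = r) (α : Hom2 p g h) (β : Hom2 q h i)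
    (hs : s = f ≫ g) (ht : t = f ≫ h) (hz : z = f ≫ i),
    whL f (comp2 e α β) hs hz = comp2 e (whL f α hs ht) (whL f β ht hz)
  id_whL : ∀ {p : Deg} {a b : B} {g h : a ⟶ b} (α : Hom2 p g h) (hs : g = 𝟙 a ≫ g)
    (ht : h = 𝟙 a ≫ h), whL (𝟙 a) α hs ht = α
  comp_whL : ∀ {p : Deg} {a b c d : B} (f : a ⟶ b) (f' : b ⟶ c) {g h : c ⟶ d} {s t : b ⟶ d}
    {y z : a ⟶ d} (α : Hom2 p g h) (hs : s = f' ≫ g) (ht : t = f' ≫ h) (hy : y = f ≫ s)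
    (hz : z = f ≫ t) (hy' : y = (f ≫ f') ≫ g) (hz' : z = (f ≫ f') ≫ h),
    whL (f ≫ f') α hy' hz' = whL f (whL f' α hs ht) hy hz
  whR_add : ∀ {p : Deg} {a b c : B} {f g : a ⟶ b} {s t : a ⟶ c} (α β : Hom2 p f g) (h : b ⟶ c)
    (hs : s = f ≫ h) (ht : t = g ≫ h), whR (α + β) h hs ht = whR α h hs ht + whR β h hs ht
  whR_smul : ∀ {p : Deg} {a b c : B} {f g : a ⟶ b} {s t : a ⟶ c} (x : k) (α : Hom2 p f g)
    (h : b ⟶ c) (hs : s = f ≫ h) (ht : t = g ≫ h), whR (x • α) h hs ht = x • whR α h hs ht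
  whR_id2 : ∀ {a b c : B} (f : a ⟶ b) (g : b ⟶ c) {s : a ⟶ c} (hs : s = f ≫ g),
    whR (id2 f) g hs hs = id2 s
  whR_comp2 : ∀ {p q r : Deg} {a b c : B} {f g i : a ⟶ b} (h : b ⟶ c) {s t z : a ⟶ c}
    (e : p + q = r) (α : Hom2 p f g) (β : Hom2 q g i)
    (hs : s = f ≫ h) (ht : t = g ≫ h) (hz : z = i ≫ h),
    whR (comp2 e α β) h hs hz = comp2 e (whR α h hs ht) (whR β h ht hz)
  whR_id : ∀ {p : Deg} {a b : B} {f g : a ⟶ b} (α : Hom2 p f g) (hs : f = f ≫ 𝟙 b)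
    (ht : g = g ≫ 𝟙 b), whR α (𝟙 b) hs ht = α
  whR_comp : ∀ {p : Deg} {a b c d : B} {f g : a ⟶ b} (h : b ⟶ c) (h' : c ⟶ d) {s t : a ⟶ c}
    {y z : a ⟶ d} (α : Hom2 p f g) (hs : s = f ≫ h) (ht : t = g ≫ h) (hy : y = s ≫ h')
    (hz : z = t ≫ h') (hy' : y = f ≫ h ≫ h') (hz' : z = g ≫ h ≫ h'),
    whR α (h ≫ h') hy' hz' = whR (whR α h hs ht) h' hy hz
  whL_whR : ∀ {p : Deg} {a b c d : B} (f : a ⟶ b) {g g' : b ⟶ c} (h : c ⟶ d) {s t : b ⟶ d}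
    {s' t' : a ⟶ c} {y z : a ⟶ d} (α : Hom2 p g g') (hs : s = g ≫ h) (ht : t = g' ≫ h)
    (hs' : s' = f ≫ g) (ht' : t' = f ≫ g') (hy : y = f ≫ s) (hz : z = f ≫ t)
    (hy' : y = s' ≫ h) (hz' : z = t' ≫ h),
    whL f (whR α h hs ht) hy hz = whR (whL f α hs' ht') h hy' hz'
  /-- The superinterchange law. -/
  interchange : ∀ {p q r : Deg} {a b c : B} {f f' : a ⟶ b} {g g' : b ⟶ c} {s t t' z : a ⟶ c}
    (e : p + q = r) (e' : q + p = r) (α : Hom2 p f f') (β : Hom2 q g g') (hs : s = f ≫ g)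
    (ht : t = f' ≫ g) (ht' : t' = f ≫ g') (hz : z = f' ≫ g'),
    comp2 e' (whL f β hs ht') (whR α g' ht' hz) =
      sgn k (p.2 * q.2) • comp2 e (whR α g hs ht) (whL f' β ht hz)

attribute [reducible, instance] TwoSupercat.grp TwoSupercat.mod

namespace TwoSupercat

section
variable (k : Type u) [Field k] {B : Type v} [Category.{w} B] [TwoSupercat.{u, v, w, v'} k B]

/-- An even invertible 2-morphism of degree `0`. -/
structure Iso2 {a b : B} (f g : a ⟶ b) where
  hom : Hom2 k 0 f g
  inv : Hom2 k 0 g f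
  hom_inv : comp2 (zero_add 0) hom inv = id2 f
  inv_hom : comp2 (zero_add 0) inv hom = id2 g

/-- Transport of a homogeneous 2-morphism along an equality of degrees. -/
def castDeg {p q : Deg} (e : p = q) {a b : B} {f g : a ⟶ b} (α : Hom2 k p f g) : Hom2 k q f g :=
  e ▸ α

variable {k}

/-- Transport along an equality of degrees, multiplied by a scalar. -/
def tw (c : k) {p q : Deg} (e : p = q) {a b : B} {f g : a ⟶ b} (α : Hom2 k p f g) : Hom2 k q f g :=
  c • castDeg k e α

theorem tw_one {p : Deg} {c : k} (hc : c = 1) (e : p = p) {a b : B} {f g : a ⟶ b}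
    (α : Hom2 k p f g) : tw c e α = α := by
  subst hc; exact one_smul _ _

theorem tw_add {p q : Deg} (c : k) (e : p = q) {a b : B} {f g : a ⟶ b}
    (α β : Hom2 k p f g) : tw c e (α + β) = tw c e α + tw c e β := by
  subst e; exact smul_add _ _ _

theorem tw_smul {p q : Deg} (c : k) (e : p = q) {a b : B} {f g : a ⟶ b} (x : k)
    (α : Hom2 k p f g) : tw c e (x • α) = x • tw c e α := by
  subst e; exact smul_comm _ _ _

theorem tw_comp2 {p q r p' q' r' : Deg} {c c₁ c₂ : k} (hc : c = c₁ * c₂) (e : p + q = r)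
    (ep : p = p') (eq : q = q') (er : r = r') (e' : p' + q' = r') {a b : B} {f g h : a ⟶ b}
    (α : Hom2 k p f g) (β : Hom2 k q g h) :
    tw c er (comp2 e α β) = comp2 e' (tw c₁ ep α) (tw c₂ eq β) := by
  subst ep eq er hc
  simp only [tw, castDeg, smul_comp2, comp2_smul, smul_smul, mul_comm]

theorem tw_whL_whL {p q r : Deg} {c c₁ c₂ : k} (hc : c = c₁ * c₂) (e₁ : p = r) (e₂ : p = q)
    (e₃ : q = r) {a b d : B} (f : a ⟶ b) {g h : b ⟶ d} {s t : a ⟶ d}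
    (α : Hom2 k p g h) (hs : s = f ≫ g) (ht : t = f ≫ h) :
    tw c e₁ (whL f α hs ht) = tw c₁ e₃ (whL f (tw c₂ e₂ α) hs ht) := by
  subst e₂ e₃ hc
  simp only [tw, castDeg, whL_smul, mul_smul]

theorem tw_whR_whR {p q r : Deg} {c c₁ c₂ : k} (hc : c = c₁ * c₂) (e₁ : p = r) (e₂ : p = q)
    (e₃ : q = r) {a b d : B} {f g : a ⟶ b} (h : b ⟶ d) {s t : a ⟶ d}
    (α : Hom2 k p f g) (hs : s = f ≫ h) (ht : t = g ≫ h) :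
    tw c e₁ (whR α h hs ht) = tw c₁ e₃ (whR (tw c₂ e₂ α) h hs ht) := by
  subst e₂ e₃ hc
  simp only [tw, castDeg, whR_smul, mul_smul]

theorem tw_whL_whR {p q q' r : Deg} {c₁ c₂ c₃ c₄ : k} (hc : c₁ * c₂ = c₃ * c₄) (e₁ : p = q)
    (e₂ : q = r) (e₃ : p = q') (e₄ : q' = r) {a b d d' : B} (f : a ⟶ b) {g g' : b ⟶ d}
    (h : d ⟶ d') {s t : b ⟶ d'} {s' t' : a ⟶ d} {y z : a ⟶ d'} (α : Hom2 k p g g')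
    (hs : s = g ≫ h) (ht : t = g' ≫ h) (hs' : s' = f ≫ g) (ht' : t' = f ≫ g') (hy : y = f ≫ s)
    (hz : z = f ≫ t) (hy' : y = s' ≫ h) (hz' : z = t' ≫ h) :
    tw c₁ e₂ (whL f (tw c₂ e₁ (whR α h hs ht)) hy hz) =
      tw c₃ e₄ (whR (tw c₄ e₃ (whL f α hs' ht')) h hy' hz') := by
  subst e₁ e₂ e₃
  simp only [tw, castDeg, whL_smul, whR_smul, smul_smul, hc]
  rw [whL_whR f h α hs ht hs' ht' hy hz hy' hz']

theorem tw_id2_comp2 {p q : Deg} (eq : 0 = q) (e : q + p = p) {a b : B} {f g : a ⟶ b}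
    (α : Hom2 k p f g) : comp2 e (castDeg k eq (id2 f)) α = α := by
  subst eq; exact id2_comp2 _ _

theorem tw_comp2_id2 {p q : Deg} (eq : 0 = q) (e : p + q = p) {a b : B} {f g : a ⟶ b}
    (α : Hom2 k p f g) : comp2 e α (castDeg k eq (id2 g)) = α := by
  subst eq; exact comp2_id2 _ _

theorem tw_whL_id2 {q r : Deg} {c : k} (hc : c = 1) (eq : 0 = q) (e : q = r) (er : 0 = r)
    {a b d : B} (f : a ⟶ b) (g : b ⟶ d) {s : a ⟶ d} (hs : s = f ≫ g) :
    tw c e (whL f (castDeg k eq (id2 g)) hs hs) = castDeg k er (id2 s) := by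
  subst hc eq e; exact (one_smul _ _).trans (whL_id2 _ _ _)

theorem tw_whR_id2 {q r : Deg} {c : k} (hc : c = 1) (eq : 0 = q) (e : q = r) (er : 0 = r)
    {a b d : B} (f : a ⟶ b) (g : b ⟶ d) {s : a ⟶ d} (hs : s = f ≫ g) :
    tw c e (whR (castDeg k eq (id2 f)) g hs hs) = castDeg k er (id2 s) := by
  subst hc eq e; exact (one_smul _ _).trans (whR_id2 _ _ _)

theorem tw_interchange {p p₁ p₂ q q₁ q₂ r : Deg} {c c₁ c₂ c₃ c₄ : k} {a b d : B} {f f' : a ⟶ b}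
    {g g' : b ⟶ d} {s t t' z : a ⟶ d} (ep₁ : p = p₁) (ep₂ : p = p₂) (eq₁ : q = q₁) (eq₂ : q = q₂)
    (hc : c₁ * c₂ * sgn k (p.2 * q.2) = c * (c₃ * c₄))
    (e : p₁ + q₂ = r) (e' : q₁ + p₂ = r) (α : Hom2 k p f f') (β : Hom2 k q g g') (hs : s = f ≫ g)
    (ht : t = f' ≫ g) (ht' : t' = f ≫ g') (hz : z = f' ≫ g') :
    comp2 e' (tw c₁ eq₁ (whL f β hs ht')) (tw c₂ ep₂ (whR α g' ht' hz)) =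
      c • comp2 e (tw c₃ ep₁ (whR α g hs ht)) (tw c₄ eq₂ (whL f' β ht hz)) := by
  subst ep₁ ep₂ eq₁ eq₂
  simp only [tw, castDeg, smul_comp2, comp2_smul, smul_smul]
  rw [interchange e e' α β hs ht ht' hz, smul_smul, mul_comm c₂ c₁, hc, mul_comm c₄ c₃]

end

end TwoSupercat

open TwoSupercat

/-! ## 2-superfunctors -/

/-- A graded 2-superfunctor between strict graded 2-supercategories with object part `obj`; the
coherence maps `mapId` and `mapComp` are even 2-isomorphisms of degree `0`. -/
structure TwoSuperfunctor (k : Type u) [Field k] {B : Type v} [Category.{w} B]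
    [TwoSupercat.{u, v, w} k B] {C : Type v'} [Category.{w'} C] [TwoSupercat.{u, v', w'} k C]
    (obj : B → C) where
  map : ∀ {a b : B}, (a ⟶ b) → (obj a ⟶ obj b)
  map2 : ∀ {p : Deg} {a b : B} {f g : a ⟶ b}, Hom2 k p f g → Hom2 k p (map f) (map g)
  map2_add : ∀ {p : Deg} {a b : B} {f g : a ⟶ b} (α β : Hom2 k p f g),
    map2 (α + β) = map2 α + map2 β
  map2_smul : ∀ {p : Deg} {a b : B} {f g : a ⟶ b} (c : k) (α : Hom2 k p f g),
    map2 (c • α) = c • map2 α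
  map2_id2 : ∀ {a b : B} (f : a ⟶ b), map2 (id2 f : Hom2 k 0 f f) = id2 (map f)
  map2_comp2 : ∀ {p q r : Deg} {a b : B} {f g h : a ⟶ b} (e : p + q = r)
    (α : Hom2 k p f g) (β : Hom2 k q g h), map2 (comp2 e α β) = comp2 e (map2 α) (map2 β)
  mapId : ∀ a : B, Iso2 k (𝟙 (obj a)) (map (𝟙 a))
  mapComp : ∀ {a b c : B} (f : a ⟶ b) (g : b ⟶ c) {fg : a ⟶ c}, fg = f ≫ g →
    Iso2 k (map f ≫ map g) (map fg)
  mapComp_whL : ∀ {p : Deg} {a b c : B} (f : a ⟶ b) {g h : b ⟶ c} {s t : a ⟶ c}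
    (α : Hom2 k p g h) (hs : s = f ≫ g) (ht : t = f ≫ h),
    comp2 (zero_add p) (mapComp f g hs).hom (map2 (whL f α hs ht)) =
      comp2 (add_zero p) (whL (map f) (map2 α) rfl rfl) (mapComp f h ht).hom
  mapComp_whR : ∀ {p : Deg} {a b c : B} {f g : a ⟶ b} (h : b ⟶ c) {s t : a ⟶ c}
    (α : Hom2 k p f g) (hs : s = f ≫ h) (ht : t = g ≫ h),
    comp2 (zero_add p) (mapComp f h hs).hom (map2 (whR α h hs ht)) =
      comp2 (add_zero p) (whR (map2 α) (map h) rfl rfl) (mapComp g h ht).hom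
  mapComp_assoc : ∀ {a b c d : B} (f : a ⟶ b) (g : b ⟶ c) (h : c ⟶ d) {fg : a ⟶ c} {gh : b ⟶ d}
    {fgh : a ⟶ d} (e₁ : fg = f ≫ g) (e₂ : gh = g ≫ h) (e₃ : fgh = fg ≫ h) (e₄ : fgh = f ≫ gh),
    comp2 (zero_add 0) (whR (mapComp f g e₁).hom (map h)
        (Category.assoc (map f) (map g) (map h)).symm rfl) (mapComp fg h e₃).hom =
      comp2 (zero_add 0) (whL (map f) (mapComp g h e₂).hom rfl rfl) (mapComp f gh e₄).hom
  mapComp_id_left : ∀ {a b : B} (f : a ⟶ b) (e : f = 𝟙 a ≫ f),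
    comp2 (zero_add 0) (whR (mapId a).hom (map f) (Category.id_comp (map f)).symm rfl)
      (mapComp (𝟙 a) f e).hom = id2 (map f)
  mapComp_id_right : ∀ {a b : B} (f : a ⟶ b) (e : f = f ≫ 𝟙 b),
    comp2 (zero_add 0) (whL (map f) (mapId b).hom (Category.comp_id (map f)).symm rfl)
      (mapComp f (𝟙 b) e).hom = id2 (map f)

/-- Given 2-isomorphisms `Φ(f) ≅ f'` and `Φ(g) ≅ g'`, the induced 2-isomorphism from
`Φ(f ≫ g)` to `f' ≫ g'`. -/
def TwoSuperfunctor.pair {k : Type u} [Field k] {B : Type v} [Category.{w} B]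
    [TwoSupercat.{u, v, w} k B] {C : Type v'} [Category.{w'} C] [TwoSupercat.{u, v', w'} k C]
    {obj : B → C} (Φ : TwoSuperfunctor k obj) {a b c : B} {f : a ⟶ b} {g : b ⟶ c} {fg : a ⟶ c}
    (e : fg = f ≫ g) {f' : obj a ⟶ obj b} {g' : obj b ⟶ obj c} (α : Iso2 k (Φ.map f) f')
    (β : Iso2 k (Φ.map g) g') : Hom2 k 0 (Φ.map fg) (f' ≫ g') :=
  comp2 (zero_add 0) (Φ.mapComp f g e).inv
    (comp2 (zero_add 0) (whR α.hom (Φ.map g) rfl rfl) (whL f' β.hom rfl rfl))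

/-! ## The `(Q, Π)`-envelope -/

/-- The objects of the `(Q, Π)`-envelope are the objects of `B`. -/
structure Envelope (B : Type v) where
  as : B

/-- A 1-morphism `Q^m Π^a F` of the `(Q, Π)`-envelope, with `shift = (m, a)` and `mor = F`. -/
@[ext]
structure EnvHom {B : Type v} [Category.{w} B] (a b : Envelope B) where
  shift : Deg
  mor : a.as ⟶ b.as

instance {B : Type v} [Category.{w} B] : Category (Envelope B) where
  Hom a b := EnvHom a b
  id a := ⟨0, 𝟙 a.as⟩
  comp f g := ⟨f.shift + g.shift, f.mor ≫ g.mor⟩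
  id_comp f := EnvHom.ext (zero_add _) (Category.id_comp _)
  comp_id f := EnvHom.ext (add_zero _) (Category.comp_id _)
  assoc f g h := EnvHom.ext (add_assoc _ _ _) (Category.assoc _ _ _)

theorem Envelope.shift_id {B : Type v} [Category.{w} B] (a : Envelope B) :
    EnvHom.shift (𝟙 a) = 0 := rfl

theorem Envelope.shift_comp {B : Type v} [Category.{w} B] {a b c : Envelope B} (f : a ⟶ b)
    (g : b ⟶ c) {s : a ⟶ c} (h : s = f ≫ g) :
    EnvHom.shift s = EnvHom.shift f + EnvHom.shift g :=
  congrArg EnvHom.shift h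

theorem Envelope.mor_comp {B : Type v} [Category.{w} B] {a b c : Envelope B} (f : a ⟶ b)
    (g : b ⟶ c) {s : a ⟶ c} (h : s = f ≫ g) :
    EnvHom.mor s = EnvHom.mor f ≫ EnvHom.mor g :=
  congrArg EnvHom.mor h

/-- The 2-morphisms `x_{m,a}^{n,b} : Q^m Π^a F ⇒ Q^n Π^b G` of degree `p` in the envelope are the
2-morphisms `x : F ⇒ G` of degree `p + (m, a) - (n, b)`. -/
def EnvHom2 (k : Type u) [Field k] {B : Type v} [Category.{w} B] [TwoSupercat.{u, v, w, v'} k B]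
    (p : Deg) {a b : Envelope B} (f g : a ⟶ b) : Type v' :=
  Hom2 k (p + EnvHom.shift f - EnvHom.shift g) (EnvHom.mor f) (EnvHom.mor g)

section
variable (k : Type u) [Field k] {B : Type v} [Category.{w} B] [TwoSupercat.{u, v, w, v'} k B]

instance (p : Deg) {a b : Envelope B} (f g : a ⟶ b) : AddCommGroup (EnvHom2 k p f g) :=
  inferInstanceAs (AddCommGroup (Hom2 k _ _ _))

instance (p : Deg) {a b : Envelope B} (f g : a ⟶ b) : Module k (EnvHom2 k p f g) :=
  inferInstanceAs (Module k (Hom2 k _ _ _))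

theorem env_whL_deg {a b c : Envelope B} (p : Deg) (f : a ⟶ b) (g h : b ⟶ c) {s t : a ⟶ c}
    (hs : s = f ≫ g) (ht : t = f ≫ h) :
    p + EnvHom.shift g - EnvHom.shift h = p + EnvHom.shift s - EnvHom.shift t := by
  rw [Envelope.shift_comp f g hs, Envelope.shift_comp f h ht]; abel

theorem env_whR_deg {a b c : Envelope B} (p : Deg) (f g : a ⟶ b) (h : b ⟶ c) {s t : a ⟶ c}
    (hs : s = f ≫ h) (ht : t = g ≫ h) :
    p + EnvHom.shift f - EnvHom.shift g = p + EnvHom.shift s - EnvHom.shift t := by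
  rw [Envelope.shift_comp f h hs, Envelope.shift_comp g h ht]; abel

/-- The whiskerings follow the rule
`y_c^d · x_a^b = (-1)^(c|x| + b|y| + ac + bc) (y · x)_(a+c)^(b+d)`
for the horizontal composition of `x` followed by `y`, in the cases `y = 1` and `x = 1`. -/
instance instEnvelope : TwoSupercat.{u, v, w, v'} k (Envelope B) where
  Hom2 p _ _ f g := EnvHom2 k p f g
  id2 f := castDeg k (show (0 : Deg) = 0 + EnvHom.shift f - EnvHom.shift f by abel)
    (id2 (EnvHom.mor f))
  comp2 {p q r _ _ f g h} e α β :=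
    comp2 (f := EnvHom.mor f) (g := EnvHom.mor g) (h := EnvHom.mor h)
      (show (p + EnvHom.shift f - EnvHom.shift g) + (q + EnvHom.shift g - EnvHom.shift h) =
        r + EnvHom.shift f - EnvHom.shift h by rw [← e]; abel) α β
  whL {p _ _ _} f {g h _ _} α hs ht :=
    tw (sgn k ((EnvHom.shift f).2 * (p + EnvHom.shift g - EnvHom.shift h).2))
      (env_whL_deg p f g h hs ht)
      (whL (EnvHom.mor f) (g := EnvHom.mor g) (h := EnvHom.mor h) α
        (Envelope.mor_comp _ _ hs) (Envelope.mor_comp _ _ ht))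
  whR {p _ _ _ f g _ _} α h hs ht :=
    tw (sgn k ((EnvHom.shift h).2 * p.2))
      (env_whR_deg p f g h hs ht)
      (whR (f := EnvHom.mor f) (g := EnvHom.mor g) α (EnvHom.mor h)
        (Envelope.mor_comp _ _ hs) (Envelope.mor_comp _ _ ht))
  add_comp2 _ α β γ := add_comp2 _ _ _ _
  comp2_add _ α β γ := comp2_add _ _ _ _
  smul_comp2 _ c α β := smul_comp2 _ _ _ _
  comp2_smul _ c α β := comp2_smul _ _ _ _
  id2_comp2 {p _ _ f g} _ α := tw_id2_comp2 (p := p + EnvHom.shift f - EnvHom.shift g) _ _ α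
  comp2_id2 {p _ _ f g} _ α := tw_comp2_id2 (p := p + EnvHom.shift f - EnvHom.shift g) _ _ α
  assoc2 _ _ _ _ α β γ := assoc2 _ _ _ _ _ _ _
  whL_add f _ _ _ _ α β hs ht := (congrArg _ (whL_add _ _ _ _ _)).trans (tw_add _ _ _ _)
  whL_smul f _ _ _ _ x α hs ht := (congrArg _ (whL_smul _ _ _ _ _)).trans (tw_smul _ _ _ _)
  whL_id2 f g s hs := tw_whL_id2 (by simp [sgn_zero]) _ _ _ _ _ _
  whL_comp2 {p q r _ _ _} f g h i _ _ _ e α β hs ht hz :=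
    (congrArg _ (whL_comp2 _ _ _ _ _ (Envelope.mor_comp _ _ ht) _)).trans
      (tw_comp2 (by
        rw [← sgn_add, ← mul_add, ← Prod.snd_add]
        congr 3
        rw [← e]; abel) _ _ _ _ _ _ _)
  id_whL α hs ht := (congrArg _ (id_whL _ _ _)).trans
    (tw_one (by rw [Envelope.shift_id]; simp [sgn_zero]) _ _)
  comp_whL {p _ _ _ _} f f' g h s t _ _ α hs ht hy hz hy' hz' :=
    (congrArg _ (comp_whL _ _ _ (Envelope.mor_comp _ _ hs) (Envelope.mor_comp _ _ ht)
      (Envelope.mor_comp _ _ hy) (Envelope.mor_comp _ _ hz) _ _)).trans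
    (tw_whL_whL (by
      rw [← sgn_add, ← env_whL_deg p f' g h hs ht, ← add_mul]; rfl) _ _ _ _ _ _ _)
  whR_add α β h hs ht := (congrArg _ (whR_add _ _ _ _ _)).trans (tw_add _ _ _ _)
  whR_smul x α h hs ht := (congrArg _ (whR_smul _ _ _ _ _)).trans (tw_smul _ _ _ _)
  whR_id2 f g s hs := tw_whR_id2 (by simp [sgn_zero]) _ _ _ _ _ _
  whR_comp2 h _ _ _ e α β hs ht hz :=
    (congrArg _ (whR_comp2 _ _ _ _ _ (Envelope.mor_comp _ _ ht) _)).trans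
      (tw_comp2 (by rw [← sgn_add, ← mul_add, ← Prod.snd_add, e]) _ _ _ _ _ _ _)
  whR_id α hs ht := (congrArg _ (whR_id _ _ _)).trans
    (tw_one (by rw [Envelope.shift_id]; simp [sgn_zero]) _ _)
  whR_comp h h' _ _ _ _ α hs ht hy hz hy' hz' :=
    (congrArg _ (whR_comp _ _ _ (Envelope.mor_comp _ _ hs) (Envelope.mor_comp _ _ ht)
      (Envelope.mor_comp _ _ hy) (Envelope.mor_comp _ _ hz) _ _)).trans
    (tw_whR_whR (by
      rw [← sgn_add, ← add_mul, add_comm (EnvHom.shift h').2]; rfl) _ _ _ _ _ _ _)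
  whL_whR {p _ _ _ _} f g g' h _ _ s' t' _ _ α hs ht hs' ht' hy hz hy' hz' :=
    tw_whL_whR (by
      rw [← sgn_add, ← sgn_add, ← env_whR_deg p g g' h hs ht, add_comm]) _ _ _ _ _ _ _ _ _ _ _
      _ _ _ _
  interchange {p q _ _ _ _ f f' g g' _ _ _ _} e e' α β hs ht ht' hz :=
    tw_interchange _ _ _ _ (by
      have key : ∀ f f' g g' p q : ZMod 2, f * (q + g - g') + g' * p +
          (p + f - f') * (q + g - g') = p * q + (g * p + f' * (q + g - g')) := by decide
      simp only [← sgn_add]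
      exact congrArg _ (key _ _ _ _ _ _)) _ _ _ _ _ _ _ _
end

/-- The canonical embedding of `B` into its `(Q, Π)`-envelope, on 1-morphisms. -/
def envMap {B : Type v} [Category.{w} B] {a b : B} (f : a ⟶ b) :
    (Envelope.mk a) ⟶ (Envelope.mk b) :=
  (⟨0, f⟩ : EnvHom (Envelope.mk a) (Envelope.mk b))

/-- The canonical embedding of `B` into its `(Q, Π)`-envelope, on 2-morphisms. -/
def envMap2 {k : Type u} [Field k] {B : Type v} [Category.{w} B] [TwoSupercat.{u, v, w, v'} k B]
    {p : Deg} {a b : B} {f g : a ⟶ b} (α : Hom2 k p f g) : Hom2 k p (envMap f) (envMap g) :=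
  (castDeg k (show p = p + (0 : Deg) - (0 : Deg) by abel) α : EnvHom2 k p (envMap f) (envMap g))

theorem envMap_comp {B : Type v} [Category.{w} B] {a b c : B} {f : a ⟶ b} {g : b ⟶ c} {s : a ⟶ c}
    (h : s = f ≫ g) : envMap s = envMap f ≫ envMap g :=
  EnvHom.ext (add_zero _).symm h

/-! ## Graded supercategories -/

/-- A graded supercategory over `k`; `Hom p X Y` is the space of morphisms that are homogeneous of
degree and parity `p`. Composition is in diagrammatic order. -/
structure GSCat (k : Type u) [Field k] where
  Obj : Type (u + 1)
  Hom : Deg → Obj → Obj → Type u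
  [grp : ∀ p X Y, AddCommGroup (Hom p X Y)]
  [mod : ∀ p X Y, Module k (Hom p X Y)]
  id : ∀ X, Hom 0 X X
  comp : ∀ {p q r : Deg} {X Y Z : Obj}, p + q = r → Hom p X Y → Hom q Y Z → Hom r X Z
  add_comp : ∀ {p q r : Deg} {X Y Z : Obj} (e : p + q = r) (f g : Hom p X Y) (h : Hom q Y Z),
    comp e (f + g) h = comp e f h + comp e g h
  comp_add : ∀ {p q r : Deg} {X Y Z : Obj} (e : p + q = r) (f : Hom p X Y) (g h : Hom q Y Z),
    comp e f (g + h) = comp e f g + comp e f h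
  smul_comp : ∀ {p q r : Deg} {X Y Z : Obj} (e : p + q = r) (c : k) (f : Hom p X Y)
    (g : Hom q Y Z), comp e (c • f) g = c • comp e f g
  comp_smul : ∀ {p q r : Deg} {X Y Z : Obj} (e : p + q = r) (c : k) (f : Hom p X Y)
    (g : Hom q Y Z), comp e f (c • g) = c • comp e f g
  id_comp : ∀ {p : Deg} {X Y : Obj} (e : 0 + p = p) (f : Hom p X Y), comp e (id X) f = f
  comp_id : ∀ {p : Deg} {X Y : Obj} (e : p + 0 = p) (f : Hom p X Y), comp e f (id Y) = f
  assoc : ∀ {p q r pq qr s : Deg} {W X Y Z : Obj} (e₁ : p + q = pq) (e₂ : pq + r = s)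
    (e₃ : q + r = qr) (e₄ : p + qr = s) (f : Hom p W X) (g : Hom q X Y) (h : Hom r Y Z),
    comp e₂ (comp e₁ f g) h = comp e₄ f (comp e₃ g h)

attribute [instance] GSCat.grp GSCat.mod

/-- A graded superfunctor: it preserves degrees and parities. -/
structure GSFun {k : Type u} [Field k] (C D : GSCat k) where
  obj : C.Obj → D.Obj
  map : ∀ {p : Deg} {X Y : C.Obj}, C.Hom p X Y →ₗ[k] D.Hom p (obj X) (obj Y)
  map_id : ∀ X, map (C.id X) = D.id (obj X)
  map_comp : ∀ {p q r : Deg} {X Y Z : C.Obj} (e : p + q = r) (f : C.Hom p X Y) (g : C.Hom q Y Z),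
    map (C.comp e f g) = D.comp e (map f) (map g)

section
variable {k : Type u} [Field k] {C D E : GSCat k}

/-- The identity superfunctor. -/
def GSFun.id (C : GSCat k) : GSFun C C where
  obj X := X
  map := LinearMap.id
  map_id _ := rfl
  map_comp _ _ _ := rfl

/-- Composition of superfunctors, `F` being applied first. -/
def GSFun.comp (F : GSFun C D) (G : GSFun D E) : GSFun C E where
  obj X := G.obj (F.obj X)
  map := G.map ∘ₗ F.map
  map_id X := (congrArg _ (F.map_id X)).trans (G.map_id _)
  map_comp e f g := (congrArg _ (F.map_comp e f g)).trans (G.map_comp e _ _)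

/-- Supernaturality of a family of morphisms `F X → G X` that are homogeneous of degree and
parity `p`. -/
def IsSupernatural (p : Deg) (F G : GSFun C D) (α : ∀ X, D.Hom p (F.obj X) (G.obj X)) : Prop :=
  ∀ (q r : Deg) (e : q + p = r) (e' : p + q = r) (X Y : C.Obj) (f : C.Hom q X Y),
    D.comp e (F.map f) (α Y) = sgn k (p.2 * q.2) • D.comp e' (α X) (G.map f)

/-- The supernatural transformations `F ⇒ G` that are homogeneous of degree and parity `p`. -/
def GSNat (p : Deg) (F G : GSFun C D) : Submodule k (∀ X, D.Hom p (F.obj X) (G.obj X)) where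
  carrier := {α | IsSupernatural p F G α}
  add_mem' {α β} hα hβ q r e e' X Y f := by
    simp only [Pi.add_apply, D.comp_add, D.add_comp, smul_add, hα q r e e' X Y f,
      hβ q r e e' X Y f]
  zero_mem' q r e e' X Y f := by
    have h := D.comp_smul e (0 : k) (F.map f) (0 : D.Hom p (F.obj Y) (G.obj Y))
    have h' := D.smul_comp e' (0 : k) (0 : D.Hom p (F.obj X) (G.obj X)) (G.map f)
    simp only [zero_smul] at h h'
    simp only [Pi.zero_apply, h, h', smul_zero]
  smul_mem' c α hα q r e e' X Y f := by
    simp only [Pi.smul_apply, D.comp_smul, D.smul_comp, hα q r e e' X Y f, smul_comm c]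

theorem GSNat.naturality {p : Deg} {F G : GSFun C D} (α : GSNat p F G) {q r : Deg}
    (e : q + p = r) (e' : p + q = r) {X Y : C.Obj} (f : C.Hom q X Y) :
    D.comp e (F.map f) (α.1 Y) = sgn k (p.2 * q.2) • D.comp e' (α.1 X) (G.map f) :=
  α.2 q r e e' X Y f

/-- A supernatural isomorphism, homogeneous of degree and parity `p`. -/
structure GSIso (p : Deg) (F G : GSFun C D) where
  hom : GSNat p F G
  inv : GSNat (-p) G F
  hom_inv : ∀ X, D.comp (add_neg_cancel p) (hom.1 X) (inv.1 X) = D.id (F.obj X)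
  inv_hom : ∀ X, D.comp (neg_add_cancel p) (inv.1 X) (hom.1 X) = D.id (G.obj X)

end

/-- A graded `(Q, Π)`-supercategory: `Q`, `Q⁻¹` and `Π` are isomorphic to the identity functor
through homogeneous supernatural isomorphisms; the conventions are those for the
degree shift `(Q M)_i = M_(i - 1)`. -/
structure QPCat (k : Type u) [Field k] where
  cat : GSCat k
  Q : GSFun cat cat
  Qinv : GSFun cat cat
  P : GSFun cat cat
  σ : GSIso ((-1, 0) : Deg) Q (GSFun.id cat)
  σbar : GSIso ((1, 0) : Deg) Qinv (GSFun.id cat)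
  ζ : GSIso ((0, 1) : Deg) P (GSFun.id cat)

instance (k : Type u) [Field k] : Category (QPCat k) where
  Hom C D := GSFun C.cat D.cat
  id C := GSFun.id C.cat
  comp F G := GSFun.comp F G

/-- The graded 2-supercategory of graded `(Q, Π)`-supercategories, graded superfunctors and
supernatural transformations. -/
instance instQPCat (k : Type u) [Field k] : TwoSupercat.{u, u + 2, u + 1, u + 1} k (QPCat k) where
  Hom2 p C D F G := GSNat (C := C.cat) (D := D.cat) p F G
  grp p C D F G := inferInstanceAs (AddCommGroup (GSNat (C := C.cat) (D := D.cat) p F G))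
  mod p C D F G := inferInstanceAs (Module k (GSNat (C := C.cat) (D := D.cat) p F G))
  id2 {C D} F := ⟨fun X => D.cat.id (GSFun.obj F X), fun q r e e' X Y f => by
    have h : q = r := by rw [← e, add_zero]
    subst h
    rw [D.cat.comp_id, D.cat.id_comp, Prod.snd_zero, zero_mul, sgn_zero, one_smul]⟩
  comp2 {p q r C D F G H} e α β :=
    ⟨fun X => D.cat.comp e (α.1 X) (β.1 X), fun s t e₁ e₂ X Y f => by
    rw [← D.cat.assoc (pq := s + p) rfl (by rw [← e₁, ← e]; abel) e e₁,
      GSNat.naturality α rfl (add_comm p s) f, D.cat.smul_comp,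
      D.cat.assoc (qr := s + q) _ _ rfl (by rw [← e₁, ← e]; abel),
      GSNat.naturality β rfl (add_comm q s) f, D.cat.comp_smul, smul_smul,
      D.cat.assoc e e₂ (add_comm q s) (by rw [← e₁, ← e]; abel), ← sgn_add, ← add_mul]
    subst e
    rfl⟩
  whL {p C D E F G H S T} α hs ht :=
    ⟨fun X => hs ▸ ht ▸ α.1 (GSFun.obj F X), fun q r e e' X Y f => by
    subst hs ht
    exact GSNat.naturality α e e' (GSFun.map F f)⟩
  whR {p C D E F G S T} α H hs ht :=
    ⟨fun X => hs ▸ ht ▸ GSFun.map H (α.1 X), fun q r e e' X Y f => by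
    subst hs ht
    have h := congrArg (GSFun.map H) (GSNat.naturality α e e' f)
    rw [map_smul, GSFun.map_comp, GSFun.map_comp] at h
    exact h⟩
  add_comp2 {_ _ _ C D _ _ _} e α β γ := Subtype.ext (funext fun X => D.cat.add_comp e _ _ _)
  comp2_add {_ _ _ C D _ _ _} e α β γ := Subtype.ext (funext fun X => D.cat.comp_add e _ _ _)
  smul_comp2 {_ _ _ C D _ _ _} e c α β := Subtype.ext (funext fun X => D.cat.smul_comp e _ _ _)
  comp2_smul {_ _ _ C D _ _ _} e c α β := Subtype.ext (funext fun X => D.cat.comp_smul e _ _ _)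
  id2_comp2 {_ C D _ _} e α := Subtype.ext (funext fun X => D.cat.id_comp e _)
  comp2_id2 {_ C D _ _} e α := Subtype.ext (funext fun X => D.cat.comp_id e _)
  assoc2 {_ _ _ _ _ _ C D _ _ _ _} e₁ e₂ e₃ e₄ α β γ :=
    Subtype.ext (funext fun X => D.cat.assoc e₁ e₂ e₃ e₄ _ _ _)
  whL_add F _ _ _ _ α β hs ht := by subst hs ht; rfl
  whL_smul F _ _ _ _ c α hs ht := by subst hs ht; rfl
  whL_id2 F G _ hs := by subst hs; rfl
  whL_comp2 F _ _ _ _ _ _ e α β hs ht hz := by subst hs ht hz; rfl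
  id_whL α hs ht := rfl
  comp_whL F F' _ _ _ _ _ _ α hs ht hy hz hy' hz' := by subst hs ht hy hz; rfl
  whR_add α β H hs ht := by
    subst hs ht; exact Subtype.ext (funext fun X => (GSFun.map H).map_add _ _)
  whR_smul c α H hs ht := by
    subst hs ht; exact Subtype.ext (funext fun X => (GSFun.map H).map_smul _ _)
  whR_id2 F G _ hs := by
    subst hs; exact Subtype.ext (funext fun X => GSFun.map_id G _)
  whR_comp2 H _ _ _ e α β hs ht hz := by
    subst hs ht hz; exact Subtype.ext (funext fun X => GSFun.map_comp H e _ _)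
  whR_id α hs ht := rfl
  whR_comp H H' _ _ _ _ α hs ht hy hz hy' hz' := by subst hs ht hy hz; rfl
  whL_whR F _ _ H _ _ _ _ _ _ α hs ht hs' ht' hy hz hy' hz' := by
    subst hs ht hs' ht' hy hz; rfl
  interchange {p q r C D E F F' G G' _ _ _ _} e e' α β hs ht ht' hz := by
    subst hs ht ht' hz
    refine Subtype.ext (funext fun X => ?_)
    have h := GSNat.naturality β e e' (α.1 X)
    have h' := congrArg (fun y => sgn k (p.2 * q.2) • y) h
    simp only [smul_smul] at h'
    rw [mul_comm q.2 p.2, sgn_mul_self, one_smul] at h'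
    exact h'.symm

/-! ## The odd 2-category `𝔘(sl₂)` -/

/-- The generating 1-morphisms. -/
inductive Letter
  | E
  | F

/-- The weights of the generating 1-morphisms. -/
def Letter.weight : Letter → ℤ
  | .E => 2
  | .F => -2

/-- The weight of a word in `E`, `F`. -/
def wordWeight (w : List Letter) : ℤ := (w.map Letter.weight).sum

theorem wordWeight_append (w w' : List Letter) :
    wordWeight (w ++ w') = wordWeight w + wordWeight w' := by
  simp [wordWeight]

/-- The objects of `𝔘` are the weights `l ∈ ℤ`. -/
@[ext]
structure UObj where
  wt : ℤ

/-- The 1-morphisms of `𝔘` from `a` to `b`: words in `E`, `F` of weight `b - a`. The letters are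
listed in the order in which they are applied, that is, from right to left in the usual notation. -/
@[ext]
structure UHom (a b : UObj) where
  word : List Letter
  target : a.wt + wordWeight word = b.wt

instance : Category UObj where
  Hom a b := UHom a b
  id a := ⟨[], by simp [wordWeight]⟩
  comp f g := ⟨f.word ++ g.word, by rw [wordWeight_append, ← add_assoc, f.target, g.target]⟩
  id_comp f := UHom.ext (List.nil_append _)
  comp_id f := UHom.ext (List.append_nil _)
  assoc f g h := UHom.ext (List.append_assoc _ _ _)

/-- `E 1_l : l → l + 2`. -/
def oneE {a b : UObj} (h : a.wt + 2 = b.wt) : a ⟶ b :=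
  (⟨[.E], by simpa [wordWeight, Letter.weight] using h⟩ : UHom a b)

/-- `F 1_l : l → l - 2`. -/
def oneF {a b : UObj} (h : b.wt + 2 = a.wt) : a ⟶ b :=
  (⟨[.F], by simp [wordWeight, Letter.weight]; lia⟩ : UHom a b)

/-- `E E 1_l : l → l + 4`. -/
def oneEE {a b : UObj} (h : a.wt + 4 = b.wt) : a ⟶ b :=
  (⟨[.E, .E], by simp [wordWeight, Letter.weight]; lia⟩ : UHom a b)

/-- `E F 1_l : l → l` (first `F`, then `E`). -/
def oneEF (a : UObj) : a ⟶ a :=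
  (⟨[.F, .E], by simp [wordWeight, Letter.weight]⟩ : UHom a a)

/-- `F E 1_l : l → l` (first `E`, then `F`). -/
def oneFE (a : UObj) : a ⟶ a :=
  (⟨[.E, .F], by simp [wordWeight, Letter.weight]⟩ : UHom a a)

/-- Formal expressions for the homogeneous 2-morphisms of `𝔘`. Besides `x`, `τ`, `η`, `ε`, there
are generators for the matrix entries of the inverses of the odd `sl₂`-isomorphisms: `crossInv`,
`toEF j` (for `0 ≤ j < l`) and `ofFE j` (for `0 ≤ j < -l`), where `l` is the weight. -/
inductive Term (k : Type u) : Deg → ∀ {a b : UObj}, (a ⟶ b) → (a ⟶ b) → Type u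
  | zero (p : Deg) {a b : UObj} (f g : a ⟶ b) : Term k p f g
  | add {p : Deg} {a b : UObj} {f g : a ⟶ b} (s t : Term k p f g) : Term k p f g
  | smul {p : Deg} {a b : UObj} {f g : a ⟶ b} (c : k) (t : Term k p f g) : Term k p f g
  | id {p : Deg} {a b : UObj} (f : a ⟶ b) (e : p = 0) : Term k p f f
  | comp {p q r : Deg} {a b : UObj} {f g h : a ⟶ b} (e : p + q = r) (s : Term k p f g)
      (t : Term k q g h) : Term k r f h
  | whL {p : Deg} {a b c : UObj} (f : a ⟶ b) {g h : b ⟶ c} {y z : a ⟶ c} (t : Term k p g h)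
      (hy : y = f ≫ g) (hz : z = f ≫ h) : Term k p y z
  | whR {p : Deg} {a b c : UObj} {f g : a ⟶ b} {y z : a ⟶ c} (t : Term k p f g) (h : b ⟶ c)
      (hy : y = f ≫ h) (hz : z = g ≫ h) : Term k p y z
  | x {a b : UObj} (h : a.wt + 2 = b.wt) : Term k (2, 1) (oneE h) (oneE h)
  | τ {a b : UObj} (h : a.wt + 4 = b.wt) : Term k (-2, 1) (oneEE h) (oneEE h)
  | η (a : UObj) : Term k (1 + a.wt, 0) (𝟙 a) (oneFE a)
  | ε (a : UObj) : Term k (1 - a.wt, 0) (oneEF a) (𝟙 a)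
  | crossInv (a : UObj) : Term k (0, 1) (oneFE a) (oneEF a)
  | toEF (a : UObj) (j : ℕ) (h : (j : ℤ) < a.wt) :
      Term k (a.wt - 1 - 2 * j, (j : ZMod 2)) (𝟙 a) (oneEF a)
  | ofFE (a : UObj) (j : ℕ) (h : (j : ℤ) < -a.wt) :
      Term k (-a.wt - 1 - 2 * j, (j : ZMod 2)) (oneFE a) (𝟙 a)

namespace Term

variable {k : Type u}

/-- The power `x ^ j` of the dot on an upward strand. -/
def xpow {a b : UObj} (h : a.wt + 2 = b.wt) :
    (j : ℕ) → Term k (2 * (j : ℤ), (j : ZMod 2)) (oneE h) (oneE h)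
  | 0 => .id _ (by simp)
  | j + 1 => .comp (by ext <;> simp; ring) (xpow h j) (.x h)

/-- The crossing `E F 1_l ⇒ F E 1_l`, `(F E ε) ∘ (F τ F) ∘ (η E F)`. -/
def cross (a : UObj) : Term k (0, 1) (oneEF a) (oneFE a) :=
  .comp (p := (1 + a.wt - 2, 1)) (q := (1 - a.wt, 0)) (by ext <;> simp; ring)
    (.comp (p := (1 + a.wt, 0)) (q := (-2, 1))
      (g := (⟨[.F, .E, .E, .F], by simp [wordWeight, Letter.weight]⟩ : UHom a a))
      (by ext <;> simp; ring)
      (.whL (oneEF a) (.η a) (Category.comp_id _).symm rfl)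
      (.whL (b := ⟨a.wt - 2⟩) (oneF (by simp))
        (.whR (b := ⟨a.wt + 2⟩) (.τ (by simp; ring)) (oneF (by simp)) rfl rfl) rfl rfl))
    (.whR (.ε a) (oneFE a) rfl (Category.id_comp _).symm)

/-- The cap with `j` dots, `ε ∘ (x ^ j F) : E F 1_l ⇒ 1_l`. -/
def cap (a : UObj) (j : ℕ) : Term k (2 * (j : ℤ) + (1 - a.wt), (j : ZMod 2)) (oneEF a) (𝟙 a) :=
  .comp (by ext <;> simp)
    (.whL (b := ⟨a.wt - 2⟩) (oneF (by simp)) (xpow (by simp) j) rfl rfl) (.ε a)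

/-- The cup with `j` dots, `(F x ^ j) ∘ η : 1_l ⇒ F E 1_l`. -/
def cup (a : UObj) (j : ℕ) : Term k (1 + a.wt + 2 * (j : ℤ), (j : ZMod 2)) (𝟙 a) (oneFE a) :=
  .comp (by ext <;> simp) (.η a)
    (.whR (b := ⟨a.wt + 2⟩) (xpow (by simp) j) (oneF (by simp)) rfl rfl)

/-- Finite sums `∑_{j < N} t j`. -/
def sum {p : Deg} {a b : UObj} {f g : a ⟶ b} : (N : ℕ) → ((j : ℕ) → j < N → Term k p f g) →
    Term k p f g
  | 0, _ => .zero p f g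
  | N + 1, t => .add (sum N fun j h => t j (by lia)) (t N (by lia))

end Term

/-- The relations of `𝔘`: the axioms of a graded 2-supercategory, the odd nilHecke relations, the
right adjunction axioms and the odd `sl₂`-isomorphisms. -/
inductive Rel (k : Type u) [Field k] : ∀ {p : Deg} {a b : UObj} {f g : a ⟶ b},
    Term k p f g → Term k p f g → Prop
  -- compatibility with the operations
  | add_left {p : Deg} {a b : UObj} {f g : a ⟶ b} {s s' : Term k p f g} (t : Term k p f g) :
      Rel k s s' → Rel k (.add s t) (.add s' t)
  | add_right {p : Deg} {a b : UObj} {f g : a ⟶ b} (s : Term k p f g) {t t' : Term k p f g} :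
      Rel k t t' → Rel k (.add s t) (.add s t')
  | smul_congr {p : Deg} {a b : UObj} {f g : a ⟶ b} (c : k) {t t' : Term k p f g} :
      Rel k t t' → Rel k (.smul c t) (.smul c t')
  | comp_left {p q r : Deg} {a b : UObj} {f g h : a ⟶ b} (e : p + q = r) {s s' : Term k p f g}
      (t : Term k q g h) : Rel k s s' → Rel k (.comp e s t) (.comp e s' t)
  | comp_right {p q r : Deg} {a b : UObj} {f g h : a ⟶ b} (e : p + q = r) (s : Term k p f g)
      {t t' : Term k q g h} : Rel k t t' → Rel k (.comp e s t) (.comp e s t')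
  | whL_congr {p : Deg} {a b c : UObj} (f : a ⟶ b) {g h : b ⟶ c} {y z : a ⟶ c}
      {t t' : Term k p g h} (hy : y = f ≫ g) (hz : z = f ≫ h) :
      Rel k t t' → Rel k (.whL f t hy hz) (.whL f t' hy hz)
  | whR_congr {p : Deg} {a b c : UObj} {f g : a ⟶ b} {y z : a ⟶ c} {t t' : Term k p f g}
      (h : b ⟶ c) (hy : y = f ≫ h) (hz : z = g ≫ h) :
      Rel k t t' → Rel k (.whR t h hy hz) (.whR t' h hy hz)
  -- vector space axioms
  | add_assoc {p : Deg} {a b : UObj} {f g : a ⟶ b} (s t t' : Term k p f g) :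
      Rel k (.add (.add s t) t') (.add s (.add t t'))
  | add_comm {p : Deg} {a b : UObj} {f g : a ⟶ b} (s t : Term k p f g) :
      Rel k (.add s t) (.add t s)
  | zero_add {p : Deg} {a b : UObj} {f g : a ⟶ b} (t : Term k p f g) :
      Rel k (.add (.zero p f g) t) t
  | zero_smul {p : Deg} {a b : UObj} {f g : a ⟶ b} (t : Term k p f g) :
      Rel k (.smul 0 t) (.zero p f g)
  | one_smul {p : Deg} {a b : UObj} {f g : a ⟶ b} (t : Term k p f g) : Rel k (.smul 1 t) t
  | mul_smul {p : Deg} {a b : UObj} {f g : a ⟶ b} (c d : k) (t : Term k p f g) :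
      Rel k (.smul (c * d) t) (.smul c (.smul d t))
  | add_smul {p : Deg} {a b : UObj} {f g : a ⟶ b} (c d : k) (t : Term k p f g) :
      Rel k (.smul (c + d) t) (.add (.smul c t) (.smul d t))
  | smul_add {p : Deg} {a b : UObj} {f g : a ⟶ b} (c : k) (s t : Term k p f g) :
      Rel k (.smul c (.add s t)) (.add (.smul c s) (.smul c t))
  -- axioms of a graded 2-supercategory
  | add_comp {p q r : Deg} {a b : UObj} {f g h : a ⟶ b} (e : p + q = r)
      (s s' : Term k p f g) (t : Term k q g h) :
      Rel k (.comp e (.add s s') t) (.add (.comp e s t) (.comp e s' t))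
  | comp_add {p q r : Deg} {a b : UObj} {f g h : a ⟶ b} (e : p + q = r)
      (s : Term k p f g) (t t' : Term k q g h) :
      Rel k (.comp e s (.add t t')) (.add (.comp e s t) (.comp e s t'))
  | smul_comp {p q r : Deg} {a b : UObj} {f g h : a ⟶ b} (e : p + q = r) (c : k)
      (s : Term k p f g) (t : Term k q g h) :
      Rel k (.comp e (.smul c s) t) (.smul c (.comp e s t))
  | comp_smul {p q r : Deg} {a b : UObj} {f g h : a ⟶ b} (e : p + q = r) (c : k)
      (s : Term k p f g) (t : Term k q g h) :
      Rel k (.comp e s (.smul c t)) (.smul c (.comp e s t))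
  | id_comp {p q : Deg} {a b : UObj} {f g : a ⟶ b} (e₀ : q = 0) (e : q + p = p)
      (t : Term k p f g) : Rel k (.comp e (.id f e₀) t) t
  | comp_id {p q : Deg} {a b : UObj} {f g : a ⟶ b} (e₀ : q = 0) (e : p + q = p)
      (t : Term k p f g) : Rel k (.comp e t (.id g e₀)) t
  | assoc {p q r pq qr s : Deg} {a b : UObj} {f g h i : a ⟶ b} (e₁ : p + q = pq)
      (e₂ : pq + r = s) (e₃ : q + r = qr) (e₄ : p + qr = s) (t : Term k p f g)
      (t' : Term k q g h) (t'' : Term k r h i) :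
      Rel k (.comp e₂ (.comp e₁ t t') t'') (.comp e₄ t (.comp e₃ t' t''))
  | whL_add {p : Deg} {a b c : UObj} (f : a ⟶ b) {g h : b ⟶ c} {y z : a ⟶ c}
      (t t' : Term k p g h) (hy : y = f ≫ g) (hz : z = f ≫ h) :
      Rel k (.whL f (.add t t') hy hz) (.add (.whL f t hy hz) (.whL f t' hy hz))
  | whL_smul {p : Deg} {a b c : UObj} (f : a ⟶ b) {g h : b ⟶ c} {y z : a ⟶ c} (d : k)
      (t : Term k p g h) (hy : y = f ≫ g) (hz : z = f ≫ h) :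
      Rel k (.whL f (.smul d t) hy hz) (.smul d (.whL f t hy hz))
  | whL_id {p : Deg} {a b c : UObj} (f : a ⟶ b) (g : b ⟶ c) (e : p = 0) {y : a ⟶ c}
      (hy : y = f ≫ g) : Rel k (.whL f (.id g e) hy hy) (.id y e)
  | whL_comp {p q r : Deg} {a b c : UObj} (f : a ⟶ b) {g h i : b ⟶ c} {y z w : a ⟶ c}
      (e : p + q = r) (t : Term k p g h) (t' : Term k q h i) (hy : y = f ≫ g) (hz : z = f ≫ h)
      (hw : w = f ≫ i) :
      Rel k (.whL f (.comp e t t') hy hw) (.comp e (.whL f t hy hz) (.whL f t' hz hw))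
  | id_whL {p : Deg} {a b : UObj} {g h : a ⟶ b} (t : Term k p g h) (hy : g = 𝟙 a ≫ g)
      (hz : h = 𝟙 a ≫ h) : Rel k (.whL (𝟙 a) t hy hz) t
  | comp_whL {p : Deg} {a b c d : UObj} (f : a ⟶ b) (f' : b ⟶ c) {g h : c ⟶ d} {y z : b ⟶ d}
      {y' z' : a ⟶ d} (t : Term k p g h) (hy : y = f' ≫ g) (hz : z = f' ≫ h) (hy' : y' = f ≫ y)
      (hz' : z' = f ≫ z) (hy'' : y' = (f ≫ f') ≫ g) (hz'' : z' = (f ≫ f') ≫ h) :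
      Rel k (.whL (f ≫ f') t hy'' hz'') (.whL f (.whL f' t hy hz) hy' hz')
  | whR_add {p : Deg} {a b c : UObj} {f g : a ⟶ b} {y z : a ⟶ c} (t t' : Term k p f g)
      (h : b ⟶ c) (hy : y = f ≫ h) (hz : z = g ≫ h) :
      Rel k (.whR (.add t t') h hy hz) (.add (.whR t h hy hz) (.whR t' h hy hz))
  | whR_smul {p : Deg} {a b c : UObj} {f g : a ⟶ b} {y z : a ⟶ c} (d : k) (t : Term k p f g)
      (h : b ⟶ c) (hy : y = f ≫ h) (hz : z = g ≫ h) :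
      Rel k (.whR (.smul d t) h hy hz) (.smul d (.whR t h hy hz))
  | whR_id {p : Deg} {a b c : UObj} (f : a ⟶ b) (g : b ⟶ c) (e : p = 0) {y : a ⟶ c}
      (hy : y = f ≫ g) : Rel k (.whR (.id f e) g hy hy) (.id y e)
  | whR_comp {p q r : Deg} {a b c : UObj} {f g i : a ⟶ b} (h : b ⟶ c) {y z w : a ⟶ c}
      (e : p + q = r) (t : Term k p f g) (t' : Term k q g i) (hy : y = f ≫ h) (hz : z = g ≫ h)
      (hw : w = i ≫ h) :
      Rel k (.whR (.comp e t t') h hy hw) (.comp e (.whR t h hy hz) (.whR t' h hz hw))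
  | whR_one {p : Deg} {a b : UObj} {f g : a ⟶ b} (t : Term k p f g) (hy : f = f ≫ 𝟙 b)
      (hz : g = g ≫ 𝟙 b) : Rel k (.whR t (𝟙 b) hy hz) t
  | whR_whR {p : Deg} {a b c d : UObj} {f g : a ⟶ b} (h : b ⟶ c) (h' : c ⟶ d) {y z : a ⟶ c}
      {y' z' : a ⟶ d} (t : Term k p f g) (hy : y = f ≫ h) (hz : z = g ≫ h) (hy' : y' = y ≫ h')
      (hz' : z' = z ≫ h') (hy'' : y' = f ≫ h ≫ h') (hz'' : z' = g ≫ h ≫ h') :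
      Rel k (.whR t (h ≫ h') hy'' hz'') (.whR (.whR t h hy hz) h' hy' hz')
  | whL_whR {p : Deg} {a b c d : UObj} (f : a ⟶ b) {g g' : b ⟶ c} (h : c ⟶ d) {y z : b ⟶ d}
      {y' z' : a ⟶ c} {v w : a ⟶ d} (t : Term k p g g') (hy : y = g ≫ h) (hz : z = g' ≫ h)
      (hy' : y' = f ≫ g) (hz' : z' = f ≫ g') (hv : v = f ≫ y) (hw : w = f ≫ z)
      (hv' : v = y' ≫ h) (hw' : w = z' ≫ h) :
      Rel k (.whL f (.whR t h hy hz) hv hw) (.whR (.whL f t hy' hz') h hv' hw')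
  | interchange {p q r : Deg} {a b c : UObj} {f f' : a ⟶ b} {g g' : b ⟶ c} {v w w' z : a ⟶ c}
      (e : p + q = r) (e' : q + p = r) (s : Term k p f f') (t : Term k q g g') (hv : v = f ≫ g)
      (hw : w = f' ≫ g) (hw' : w' = f ≫ g') (hz : z = f' ≫ g') :
      Rel k (.comp e' (.whL f t hv hw') (.whR s g' hw' hz))
        (.smul (sgn k (p.2 * q.2)) (.comp e (.whR s g hv hw) (.whL f' t hw hz)))
  -- odd nilHecke relations
  | τ_sq {a b : UObj} (h : a.wt + 4 = b.wt) :
      Rel k (.comp (r := (-4, 0)) rfl (.τ h) (.τ h)) (.zero _ _ _)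
  | x_τ {a b c : UObj} (h : a.wt + 4 = c.wt) (h₁ : a.wt + 2 = b.wt) (h₂ : b.wt + 2 = c.wt) :
      Rel k (.add (.comp (r := 0) rfl (.whR (.x h₁) (oneE h₂) rfl rfl) (.τ h))
        (.comp (r := 0) rfl (.τ h) (.whL (oneE h₁) (.x h₂) rfl rfl))) (.id (oneEE h) rfl)
  | τ_x {a b c : UObj} (h : a.wt + 4 = c.wt) (h₁ : a.wt + 2 = b.wt) (h₂ : b.wt + 2 = c.wt) :
      Rel k (.add (.comp (r := 0) rfl (.τ h) (.whR (.x h₁) (oneE h₂) rfl rfl))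
        (.comp (r := 0) rfl (.whL (oneE h₁) (.x h₂) rfl rfl) (.τ h))) (.id (oneEE h) rfl)
  | braid {a b c d : UObj} (h₁ : a.wt + 2 = b.wt) (h₂ : b.wt + 4 = d.wt) (h₃ : a.wt + 4 = c.wt)
      (h₄ : c.wt + 2 = d.wt) {f : a ⟶ d} (hf : f = oneE h₁ ≫ oneEE h₂)
      (hf' : f = oneEE h₃ ≫ oneE h₄) :
      Rel k (.comp (r := (-6, 1)) rfl (.whL (oneE h₁) (.τ h₂) hf hf)
          (.comp (r := (-4, 0)) rfl (.whR (.τ h₃) (oneE h₄) hf' hf')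
            (.whL (oneE h₁) (.τ h₂) hf hf)))
        (.comp (r := (-6, 1)) rfl (.whR (.τ h₃) (oneE h₄) hf' hf')
          (.comp (r := (-4, 0)) rfl (.whL (oneE h₁) (.τ h₂) hf hf)
            (.whR (.τ h₃) (oneE h₄) hf' hf')))
  -- right adjunction axioms
  | zigzag_E {a b : UObj} (h : a.wt + 2 = b.wt) :
      Rel k (.comp (r := 0) (by ext <;> simp; lia)
          (.whR (z := oneE h ≫ oneEF b) (.η a) (oneE h) (Category.id_comp _).symm rfl)
          (.whL (oneE h) (.ε b) rfl (Category.comp_id _).symm)) (.id (oneE h) rfl)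
  | zigzag_F {a b : UObj} (h : b.wt + 2 = a.wt) :
      Rel k (.comp (r := 0) (by ext <;> simp; lia)
          (.whL (z := oneEF a ≫ oneF h) (oneF h) (.η b) (Category.comp_id _).symm rfl)
          (.whR (.ε a) (oneF h) rfl (Category.id_comp _).symm)) (.id (oneF h) rfl)
  -- odd `sl₂`-isomorphisms
  | iso_EF (a : UObj) :
      Rel k (.add (.comp (r := 0) rfl (.cross a) (.crossInv a))
        (.sum a.wt.toNat fun j h => .comp (r := 0)
          (by ext <;> simp [CharTwo.add_self_eq_zero]; ring)
          (.cap a j) (.toEF a j (by lia)))) (.id (oneEF a) rfl)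
  | iso_FE (a : UObj) :
      Rel k (.add (.comp (r := 0) rfl (.crossInv a) (.cross a))
        (.sum (-a.wt).toNat fun j h => .comp (r := 0)
          (by ext <;> simp [CharTwo.add_self_eq_zero]; ring)
          (.ofFE a j (by lia)) (.cup a j))) (.id (oneFE a) rfl)
  | crossInv_cap (a : UObj) (j : ℕ) (h : (j : ℤ) < a.wt) :
      Rel k (.comp rfl (.crossInv a) (.cap a j)) (.zero _ _ _)
  | toEF_cross (a : UObj) (j : ℕ) (h : (j : ℤ) < a.wt) :
      Rel k (.comp rfl (.toEF a j h) (.cross a)) (.zero _ _ _)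
  | toEF_cap (a : UObj) (j : ℕ) (h : (j : ℤ) < a.wt) :
      Rel k (.comp (r := 0) (by ext <;> simp [CharTwo.add_self_eq_zero]; ring)
        (.toEF a j h) (.cap a j)) (.id (𝟙 a) rfl)
  | toEF_cap_ne (a : UObj) (i j : ℕ) (hi : (i : ℤ) < a.wt) (hj : (j : ℤ) < a.wt) (hij : i ≠ j) :
      Rel k (.comp rfl (.toEF a i hi) (.cap a j)) (.zero _ _ _)
  | cup_crossInv (a : UObj) (j : ℕ) (h : (j : ℤ) < -a.wt) :
      Rel k (.comp rfl (.cup a j) (.crossInv a)) (.zero _ _ _)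
  | cross_ofFE (a : UObj) (j : ℕ) (h : (j : ℤ) < -a.wt) :
      Rel k (.comp rfl (.cross a) (.ofFE a j h)) (.zero _ _ _)
  | cup_ofFE (a : UObj) (j : ℕ) (h : (j : ℤ) < -a.wt) :
      Rel k (.comp (r := 0) (by ext <;> simp [CharTwo.add_self_eq_zero]; ring)
        (.cup a j) (.ofFE a j h)) (.id (𝟙 a) rfl)
  | cup_ofFE_ne (a : UObj) (i j : ℕ) (hi : (i : ℤ) < -a.wt) (hj : (j : ℤ) < -a.wt)
      (hij : i ≠ j) : Rel k (.comp rfl (.cup a i) (.ofFE a j hj)) (.zero _ _ _)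

/-- The homogeneous 2-morphisms of `𝔘`. -/
def UHom2 (k : Type u) [Field k] (p : Deg) {a b : UObj} (f g : a ⟶ b) : Type u :=
  Quot (Rel k (p := p) (f := f) (g := g))

section
variable (k : Type u) [Field k]

instance (p : Deg) {a b : UObj} (f g : a ⟶ b) : Zero (UHom2 k p f g) := ⟨Quot.mk _ (.zero p f g)⟩

instance (p : Deg) {a b : UObj} (f g : a ⟶ b) : Add (UHom2 k p f g) :=
  ⟨Quot.map₂ Term.add (fun s _ _ h => .add_right s h) (fun _ _ t h => .add_left t h)⟩

instance (p : Deg) {a b : UObj} (f g : a ⟶ b) : SMul k (UHom2 k p f g) :=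
  ⟨fun c => Quot.map (Term.smul c) fun _ _ h => .smul_congr c h⟩

instance (p : Deg) {a b : UObj} (f g : a ⟶ b) : Neg (UHom2 k p f g) := ⟨fun t => (-1 : k) • t⟩

instance (p : Deg) {a b : UObj} (f g : a ⟶ b) : AddCommGroup (UHom2 k p f g) where
  add_assoc := by rintro ⟨s⟩ ⟨t⟩ ⟨t'⟩; exact Quot.sound (.add_assoc s t t')
  add_comm := by rintro ⟨s⟩ ⟨t⟩; exact Quot.sound (.add_comm s t)
  zero_add := by rintro ⟨t⟩; exact Quot.sound (.zero_add t)
  add_zero := by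
    rintro ⟨t⟩; exact (Quot.sound (.add_comm _ _)).trans (Quot.sound (.zero_add t))
  neg_add_cancel := by
    rintro ⟨t⟩
    have h₁ : (Quot.mk (Rel k) (.add (.smul (-1) t) t) : UHom2 k p f g) =
        Quot.mk (Rel k) (.add (.smul (-1) t) (.smul 1 t)) :=
      congrArg (Quot.map (Term.add (.smul (-1) t)) fun _ _ h => .add_right _ h)
        (Quot.sound (.one_smul t)).symm
    have h₂ := Quot.sound (Rel.add_smul (-1) 1 t)
    rw [neg_add_cancel] at h₂
    exact h₁.trans (h₂.symm.trans (Quot.sound (.zero_smul t)))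
  nsmul := nsmulRec
  zsmul := zsmulRec

instance (p : Deg) {a b : UObj} (f g : a ⟶ b) : Module k (UHom2 k p f g) :=
  Module.ofMinimalAxioms (by rintro c ⟨s⟩ ⟨t⟩; exact Quot.sound (.smul_add c s t))
    (by rintro c d ⟨t⟩; exact Quot.sound (.add_smul c d t))
    (by rintro c d ⟨t⟩; exact Quot.sound (.mul_smul c d t))
    (by rintro ⟨t⟩; exact Quot.sound (.one_smul t))

/-- The odd 2-category `𝔘(sl₂)`, as a graded 2-supercategory on the objects `UObj`. -/
instance instU : TwoSupercat.{u, 0, 0, u} k UObj where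
  Hom2 p _ _ f g := UHom2 k p f g
  id2 f := Quot.mk _ (.id f rfl)
  comp2 e := Quot.map₂ (Term.comp e) (fun s _ _ h => .comp_right e s h)
    (fun _ _ t h => .comp_left e t h)
  whL f _ _ _ _ α hs ht := Quot.map (fun t => .whL f t hs ht) (fun _ _ h => .whL_congr f hs ht h) α
  whR α h hs ht := Quot.map (fun t => .whR t h hs ht) (fun _ _ h' => .whR_congr h hs ht h') α
  add_comp2 e := by rintro ⟨s⟩ ⟨s'⟩ ⟨t⟩; exact Quot.sound (.add_comp e s s' t)
  comp2_add e := by rintro ⟨s⟩ ⟨t⟩ ⟨t'⟩; exact Quot.sound (.comp_add e s t t')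
  smul_comp2 e c := by rintro ⟨s⟩ ⟨t⟩; exact Quot.sound (.smul_comp e c s t)
  comp2_smul e c := by rintro ⟨s⟩ ⟨t⟩; exact Quot.sound (.comp_smul e c s t)
  id2_comp2 e := by rintro ⟨t⟩; exact Quot.sound (.id_comp rfl e t)
  comp2_id2 e := by rintro ⟨t⟩; exact Quot.sound (.comp_id rfl e t)
  assoc2 e₁ e₂ e₃ e₄ := by rintro ⟨t⟩ ⟨t'⟩ ⟨t''⟩; exact Quot.sound (.assoc e₁ e₂ e₃ e₄ t t' t'')
  whL_add f _ _ _ _ := by rintro ⟨t⟩ ⟨t'⟩ hs ht; exact Quot.sound (.whL_add f t t' hs ht)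
  whL_smul f _ _ _ _ c := by rintro ⟨t⟩ hs ht; exact Quot.sound (.whL_smul f c t hs ht)
  whL_id2 f g _ hs := Quot.sound (.whL_id f g rfl hs)
  whL_comp2 f _ _ _ _ _ _ e := by
    rintro ⟨t⟩ ⟨t'⟩ hs ht hz; exact Quot.sound (.whL_comp f e t t' hs ht hz)
  id_whL := by rintro _ _ _ _ _ ⟨t⟩ hs ht; exact Quot.sound (.id_whL t hs ht)
  comp_whL f f' _ _ _ _ _ _ := by
    rintro ⟨t⟩ hs ht hy hz hy' hz'; exact Quot.sound (.comp_whL f f' t hs ht hy hz hy' hz')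
  whR_add := by
    rintro _ _ _ _ _ _ _ _ ⟨t⟩ ⟨t'⟩ h hs ht; exact Quot.sound (.whR_add t t' h hs ht)
  whR_smul c := by rintro ⟨t⟩ h hs ht; exact Quot.sound (.whR_smul c t h hs ht)
  whR_id2 f g _ hs := Quot.sound (.whR_id f g rfl hs)
  whR_comp2 h _ _ _ e := by
    rintro ⟨t⟩ ⟨t'⟩ hs ht hz; exact Quot.sound (.whR_comp h e t t' hs ht hz)
  whR_id := by rintro _ _ _ _ _ ⟨t⟩ hs ht; exact Quot.sound (.whR_one t hs ht)
  whR_comp h h' _ _ _ _ := by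
    rintro ⟨t⟩ hs ht hy hz hy' hz'; exact Quot.sound (.whR_whR h h' t hs ht hy hz hy' hz')
  whL_whR f _ _ h _ _ _ _ _ _ := by
    rintro ⟨t⟩ hs ht hs' ht' hy hz hy' hz'
    exact Quot.sound (.whL_whR f h t hs ht hs' ht' hy hz hy' hz')
  interchange e e' := by
    rintro ⟨s⟩ ⟨t⟩ hs ht ht' hz; exact Quot.sound (.interchange e e' s t hs ht ht' hz)

end

/-- The generating 2-morphism `x : E 1_l ⇒ E 1_l` of `𝔘`. -/
def genX (k : Type u) [Field k] {a b : UObj} (h : a.wt + 2 = b.wt) :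
    Hom2 k (2, 1) (oneE h) (oneE h) :=
  (Quot.mk _ (.x h) : UHom2 k _ _ _)

/-- The generating 2-morphism `τ : E E 1_l ⇒ E E 1_l` of `𝔘`. -/
def genTau (k : Type u) [Field k] {a b : UObj} (h : a.wt + 4 = b.wt) :
    Hom2 k (-2, 1) (oneEE h) (oneEE h) :=
  (Quot.mk _ (.τ h) : UHom2 k _ _ _)

/-- The generating 2-morphism `η : 1_l ⇒ F E 1_l` of `𝔘`. -/
def genEta (k : Type u) [Field k] (a : UObj) : Hom2 k (1 + a.wt, 0) (𝟙 a) (oneFE a) :=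
  (Quot.mk _ (.η a) : UHom2 k _ _ _)

/-- The generating 2-morphism `ε : E F 1_l ⇒ 1_l` of `𝔘`. -/
def genEps (k : Type u) [Field k] (a : UObj) : Hom2 k (1 - a.wt, 0) (oneEF a) (𝟙 a) :=
  (Quot.mk _ (.ε a) : UHom2 k _ _ _)

/-! ## Graded superalgebras and supermodules -/

/-- A graded superalgebra over `k`; `gr (i, a)` is the component of degree `i` and parity `a`. -/
structure GSAlg (k : Type u) [Field k] where
  carrier : Type u
  [ring : Ring carrier]
  [alg : Algebra k carrier]
  gr : Deg → Submodule k carrier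
  [graded : GradedAlgebra gr]

attribute [instance] GSAlg.ring GSAlg.alg GSAlg.graded

/-- A homomorphism of graded superalgebras. -/
structure GSAlg.Hom {k : Type u} [Field k] (A B : GSAlg k) where
  map : A.carrier →ₐ[k] B.carrier
  map_mem : ∀ p a, a ∈ A.gr p → map a ∈ B.gr p

namespace GSAlg

variable {k : Type u} [Field k] (A : GSAlg k)

/-- Auxiliary to `GSAlg.inv`: the map `(a_p)_p ↦ ∑_p (-1)^(s|a_p|) a_p`. -/
noncomputable def invAux (s : ZMod 2) : (DirectSum Deg fun p => A.gr p) →ₐ[k] A.carrier :=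
  DirectSum.toAlgebra k (fun p => A.gr p) (fun p => sgn k (s * p.2) • (A.gr p).subtype)
    (by
      rw [LinearMap.smul_apply, Prod.snd_zero, mul_zero, sgn_zero, one_smul]; rfl)
    (by
      intro p q a b
      simp only [LinearMap.smul_apply, Submodule.subtype_apply, Prod.snd_add, mul_add, sgn_add,
        smul_mul_smul_comm]
      rfl)

/-- The automorphism `a ↦ (-1)^(s|a|) a` of a superalgebra, that is, the power `φ^s` of the
parity involution `φ`. -/
noncomputable def inv (s : ZMod 2) : A.carrier →ₐ[k] A.carrier :=
  (A.invAux s).comp (DirectSum.decomposeAlgEquiv A.gr).toAlgHom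

theorem inv_of_mem (s : ZMod 2) {p : Deg} {a : A.carrier} (ha : a ∈ A.gr p) :
    A.inv s a = sgn k (s * p.2) • a := by
  change A.invAux s (DirectSum.decompose A.gr a) = _
  rw [DirectSum.decompose_of_mem A.gr ha, invAux, DirectSum.toAlgebra_apply]
  exact DirectSum.toSemiring_of _ _ _ _ _

theorem hom_induction {motive : A.carrier → Prop} (h : ∀ p a, a ∈ A.gr p → motive a)
    (h0 : motive 0) (hadd : ∀ a b, motive a → motive b → motive (a + b)) (a : A.carrier) :
    motive a :=
  DirectSum.Decomposition.inductionOn A.gr h0 (fun {p} m => h p m m.2) hadd a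

theorem inv_inv (s t : ZMod 2) (a : A.carrier) : A.inv s (A.inv t a) = A.inv (s + t) a := by
  induction a using A.hom_induction with
  | h p a ha =>
    rw [A.inv_of_mem t ha, map_smul, A.inv_of_mem s ha, A.inv_of_mem _ ha, smul_smul, ← sgn_add]
    congr 2; ring
  | h0 => simp
  | hadd a b ha hb => simp only [map_add, ha, hb]

theorem inv_zero (a : A.carrier) : A.inv 0 a = a := by
  induction a using A.hom_induction with
  | h p a ha => rw [A.inv_of_mem _ ha, zero_mul, sgn_zero, one_smul]
  | h0 => simp
  | hadd a b ha hb => simp only [map_add, ha, hb]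

theorem inv_self (s : ZMod 2) (a : A.carrier) : A.inv s (A.inv s a) = a := by
  rw [inv_inv, CharTwo.add_self_eq_zero, inv_zero]

variable {A} in
theorem Hom.map_inv {B : GSAlg k} (f : A.Hom B) (s : ZMod 2) (a : A.carrier) :
    f.map (A.inv s a) = B.inv s (f.map a) := by
  induction a using A.hom_induction with
  | h p a ha => rw [A.inv_of_mem s ha, map_smul, B.inv_of_mem s (f.map_mem p a ha)]
  | h0 => simp
  | hadd a b ha hb => simp only [map_add, ha, hb]

end GSAlg

/-- A graded left supermodule over a graded superalgebra. -/
structure SMod {k : Type u} [Field k] (A : GSAlg k) where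
  carrier : Type u
  [grp : AddCommGroup carrier]
  [kmod : Module k carrier]
  [mod : Module A.carrier carrier]
  [tower : IsScalarTower k A.carrier carrier]
  gr : Deg → Submodule k carrier
  internal : DirectSum.IsInternal gr
  smul_mem : ∀ p q a m, a ∈ A.gr p → m ∈ gr q → a • m ∈ gr (p + q)

attribute [instance] SMod.grp SMod.kmod SMod.mod SMod.tower

namespace SMod

variable {k : Type u} [Field k] {A : GSAlg k}

theorem hom_induction (M : SMod A) {motive : M.carrier → Prop}
    (h : ∀ p a, a ∈ M.gr p → motive a)
    (h0 : motive 0) (hadd : ∀ a b, motive a → motive b → motive (a + b)) (a : M.carrier) :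
    motive a := by
  let _ := M.internal.chooseDecomposition
  exact DirectSum.Decomposition.inductionOn M.gr h0 (fun {p} m => h p m m.2) hadd a

/-- The morphisms `M → N` of degree and parity `p`: linear maps `f` that shift degrees by `p` and
satisfy `f (a m) = (-1)^(|f||a|) a f(m)`. -/
def Hom (p : Deg) (M N : SMod A) : Submodule k (M.carrier →ₗ[k] N.carrier) where
  carrier := {f | (∀ q, ∀ m ∈ M.gr q, f m ∈ N.gr (q + p)) ∧
    ∀ (a : A.carrier) (m : M.carrier), f (a • m) = A.inv p.2 a • f m}
  add_mem' {f g} hf hg := ⟨fun q m hm => add_mem (hf.1 q m hm) (hg.1 q m hm), fun a m => by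
    simp only [LinearMap.add_apply, hf.2, hg.2, smul_add]⟩
  zero_mem' := ⟨fun q m _ => zero_mem _, fun a m => by simp⟩
  smul_mem' c f hf := ⟨fun q m hm => Submodule.smul_mem _ _ (hf.1 q m hm), fun a m => by
    simp only [LinearMap.smul_apply, hf.2, smul_comm c]⟩

/-- Composition of morphisms, `f` being applied first. -/
def comp {p q r : Deg} {M N L : SMod A} (e : p + q = r) (f : Hom p M N) (g : Hom q N L) :
    Hom r M L :=
  ⟨g.1 ∘ₗ f.1, fun s m hm => by
      have h := g.2.1 _ _ (f.2.1 s m hm)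
      rwa [add_assoc, e] at h, fun a m => by
      rw [LinearMap.comp_apply, LinearMap.comp_apply, f.2.2, g.2.2, GSAlg.inv_inv, ← e, add_comm]
      rfl⟩

end SMod

/-- The graded supercategory of graded left supermodules over `A`. -/
abbrev sMod {k : Type u} [Field k] (A : GSAlg k) : GSCat k where
  Obj := SMod A
  Hom p M N := SMod.Hom p M N
  id M := ⟨LinearMap.id, fun q m hm => by rw [add_zero]; exact hm, fun a m => by
    rw [Prod.snd_zero, GSAlg.inv_zero]; rfl⟩
  comp e f g := SMod.comp e f g
  add_comp e f g h := Subtype.ext (LinearMap.comp_add _ _ _)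
  comp_add e f g h := Subtype.ext (LinearMap.add_comp _ _ _)
  smul_comp e c f g := Subtype.ext (LinearMap.comp_smul _ _ _)
  comp_smul e c f g := Subtype.ext (LinearMap.smul_comp _ _ _)
  id_comp e f := rfl
  comp_id e f := rfl
  assoc e₁ e₂ e₃ e₄ f g h := rfl

/-! ### Degree and parity shifts -/

namespace SMod

variable {k : Type u} [Field k] {A : GSAlg k}

/-- The shift `Q^m Π^a M`, for `s = (m, a)`: the same space with `(Q^m Π^a M)_p = M_(p - s)` and
with the action twisted by the power `φ^a` of the parity involution. -/
noncomputable def shift (s : Deg) (M : SMod A) : SMod A :=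
  { carrier := M.carrier
    mod := Module.compHom M.carrier (A.inv s.2).toRingHom
    tower := @IsScalarTower.mk k A.carrier M.carrier _
      (Module.compHom M.carrier (A.inv s.2).toRingHom).toSMul _ fun c a x => by
        change A.inv s.2 (c • a) • x = c • (A.inv s.2 a • x)
        rw [map_smul, smul_assoc]
    gr := fun p => M.gr (p - s)
    internal := by
      have h := (DirectSum.isInternal_submodule_iff_iSupIndep_and_iSup_eq_top M.gr).1 M.internal
      refine (DirectSum.isInternal_submodule_iff_iSupIndep_and_iSup_eq_top _).2
        ⟨h.1.comp (sub_left_injective (b := s)), ?_⟩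
      rw [← h.2]
      exact (Equiv.subRight s).iSup_comp (g := M.gr)
    smul_mem := fun p q a x ha hx => by
      change A.inv s.2 a • x ∈ M.gr (p + q - s)
      rw [A.inv_of_mem _ ha, add_sub_assoc]
      exact M.smul_mem _ _ _ _ (Submodule.smul_mem _ _ ha) hx }

/-- A linear map, viewed as a map between shifted modules. -/
noncomputable def shiftLin (s : Deg) {M N : SMod A} (f : M.carrier →ₗ[k] N.carrier) :
    (shift s M).carrier →ₗ[k] (shift s N).carrier := f

/-- The action of `Q^m Π^a` on morphisms: `f ↦ (-1)^(a|f|) f`. -/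
noncomputable def shiftMap (s : Deg) {p : Deg} {M N : SMod A} (f : Hom p M N) :
    Hom p (shift s M) (shift s N) :=
  ⟨sgn k (s.2 * p.2) • shiftLin s f.1, fun q m hm => by
    have h := f.2.1 _ m hm
    have e : q - s + p = q + p - s := by abel
    rw [e] at h
    exact Submodule.smul_mem _ _ h, by
    have h : ∀ (a : A.carrier) (m : M.carrier), sgn k (s.2 * p.2) • f.1 (A.inv s.2 a • m) =
        A.inv s.2 (A.inv p.2 a) • (sgn k (s.2 * p.2) • f.1 m) := fun a m => by
      rw [f.2.2, GSAlg.inv_inv, GSAlg.inv_inv, smul_comm, add_comm]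
    exact h⟩

/-- The identity map `Q^m Π^a M → M`, of degree `(-m, a)`. -/
def ofShift (s p : Deg) (e : p = -s) (M : SMod A) : Hom p (shift s M) M :=
  ⟨{ toFun := fun m => m
     map_add' := fun _ _ => rfl
     map_smul' := fun _ _ => rfl }, fun q m hm => by
      rw [e, ← sub_eq_add_neg]; exact hm, fun a m => by
      rw [e, Prod.snd_neg, CharTwo.neg_eq]; rfl⟩

/-- The identity map `M → Q^m Π^a M`, of degree `(m, a)`. -/
def toShift (s p : Deg) (e : p = s) (M : SMod A) : Hom p M (shift s M) :=
  ⟨{ toFun := fun m => m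
     map_add' := fun _ _ => rfl
     map_smul' := fun _ _ => rfl }, fun q m hm => by
      change m ∈ M.gr (q + p - s)
      rw [e, add_sub_cancel_right]; exact hm, fun a m => by
      change a • m = A.inv s.2 (A.inv p.2 a) • m
      rw [e, GSAlg.inv_self]⟩

end SMod

section
variable {k : Type u} [Field k] (A : GSAlg k)

/-- The superfunctor `Q^m Π^a` on supermodules, for `s = (m, a)`. -/
noncomputable def shiftFun (s : Deg) : GSFun (sMod A) (sMod A) where
  obj M := SMod.shift s M
  map {p M N} :=
    { toFun := fun f => SMod.shiftMap s f
      map_add' := fun f g => Subtype.ext (smul_add _ (SMod.shiftLin s f.1) (SMod.shiftLin s g.1))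
      map_smul' := fun c f => Subtype.ext (LinearMap.ext fun (m : M.carrier) =>
        smul_comm (sgn k (s.2 * p.2)) c (f.1 m)) }
  map_id M := Subtype.ext (by
    change sgn k (s.2 * 0) • SMod.shiftLin s _ = _
    rw [mul_zero, sgn_zero, one_smul]; rfl)
  map_comp {p q r M N L} e f g := Subtype.ext (by
    change sgn k (s.2 * r.2) • (SMod.shiftLin s g.1 ∘ₗ SMod.shiftLin s f.1) =
      (sgn k (s.2 * q.2) • SMod.shiftLin s g.1) ∘ₗ (sgn k (s.2 * p.2) • SMod.shiftLin s f.1)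
    rw [LinearMap.smul_comp, LinearMap.comp_smul, smul_smul, ← sgn_add, ← mul_add, ← e, add_comm]
    rfl)

/-- The identity map of `M`, as a supernatural isomorphism `Q^m Π^a M → M` of degree `(-m, a)`. -/
noncomputable def shiftIso (s p : Deg) (e : p = -s) : GSIso p (shiftFun A s) (GSFun.id (sMod A)) where
  hom := ⟨fun M => SMod.ofShift s p e M, fun q r e₁ e₂ M N f => Subtype.ext (by
      change sgn k (s.2 * q.2) • f.1 = sgn k (p.2 * q.2) • f.1
      rw [e, Prod.snd_neg, CharTwo.neg_eq])⟩
  inv := ⟨fun M => SMod.toShift s (-p) (by rw [e, neg_neg]) M,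
    fun q r e₁ e₂ M N f => Subtype.ext (by
      change f.1 = sgn k ((-p).2 * q.2) • sgn k (s.2 * q.2) • f.1
      rw [e, neg_neg, smul_smul, sgn_mul_self, one_smul])⟩
  hom_inv M := rfl
  inv_hom M := rfl

end

/-- The full subcategory on the objects that satisfy `P`. -/
def GSCat.full {k : Type u} [Field k] (C : GSCat k) (P : C.Obj → Prop) : GSCat k where
  Obj := {X : C.Obj // P X}
  Hom p X Y := C.Hom p X.1 Y.1
  id X := C.id X.1
  comp e f g := C.comp e f g
  add_comp := C.add_comp
  comp_add := C.comp_add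
  smul_comp := C.smul_comp
  comp_smul := C.comp_smul
  id_comp := C.id_comp
  comp_id := C.comp_id
  assoc := C.assoc

/-- The restriction of a superfunctor to full subcategories. -/
def GSFun.restrict {k : Type u} [Field k] {C D : GSCat k} (F : GSFun C D) (P : C.Obj → Prop)
    (P' : D.Obj → Prop) (h : ∀ X, P X → P' (F.obj X)) : GSFun (C.full P) (D.full P') where
  obj X := ⟨F.obj X.1, h X.1 X.2⟩
  map := F.map
  map_id X := F.map_id X.1
  map_comp := F.map_comp

/-- The restriction of a supernatural isomorphism `F ⇒ 1` to a full subcategory. -/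
def GSIso.restrict {k : Type u} [Field k] {C : GSCat k} {p : Deg} {F : GSFun C C}
    (α : GSIso p F (GSFun.id C)) (P : C.Obj → Prop) (h : ∀ X, P X → P (F.obj X)) :
    GSIso p (F.restrict P P h) (GSFun.id (C.full P)) where
  hom := ⟨fun X => α.hom.1 X.1, fun q r e e' X Y f => α.hom.2 q r e e' X.1 Y.1 f⟩
  inv := ⟨fun X => α.inv.1 X.1, fun q r e e' X Y f => α.inv.2 q r e e' X.1 Y.1 f⟩
  hom_inv X := α.hom_inv X.1
  inv_hom X := α.inv_hom X.1

section
variable {k : Type u} [Field k]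

/-- Projective supermodules; finitely generated ones if `fg` holds. -/
def IsProj (fg : Prop) (A : GSAlg k) (M : SMod A) : Prop :=
  Module.Projective A.carrier M.carrier ∧ (fg → Module.Finite A.carrier M.carrier)

/-- The automorphism `φ^s` as a ring isomorphism. -/
noncomputable def GSAlg.invEquiv (A : GSAlg k) (s : ZMod 2) : A.carrier ≃+* A.carrier :=
  RingEquiv.ofRingHom (A.inv s).toRingHom (A.inv s).toRingHom
    (RingHom.ext fun a => A.inv_self s a) (RingHom.ext fun a => A.inv_self s a)

theorem IsProj.shift {fg : Prop} {A : GSAlg k} (s : Deg) (M : SMod A) (h : IsProj fg A M) :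
    IsProj fg A (M.shift s) := by
  have := RingHomInvPair.of_ringEquiv (A.invEquiv s.2)
  have := RingHomInvPair.symm (↑(A.invEquiv s.2) : A.carrier →+* A.carrier)
    (↑(A.invEquiv s.2).symm : A.carrier →+* A.carrier)
  let e : M.carrier ≃ₛₗ[(↑(A.invEquiv s.2) : A.carrier →+* A.carrier)] (M.shift s).carrier :=
    { toFun := fun m => m
      invFun := fun m => m
      left_inv := fun _ => rfl
      right_inv := fun _ => rfl
      map_add' := fun _ _ => rfl
      map_smul' := fun a m => by
        change a • m = A.inv s.2 (A.inv s.2 a) • m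
        rw [A.inv_self] }
  obtain ⟨h₁, h₂⟩ := h
  refine ⟨Module.Projective.of_equiv e, fun hfg => ?_⟩
  have := h₂ hfg
  exact Module.Finite.of_surjective (e.toLinearMap) e.surjective

/-- The graded `(Q, Π)`-supercategory of graded projective supermodules over `A` (of finitely
generated ones if `fg` holds). -/
noncomputable def sProj (fg : Prop) (A : GSAlg k) : QPCat k where
  cat := (sMod A).full (IsProj fg A)
  Q := (shiftFun A (1, 0)).restrict _ _ (IsProj.shift _)
  Qinv := (shiftFun A (-1, 0)).restrict _ _ (IsProj.shift _)
  P := (shiftFun A (0, 1)).restrict _ _ (IsProj.shift _)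
  σ := (shiftIso A (1, 0) (-1, 0) rfl).restrict _ (IsProj.shift _)
  σbar := (shiftIso A (-1, 0) (1, 0) rfl).restrict _ (IsProj.shift _)
  ζ := (shiftIso A (0, 1) (0, 1) rfl).restrict _ (IsProj.shift _)

/-- The zero supercategory. -/
def zeroGSCat (k : Type u) [Field k] : GSCat k where
  Obj := PUnit
  Hom _ _ _ := PUnit
  id _ := PUnit.unit
  comp _ _ _ := PUnit.unit
  add_comp _ _ _ _ := rfl
  comp_add _ _ _ _ := rfl
  smul_comp _ _ _ _ := rfl
  comp_smul _ _ _ _ := rfl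
  id_comp _ _ := rfl
  comp_id _ _ := rfl
  assoc _ _ _ _ _ _ _ := rfl

/-- The identity of the zero supercategory, as a supernatural isomorphism of any degree. -/
def zeroGSIso (k : Type u) [Field k] (p : Deg) :
    GSIso p (GSFun.id (zeroGSCat k)) (GSFun.id (zeroGSCat k)) where
  hom := 0
  inv := 0
  hom_inv _ := rfl
  inv_hom _ := rfl

/-- The zero `(Q, Π)`-supercategory. -/
def zeroQPCat (k : Type u) [Field k] : QPCat k where
  cat := zeroGSCat k
  Q := GSFun.id _
  Qinv := GSFun.id _
  P := GSFun.id _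
  σ := zeroGSIso k _
  σbar := zeroGSIso k _
  ζ := zeroGSIso k _

end

/-! ### Graded superalgebras given by generators and relations -/

section
variable {k : Type u} [Field k] {X : Type} (deg : X → Deg)

/-- Homogeneous elements of the free algebra, for given degrees of the generators. -/
inductive Homog : Deg → FreeAlgebra k X → Prop
  | gen (g : X) : Homog (deg g) (FreeAlgebra.ι k g)
  | one : Homog 0 1
  | mul {p q : Deg} {a b : FreeAlgebra k X} : Homog p a → Homog q b → Homog (p + q) (a * b)
  | zero (p : Deg) : Homog p 0
  | add {p : Deg} {a b : FreeAlgebra k X} : Homog p a → Homog p b → Homog p (a + b)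
  | smul {p : Deg} {a : FreeAlgebra k X} (c : k) : Homog p a → Homog p (c • a)

variable (r : FreeAlgebra k X → FreeAlgebra k X → Prop)

/-- The homogeneous components of the quotient of the free algebra by the relations `r`. -/
def presentedGr (p : Deg) : Submodule k (RingQuot r) where
  carrier := {y | ∃ a, Homog deg p a ∧ RingQuot.mkAlgHom k r a = y}
  add_mem' := by
    rintro _ _ ⟨a, ha, rfl⟩ ⟨b, hb, rfl⟩
    exact ⟨a + b, ha.add hb, map_add _ _ _⟩
  zero_mem' := ⟨0, .zero p, map_zero _⟩
  smul_mem' := by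
    rintro c _ ⟨a, ha, rfl⟩
    exact ⟨c • a, ha.smul c, map_smul _ _ _⟩

instance : SetLike.GradedMonoid (presentedGr deg r) where
  one_mem := ⟨1, .one, map_one _⟩
  mul_mem := by
    rintro p q _ _ ⟨a, ha, rfl⟩ ⟨b, hb, rfl⟩
    exact ⟨a * b, ha.mul hb, map_mul _ _ _⟩

/-- Auxiliary to the decomposition of `RingQuot r`. -/
noncomputable def presentedPre :
    FreeAlgebra k X →ₐ[k] DirectSum Deg fun p => presentedGr deg r p :=
  FreeAlgebra.lift k fun g => DirectSum.of (fun p => presentedGr deg r p) (deg g)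
    ⟨RingQuot.mkAlgHom k r (FreeAlgebra.ι k g), _, .gen g, rfl⟩

theorem presentedPre_of {p : Deg} {a : FreeAlgebra k X} (ha : Homog deg p a) :
    presentedPre deg r a = DirectSum.of (fun p => presentedGr deg r p) p
      ⟨RingQuot.mkAlgHom k r a, a, ha, rfl⟩ := by
  induction ha with
  | gen g => exact FreeAlgebra.lift_ι_apply _ _
  | one =>
    rw [map_one, DirectSum.one_def]
    congr 1
    exact Subtype.ext (map_one _).symm
  | mul ha hb iha ihb =>
    rw [map_mul, iha, ihb, DirectSum.of_mul_of]
    congr 1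
    exact Subtype.ext (map_mul _ _ _).symm
  | zero p =>
    rw [map_zero, ← map_zero (DirectSum.of (fun p => presentedGr deg r p) p)]
    congr 1
    exact Subtype.ext (map_zero _).symm
  | add ha hb iha ihb =>
    rw [map_add, iha, ihb, ← map_add]
    congr 1
    exact Subtype.ext (map_add _ _ _).symm
  | smul c ha iha =>
    rw [map_smul, iha, ← DirectSum.of_smul]
    congr 1
    exact Subtype.ext (map_smul _ _ _).symm

/-- The graded superalgebra with generators `X` in degrees `deg` and with homogeneous
relations `r`. -/
noncomputable def presented
    (h : ∀ a b, r a b → ∃ p, Homog deg p a ∧ Homog deg p b) : GSAlg k where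
  carrier := RingQuot r
  gr := presentedGr deg r
  graded := GradedAlgebra.ofAlgHom _
    (RingQuot.liftAlgHom k ⟨presentedPre deg r, by
      intro a b hab
      obtain ⟨p, ha, hb⟩ := h a b hab
      rw [presentedPre_of deg r ha, presentedPre_of deg r hb]
      congr 1
      exact Subtype.ext (RingQuot.mkAlgHom_rel k hab)⟩)
    (by
      apply RingQuot.ringQuot_ext'
      apply FreeAlgebra.hom_ext
      funext g
      change DirectSum.coeAlgHom _ (RingQuot.liftAlgHom k _ (RingQuot.mkAlgHom k r _)) = _
      rw [RingQuot.liftAlgHom_mkAlgHom_apply, presentedPre, FreeAlgebra.lift_ι_apply]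
      exact DirectSum.coeAlgHom_of _ _ _)
    (by
      rintro p ⟨_, a, ha, rfl⟩
      rw [RingQuot.liftAlgHom_mkAlgHom_apply]
      exact presentedPre_of deg r ha)

variable (h : ∀ a b, r a b → ∃ p, Homog deg p a ∧ Homog deg p b)

/-- The generators of a presented algebra. -/
noncomputable def pgen (g : X) : (presented deg r h).carrier :=
  RingQuot.mkAlgHom k r (FreeAlgebra.ι k g)

theorem pgen_mem (g : X) : pgen deg r h g ∈ (presented deg r h).gr (deg g) := ⟨_, .gen g, rfl⟩

variable {deg r h}

theorem presented_induction {motive : (presented deg r h).carrier → Prop}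
    (gen : ∀ g, motive (pgen deg r h g)) (hc : ∀ c, motive (algebraMap k _ c))
    (hmul : ∀ a b, motive a → motive b → motive (a * b))
    (hadd : ∀ a b, motive a → motive b → motive (a + b)) (a : (presented deg r h).carrier) :
    motive a := by
  obtain ⟨a, rfl⟩ := RingQuot.mkAlgHom_surjective k r a
  induction a using FreeAlgebra.induction with
  | grade0 c => rw [AlgHom.commutes]; exact hc c
  | grade1 g => exact gen g
  | mul a b ha hb => rw [map_mul]; exact hmul _ _ ha hb
  | add a b ha hb => rw [map_add]; exact hadd _ _ ha hb

/-- Auxiliary to `presentedLift`. -/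
noncomputable def presentedLiftAux {B : GSAlg k} (f : X → B.carrier)
    (hr : ∀ a b, r a b → FreeAlgebra.lift k f a = FreeAlgebra.lift k f b) :
    RingQuot r →ₐ[k] B.carrier :=
  RingQuot.liftAlgHom k ⟨FreeAlgebra.lift k f, fun {a b} h => hr a b h⟩

theorem presentedLiftAux_mk {B : GSAlg k} (f : X → B.carrier)
    (hr : ∀ a b, r a b → FreeAlgebra.lift k f a = FreeAlgebra.lift k f b) (a : FreeAlgebra k X) :
    presentedLiftAux f hr (RingQuot.mkAlgHom k r a) = FreeAlgebra.lift k f a :=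
  RingQuot.liftAlgHom_mkAlgHom_apply _ _ _ _

/-- The homomorphism out of a presented algebra with given values on the generators. -/
noncomputable def presentedLift {B : GSAlg k} (f : X → B.carrier)
    (hf : ∀ g, f g ∈ B.gr (deg g))
    (hr : ∀ a b, r a b → FreeAlgebra.lift k f a = FreeAlgebra.lift k f b) :
    (presented deg r h).Hom B where
  map := presentedLiftAux f hr
  map_mem := by
    rintro p _ ⟨a, ha, rfl⟩
    have key : FreeAlgebra.lift k f a ∈ B.gr p := by
      induction ha with
      | gen g => rw [FreeAlgebra.lift_ι_apply]; exact hf g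
      | one => rw [map_one]; exact SetLike.GradedOne.one_mem
      | mul ha hb iha ihb => rw [map_mul]; exact SetLike.GradedMul.mul_mem iha ihb
      | zero p => rw [map_zero]; exact zero_mem _
      | add ha hb iha ihb => rw [map_add]; exact add_mem iha ihb
      | smul c ha iha => rw [map_smul]; exact Submodule.smul_mem _ _ iha
    rw [← presentedLiftAux_mk f hr] at key
    exact key

theorem presentedLift_pgen {B : GSAlg k} (f : X → B.carrier) (hf : ∀ g, f g ∈ B.gr (deg g))
    (hr : ∀ a b, r a b → FreeAlgebra.lift k f a = FreeAlgebra.lift k f b) (g : X) :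
    (presentedLift (h := h) f hf hr).map (pgen deg r h g) = f g :=
  (presentedLiftAux_mk f hr _).trans (FreeAlgebra.lift_ι_apply _ _)

/-- An element that supercommutes with the images of the generators supercommutes with the image
of the algebra. -/
theorem supercomm_of_gen {B : GSAlg k} (f : (presented deg r h).Hom B) (s : ZMod 2)
    (z : B.carrier)
    (hz : ∀ g, z * f.map (pgen deg r h g) = sgn k (s * (deg g).2) • (f.map (pgen deg r h g) * z))
    (a : (presented deg r h).carrier) :
    z * f.map a = f.map ((presented deg r h).inv s a) * z := by
  induction a using presented_induction with
  | gen g => rw [hz, GSAlg.inv_of_mem _ _ (pgen_mem deg r h g), map_smul, smul_mul_assoc]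
  | hc c => rw [AlgHom.commutes, AlgHom.commutes, AlgHom.commutes, Algebra.commutes]
  | hmul a b ha hb => rw [map_mul, map_mul, map_mul, ← mul_assoc, ha, mul_assoc, hb, mul_assoc]
  | hadd a b ha hb => rw [map_add, map_add, map_add, mul_add, add_mul, ha, hb]

end

/-! ### Deformed cyclotomic quotients of odd nilHecke algebras -/

/-- The generators of `ONH_m ⊗ A_n`: the generators `x_i` (`i < m`) and `τ_i` (`i + 1 < m`) of
the odd nilHecke algebra, with indices starting at `0`, and the generators `χ_j` (`1 ≤ j ≤ n / 2`)
and `d` of `A_n`. -/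
inductive Gen (n m : ℕ) : Type
  | x (i : ℕ) (h : i < m)
  | tau (i : ℕ) (h : i + 1 < m)
  | chi (j : ℕ) (h₀ : 0 < j) (h : 2 * j ≤ n)
  | d

/-- Degrees and parities of the generators. -/
def Gen.deg {n m : ℕ} : Gen n m → Deg
  | .x _ _ => (2, 1)
  | .tau _ _ => (-2, 1)
  | .chi j _ _ => (4 * j, 0)
  | .d => (2, 1)

section
variable (k : Type u) [Field k] (n m : ℕ)

/-- `x_i` in the free algebra. -/
def fx {n m : ℕ} (i : ℕ) (h : i < m) : FreeAlgebra k (Gen n m) := FreeAlgebra.ι k (.x i h)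

/-- `τ_i` in the free algebra. -/
def ftau {n m : ℕ} (i : ℕ) (h : i + 1 < m) : FreeAlgebra k (Gen n m) := FreeAlgebra.ι k (.tau i h)

/-- `d` in the free algebra. -/
def fd {n m : ℕ} : FreeAlgebra k (Gen n m) := FreeAlgebra.ι k .d

/-- `χ_j` in the free algebra, with `χ_0 = 1`. -/
def fchi {n m : ℕ} (j : ℕ) (h : 2 * j ≤ n) : FreeAlgebra k (Gen n m) :=
  if h₀ : 0 < j then FreeAlgebra.ι k (.chi j h₀ h) else 1

/-- The coefficients `c_i` (`i ≤ n`): `c_(2j) = χ_j` and `c_(2j+1) = d χ_j`. -/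
def fc {n m : ℕ} (i : ℕ) (h : i ≤ n) : FreeAlgebra k (Gen n m) :=
  if Even i then fchi k (i / 2) (by lia) else fd k * fchi k (i / 2) (by lia)

/-- The element `a^n(x_0) = ∑_{l ≤ n} (-1)^l x_0^l c_(n-l)`. -/
def fcyc {n m : ℕ} (h : 0 < m) : FreeAlgebra k (Gen n m) :=
  ∑ l : Fin (n + 1), (-1 : k) ^ (l : ℕ) • (fx k 0 h ^ (l : ℕ) * fc k (n - l) (Nat.sub_le _ _))

/-- The relations of `(ONH_m ⊗ A_n) / (a^n(x_0))`: those of the odd nilHecke algebra, those of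
`A_n`, the supercommutation of the two tensor factors and, if `m > 0`, the vanishing
of `a^n(x_0)`. -/
inductive ONHRel : FreeAlgebra k (Gen n m) → FreeAlgebra k (Gen n m) → Prop
  | tau_sq (i : ℕ) (h : i + 1 < m) : ONHRel (ftau k i h * ftau k i h) 0
  | braid (i : ℕ) (h : i + 2 < m) :
      ONHRel (ftau k i (by lia) * ftau k (i + 1) h * ftau k i (by lia))
        (ftau k (i + 1) h * ftau k i (by lia) * ftau k (i + 1) h)
  | x_tau (i : ℕ) (h : i + 1 < m) :
      ONHRel (fx k i (by lia) * ftau k i h + ftau k i h * fx k (i + 1) h) 1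
  | tau_x (i : ℕ) (h : i + 1 < m) :
      ONHRel (ftau k i h * fx k i (by lia) + fx k (i + 1) h * ftau k i h) 1
  | x_x (i j : ℕ) (hi : i < m) (hj : j < m) (hij : i ≠ j) :
      ONHRel (fx k i hi * fx k j hj + fx k j hj * fx k i hi) 0
  | tau_tau (i j : ℕ) (hi : i + 1 < m) (hj : j + 1 < m) (hij : i + 1 < j) :
      ONHRel (ftau k i hi * ftau k j hj + ftau k j hj * ftau k i hi) 0
  | x_tau_far (i j : ℕ) (hi : i < m) (hj : j + 1 < m) (h₁ : i ≠ j) (h₂ : i ≠ j + 1) :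
      ONHRel (fx k i hi * ftau k j hj + ftau k j hj * fx k i hi) 0
  | chi_comm (j : ℕ) (h : 2 * j ≤ n) (g : Gen n m) :
      ONHRel (fchi k j h * FreeAlgebra.ι k g) (FreeAlgebra.ι k g * fchi k j h)
  | d_x (i : ℕ) (h : i < m) : ONHRel (fd k * fx k i h + fx k i h * fd k) 0
  | d_tau (i : ℕ) (h : i + 1 < m) : ONHRel (fd k * ftau k i h + ftau k i h * fd k) 0
  | d_sq : ONHRel (fd k * fd k) 0
  | d_chi (j : ℕ) (h : 2 * j = n) : ONHRel (fd k * fchi k j h.le) 0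
  | cyc (h : 0 < m) : ONHRel (fcyc k h) 0

variable {k n m}

theorem homog_fx (i : ℕ) (h : i < m) : Homog Gen.deg (2, 1) (fx k (n := n) i h) :=
  .gen (deg := Gen.deg) (.x i h)

theorem homog_ftau (i : ℕ) (h : i + 1 < m) : Homog Gen.deg (-2, 1) (ftau k (n := n) i h) :=
  .gen (deg := Gen.deg) (.tau i h)

theorem homog_fd : Homog Gen.deg (2, 1) (fd k (n := n) (m := m)) := .gen (deg := Gen.deg) .d

theorem homog_fchi (j : ℕ) (h : 2 * j ≤ n) :
    Homog Gen.deg (4 * j, 0) (fchi k (m := m) j h) := by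
  unfold fchi
  split_ifs with h₀
  · exact .gen (deg := Gen.deg) (.chi j h₀ h)
  · obtain rfl : j = 0 := by lia
    exact .one

theorem Homog.cast {X : Type} {deg : X → Deg} {p q : Deg} {a : FreeAlgebra k X}
    (h : Homog deg p a) (e : p = q) : Homog deg q a := e ▸ h

theorem Homog.sum {X ι : Type} {deg : X → Deg} {p : Deg} (s : Finset ι) (f : ι → FreeAlgebra k X)
    (h : ∀ i, Homog deg p (f i)) : Homog deg p (∑ i ∈ s, f i) := by
  classical
  induction s using Finset.induction_on with
  | empty => exact .zero p
  | insert a s ha ih => rw [Finset.sum_insert ha]; exact (h a).add ih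

theorem Homog.pow {X : Type} {deg : X → Deg} {p : Deg} {a : FreeAlgebra k X}
    (h : Homog deg p a) (l : ℕ) : Homog deg (l * p.1, l * p.2) (a ^ l) := by
  induction l with
  | zero => rw [pow_zero]; exact Homog.one.cast (by ext <;> simp)
  | succ l ih =>
    rw [pow_succ]
    exact (ih.mul h).cast (by ext <;> push_cast <;> simp <;> ring)

theorem homog_fc (i : ℕ) (h : i ≤ n) : Homog Gen.deg (2 * i, i) (fc k (m := m) i h) := by
  unfold fc
  split_ifs with hi
  · obtain ⟨j, rfl⟩ := hi
    exact (homog_fchi _ _).cast (by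
      ext
      · change (4 : ℤ) * ((j + j) / 2 : ℕ) = 2 * ((j + j : ℕ) : ℤ)
        lia
      · push_cast; exact (CharTwo.add_self_eq_zero _).symm)
  · obtain ⟨j, rfl⟩ := Nat.not_even_iff_odd.1 hi
    exact (homog_fd.mul (homog_fchi _ _)).cast (by
      ext
      · change (2 : ℤ) + 4 * ((2 * j + 1) / 2 : ℕ) = 2 * ((2 * j + 1 : ℕ) : ℤ)
        lia
      · change (1 : ZMod 2) + 0 = ((2 * j + 1 : ℕ) : ZMod 2)
        rw [Nat.cast_add, Nat.cast_mul]
        simp [CharTwo.two_eq_zero])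

theorem homog_fcyc (h : 0 < m) : Homog Gen.deg (2 * n, n) (fcyc k (n := n) h) := by
  refine Homog.sum _ _ fun l => ?_
  refine (((homog_fx 0 h).pow l).mul (homog_fc (n - l) (Nat.sub_le _ _))).smul _ |>.cast ?_
  have := l.2
  ext
  · simp; lia
  · simp only [mul_one, Prod.snd_add]
    rw [← Nat.cast_add]
    congr 1
    lia

theorem ONHRel.homog (a b : FreeAlgebra k (Gen n m)) (h : ONHRel k n m a b) :
    ∃ p, Homog Gen.deg p a ∧ Homog Gen.deg p b := by
  cases h with
  | tau_sq i h => exact ⟨_, (homog_ftau i h).mul (homog_ftau i h), .zero _⟩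
  | braid i h =>
    exact ⟨_, ((homog_ftau i _).mul (homog_ftau (i + 1) h)).mul (homog_ftau i _),
      ((homog_ftau (i + 1) h).mul (homog_ftau i _)).mul (homog_ftau (i + 1) h)⟩
  | x_tau i h =>
    exact ⟨0, ((homog_fx i _).mul (homog_ftau i h)).add ((homog_ftau i h).mul (homog_fx _ h)), .one⟩
  | tau_x i h =>
    exact ⟨0, ((homog_ftau i h).mul (homog_fx i _)).add ((homog_fx _ h).mul (homog_ftau i h)), .one⟩
  | x_x i j hi hj _ =>
    exact ⟨_, ((homog_fx i hi).mul (homog_fx j hj)).add ((homog_fx j hj).mul (homog_fx i hi)),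
      .zero _⟩
  | tau_tau i j hi hj _ =>
    exact ⟨_, ((homog_ftau i hi).mul (homog_ftau j hj)).add
      ((homog_ftau j hj).mul (homog_ftau i hi)), .zero _⟩
  | x_tau_far i j hi hj _ _ =>
    exact ⟨0, ((homog_fx i hi).mul (homog_ftau j hj)).add
      ((homog_ftau j hj).mul (homog_fx i hi)), .zero _⟩
  | chi_comm j h g =>
    exact ⟨_, (homog_fchi j h).mul (.gen g), ((Homog.gen g).mul (homog_fchi j h)).cast
      (add_comm _ _)⟩
  | d_x i h =>
    exact ⟨_, (homog_fd.mul (homog_fx i h)).add ((homog_fx i h).mul homog_fd), .zero _⟩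
  | d_tau i h =>
    exact ⟨0, (homog_fd.mul (homog_ftau i h)).add ((homog_ftau i h).mul homog_fd), .zero _⟩
  | d_sq => exact ⟨_, homog_fd.mul homog_fd, .zero _⟩
  | d_chi j h => exact ⟨_, homog_fd.mul (homog_fchi j _), .zero _⟩
  | cyc h => exact ⟨_, homog_fcyc h, .zero _⟩

variable (k n m)

/-- The deformed cyclotomic quotient `ONH_m^n`. -/
noncomputable def ONH : GSAlg k := presented Gen.deg (ONHRel k n m) ONHRel.homog

/-- The generators of `ONH_m^n`. -/
noncomputable def ONH.gen (g : Gen n m) : (ONH k n m).carrier :=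
  pgen Gen.deg (ONHRel k n m) ONHRel.homog g

variable {k n m}

theorem ONH.gen_mem (g : Gen n m) : ONH.gen k n m g ∈ (ONH k n m).gr g.deg := pgen_mem _ _ _ g

theorem ONH.rel {a b : FreeAlgebra k (Gen n m)} (h : ONHRel k n m a b) :
    FreeAlgebra.lift k (ONH.gen k n m) a = FreeAlgebra.lift k (ONH.gen k n m) b := by
  have key : FreeAlgebra.lift k (ONH.gen k n m) = RingQuot.mkAlgHom k (ONHRel k n m) :=
    FreeAlgebra.hom_ext (funext fun g => FreeAlgebra.lift_ι_apply _ _)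
  rw [key]
  exact RingQuot.mkAlgHom_rel k h

/-- The inclusion of generators for `m ≤ m'`. -/
def Gen.incl {m' : ℕ} (e : m ≤ m') : Gen n m → Gen n m'
  | .x i h => .x i (by lia)
  | .tau i h => .tau i (by lia)
  | .chi j h₀ h => .chi j h₀ h
  | .d => .d

theorem Gen.deg_incl {m' : ℕ} (e : m ≤ m') (g : Gen n m) : (g.incl e).deg = g.deg := by
  cases g <;> rfl

theorem lift_incl_fchi {m' : ℕ} (e : m ≤ m') (j : ℕ) (h : 2 * j ≤ n) :
    FreeAlgebra.lift k (fun g : Gen n m => FreeAlgebra.ι k (g.incl e)) (fchi k j h) =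
      fchi k j h := by
  unfold fchi
  split_ifs with h₀
  · exact FreeAlgebra.lift_ι_apply _ _
  · exact map_one _

theorem ONHRel.incl {m' : ℕ} (e : m ≤ m') {a b : FreeAlgebra k (Gen n m)} (h : ONHRel k n m a b) :
    ONHRel k n m' (FreeAlgebra.lift k (fun g : Gen n m => FreeAlgebra.ι k (g.incl e)) a)
      (FreeAlgebra.lift k (fun g : Gen n m => FreeAlgebra.ι k (g.incl e)) b) := by
  have hx : ∀ i h, FreeAlgebra.lift k (fun g : Gen n m => FreeAlgebra.ι k (g.incl e)) (fx k i h) =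
      fx k i (by lia) := fun i h => FreeAlgebra.lift_ι_apply _ _
  have ht : ∀ i h, FreeAlgebra.lift k (fun g : Gen n m => FreeAlgebra.ι k (g.incl e))
      (ftau k i h) = ftau k i (by lia) := fun i h => FreeAlgebra.lift_ι_apply _ _
  have hd : FreeAlgebra.lift k (fun g : Gen n m => FreeAlgebra.ι k (g.incl e)) (fd k) = fd k :=
    FreeAlgebra.lift_ι_apply _ _
  cases h with
  | tau_sq i h => simp only [map_mul, map_zero, ht]; exact .tau_sq i _
  | braid i h => simp only [map_mul, ht]; exact .braid i _
  | x_tau i h => simp only [map_mul, map_add, map_one, hx, ht]; exact .x_tau i _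
  | tau_x i h => simp only [map_mul, map_add, map_one, hx, ht]; exact .tau_x i _
  | x_x i j hi hj hij => simp only [map_mul, map_add, map_zero, hx]; exact .x_x i j _ _ hij
  | tau_tau i j hi hj hij => simp only [map_mul, map_add, map_zero, ht]; exact .tau_tau i j _ _ hij
  | x_tau_far i j hi hj h₁ h₂ =>
    simp only [map_mul, map_add, map_zero, hx, ht]; exact .x_tau_far i j _ _ h₁ h₂
  | chi_comm j h g =>
    simp only [map_mul, lift_incl_fchi, FreeAlgebra.lift_ι_apply]; exact .chi_comm j h _
  | d_x i h => simp only [map_mul, map_add, map_zero, hx, hd]; exact .d_x i _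
  | d_tau i h => simp only [map_mul, map_add, map_zero, ht, hd]; exact .d_tau i _
  | d_sq => simp only [map_mul, map_zero, hd]; exact .d_sq
  | d_chi j h => simp only [map_mul, map_zero, lift_incl_fchi, hd]; exact .d_chi j h
  | cyc h =>
    have hc : ∀ i h, FreeAlgebra.lift k (fun g : Gen n m => FreeAlgebra.ι k (g.incl e))
        (fc k i h) = fc k i h := fun i h => by
      unfold fc
      split_ifs
      · exact lift_incl_fchi _ _ _
      · rw [map_mul, hd, lift_incl_fchi]
    simp only [fcyc, map_sum, map_smul, map_mul, map_pow, map_zero, hx, hc]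
    exact .cyc _

/-- The homomorphism `ONH_m^n → ONH_(m')^n`, for `m ≤ m'`, that maps generators to generators. -/
noncomputable def ONH.incl {m' : ℕ} (e : m ≤ m') : (ONH k n m).Hom (ONH k n m') :=
  presentedLift (fun g => ONH.gen k n m' (g.incl e))
    (fun g => by rw [← Gen.deg_incl e g]; exact ONH.gen_mem _) (by
      intro a b h
      have key : FreeAlgebra.lift k (fun g : Gen n m => ONH.gen k n m' (g.incl e)) =
          (FreeAlgebra.lift k (ONH.gen k n m')).comp
            (FreeAlgebra.lift k (fun g : Gen n m => FreeAlgebra.ι k (g.incl e))) :=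
        FreeAlgebra.hom_ext (funext fun g => by simp)
      rw [key, AlgHom.comp_apply, AlgHom.comp_apply]
      exact ONH.rel (h.incl e))

theorem ONH.incl_gen {m' : ℕ} (e : m ≤ m') (g : Gen n m) :
    (ONH.incl e).map (ONH.gen k n m g) = ONH.gen k n m' (g.incl e) :=
  presentedLift_pgen _ _ _ g

theorem ONH.incl_incl {m' m'' : ℕ} (e : m ≤ m') (e' : m' ≤ m'') (a : (ONH k n m).carrier) :
    (ONH.incl e').map ((ONH.incl e).map a) = (ONH.incl (e.trans e')).map a := by
  have key : (ONH.incl e').map.comp (ONH.incl e).map =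
      (ONH.incl (k := k) (n := n) (e.trans e')).map := by
    apply RingQuot.ringQuot_ext'
    apply FreeAlgebra.hom_ext
    funext g
    change (ONH.incl e').map ((ONH.incl e).map (ONH.gen k n m g)) =
      (ONH.incl (e.trans e')).map (ONH.gen k n m g)
    rw [ONH.incl_gen, ONH.incl_gen, ONH.incl_gen]
    cases g <;> rfl
  exact AlgHom.congr_fun key a

/-- The generator `x_m` of `ONH_(m+1)^n`. -/
noncomputable def ONH.lastX (k : Type u) [Field k] (n : ℕ) {m m' : ℕ} (h : m' = m + 1) :
    (ONH k n m').carrier :=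
  ONH.gen k n m' (.x m (by lia))

/-- The generator `τ_m` of `ONH_(m+2)^n`. -/
noncomputable def ONH.lastTau (k : Type u) [Field k] (n : ℕ) {m m' m'' : ℕ} (h : m' = m + 1)
    (h' : m'' = m' + 1) : (ONH k n m'').carrier :=
  ONH.gen k n m'' (.tau m (by lia))

theorem ONH.lastX_mem {m' : ℕ} (h : m' = m + 1) : ONH.lastX k n h ∈ (ONH k n m').gr (2, 1) :=
  ONH.gen_mem (.x m (by lia))

theorem ONH.lastTau_mem {m' m'' : ℕ} (h : m' = m + 1) (h' : m'' = m' + 1) :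
    ONH.lastTau k n h h' ∈ (ONH k n m'').gr (-2, 1) :=
  ONH.gen_mem (.tau m (by lia))

theorem ONH.gen_chi_comm (j : ℕ) (h₀ : 0 < j) (h : 2 * j ≤ n) (g : Gen n m) :
    ONH.gen k n m g * ONH.gen k n m (.chi j h₀ h) =
      ONH.gen k n m (.chi j h₀ h) * ONH.gen k n m g := by
  have h' := ONH.rel (ONHRel.chi_comm (k := k) j h g)
  simp only [fchi, dif_pos h₀, map_mul, FreeAlgebra.lift_ι_apply] at h'
  exact h'.symm

theorem sgn_one_mul_one (k : Type u) [Field k] : sgn k (1 * 1) = -1 := if_neg (by decide)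

theorem ONH.lastX_supercomm {m' : ℕ} (hm : m' = m + 1) (e : m ≤ m') (a : (ONH k n m).carrier) :
    ONH.lastX k n hm * (ONH.incl e).map a =
      (ONH.incl e).map ((ONH k n m).inv 1 a) * ONH.lastX k n hm := by
  refine supercomm_of_gen (ONH.incl e) 1 (ONH.lastX k n hm) (fun g => ?_) a
  change ONH.lastX k n hm * (ONH.incl e).map (ONH.gen k n m g) =
    sgn k (1 * g.deg.2) • ((ONH.incl e).map (ONH.gen k n m g) * ONH.lastX k n hm)
  rw [ONH.incl_gen]
  cases g with
  | x i h =>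
    have h' := ONH.rel (ONHRel.x_x (k := k) (n := n) (m := m') m i (by lia) (by lia) (by lia))
    simp only [fx, map_mul, map_add, map_zero, FreeAlgebra.lift_ι_apply] at h'
    simp only [Gen.deg, sgn_one_mul_one, neg_smul, one_smul]
    exact eq_neg_of_add_eq_zero_left h'
  | tau i h =>
    have h' := ONH.rel (ONHRel.x_tau_far (k := k) (n := n) (m := m') m i (by lia) (by lia)
      (by lia) (by lia))
    simp only [fx, ftau, map_mul, map_add, map_zero, FreeAlgebra.lift_ι_apply] at h'
    simp only [Gen.deg, sgn_one_mul_one, neg_smul, one_smul]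
    exact eq_neg_of_add_eq_zero_left h'
  | chi j h₀ h =>
    simp only [Gen.deg, mul_zero, sgn_zero, one_smul]
    exact ONH.gen_chi_comm j h₀ h _
  | d =>
    have h' := ONH.rel (ONHRel.d_x (k := k) (n := n) (m := m') m (by lia))
    simp only [fx, fd, map_mul, map_add, map_zero, FreeAlgebra.lift_ι_apply] at h'
    simp only [Gen.deg, sgn_one_mul_one, neg_smul, one_smul]
    exact eq_neg_of_add_eq_zero_right h'

theorem ONH.lastTau_supercomm {m' m'' : ℕ} (h₁ : m' = m + 1) (h₂ : m'' = m' + 1) (e : m ≤ m'')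
    (a : (ONH k n m).carrier) :
    ONH.lastTau k n h₁ h₂ * (ONH.incl e).map a =
      (ONH.incl e).map ((ONH k n m).inv 1 a) * ONH.lastTau k n h₁ h₂ := by
  refine supercomm_of_gen (ONH.incl e) 1 (ONH.lastTau k n h₁ h₂) (fun g => ?_) a
  change ONH.lastTau k n h₁ h₂ * (ONH.incl e).map (ONH.gen k n m g) =
    sgn k (1 * g.deg.2) • ((ONH.incl e).map (ONH.gen k n m g) * ONH.lastTau k n h₁ h₂)
  rw [ONH.incl_gen]
  cases g with
  | x i h =>
    have h' := ONH.rel (ONHRel.x_tau_far (k := k) (n := n) (m := m'') i m (by lia) (by lia)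
      (by lia) (by lia))
    simp only [fx, ftau, map_mul, map_add, map_zero, FreeAlgebra.lift_ι_apply] at h'
    simp only [Gen.deg, sgn_one_mul_one, neg_smul, one_smul]
    exact eq_neg_of_add_eq_zero_right h'
  | tau i h =>
    have h' := ONH.rel (ONHRel.tau_tau (k := k) (n := n) (m := m'') i m (by lia) (by lia)
      (by lia))
    simp only [ftau, map_mul, map_add, map_zero, FreeAlgebra.lift_ι_apply] at h'
    simp only [Gen.deg, sgn_one_mul_one, neg_smul, one_smul]
    exact eq_neg_of_add_eq_zero_right h'
  | chi j h₀ h =>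
    simp only [Gen.deg, mul_zero, sgn_zero, one_smul]
    exact ONH.gen_chi_comm j h₀ h _
  | d =>
    have h' := ONH.rel (ONHRel.d_tau (k := k) (n := n) (m := m'') m (by lia))
    simp only [ftau, fd, map_mul, map_add, map_zero, FreeAlgebra.lift_ι_apply] at h'
    simp only [Gen.deg, sgn_one_mul_one, neg_smul, one_smul]
    exact eq_neg_of_add_eq_zero_right h'

end

/-! ### Restriction and induction -/

namespace SMod

section
variable {k : Type u} [Field k] {A B : GSAlg k} (f : A.Hom B)

/-- Restriction along `f`. -/
def res (N : SMod B) : SMod A :=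
  { carrier := N.carrier
    mod := Module.compHom N.carrier f.map.toRingHom
    tower := @IsScalarTower.mk k A.carrier N.carrier _
      (Module.compHom N.carrier f.map.toRingHom).toSMul _ fun c a x => by
        change f.map (c • a) • x = c • (f.map a • x)
        rw [map_smul, smul_assoc]
    gr := N.gr
    internal := N.internal
    smul_mem := fun p q a x ha hx => N.smul_mem p q _ x (f.map_mem p a ha) hx }

theorem res_smul (N : SMod B) (a : A.carrier) (x : N.carrier) :
    (a • (show (res f N).carrier from x) : (res f N).carrier) = f.map a • x := rfl

/-- Restriction along `f`, on morphisms. -/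
def resMap {p : Deg} {M N : SMod B} (g : Hom p M N) : Hom p (res f M) (res f N) :=
  ⟨(show M.carrier →ₗ[k] N.carrier from g.1), g.2.1, fun a (m : M.carrier) => by
    have h := g.2.2 (f.map a) m
    rw [← f.map_inv] at h
    exact h⟩

open TensorProduct in
/-- The relations `b f(a) ⊗ m = b ⊗ a m` in `B ⊗ M`. -/
def indRel (M : SMod A) : Submodule B.carrier (B.carrier ⊗[k] M.carrier) :=
  Submodule.span B.carrier
    {z | ∃ b a m, z = (b * f.map a) ⊗ₜ[k] m - b ⊗ₜ[k] (a • m)}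

open TensorProduct in
/-- The space `B ⊗_A M`. -/
abbrev IndCarrier (M : SMod A) : Type u := (B.carrier ⊗[k] M.carrier) ⧸ indRel f M

/-- The element `b ⊗ m` of `B ⊗_A M`. -/
def indMk (M : SMod A) (b : B.carrier) (m : M.carrier) : IndCarrier f M :=
  Submodule.Quotient.mk (b ⊗ₜ[k] m)

section
variable {f} {M : SMod A}

theorem indMk_add (b : B.carrier) (m m' : M.carrier) :
    indMk f M b (m + m') = indMk f M b m + indMk f M b m' :=
  congrArg Submodule.Quotient.mk (TensorProduct.tmul_add _ _ _)

theorem add_indMk (b b' : B.carrier) (m : M.carrier) :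
    indMk f M (b + b') m = indMk f M b m + indMk f M b' m :=
  congrArg Submodule.Quotient.mk (TensorProduct.add_tmul _ _ _)

theorem indMk_zero (b : B.carrier) : indMk f M b 0 = 0 :=
  congrArg Submodule.Quotient.mk (TensorProduct.tmul_zero _ _)

theorem zero_indMk (m : M.carrier) : indMk f M 0 m = 0 :=
  congrArg Submodule.Quotient.mk (TensorProduct.zero_tmul _ _)

theorem indMk_smul (c : k) (b : B.carrier) (m : M.carrier) :
    indMk f M b (c • m) = c • indMk f M b m :=
  congrArg Submodule.Quotient.mk (TensorProduct.tmul_smul _ _ _)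

theorem smul_indMk (c : k) (b : B.carrier) (m : M.carrier) :
    indMk f M (c • b) m = c • indMk f M b m :=
  congrArg Submodule.Quotient.mk (TensorProduct.smul_tmul' _ _ _).symm

theorem mul_indMk (b b' : B.carrier) (m : M.carrier) :
    b • indMk f M b' m = indMk f M (b * b') m := rfl

theorem indMk_mul_map (b : B.carrier) (a : A.carrier) (m : M.carrier) :
    indMk f M (b * f.map a) m = indMk f M b (a • m) :=
  (Submodule.Quotient.eq _).2 (Submodule.subset_span ⟨b, a, m, rfl⟩)

theorem ind_induction {motive : IndCarrier f M → Prop} (h0 : motive 0)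
    (hmk : ∀ b m, motive (indMk f M b m)) (hadd : ∀ x y, motive x → motive y → motive (x + y))
    (x : IndCarrier f M) : motive x := by
  obtain ⟨x, rfl⟩ := Submodule.Quotient.mk_surjective _ x
  induction x using TensorProduct.induction_on with
  | zero => exact h0
  | tmul b m => exact hmk b m
  | add x y hx hy => exact hadd _ _ hx hy

end

open TensorProduct in
theorem indRel_zero {M : SMod A} {V : Type u} [AddCommGroup V] [Module k V]
    (φ : B.carrier ⊗[k] M.carrier →ₗ[k] V)
    (h : ∀ b a m, φ ((b * f.map a) ⊗ₜ[k] m) = φ (b ⊗ₜ[k] (a • m)))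
    (x : B.carrier ⊗[k] M.carrier) (hx : x ∈ indRel f M) : φ x = 0 := by
  have key : ∀ c : B.carrier, φ (c • x) = 0 := by
    refine Submodule.span_induction (p := fun x _ => ∀ c : B.carrier, φ (c • x) = 0)
      ?_ ?_ ?_ ?_ hx
    · rintro _ ⟨b, a, m, rfl⟩ c
      rw [smul_sub, map_sub, TensorProduct.smul_tmul', TensorProduct.smul_tmul', smul_eq_mul,
        smul_eq_mul, ← mul_assoc, h, sub_self]
    · intro c; rw [smul_zero, map_zero]
    · intro x y _ _ hx hy c; rw [smul_add, map_add, hx, hy, add_zero]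
    · intro b x _ hx c; rw [smul_smul, hx]
  have := key 1
  rwa [one_smul] at this

/-- The linear map `B ⊗_A M → V` induced by a balanced bilinear map `B × M → V`. -/
def indLift {M : SMod A} {V : Type u} [AddCommGroup V] [Module k V]
    (g : B.carrier →ₗ[k] M.carrier →ₗ[k] V)
    (h : ∀ b a m, g (b * f.map a) m = g b (a • m)) : IndCarrier f M →ₗ[k] V :=
  ((indRel f M).restrictScalars k).liftQ (TensorProduct.lift g)
    (fun x hx => indRel_zero f (TensorProduct.lift g) h x hx) ∘ₗ
  (Submodule.Quotient.restrictScalarsEquiv k (indRel f M)).symm.toLinearMap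

theorem indLift_mk {M : SMod A} {V : Type u} [AddCommGroup V] [Module k V]
    (g : B.carrier →ₗ[k] M.carrier →ₗ[k] V)
    (h : ∀ b a m, g (b * f.map a) m = g b (a • m)) (b : B.carrier) (m : M.carrier) :
    indLift f g h (indMk f M b m) = g b m := rfl

/-- The grading of `B ⊗_A M`. -/
def indGr (M : SMod A) (r : Deg) : Submodule k (IndCarrier f M) :=
  Submodule.span k {z | ∃ p q b m, b ∈ B.gr p ∧ m ∈ M.gr q ∧ p + q = r ∧ z = indMk f M b m}

theorem indMk_mem {M : SMod A} {p q r : Deg} {b : B.carrier} {m : M.carrier} (hb : b ∈ B.gr p)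
    (hm : m ∈ M.gr q) (e : p + q = r) : indMk f M b m ∈ indGr f M r :=
  Submodule.subset_span ⟨p, q, b, m, hb, hm, e, rfl⟩

/-- Auxiliary to the decomposition of `B ⊗_A M`. -/
noncomputable def indDec₀ (M : SMod A) (p q : Deg) :
    B.gr p →ₗ[k] M.gr q →ₗ[k] DirectSum Deg fun r => indGr f M r :=
  LinearMap.mk₂ k (fun b m => DirectSum.lof k Deg (fun r => indGr f M r) (p + q)
      ⟨indMk f M b m, indMk_mem f b.2 m.2 rfl⟩)
    (fun b b' m => by
      rw [← map_add]; congr 1; exact Subtype.ext (add_indMk _ _ _))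
    (fun c b m => by
      rw [← map_smul]; rfl)
    (fun b m m' => by
      rw [← map_add]; congr 1; exact Subtype.ext (indMk_add _ _ _))
    (fun c b m => by
      rw [← map_smul]; congr 1; exact Subtype.ext (indMk_smul _ _ _))

/-- Auxiliary to the decomposition of `B ⊗_A M`. -/
noncomputable def indDec₁ (M : SMod A) :
    B.carrier →ₗ[k] M.carrier →ₗ[k] DirectSum Deg fun r => indGr f M r :=
  (LinearMap.lcomp k _ (LinearEquiv.ofBijective (DirectSum.coeLinearMap M.gr)
      M.internal).symm.toLinearMap) ∘ₗ
    (DirectSum.toModule k Deg _ fun p =>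
      (DirectSum.toModule k Deg _ fun q => (indDec₀ f M p q).flip).flip) ∘ₗ
    (DirectSum.decomposeLinearEquiv B.gr).toLinearMap

theorem indDec₁_of {M : SMod A} {p q r : Deg} {b : B.carrier} {m : M.carrier} (hb : b ∈ B.gr p)
    (hm : m ∈ M.gr q) (e : p + q = r) : indDec₁ f M b m =
      DirectSum.lof k Deg (fun r => indGr f M r) r ⟨indMk f M b m, indMk_mem f hb hm e⟩ := by
  subst e
  have h₁ : (LinearEquiv.ofBijective (DirectSum.coeLinearMap M.gr) M.internal).symm m =
      DirectSum.lof k Deg (fun r => M.gr r) q ⟨m, hm⟩ := by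
    rw [LinearEquiv.symm_apply_eq]
    exact (DirectSum.coeLinearMap_lof M.gr q ⟨m, hm⟩).symm
  have h₂ : DirectSum.decomposeLinearEquiv B.gr b =
      DirectSum.lof k Deg (fun r => B.gr r) p ⟨b, hb⟩ := DirectSum.decompose_of_mem B.gr hb
  simp only [indDec₁, LinearMap.comp_apply, LinearEquiv.coe_coe, LinearMap.lcomp_apply, h₁, h₂,
    DirectSum.toModule_lof, LinearMap.flip_apply]
  rfl

theorem indDec₁_balanced (M : SMod A) (b : B.carrier) (a : A.carrier) (m : M.carrier) :
    indDec₁ f M (b * f.map a) m = indDec₁ f M b (a • m) := by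
  induction b using B.hom_induction with
  | h0 => simp
  | hadd b b' h h' => simp only [add_mul, map_add, LinearMap.add_apply, h, h']
  | h p b hb =>
    induction a using A.hom_induction with
    | h0 => simp
    | hadd a a' h h' => simp only [mul_add, add_smul, map_add, LinearMap.add_apply, h, h']
    | h s a ha =>
      induction m using M.hom_induction with
      | h0 => simp
      | hadd m m' h h' => simp only [smul_add, map_add, h, h']
      | h q m hm =>
        rw [indDec₁_of f (SetLike.GradedMul.mul_mem hb (f.map_mem s a ha)) hm
            (add_assoc p s q), indDec₁_of f hb (M.smul_mem s q a m ha hm) rfl]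
        congr 1
        exact Subtype.ext (indMk_mul_map _ _ _)

/-- The decomposition of `B ⊗_A M` into homogeneous components. -/
noncomputable def indDec (M : SMod A) :
    IndCarrier f M →ₗ[k] DirectSum Deg fun r => indGr f M r :=
  indLift f (V := DirectSum Deg fun r => indGr f M r) (indDec₁ f M) (indDec₁_balanced f M)

theorem indDec_mk {M : SMod A} {p q r : Deg} {b : B.carrier} {m : M.carrier} (hb : b ∈ B.gr p)
    (hm : m ∈ M.gr q) (e : p + q = r) : indDec f M (indMk f M b m) =
      DirectSum.lof k Deg (fun r => indGr f M r) r ⟨indMk f M b m, indMk_mem f hb hm e⟩ :=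
  indDec₁_of f hb hm e

theorem coe_indDec (M : SMod A) (x : IndCarrier f M) :
    DirectSum.coeLinearMap (indGr f M) (indDec f M x) = x := by
  induction x using ind_induction with
  | h0 => simp
  | hadd x y hx hy => rw [map_add, map_add, hx, hy]
  | hmk b m =>
    induction b using B.hom_induction with
    | h0 => rw [zero_indMk, map_zero, map_zero]
    | hadd b b' h h' => rw [add_indMk, map_add, map_add, h, h']
    | h p b hb =>
      induction m using M.hom_induction with
      | h0 => rw [indMk_zero, map_zero, map_zero]
      | hadd m m' h h' => rw [indMk_add, map_add, map_add, h, h']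
      | h q m hm =>
        rw [indDec_mk f hb hm rfl]
        exact DirectSum.coeLinearMap_lof _ _ _

theorem indDec_of_mem (M : SMod A) (r : Deg) (x : IndCarrier f M) (hx : x ∈ indGr f M r) :
    indDec f M x = DirectSum.lof k Deg (fun r => indGr f M r) r ⟨x, hx⟩ := by
  induction hx using Submodule.span_induction with
  | mem x hx =>
    obtain ⟨p, q, b, m, hb, hm, e, rfl⟩ := hx
    exact indDec_mk f hb hm e
  | zero =>
    rw [map_zero, ← map_zero (DirectSum.lof k Deg (fun r => indGr f M r) r)]
    rfl
  | add x y _ _ hx hy => rw [map_add, hx, hy, ← map_add]; rfl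
  | smul c x _ hx => rw [map_smul, hx, ← map_smul]; rfl

theorem ind_internal (M : SMod A) : DirectSum.IsInternal (indGr f M) := by
  refine ⟨fun x y h => ?_, fun x => ⟨indDec f M x, coe_indDec f M x⟩⟩
  have key : ∀ z, indDec f M (DirectSum.coeLinearMap (indGr f M) z) = z := by
    intro z
    induction z using DirectSum.induction_on with
    | zero => rw [map_zero, map_zero]
    | of r z =>
      have := DirectSum.coeLinearMap_lof (indGr f M) r z
      rw [DirectSum.lof_eq_of] at this
      rw [this]
      exact indDec_of_mem f M r z z.2
    | add z z' h h' => rw [map_add, map_add, h, h']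
  have h' : DirectSum.coeLinearMap (indGr f M) x = DirectSum.coeLinearMap (indGr f M) y := h
  rw [← key x, h', key]

/-- Induction along `f`: the supermodule `B ⊗_A M`. -/
noncomputable def ind (M : SMod A) : SMod B :=
  { carrier := IndCarrier f M
    gr := indGr f M
    internal := ind_internal f M
    smul_mem := fun p q b x hb hx => by
      induction hx using Submodule.span_induction with
      | mem x hx =>
        obtain ⟨p', q', b', m, hb', hm, e, rfl⟩ := hx
        rw [mul_indMk]
        exact indMk_mem f (SetLike.GradedMul.mul_mem hb hb') hm (by rw [← e, add_assoc])
      | zero => rw [smul_zero]; exact zero_mem _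
      | add x y _ _ hx hy => rw [smul_add]; exact add_mem hx hy
      | smul c x _ hx => rw [smul_comm]; exact Submodule.smul_mem _ _ hx }

/-- The element `b ⊗ m` of the induced supermodule. -/
def tmul (M : SMod A) (b : B.carrier) (m : M.carrier) : (ind f M).carrier := indMk f M b m

variable {f}

theorem tmul_add {M : SMod A} (b : B.carrier) (m m' : M.carrier) :
    tmul f M b (m + m') = tmul f M b m + tmul f M b m' := indMk_add _ _ _

theorem tmul_smul {M : SMod A} (c : k) (b : B.carrier) (m : M.carrier) :
    tmul f M b (c • m) = c • tmul f M b m := indMk_smul _ _ _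

theorem smul_left_tmul {M : SMod A} (c : k) (b : B.carrier) (m : M.carrier) :
    tmul f M (c • b) m = c • tmul f M b m := smul_indMk _ _ _

theorem smul_tmul {M : SMod A} (b b' : B.carrier) (m : M.carrier) :
    b • tmul f M b' m = tmul f M (b * b') m := rfl

theorem map_smul_tmul {M : SMod A} (a : A.carrier) (m : M.carrier) :
    f.map a • tmul f M 1 m = tmul f M 1 (a • m) := by
  rw [smul_tmul, mul_one]
  have := indMk_mul_map (f := f) 1 a m
  rwa [one_mul] at this

theorem tmul_mem {M : SMod A} {p q r : Deg} {b : B.carrier} {m : M.carrier} (hb : b ∈ B.gr p)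
    (hm : m ∈ M.gr q) (e : p + q = r) : tmul f M b m ∈ (ind f M).gr r := indMk_mem f hb hm e

theorem tmul_induction {M : SMod A} {motive : (ind f M).carrier → Prop} (h0 : motive 0)
    (hmk : ∀ b m, motive (tmul f M b m)) (hadd : ∀ x y, motive x → motive y → motive (x + y))
    (x : (ind f M).carrier) : motive x :=
  ind_induction h0 hmk hadd x

variable (f) in
/-- The identity map, from the restriction of `N` to `N`. -/
def unres (N : SMod B) : (res f N).carrier →ₗ[k] N.carrier where
  toFun x := x
  map_add' _ _ := rfl
  map_smul' _ _ := rfl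

theorem unres_smul (N : SMod B) (a : A.carrier) (x : (res f N).carrier) :
    unres f N (a • x) = f.map a • unres f N x := rfl

/-- The linear map underlying `indHom`. -/
noncomputable def indHomLin {p : Deg} {M : SMod A} {N : SMod B} (g : Hom p M (res f N)) :
    (ind f M).carrier →ₗ[k] N.carrier :=
  indLift f (LinearMap.mk₂ k (fun b m => B.inv p.2 b • unres f N (g.1 m))
      (fun b b' m => by rw [map_add, add_smul])
      (fun c b m => by rw [map_smul, smul_assoc])
      (fun b m m' => by rw [map_add, map_add, smul_add])
      (fun c b m => by rw [map_smul, map_smul, smul_comm]))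
    (fun b a m => by
      change B.inv p.2 (b * f.map a) • unres f N (g.1 m) =
        B.inv p.2 b • unres f N (g.1 (a • m))
      rw [g.2.2, map_mul, ← f.map_inv, mul_smul, unres_smul])

theorem indHomLin_tmul {p : Deg} {M : SMod A} {N : SMod B} (g : Hom p M (res f N)) (b : B.carrier)
    (m : M.carrier) : indHomLin g (tmul f M b m) = B.inv p.2 b • unres f N (g.1 m) := rfl

/-- The morphism `B ⊗_A M → N`, `b ⊗ m ↦ (-1)^(|b||g|) b g(m)`, for a morphism `g : M → N` over
`A`. -/
noncomputable def indHom {p : Deg} {M : SMod A} {N : SMod B} (g : Hom p M (res f N)) :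
    Hom p (ind f M) N :=
  ⟨indHomLin g, by
    constructor
    · intro q x hx
      refine Submodule.span_induction (p := fun x _ => indHomLin g x ∈ N.gr (q + p))
        ?_ ?_ ?_ ?_ hx
      · rintro _ ⟨s, t, b, m, hb, hm, e, rfl⟩
        change B.inv p.2 b • unres f N (g.1 m) ∈ N.gr (q + p)
        rw [B.inv_of_mem _ hb, smul_assoc, ← e, add_assoc]
        exact Submodule.smul_mem _ _ (N.smul_mem _ _ _ _ hb (g.2.1 _ m hm))
      · rw [map_zero]; exact zero_mem _
      · intro x y _ _ hx hy; rw [map_add]; exact add_mem hx hy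
      · intro c x _ hx; rw [map_smul]; exact Submodule.smul_mem _ _ hx
    · intro b x
      induction x using tmul_induction with
      | h0 => rw [smul_zero, map_zero, smul_zero]
      | hadd x y hx hy => rw [smul_add, map_add, map_add, hx, hy, smul_add]
      | hmk b' m => rw [smul_tmul, indHomLin_tmul, indHomLin_tmul, map_mul, mul_smul]⟩

theorem indHom_tmul {p : Deg} {M : SMod A} {N : SMod B} (g : Hom p M (res f N)) (b : B.carrier)
    (m : M.carrier) :
    (indHom g).1 (tmul f M b m) = B.inv p.2 b • unres f N (g.1 m) := rfl

/-- Morphisms out of `B ⊗_A M` are determined by their values on the elements `1 ⊗ m`. -/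
theorem ind_hom_ext {p : Deg} {M : SMod A} {N : SMod B} {g g' : Hom p (ind f M) N}
    (h : ∀ m, g.1 (tmul f M 1 m) = g'.1 (tmul f M 1 m)) : g = g' := by
  refine Subtype.ext (LinearMap.ext fun x => ?_)
  induction x using tmul_induction with
  | h0 => rw [map_zero, map_zero]
  | hadd x y hx hy => rw [map_add, map_add, hx, hy]
  | hmk b m =>
    have e : tmul f M b m = b • tmul f M 1 m := by rw [smul_tmul, mul_one]
    rw [e, g.2.2, g'.2.2, h]

variable (f) in
/-- The unit `M → Res (Ind M)`, `m ↦ 1 ⊗ m`. -/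
noncomputable def unitMap (M : SMod A) : Hom 0 M (res f (ind f M)) :=
  ⟨{ toFun := fun m => tmul f M 1 m
     map_add' := fun m m' => tmul_add _ _ _
     map_smul' := fun c m => tmul_smul _ _ _ }, fun q m hm =>
      tmul_mem (SetLike.GradedOne.one_mem) hm (by rw [zero_add, add_zero]), fun a m => by
      change tmul f M 1 (a • m) = f.map (A.inv 0 a) • tmul f M 1 m
      rw [GSAlg.inv_zero, map_smul_tmul]⟩

variable (f) in
/-- The counit `Ind (Res N) → N`, `b ⊗ n ↦ b n`. -/
noncomputable def counitMap (N : SMod B) : Hom 0 (ind f (res f N)) N :=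
  indHom ((sMod A).id (res f N))

theorem counitMap_tmul (N : SMod B) (b : B.carrier) (x : (res f N).carrier) :
    (counitMap f N).1 (tmul f (res f N) b x) = b • unres f N x :=
  congrArg (fun b' => b' • unres f N x) (B.inv_zero b)

/-- Induction, on morphisms: `g ↦ (b ⊗ m ↦ (-1)^(|b||g|) b ⊗ g(m))`. -/
noncomputable def indMap {p : Deg} {M N : SMod A} (g : Hom p M N) : Hom p (ind f M) (ind f N) :=
  indHom (comp (add_zero p) g (unitMap f N))

theorem indMap_tmul {p : Deg} {M N : SMod A} (g : Hom p M N) (b : B.carrier) (m : M.carrier) :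
    (indMap (f := f) g).1 (tmul f M b m) = tmul f N (B.inv p.2 b) (g.1 m) := by
  have h : (indMap (f := f) g).1 (tmul f M b m) = B.inv p.2 b • tmul f N 1 (g.1 m) := rfl
  rw [h, smul_tmul, mul_one]

end

end SMod

section
variable {k : Type u} [Field k] {A B : GSAlg k} (f : A.Hom B)

/-- The restriction superfunctor. -/
def resFun : GSFun (sMod B) (sMod A) where
  obj N := SMod.res f N
  map :=
    { toFun := fun g => SMod.resMap f g
      map_add' := fun _ _ => rfl
      map_smul' := fun _ _ => rfl }
  map_id _ := rfl
  map_comp _ _ _ := rfl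

/-- The induction superfunctor. -/
noncomputable def indFun : GSFun (sMod A) (sMod B) where
  obj M := SMod.ind f M
  map {p M N} :=
    { toFun := fun g => SMod.indMap g
      map_add' := fun g g' => SMod.ind_hom_ext fun m => by
        change (SMod.indMap _).1 _ = (SMod.indMap g).1 _ + (SMod.indMap g').1 _
        rw [SMod.indMap_tmul, SMod.indMap_tmul, SMod.indMap_tmul]
        exact SMod.tmul_add _ _ _
      map_smul' := fun c g => SMod.ind_hom_ext fun m => by
        change (SMod.indMap _).1 _ = c • (SMod.indMap g).1 _
        rw [SMod.indMap_tmul, SMod.indMap_tmul]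
        exact SMod.tmul_smul _ _ _ }
  map_id M := SMod.ind_hom_ext fun m => by
    change (SMod.indMap _).1 _ = _
    rw [SMod.indMap_tmul, map_one]
    rfl
  map_comp {p q r M N L} e g g' := SMod.ind_hom_ext fun m => by
    change (SMod.indMap (SMod.comp e g g')).1 (SMod.tmul f M 1 m) =
      (SMod.indMap g').1 ((SMod.indMap g).1 (SMod.tmul f M 1 m))
    rw [SMod.indMap_tmul, SMod.indMap_tmul, SMod.indMap_tmul, map_one, map_one, map_one]
    rfl

end

/-! ### The natural transformations -/

namespace SMod

section
variable {k : Type u} [Field k] {A B C : GSAlg k} {f : A.Hom B} {g : B.Hom C}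

/-- Multiplication by a homogeneous element `z`, as a morphism `m ↦ z • h(m)` over `A`, provided
that `z` supercommutes with the image of `A`. -/
def smulHom {p : Deg} {M : SMod A} {N : SMod B} (z : B.carrier) (hz : z ∈ B.gr p)
    (hz' : ∀ a, z * f.map a = f.map (A.inv p.2 a) * z) (h : Hom 0 M (res f N)) :
    Hom p M (res f N) :=
  ⟨{ toFun := fun m => z • unres f N (h.1 m)
     map_add' := fun m m' => by rw [map_add, map_add, smul_add]; rfl
     map_smul' := fun c m => by rw [map_smul, map_smul, smul_comm]; rfl }, fun q m hm => by
      have h' := N.smul_mem p (q + 0) z _ hz (h.2.1 q m hm)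
      rw [add_zero, add_comm] at h'
      exact h', fun a m => by
      change z • unres f N (h.1 (a • m)) = f.map (A.inv p.2 a) • z • unres f N (h.1 m)
      rw [h.2.2, Prod.snd_zero, GSAlg.inv_zero, unres_smul, smul_smul, smul_smul, hz']⟩

/-- The endomorphism `b ⊗ m ↦ (-1)^(|z||b|) b z ⊗ m` of `B ⊗_A M`. -/
noncomputable def mulHom {p : Deg} (z : B.carrier) (hz : z ∈ B.gr p)
    (hz' : ∀ a, z * f.map a = f.map (A.inv p.2 a) * z) (M : SMod A) : Hom p (ind f M) (ind f M) :=
  indHom (smulHom z hz hz' (unitMap f M))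

theorem mulHom_tmul {p : Deg} (z : B.carrier) (hz : z ∈ B.gr p)
    (hz' : ∀ a, z * f.map a = f.map (A.inv p.2 a) * z) (M : SMod A) (b : B.carrier)
    (m : M.carrier) : (mulHom z hz hz' M).1 (tmul f M b m) = tmul f M (B.inv p.2 b * z) m := by
  have h : (mulHom z hz hz' M).1 (tmul f M b m) = B.inv p.2 b • z • tmul f M 1 m := rfl
  rw [h, smul_smul, smul_tmul, mul_one]

/-- The composite of two homomorphisms. -/
def _root_.OddCat.GSAlg.Hom.comp (f : A.Hom B) (g : B.Hom C) : A.Hom C where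
  map := g.map.comp f.map
  map_mem p a ha := g.map_mem p _ (f.map_mem p a ha)

/-- Auxiliary to `mulHom₂`. -/
noncomputable def unitMap₂ (M : SMod A) :
    Hom 0 M (res (f.comp g) (ind g (ind f M))) :=
  comp (add_zero 0) (unitMap f M) (resMap f (unitMap g (ind f M)))

/-- The endomorphism `c ⊗ b ⊗ m ↦ (-1)^(|z|(|b| + |c|)) c g(b) z ⊗ 1 ⊗ m` of
`C ⊗_B (B ⊗_A M)`. -/
noncomputable def mulHom₂ {p : Deg} (z : C.carrier) (hz : z ∈ C.gr p)
    (hz' : ∀ a, z * g.map (f.map a) = g.map (f.map (A.inv p.2 a)) * z) (M : SMod A) :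
    Hom p (ind g (ind f M)) (ind g (ind f M)) :=
  indHom (indHom (f := f) (N := res g (ind g (ind f M)))
    (smulHom (f := f.comp g) (N := ind g (ind f M)) z hz hz' (unitMap₂ M)))

theorem mulHom₂_tmul {p : Deg} (z : C.carrier) (hz : z ∈ C.gr p)
    (hz' : ∀ a, z * g.map (f.map a) = g.map (f.map (A.inv p.2 a)) * z) (M : SMod A)
    (c : C.carrier) (b : B.carrier) (m : M.carrier) :
    (mulHom₂ z hz hz' M).1 (tmul g (ind f M) c (tmul f M b m)) =
      tmul g (ind f M) (C.inv p.2 (c * g.map b) * z) (tmul f M 1 m) := by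
  have h : (mulHom₂ z hz hz' M).1 (tmul g (ind f M) c (tmul f M b m)) =
    C.inv p.2 c • g.map (B.inv p.2 b) • z • tmul g (ind f M) 1 (tmul f M 1 m) := rfl
  rw [h, smul_smul, smul_smul, smul_tmul, mul_one, g.map_inv, map_mul]

end

end SMod

section
variable {k : Type u} [Field k] {A B C : GSAlg k} {f : A.Hom B} {g : B.Hom C}

/-- `SMod.mulHom` is supernatural. -/
noncomputable def mulNat {p : Deg} (z : B.carrier) (hz : z ∈ B.gr p)
    (hz' : ∀ a, z * f.map a = f.map (A.inv p.2 a) * z) : GSNat p (indFun f) (indFun f) :=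
  ⟨fun M => SMod.mulHom z hz hz' M, fun q r e e' M N h => SMod.ind_hom_ext fun m => by
    change (SMod.mulHom z hz hz' N).1 ((SMod.indMap h).1 (SMod.tmul f M 1 m)) =
      sgn k (p.2 * q.2) • (SMod.indMap h).1 ((SMod.mulHom z hz hz' M).1 (SMod.tmul f M 1 m))
    rw [SMod.indMap_tmul, SMod.mulHom_tmul, SMod.mulHom_tmul, SMod.indMap_tmul, map_mul,
      map_one, map_one, map_one, one_mul, one_mul, B.inv_of_mem _ hz]
    rw [SMod.smul_left_tmul, mul_comm q.2, smul_smul, sgn_mul_self, one_smul]⟩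

/-- `SMod.mulHom₂` is supernatural. -/
noncomputable def mulNat₂ {p : Deg} (z : C.carrier) (hz : z ∈ C.gr p)
    (hz' : ∀ a, z * g.map (f.map a) = g.map (f.map (A.inv p.2 a)) * z) :
    GSNat p ((indFun f).comp (indFun g)) ((indFun f).comp (indFun g)) :=
  ⟨fun M => SMod.mulHom₂ z hz hz' M, fun q r e e' M N h => SMod.ind_hom_ext fun y => by
    change (SMod.mulHom₂ z hz hz' N).1 ((SMod.indMap (f := g) (SMod.indMap (f := f) h)).1
        (SMod.tmul g _ 1 y)) = sgn k (p.2 * q.2) • (SMod.indMap (f := g) (SMod.indMap (f := f) h)).1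
        ((SMod.mulHom₂ z hz hz' M).1 (SMod.tmul g _ 1 y))
    induction y using SMod.tmul_induction with
    | h0 =>
      have h0 : SMod.tmul g (SMod.ind f M) 1 0 = 0 := SMod.indMk_zero _
      simp only [h0, map_zero, smul_zero]
    | hadd x y hx hy => simp only [SMod.tmul_add, map_add, smul_add, hx, hy]
    | hmk b m =>
      rw [SMod.indMap_tmul, SMod.indMap_tmul, SMod.mulHom₂_tmul, SMod.mulHom₂_tmul,
        SMod.indMap_tmul, SMod.indMap_tmul, map_one, map_one, one_mul, one_mul, g.map_inv, map_mul,
        C.inv_inv, C.inv_inv, C.inv_of_mem _ hz, add_comm q.2, mul_smul_comm, SMod.smul_left_tmul,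
        mul_comm q.2, smul_smul, sgn_mul_self, one_smul]⟩

/-- The unit `1 ⇒ Q^m Res Ind` of degree `m`. -/
noncomputable def unitNat (f : A.Hom B) (m : ℤ) :
    GSNat ((m, 0) : Deg) (GSFun.id (sMod A))
      ((indFun f).comp ((resFun f).comp (shiftFun A (m, 0)))) :=
  ⟨fun M => SMod.comp (zero_add _) (SMod.unitMap f M)
      (SMod.toShift (m, 0) (m, 0) rfl (SMod.res f (SMod.ind f M))),
    fun q r e e' M N h => Subtype.ext (LinearMap.ext fun (x : M.carrier) => by
      change SMod.tmul f N 1 (h.1 x) = sgn k (0 * q.2) • sgn k (0 * q.2) •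
        (SMod.indMap h).1 (SMod.tmul f M 1 x)
      rw [smul_smul, sgn_mul_self, one_smul, SMod.indMap_tmul, map_one])⟩

/-- The counit `Ind Q^m Res ⇒ 1` of degree `-m`. -/
noncomputable def counitNat (f : A.Hom B) (m : ℤ) :
    GSNat ((-m, 0) : Deg) (((resFun f).comp (shiftFun A (m, 0))).comp (indFun f))
      (GSFun.id (sMod B)) :=
  ⟨fun N => SMod.comp (add_zero _)
      (SMod.indMap (SMod.ofShift (m, 0) (-m, 0) (by ext <;> simp) (SMod.res f N)))
      (SMod.counitMap f N), fun q r e e' M N h => SMod.ind_hom_ext fun x => by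
      let y : (SMod.shift (m, 0) (SMod.res f M)).carrier := x
      have h' : ∀ L : SMod B, ∀ b, ∀ y : (SMod.shift (m, 0) (SMod.res f L)).carrier,
          (SMod.counitMap f L).1 ((SMod.indMap (f := f) (SMod.ofShift (m, 0) (-m, 0)
            (by ext <;> simp) (SMod.res f L))).1 (SMod.tmul f _ b y)) =
          B.inv 0 b • SMod.unres f L y := fun L b y => by
        rw [SMod.indMap_tmul, SMod.counitMap_tmul]
        rfl
      change (SMod.counitMap f N).1 ((SMod.indMap (f := f) (SMod.ofShift (m, 0) (-m, 0)
            (by ext <;> simp) (SMod.res f N))).1 ((SMod.indMap (f := f)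
          (SMod.shiftMap (m, 0) (SMod.resMap f h))).1
          (SMod.tmul f (SMod.shift (m, 0) (SMod.res f M)) 1 y))) =
        sgn k (0 * q.2) • h.1 ((SMod.counitMap f M).1 ((SMod.indMap (f := f)
          (SMod.ofShift (m, 0) (-m, 0) (by ext <;> simp) (SMod.res f M))).1
          (SMod.tmul f (SMod.shift (m, 0) (SMod.res f M)) 1 y)))
      rw [SMod.indMap_tmul, h', h', map_one, map_one, one_smul, one_smul]
      rfl⟩

end

/-! ### The 2-representation -/

/-- The number of strands in the weight `l`: it is `m` if `l = 2m - n` with `0 ≤ m ≤ n`, and `none`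
if `l` is not of this form. -/
def strands (n : ℕ) (l : ℤ) : Option ℕ :=
  if Even (l + n) ∧ -(n : ℤ) ≤ l ∧ l ≤ n then some ((l + n) / 2).toNat else none

section
variable {k : Type u} [Field k]

/-- The zero supermodule. -/
def SMod.zeroMod (A : GSAlg k) : SMod A where
  carrier := PUnit.{u + 1}
  gr _ := ⊥
  internal := by
    rw [DirectSum.isInternal_submodule_iff_iSupIndep_and_iSup_eq_top]
    exact ⟨fun _ => disjoint_bot_left, Subsingleton.elim _ _⟩
  smul_mem _ _ _ _ _ _ := rfl

theorem IsProj.zeroMod (fg : Prop) (A : GSAlg k) : IsProj fg A (SMod.zeroMod A) :=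
  ⟨inferInstanceAs (Module.Projective A.carrier PUnit.{u + 1}), fun _ =>
    inferInstanceAs (Module.Finite A.carrier PUnit.{u + 1})⟩

/-- The restriction of a supernatural transformation to full subcategories. -/
def GSNat.restrict {C D : GSCat k} {p : Deg} {F G : GSFun C D} (α : GSNat p F G)
    (P : C.Obj → Prop) (P' : D.Obj → Prop) (hF : ∀ X, P X → P' (F.obj X))
    (hG : ∀ X, P X → P' (G.obj X)) : GSNat p (F.restrict P P' hF) (G.restrict P P' hG) :=
  ⟨fun X => α.1 X.1, fun q r e e' X Y f => α.2 q r e e' X.1 Y.1 f⟩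

/-- The constant superfunctor with value a zero object `Z`. -/
def GSFun.zero {C D : GSCat k} (Z : D.Obj) (h : D.id Z = 0) : GSFun C D where
  obj _ := Z
  map := 0
  map_id _ := h.symm
  map_comp {p q r _ _ _} e f g := by
    have h' := D.smul_comp e (0 : k) (0 : D.Hom p Z Z) (0 : D.Hom q Z Z)
    simp only [zero_smul] at h'
    exact h'.symm

variable {A B C : GSAlg k} (fg : Prop) (f : A.Hom B) (g : B.Hom C)

/-- Induction preserves projective supermodules. -/
def PreservesInd : Prop := ∀ M : SMod A, IsProj fg A M → IsProj fg B (SMod.ind f M)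

/-- Restriction preserves projective supermodules. -/
def PreservesRes : Prop := ∀ N : SMod B, IsProj fg B N → IsProj fg A (SMod.res f N)

variable {fg f g}

/-- Induction, on projective supermodules. -/
noncomputable def indProj (hf : PreservesInd fg f) : sProj fg A ⟶ sProj fg B :=
  (indFun f).restrict (IsProj fg A) (IsProj fg B) hf

/-- Restriction followed by the shift `Q^s`, on projective supermodules. -/
noncomputable def resProj (hf : PreservesRes fg f) (s : ℤ) : sProj fg B ⟶ sProj fg A :=
  ((resFun f).comp (shiftFun A (s, 0))).restrict (IsProj fg B) (IsProj fg A)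
    fun N hN => IsProj.shift _ _ (hf N hN)

/-- `mulNat` on projective supermodules. -/
noncomputable def mulProj (hf : PreservesInd fg f) {p : Deg} (z : B.carrier) (hz : z ∈ B.gr p)
    (hz' : ∀ a, z * f.map a = f.map (A.inv p.2 a) * z) : Hom2 k p (indProj hf) (indProj hf) :=
  GSNat.restrict (mulNat z hz hz') _ _ hf hf

/-- `mulNat₂` on projective supermodules. -/
noncomputable def mulProj₂ (hf : PreservesInd fg f) (hg : PreservesInd fg g) {p : Deg}
    (z : C.carrier) (hz : z ∈ C.gr p)
    (hz' : ∀ a, z * g.map (f.map a) = g.map (f.map (A.inv p.2 a)) * z) :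
    Hom2 k p (indProj hf ≫ indProj hg) (indProj hf ≫ indProj hg) :=
  GSNat.restrict (mulNat₂ z hz hz') (IsProj fg A) (IsProj fg C) (fun M hM => hg _ (hf M hM))
    (fun M hM => hg _ (hf M hM))

/-- `unitNat` on projective supermodules. -/
noncomputable def unitProj (hf : PreservesInd fg f) (hf' : PreservesRes fg f) (s : ℤ) :
    Hom2 k ((s, 0) : Deg) (𝟙 (sProj fg A)) (indProj hf ≫ resProj hf' s) :=
  GSNat.restrict (unitNat f s) (IsProj fg A) (IsProj fg A) (fun _ h => h)
    (fun M hM => IsProj.shift _ _ (hf' _ (hf M hM)))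

/-- `counitNat` on projective supermodules. -/
noncomputable def counitProj (hf : PreservesInd fg f) (hf' : PreservesRes fg f) (s : ℤ) :
    Hom2 k ((-s, 0) : Deg) (resProj hf' s ≫ indProj hf) (𝟙 (sProj fg B)) :=
  GSNat.restrict (counitNat f s) (IsProj fg B) (IsProj fg B)
    (fun N hN => hf _ (IsProj.shift _ _ (hf' N hN))) (fun _ h => h)

end

section
variable (k : Type u) [Field k] (fg : Prop) (n : ℕ)

/-- The component of `L(n)` with the given number of strands (the zero category for `none`). -/
noncomputable def weightCat : Option ℕ → QPCat k
  | none => zeroQPCat k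
  | some m => sProj fg (ONH k n m)

/-- A zero object. -/
noncomputable def weightZero : (o : Option ℕ) →
    {Z : (weightCat k fg n o).cat.Obj // (weightCat k fg n o).cat.id Z = 0}
  | none => ⟨PUnit.unit, rfl⟩
  | some m => ⟨⟨SMod.zeroMod (ONH k n m), IsProj.zeroMod _ _⟩,
      Subtype.ext (LinearMap.ext fun _ => rfl)⟩

/-- The two kinds of steps between adjacent weights: adding a strand, and steps from or to a weight
where `L(n)` is zero. -/
inductive Step : Option ℕ → Option ℕ → Type
  | up (m m' : ℕ) (h : m' = m + 1) : Step (some m) (some m')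
  | zero (o o' : Option ℕ) : Step o o'

/-- The step from `o` to `o'`. -/
def stepOf : (o o' : Option ℕ) → Step o o'
  | some m, some m' => if h : m' = m + 1 then .up m m' h else .zero _ _
  | none, o' => .zero none o'
  | some m, none => .zero (some m) none

/-- Induction along `ONH_m^n → ONH_(m+1)^n` preserves projective supermodules, for all `m`. -/
def IndPres : Prop := ∀ (m m' : ℕ) (h : m' = m + 1),
  PreservesInd fg (ONH.incl (k := k) (n := n) (m := m) (m' := m') (by lia))

/-- Restriction along `ONH_m^n → ONH_(m+1)^n` preserves projective supermodules, for all `m`. -/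
def ResPres : Prop := ∀ (m m' : ℕ) (h : m' = m + 1),
  PreservesRes fg (ONH.incl (k := k) (n := n) (m := m) (m' := m') (by lia))

variable {k fg n}

/-- The superfunctor `E_n`: induction. -/
noncomputable def Efun (hE : IndPres k fg n) {o o' : Option ℕ} :
    Step o o' → (weightCat k fg n o ⟶ weightCat k fg n o')
  | .up m m' h => indProj (hE m m' h)
  | .zero o o' => GSFun.zero (weightZero k fg n o').1 (weightZero k fg n o').2

/-- The superfunctor `Q^t F_n`, where `F_n` is restriction. -/
noncomputable def Ffun (hF : ResPres k fg n) (t : ℤ) {o o' : Option ℕ} :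
    Step o o' → (weightCat k fg n o' ⟶ weightCat k fg n o)
  | .up m m' h => resProj (hF m m' h) t
  | .zero o o' => GSFun.zero (weightZero k fg n o).1 (weightZero k fg n o).2

/-- The transformation `x` of `E_n`, given by `h ↦ φ(h) x_m` on `ONH_(m+1)^n` (the index of the
last generator being `m`). -/
noncomputable def xNat (hE : IndPres k fg n) {o o' : Option ℕ} :
    (s : Step o o') → Hom2 k ((2, 1) : Deg) (Efun hE s) (Efun hE s)
  | .up m m' h => mulProj (hE m m' h) (ONH.lastX k n h) (ONH.lastX_mem h) (ONH.lastX_supercomm h _)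
  | .zero _ _ => 0

/-- The transformation `τ` of `E_n E_n`, given by `h ↦ -φ(h) τ_m` on `ONH_(m+2)^n` (the index of
the last generator being `m`). -/
noncomputable def tauNat (hE : IndPres k fg n) {o o' o'' : Option ℕ} :
    (s : Step o o') → (s' : Step o' o'') →
      Hom2 k ((-2, 1) : Deg) (Efun hE s ≫ Efun hE s') (Efun hE s ≫ Efun hE s')
  | .up m m' h, .up _ m'' h' => mulProj₂ (hE m m' h) (hE m' m'' h') (-ONH.lastTau k n h h')
      (neg_mem (ONH.lastTau_mem h h')) (fun a => by
        rw [ONH.incl_incl, ONH.incl_incl, neg_mul, mul_neg, ONH.lastTau_supercomm])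
  | .up _ _ _, .zero _ _ => 0
  | .zero _ _, _ => 0

/-- The unit `1 ⇒ Q^t F_n E_n`, `m ↦ 1 ⊗ m`. -/
noncomputable def etaNat (hE : IndPres k fg n) (hF : ResPres k fg n) (t : ℤ) {o o' : Option ℕ} :
    (s : Step o o') → Hom2 k ((t, 0) : Deg) (𝟙 (weightCat k fg n o)) (Efun hE s ≫ Ffun hF t s)
  | .up m m' h => unitProj (hE m m' h) (hF m m' h) t
  | .zero _ _ => 0

/-- The counit `E_n Q^t F_n ⇒ 1`, `b ⊗ n ↦ b n`. -/
noncomputable def epsNat (hE : IndPres k fg n) (hF : ResPres k fg n) (t : ℤ) {o o' : Option ℕ} :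
    (s : Step o o') → Hom2 k ((-t, 0) : Deg) (Ffun hF t s ≫ Efun hE s) (𝟙 (weightCat k fg n o'))
  | .up m m' h => counitProj (hE m m' h) (hF m m' h) t
  | .zero _ _ => 0

end

/-- The 2-morphisms `η : 1 ⇒ f ≫ g` and `ε : g ≫ f ⇒ 1`, of degree `0`, are the unit and the counit
of an adjunction between `f` and its right adjoint `g`. -/
def IsAdjunction (k : Type u) [Field k] {B : Type v} [Category.{w} B] [TwoSupercat.{u, v, w, v'} k B]
    {a b : B} (f : a ⟶ b) (g : b ⟶ a) (η : Hom2 k 0 (𝟙 a) (f ≫ g))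
    (ε : Hom2 k 0 (g ≫ f) (𝟙 b)) : Prop :=
  comp2 (zero_add 0) (whR η f (Category.id_comp f).symm (Category.assoc f g f).symm)
      (whL f ε rfl (Category.comp_id f).symm) = id2 f ∧
    comp2 (zero_add 0) (whL g η (Category.comp_id g).symm rfl)
      (whR ε g (Category.assoc g f g).symm (Category.id_comp g).symm) = id2 g

end OddCat

open OddCat OddCat.TwoSupercat

namespace OddCat

/-! ## The tower of deformed cyclotomic quotients -/

namespace ONH

section
variable {k : Type u} [Field k] {n : ℕ}

/-- The inclusion of `ONH_m^n` into `ONH_(m+1)^n`. -/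
noncomputable abbrev up (k : Type u) [Field k] (n m : ℕ) :
    (ONH k n m).carrier →ₐ[k] (ONH k n (m + 1)).carrier :=
  (ONH.incl (k := k) (n := n) (Nat.le_succ m)).map

/-- The generator `x_m` of `ONH_(m+1)^n`. -/
noncomputable abbrev xx (k : Type u) [Field k] (n m : ℕ) : (ONH k n (m + 1)).carrier :=
  ONH.lastX k n rfl

/-- The generator `τ_m` of `ONH_(m+2)^n`. -/
noncomputable abbrev tt (k : Type u) [Field k] (n m : ℕ) : (ONH k n (m + 2)).carrier :=
  ONH.lastTau k n rfl rfl

theorem xx_mul_up (m : ℕ) (a : (ONH k n m).carrier) :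
    xx k n m * up k n m a = up k n m ((ONH k n m).inv 1 a) * xx k n m :=
  ONH.lastX_supercomm rfl _ a

theorem tt_mul_up_up (m : ℕ) (a : (ONH k n m).carrier) :
    tt k n m * up k n (m + 1) (up k n m a) =
      up k n (m + 1) (up k n m ((ONH k n m).inv 1 a)) * tt k n m := by
  have h := ONH.lastTau_supercomm (k := k) (n := n) (m := m) rfl rfl (by lia) a
  rw [ONH.incl_incl, ONH.incl_incl]
  exact h

theorem up_inv (m : ℕ) (s : ZMod 2) (a : (ONH k n m).carrier) :
    up k n m ((ONH k n m).inv s a) = (ONH k n (m + 1)).inv s (up k n m a) :=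
  GSAlg.Hom.map_inv _ s a

theorem inv_xx (m : ℕ) : (ONH k n (m + 1)).inv 1 (xx k n m) = -xx k n m := by
  rw [GSAlg.inv_of_mem _ _ (ONH.lastX_mem rfl), sgn_one_mul_one, neg_smul, one_smul]

theorem inv_tt (m : ℕ) : (ONH k n (m + 2)).inv 1 (tt k n m) = -tt k n m := by
  rw [GSAlg.inv_of_mem _ _ (ONH.lastTau_mem rfl rfl), sgn_one_mul_one, neg_smul, one_smul]

theorem up_gen (m : ℕ) (g : Gen n m) :
    up k n m (ONH.gen k n m g) = ONH.gen k n (m + 1) (g.incl (Nat.le_succ m)) :=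
  ONH.incl_gen _ g

theorem x_tt (m : ℕ) :
    up k n (m + 1) (xx k n m) * tt k n m + tt k n m * xx k n (m + 1) = 1 := by
  have h := ONH.rel (ONHRel.x_tau (k := k) (n := n) (m := m + 2) m (by lia))
  simp only [fx, ftau, map_mul, map_add, map_one, FreeAlgebra.lift_ι_apply] at h
  rw [xx, ONH.lastX, up_gen]
  exact h

theorem tt_x (m : ℕ) :
    tt k n m * up k n (m + 1) (xx k n m) + xx k n (m + 1) * tt k n m = 1 := by
  have h := ONH.rel (ONHRel.tau_x (k := k) (n := n) (m := m + 2) m (by lia))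
  simp only [fx, ftau, map_mul, map_add, map_one, FreeAlgebra.lift_ι_apply] at h
  rw [xx, ONH.lastX, up_gen]
  exact h

theorem tt_sq (m : ℕ) : tt k n m * tt k n m = 0 := by
  have h := ONH.rel (ONHRel.tau_sq (k := k) (n := n) (m := m + 2) m (by lia))
  simp only [ftau, map_mul, map_zero, FreeAlgebra.lift_ι_apply] at h
  exact h

theorem braid (m : ℕ) :
    up k n (m + 2) (tt k n m) * tt k n (m + 1) * up k n (m + 2) (tt k n m) =
      tt k n (m + 1) * up k n (m + 2) (tt k n m) * tt k n (m + 1) := by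
  have h := ONH.rel (ONHRel.braid (k := k) (n := n) (m := m + 3) m (by lia))
  simp only [ftau, map_mul, FreeAlgebra.lift_ι_apply] at h
  rw [tt, ONH.lastTau, up_gen]
  exact h

theorem xx_pow_mul_up (m i : ℕ) (a : (ONH k n m).carrier) :
    xx k n m ^ i * up k n m a = up k n m ((ONH k n m).inv i a) * xx k n m ^ i := by
  induction i generalizing a with
  | zero => simp [GSAlg.inv_zero]
  | succ i ih =>
    rw [pow_succ, mul_assoc, xx_mul_up, ← mul_assoc, ih, GSAlg.inv_inv, mul_assoc, Nat.cast_succ]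

theorem up_mul_xx_pow (m i : ℕ) (a : (ONH k n m).carrier) :
    up k n m a * xx k n m ^ i = xx k n m ^ i * up k n m ((ONH k n m).inv i a) := by
  rw [xx_pow_mul_up, GSAlg.inv_self]

theorem tt_mul_x (m : ℕ) : tt k n m * up k n (m + 1) (xx k n m) = 1 - xx k n (m + 1) * tt k n m :=
  eq_sub_of_add_eq (tt_x m)

theorem xx_mul_tt (m : ℕ) : xx k n (m + 1) * tt k n m = 1 - tt k n m * up k n (m + 1) (xx k n m) :=
  eq_sub_of_add_eq' (tt_x m)

theorem tt_mul_xx (m : ℕ) : tt k n m * xx k n (m + 1) = 1 - up k n (m + 1) (xx k n m) * tt k n m :=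
  eq_sub_of_add_eq' (x_tt m)

end

section
variable (k : Type u) [Field k] (n m : ℕ)

open TensorProduct

/-- `a ⊗ b ↦ φ^s(a) z b`. -/
noncomputable def sandwich (s : ZMod 2) (z : (ONH k n (m + 1)).carrier) :
    (ONH k n m).carrier ⊗[k] (ONH k n m).carrier →ₗ[k] (ONH k n (m + 1)).carrier :=
  TensorProduct.lift (LinearMap.mk₂ k (fun a b => up k n m ((ONH k n m).inv s a) * z * up k n m b)
    (fun a a' b => by simp only [map_add, add_mul])
    (fun c a b => by simp only [map_smul, smul_mul_assoc])
    (fun a b b' => by simp only [map_add, mul_add])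
    (fun c a b => by simp only [map_smul, mul_smul_comm]))

variable {k n m}

@[simp] theorem sandwich_tmul (s : ZMod 2) (z : (ONH k n (m + 1)).carrier)
    (a b : (ONH k n m).carrier) :
    sandwich k n m s z (a ⊗ₜ b) = up k n m ((ONH k n m).inv s a) * z * up k n m b := rfl

variable (k n m)

/-- `a ⊗ b ↦ φ(a) τ_m b`. -/
noncomputable abbrev crossing :
    (ONH k n (m + 1)).carrier ⊗[k] (ONH k n (m + 1)).carrier →ₗ[k] (ONH k n (m + 2)).carrier :=
  sandwich k n (m + 1) 1 (tt k n m)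

/-- `a ⊗ b ↦ φ^i(a) x_m^i b`. -/
noncomputable def dotted (i : ℕ) :
    (ONH k n (m + 1)).carrier ⊗[k] (ONH k n (m + 1)).carrier →ₗ[k] (ONH k n (m + 1)).carrier :=
  TensorProduct.lift (LinearMap.mk₂ k
    (fun a b => (ONH k n (m + 1)).inv i a * xx k n m ^ i * b)
    (fun a a' b => by simp only [map_add, add_mul])
    (fun c a b => by simp only [map_smul, smul_mul_assoc])
    (fun a b b' => by simp only [mul_add])
    (fun c a b => by simp only [mul_smul_comm]))

variable {k n m}

@[simp] theorem dotted_tmul (i : ℕ) (a b : (ONH k n (m + 1)).carrier) :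
    dotted k n m i (a ⊗ₜ b) = (ONH k n (m + 1)).inv i a * xx k n m ^ i * b := rfl

/-! ### Generation -/

variable (k n m) in
/-- The elements of degree less than `N` in `x_m`, with coefficients in `ONH_m^n`. -/
noncomputable def polyLT (N : ℕ) : Submodule k (ONH k n (m + 1)).carrier :=
  Submodule.span k {z | ∃ a i, i < N ∧ z = up k n m a * xx k n m ^ i}

variable (k n m) in
/-- The polynomials in `x_m` with coefficients in `ONH_m^n`. -/
noncomputable def polyAll : Submodule k (ONH k n (m + 1)).carrier :=
  Submodule.span k {z | ∃ a i, z = up k n m a * xx k n m ^ i}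

theorem mem_polyLT {N : ℕ} (a : (ONH k n m).carrier) {i : ℕ} (h : i < N) :
    up k n m a * xx k n m ^ i ∈ polyLT k n m N :=
  Submodule.subset_span ⟨a, i, h, rfl⟩

theorem mem_polyAll (a : (ONH k n m).carrier) (i : ℕ) :
    up k n m a * xx k n m ^ i ∈ polyAll k n m :=
  Submodule.subset_span ⟨a, i, rfl⟩

theorem polyLT_mono {N N' : ℕ} (h : N ≤ N') : polyLT k n m N ≤ polyLT k n m N' :=
  Submodule.span_mono fun _ ⟨a, i, hi, e⟩ => ⟨a, i, hi.trans_le h, e⟩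

/-- A linear map that sends a spanning set of a submodule to a submodule. -/
theorem mul_span_mem {B : Type*} [Ring B] [Algebra k B] {S : Set B} {W : Submodule k B} (c : B)
    (h : ∀ z ∈ S, c * z ∈ W) {z : B} (hz : z ∈ Submodule.span k S) : c * z ∈ W := by
  have : Submodule.span k S ≤ W.comap (LinearMap.mulLeft k c) := Submodule.span_le.2 h
  exact this hz

theorem span_mul_mem {B : Type*} [Ring B] [Algebra k B] {S : Set B} {W : Submodule k B} (c : B)
    (h : ∀ z ∈ S, z * c ∈ W) {z : B} (hz : z ∈ Submodule.span k S) : z * c ∈ W := by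
  have : Submodule.span k S ≤ W.comap (LinearMap.mulRight k c) := Submodule.span_le.2 h
  exact this hz

theorem up_mul_polyLT {N : ℕ} (a : (ONH k n m).carrier) {z : (ONH k n (m + 1)).carrier}
    (hz : z ∈ polyLT k n m N) : up k n m a * z ∈ polyLT k n m N :=
  mul_span_mem _ (by
    rintro _ ⟨b, i, hi, rfl⟩
    rw [← mul_assoc, ← map_mul]; exact mem_polyLT _ hi) hz

theorem xx_mul_polyLT {N : ℕ} {z : (ONH k n (m + 1)).carrier}
    (hz : z ∈ polyLT k n m N) : xx k n m * z ∈ polyLT k n m (N + 1) :=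
  mul_span_mem _ (by
    rintro _ ⟨b, i, hi, rfl⟩
    rw [← mul_assoc, xx_mul_up, mul_assoc, ← pow_succ']; exact mem_polyLT _ (by lia)) hz

theorem up_mul_polyAll (a : (ONH k n m).carrier) {z : (ONH k n (m + 1)).carrier}
    (hz : z ∈ polyAll k n m) : up k n m a * z ∈ polyAll k n m :=
  mul_span_mem _ (by
    rintro _ ⟨b, i, rfl⟩
    rw [← mul_assoc, ← map_mul]; exact mem_polyAll _ _) hz

theorem polyAll_mul_up (a : (ONH k n m).carrier) {z : (ONH k n (m + 1)).carrier}
    (hz : z ∈ polyAll k n m) : z * up k n m a ∈ polyAll k n m :=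
  span_mul_mem _ (by
    rintro _ ⟨b, i, rfl⟩
    rw [mul_assoc, xx_pow_mul_up, ← mul_assoc, ← map_mul]; exact mem_polyAll _ _) hz

theorem xx_mul_polyAll {z : (ONH k n (m + 1)).carrier}
    (hz : z ∈ polyAll k n m) : xx k n m * z ∈ polyAll k n m :=
  mul_span_mem _ (by
    rintro _ ⟨b, i, rfl⟩
    rw [← mul_assoc, xx_mul_up, mul_assoc, ← pow_succ']; exact mem_polyAll _ _) hz

theorem polyLT_le_polyAll (N : ℕ) : polyLT k n m N ≤ polyAll k n m :=
  Submodule.span_mono fun _ ⟨a, i, _, e⟩ => ⟨a, i, e⟩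

variable (k n m) in
/-- The span of the elements `a τ_m b`. -/
noncomputable abbrev crossRange : Submodule k (ONH k n (m + 2)).carrier :=
  LinearMap.range (crossing k n m)

theorem mem_crossRange (a b : (ONH k n (m + 1)).carrier) :
    up k n (m + 1) a * tt k n m * up k n (m + 1) b ∈ crossRange k n m :=
  ⟨(ONH k n (m + 1)).inv 1 a ⊗ₜ b, by rw [sandwich_tmul, GSAlg.inv_self]⟩

theorem crossRange_eq : crossRange k n m =
    Submodule.span k {z | ∃ a b, z = up k n (m + 1) a * tt k n m * up k n (m + 1) b} := by
  refine le_antisymm ?_ (Submodule.span_le.2 ?_)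
  · rintro _ ⟨z, rfl⟩
    induction z using TensorProduct.induction_on with
    | zero => rw [map_zero]; exact zero_mem _
    | tmul a b => exact Submodule.subset_span ⟨_, _, rfl⟩
    | add x y hx hy => rw [map_add]; exact add_mem hx hy
  · rintro _ ⟨a, b, rfl⟩
    exact mem_crossRange a b

theorem up_mul_crossRange (a : (ONH k n (m + 1)).carrier) {z : (ONH k n (m + 2)).carrier}
    (hz : z ∈ crossRange k n m) : up k n (m + 1) a * z ∈ crossRange k n m := by
  rw [crossRange_eq] at hz
  refine mul_span_mem _ ?_ hz
  rintro _ ⟨b, c, rfl⟩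
  rw [← mul_assoc, ← mul_assoc, ← map_mul]
  exact mem_crossRange _ _

theorem crossRange_mul_up (a : (ONH k n (m + 1)).carrier) {z : (ONH k n (m + 2)).carrier}
    (hz : z ∈ crossRange k n m) : z * up k n (m + 1) a ∈ crossRange k n m := by
  rw [crossRange_eq] at hz
  refine span_mul_mem _ ?_ hz
  rintro _ ⟨b, c, rfl⟩
  rw [mul_assoc, ← map_mul]
  exact mem_crossRange _ _

theorem xx_mul_crossRange {z : (ONH k n (m + 2)).carrier} (hz : z ∈ crossRange k n m) :
    xx k n (m + 1) * z ∈ crossRange k n m ⊔ polyLT k n (m + 1) 1 := by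
  rw [crossRange_eq] at hz
  refine mul_span_mem _ ?_ hz
  rintro _ ⟨b, c, rfl⟩
  have e : xx k n (m + 1) * (up k n (m + 1) b * tt k n m * up k n (m + 1) c) =
      up k n (m + 1) ((ONH k n (m + 1)).inv 1 b * c) * xx k n (m + 1) ^ 0 -
      up k n (m + 1) ((ONH k n (m + 1)).inv 1 b) * tt k n m *
        up k n (m + 1) (xx k n m * c) := by
    rw [← mul_assoc, ← mul_assoc, xx_mul_up, mul_assoc (up k n (m + 1) _) (xx k n (m + 1)),
      xx_mul_tt, map_mul, map_mul]
    noncomm_ring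
  rw [e]
  exact sub_mem (Submodule.mem_sup_right (mem_polyLT _ (by lia)))
    (Submodule.mem_sup_left (mem_crossRange _ _))

theorem gen_cases {m : ℕ} (g : Gen n (m + 2)) :
    g = .x (m + 1) (by lia) ∨ g = .tau m (by lia) ∨ ∃ g', g = Gen.incl (Nat.le_succ (m + 1)) g' := by
  cases g with
  | x i h =>
    by_cases hi : i = m + 1
    · subst hi; exact .inl rfl
    · exact .inr (.inr ⟨.x i (by lia), rfl⟩)
  | tau i h =>
    by_cases hi : i = m
    · subst hi; exact .inr (.inl rfl)
    · exact .inr (.inr ⟨.tau i (by lia), rfl⟩)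
  | chi j h₀ h => exact .inr (.inr ⟨.chi j h₀ h, rfl⟩)
  | d => exact .inr (.inr ⟨.d, rfl⟩)

/-- A subspace that contains `1` and is closed under left multiplication by generators. -/
theorem eq_top_of_gen {m : ℕ} (W : Submodule k (ONH k n m).carrier) (h1 : (1 : (ONH k n m).carrier) ∈ W)
    (h : ∀ g, ∀ z ∈ W, ONH.gen k n m g * z ∈ W) : W = ⊤ := by
  have hc : ∀ c : k, ∀ z ∈ W, algebraMap k (ONH k n m).carrier c * z ∈ W := by
    intro c z hz
    rw [Algebra.algebraMap_eq_smul_one, smul_mul_assoc, one_mul]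
    exact Submodule.smul_mem _ _ hz
  have hm : ∀ a b : (ONH k n m).carrier, (∀ z ∈ W, a * z ∈ W) → (∀ z ∈ W, b * z ∈ W) →
      ∀ z ∈ W, a * b * z ∈ W := by
    intro a b ha hb z hz
    rw [mul_assoc]; exact ha _ (hb _ hz)
  have ha : ∀ a b : (ONH k n m).carrier, (∀ z ∈ W, a * z ∈ W) → (∀ z ∈ W, b * z ∈ W) →
      ∀ z ∈ W, (a + b) * z ∈ W := by
    intro a b ha hb z hz
    rw [add_mul]; exact add_mem (ha _ hz) (hb _ hz)
  have key : ∀ a : (ONH k n m).carrier, ∀ z ∈ W, a * z ∈ W := by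
    intro a
    exact presented_induction (motive := fun a : (ONH k n m).carrier => ∀ z ∈ W, a * z ∈ W)
      (fun g => h g) hc hm ha a
  refine eq_top_iff.2 fun a _ => ?_
  have := key a 1 h1
  rwa [mul_one] at this

theorem polyAll_zero : polyAll k n 0 = ⊤ := by
  refine eq_top_of_gen _ ?_ ?_
  · have := mem_polyAll (k := k) (n := n) (m := 0) 1 0
    simpa using this
  · intro g z hz
    have key : (∃ g' : Gen n 0, g = g'.incl (Nat.le_succ 0)) ∨ g = .x 0 (by lia) := by
      cases g with
      | x i h => obtain rfl : i = 0 := by lia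
                 exact .inr rfl
      | tau i h => lia
      | chi j h₀ h => exact .inl ⟨.chi j h₀ h, rfl⟩
      | d => exact .inl ⟨.d, rfl⟩
    obtain ⟨g', rfl⟩ | rfl := key
    · rw [← up_gen]; exact up_mul_polyAll _ hz
    · exact xx_mul_polyAll hz

variable (k n m) in
/-- The span of the elements `a τ_m b` and `a x_(m+1)^i`. -/
noncomputable abbrev mackeySpan : Submodule k (ONH k n (m + 2)).carrier :=
  crossRange k n m ⊔ polyAll k n (m + 1)

theorem up_mul_mackeySpan (a : (ONH k n (m + 1)).carrier) {z : (ONH k n (m + 2)).carrier}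
    (hz : z ∈ mackeySpan k n m) : up k n (m + 1) a * z ∈ mackeySpan k n m := by
  obtain ⟨s, hs, p, hp, rfl⟩ := Submodule.mem_sup.1 hz
  rw [mul_add]
  exact add_mem (Submodule.mem_sup_left (up_mul_crossRange _ hs))
    (Submodule.mem_sup_right (up_mul_polyAll _ hp))

theorem mackeySpan_mul_up (a : (ONH k n (m + 1)).carrier) {z : (ONH k n (m + 2)).carrier}
    (hz : z ∈ mackeySpan k n m) : z * up k n (m + 1) a ∈ mackeySpan k n m := by
  obtain ⟨s, hs, p, hp, rfl⟩ := Submodule.mem_sup.1 hz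
  rw [add_mul]
  exact add_mem (Submodule.mem_sup_left (crossRange_mul_up _ hs))
    (Submodule.mem_sup_right (polyAll_mul_up _ hp))

theorem xx_mul_mackeySpan {z : (ONH k n (m + 2)).carrier}
    (hz : z ∈ mackeySpan k n m) : xx k n (m + 1) * z ∈ mackeySpan k n m := by
  obtain ⟨s, hs, p, hp, rfl⟩ := Submodule.mem_sup.1 hz
  rw [mul_add]
  exact add_mem (sup_le_sup_left (polyLT_le_polyAll 1) _ (xx_mul_crossRange hs))
    (Submodule.mem_sup_right (xx_mul_polyAll hp))

theorem tt_mem_crossRange : tt k n m ∈ crossRange k n m := by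
  have := mem_crossRange (k := k) (n := n) (m := m) 1 1
  simpa only [map_one, one_mul, mul_one] using this

theorem tt_mul_xx_pow_mem (i : ℕ) : tt k n m * xx k n (m + 1) ^ i ∈ mackeySpan k n m := by
  induction i with
  | zero => rw [pow_zero, mul_one]; exact Submodule.mem_sup_left tt_mem_crossRange
  | succ i ih =>
    have e : tt k n m * xx k n (m + 1) ^ (i + 1) = up k n (m + 1) 1 * xx k n (m + 1) ^ i -
        up k n (m + 1) (xx k n m) * (tt k n m * xx k n (m + 1) ^ i) := by
      rw [pow_succ', ← mul_assoc, tt_mul_xx, map_one]; noncomm_ring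
    rw [e]
    exact sub_mem (Submodule.mem_sup_right (mem_polyAll _ _)) (up_mul_mackeySpan _ ih)

theorem tt_mul_x_pow_mem {w : (ONH k n (m + 2)).carrier} (hw : w ∈ mackeySpan k n m)
    (hw' : tt k n m * w ∈ mackeySpan k n m) (i : ℕ) :
    tt k n m * (up k n (m + 1) (xx k n m ^ i) * w) ∈ mackeySpan k n m := by
  induction i with
  | zero => rw [pow_zero, map_one, one_mul]; exact hw'
  | succ i ih =>
    have e : tt k n m * (up k n (m + 1) (xx k n m ^ (i + 1)) * w) =
        up k n (m + 1) (xx k n m ^ i) * w -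
        xx k n (m + 1) * (tt k n m * (up k n (m + 1) (xx k n m ^ i) * w)) := by
      rw [pow_succ', map_mul, mul_assoc, ← mul_assoc, tt_mul_x]; noncomm_ring
    rw [e]
    exact sub_mem (up_mul_mackeySpan _ hw) (xx_mul_mackeySpan ih)

variable (k n m) in
/-- The coefficients `a` such that `τ_m a x_(m+1)^i` and `τ_m a τ_m` lie in `mackeySpan`. -/
noncomputable def goodCoeff : Submodule k (ONH k n (m + 1)).carrier where
  carrier := {a | (∀ i : ℕ, tt k n m * (up k n (m + 1) a * xx k n (m + 1) ^ i) ∈ mackeySpan k n m) ∧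
    tt k n m * (up k n (m + 1) a * tt k n m) ∈ mackeySpan k n m}
  add_mem' {x y} hx hy := by
    simp only [Set.mem_ofPred_eq, map_add, add_mul, mul_add]
    exact ⟨fun i => add_mem (hx.1 i) (hy.1 i), add_mem hx.2 hy.2⟩
  zero_mem' := by simp
  smul_mem' c x hx := by
    simp only [Set.mem_ofPred_eq, map_smul, smul_mul_assoc, mul_smul_comm]
    exact ⟨fun i => Submodule.smul_mem _ _ (hx.1 i), Submodule.smul_mem _ _ hx.2⟩

theorem polyAll_le_goodCoeff : polyAll k n m ≤ goodCoeff k n m := by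
  refine Submodule.span_le.2 ?_
  rintro _ ⟨c, j, rfl⟩
  have e : ∀ w, tt k n m * (up k n (m + 1) (up k n m c * xx k n m ^ j) * w) =
      up k n (m + 1) (up k n m ((ONH k n m).inv 1 c)) *
        (tt k n m * (up k n (m + 1) (xx k n m ^ j) * w)) := by
    intro w
    rw [map_mul, mul_assoc (up k n (m + 1) (up k n m c)), ← mul_assoc (tt k n m), tt_mul_up_up,
      mul_assoc]
  refine ⟨fun i => ?_, ?_⟩
  · rw [e]
    have := mem_polyAll (k := k) (n := n) (m := m + 1) 1 i
    rw [map_one, one_mul] at this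
    exact up_mul_mackeySpan _ (tt_mul_x_pow_mem (Submodule.mem_sup_right this)
      (tt_mul_xx_pow_mem _) _)
  · rw [e]
    exact up_mul_mackeySpan _ (tt_mul_x_pow_mem (Submodule.mem_sup_left tt_mem_crossRange)
      (by rw [tt_sq]; exact zero_mem _) _)

theorem conj_braid {R : Type*} [Semigroup R] {S T b b' c c' : R} (hb : S * b = b' * S)
    (hc : c * S = S * c') (h : S * T * S = T * S * T) :
    S * (b * T * c * S) = b' * T * S * (T * c') := by
  calc S * (b * T * c * S) = S * b * T * (c * S) := by simp only [mul_assoc]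
    _ = b' * (S * T * S) * c' := by rw [hb, hc]; simp only [mul_assoc]
    _ = _ := by rw [h]; simp only [mul_assoc]

theorem crossRange_le_goodCoeff : crossRange k n m ≤ goodCoeff k n (m + 1) := by
  rw [crossRange_eq]
  refine Submodule.span_le.2 ?_
  rintro _ ⟨b, c, rfl⟩
  refine ⟨fun i => ?_, ?_⟩
  · have e : tt k n (m + 1) * (up k n (m + 2) (up k n (m + 1) b * tt k n m * up k n (m + 1) c) *
        xx k n (m + 2) ^ i) = up k n (m + 2) (up k n (m + 1) ((ONH k n (m + 1)).inv 1 b)) *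
        (tt k n (m + 1) * xx k n (m + 2) ^ i) *
        up k n (m + 2) ((ONH k n (m + 2)).inv i (tt k n m * up k n (m + 1) c)) := by
      rw [mul_assoc (up k n (m + 1) b), map_mul, mul_assoc (up k n (m + 2) _), up_mul_xx_pow,
        ← mul_assoc, tt_mul_up_up, mul_assoc, mul_assoc, mul_assoc]
    rw [e]
    exact mackeySpan_mul_up _ (up_mul_mackeySpan _ (tt_mul_xx_pow_mem i))
  · have e : tt k n (m + 1) * (up k n (m + 2) (up k n (m + 1) b * tt k n m * up k n (m + 1) c) *
        tt k n (m + 1)) = up k n (m + 2) (up k n (m + 1) ((ONH k n (m + 1)).inv 1 b) * tt k n m) *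
        tt k n (m + 1) *
        up k n (m + 2) (tt k n m * up k n (m + 1) ((ONH k n (m + 1)).inv 1 c)) := by
      have hc : up k n (m + 2) (up k n (m + 1) c) * tt k n (m + 1) =
          tt k n (m + 1) * up k n (m + 2) (up k n (m + 1) ((ONH k n (m + 1)).inv 1 c)) := by
        rw [tt_mul_up_up, GSAlg.inv_self]
      have hb := braid (k := k) (n := n) m
      have ht := tt_mul_up_up (k := k) (n := n) (m + 1) b
      simp only [map_mul]
      exact conj_braid ht hc hb.symm
    rw [e]
    exact Submodule.mem_sup_left (mem_crossRange _ _)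

theorem goodCoeff_eq_top (m : ℕ) (h : goodCoeff k n m = ⊤) : mackeySpan k n m = ⊤ := by
  have h' : ∀ a, a ∈ goodCoeff k n m := fun a => by rw [h]; trivial
  refine eq_top_of_gen _ ?_ ?_
  · have := mem_polyAll (k := k) (n := n) (m := m + 1) 1 0
    simp only [map_one, pow_zero, mul_one] at this
    exact Submodule.mem_sup_right this
  · intro g z hz
    obtain rfl | rfl | ⟨g', rfl⟩ := gen_cases g
    · exact xx_mul_mackeySpan hz
    · change tt k n m * z ∈ _
      obtain ⟨s, hs, p, hp, rfl⟩ := Submodule.mem_sup.1 hz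
      rw [mul_add]
      refine add_mem ?_ ?_
      · rw [crossRange_eq] at hs
        refine mul_span_mem _ ?_ hs
        rintro _ ⟨a, b, rfl⟩
        rw [← mul_assoc]
        exact mackeySpan_mul_up _ (h' a).2
      · refine mul_span_mem _ ?_ hp
        rintro _ ⟨a, i, rfl⟩
        exact (h' a).1 i
    · rw [← up_gen]; exact up_mul_mackeySpan _ hz

theorem mackeySpan_eq_top (m : ℕ) : mackeySpan k n m = ⊤ := by
  induction m with
  | zero =>
    refine goodCoeff_eq_top _ (eq_top_iff.2 ?_)
    rw [← polyAll_zero]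
    exact polyAll_le_goodCoeff
  | succ m ih =>
    refine goodCoeff_eq_top _ (eq_top_iff.2 ?_)
    rw [← ih]
    exact sup_le crossRange_le_goodCoeff polyAll_le_goodCoeff

end

end ONH

end OddCat

namespace OddCat

/-! ## Surjectivity of the Mackey maps -/

namespace ONH

open TensorProduct

section
variable {k : Type u} [Field k] {n m : ℕ}

theorem inv_natCast_succ (i : ℕ) (a : (ONH k n m).carrier) :
    (ONH k n m).inv ((i + 1 : ℕ) : ZMod 2) a = (ONH k n m).inv 1 ((ONH k n m).inv i a) := by
  rw [GSAlg.inv_inv, Nat.cast_succ, add_comm]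

theorem inv_pow_of_odd {z : (ONH k n m).carrier} (hz : (ONH k n m).inv 1 z = -z) (i r : ℕ) :
    (ONH k n m).inv i (z ^ r) = (-1) ^ (i * r) * z ^ r := by
  induction i with
  | zero => simp [GSAlg.inv_zero]
  | succ i ih =>
    rw [inv_natCast_succ, ih, map_mul, map_pow, map_pow, hz, map_neg, map_one, neg_pow z, ← mul_assoc,
      ← pow_add, add_one_mul]

theorem up_xx_pow_mul (i : ℕ) (s : ZMod 2) (w : (ONH k n (m + 1)).carrier)
    (z : (ONH k n m).carrier ⊗[k] (ONH k n m).carrier) :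
    xx k n m ^ i * sandwich k n m s w z = sandwich k n m (i + s) (xx k n m ^ i * w) z := by
  induction z using TensorProduct.induction_on with
  | zero => simp
  | tmul a b =>
    rw [sandwich_tmul, sandwich_tmul, ← mul_assoc, ← mul_assoc, xx_pow_mul_up, GSAlg.inv_inv,
      mul_assoc (up k n m _)]
  | add x y hx hy => rw [map_add, map_add, mul_add, hx, hy]

theorem inv_sandwich_mul_xx (s : ZMod 2) (w : (ONH k n (m + 1)).carrier)
    (z : (ONH k n m).carrier ⊗[k] (ONH k n m).carrier) :
    (ONH k n (m + 1)).inv 1 (sandwich k n m s w z) * xx k n m =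
      sandwich k n m (1 + s) ((ONH k n (m + 1)).inv 1 w * xx k n m) z := by
  induction z using TensorProduct.induction_on with
  | zero => simp
  | tmul a b =>
    rw [sandwich_tmul, sandwich_tmul, map_mul, map_mul, ← up_inv, ← up_inv, GSAlg.inv_inv,
      mul_assoc, ← xx_mul_up]
    simp only [mul_assoc]
  | add x y hx hy => rw [map_add, map_add, map_add, add_mul, hx, hy]

theorem sandwich_sub (s : ZMod 2) (w w' : (ONH k n (m + 1)).carrier)
    (z : (ONH k n m).carrier ⊗[k] (ONH k n m).carrier) :
    sandwich k n m s (w - w') z = sandwich k n m s w z - sandwich k n m s w' z := by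
  induction z using TensorProduct.induction_on with
  | zero => simp
  | tmul a b => simp only [sandwich_tmul, mul_sub, sub_mul]
  | add x y hx hy => rw [map_add, map_add, map_add, hx, hy]; abel

theorem sandwich_neg_one_pow_mul (s : ZMod 2) (i : ℕ) (w : (ONH k n (m + 1)).carrier)
    (z : (ONH k n m).carrier ⊗[k] (ONH k n m).carrier) :
    sandwich k n m s ((-1) ^ i * w) z = (-1) ^ i * sandwich k n m s w z := by
  obtain h | h := neg_one_pow_eq_or (ONH k n (m + 1)).carrier i
  · rw [h, one_mul, one_mul]
  · rw [h, neg_one_mul, neg_one_mul, ← zero_sub, sandwich_sub, ← zero_sub (sandwich k n m s w z)]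
    congr 1
    rw [← sub_self (0 : (ONH k n (m + 1)).carrier), sandwich_sub, sub_self, sub_self]

theorem up_dotted (i : ℕ) (z : (ONH k n (m + 1)).carrier ⊗[k] (ONH k n (m + 1)).carrier) :
    up k n (m + 1) (dotted k n m i z) =
      sandwich k n (m + 1) i (up k n (m + 1) (xx k n m) ^ i) z := by
  induction z using TensorProduct.induction_on with
  | zero => simp
  | tmul a b => rw [dotted_tmul, sandwich_tmul, map_mul, map_mul, map_pow]
  | add x y hx hy => rw [map_add, map_add, map_add, hx, hy]

variable (k n m) in
/-- `a ⊗ b ↦ φ^(r+1)(a) x_m^r τ_m b`. -/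
noncomputable def dottedCrossing (r : ℕ) :
    (ONH k n (m + 1)).carrier ⊗[k] (ONH k n (m + 1)).carrier →ₗ[k] (ONH k n (m + 2)).carrier :=
  sandwich k n (m + 1) (r + 1) (up k n (m + 1) (xx k n m) ^ r * tt k n m)

theorem dottedCrossing_zero : dottedCrossing k n m 0 = crossing k n m := by
  rw [dottedCrossing, crossing, Nat.cast_zero, zero_add, pow_zero, one_mul]

theorem inv_up_xx_pow_mul_tt (r : ℕ) :
    (ONH k n (m + 2)).inv 1 (up k n (m + 1) (xx k n m) ^ r * tt k n m) =
      (-1) ^ (r + 1) * (up k n (m + 1) (xx k n m) ^ r * tt k n m) := by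
  rw [map_mul, inv_tt, map_pow, ← up_inv, inv_xx, map_neg, neg_pow, pow_succ]
  simp only [mul_assoc, mul_neg, neg_mul, one_mul]

theorem dottedCrossing_succ (r : ℕ)
    (z : (ONH k n (m + 1)).carrier ⊗[k] (ONH k n (m + 1)).carrier) :
    dottedCrossing k n m (r + 1) z = up k n (m + 1) (dotted k n m r z) -
      (-1) ^ (r + 1) * (ONH k n (m + 2)).inv 1 (dottedCrossing k n m r z) * xx k n (m + 1) := by
  have hs : (1 + (r + 1) : ZMod 2) = r := by
    rw [add_left_comm, CharTwo.add_self_eq_zero, add_zero]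
  rw [up_dotted, dottedCrossing, dottedCrossing, mul_assoc ((-1) ^ (r + 1)), inv_sandwich_mul_xx,
    inv_up_xx_pow_mul_tt, mul_assoc ((-1) ^ (r + 1)), sandwich_neg_one_pow_mul, ← mul_assoc,
    ← pow_add, Even.neg_one_pow ⟨_, rfl⟩, one_mul, hs, mul_assoc, tt_mul_xx, mul_sub, mul_one,
    sandwich_sub, sub_sub_cancel, pow_succ, mul_assoc, Nat.cast_succ, add_assoc, CharTwo.add_self_eq_zero, add_zero]

variable (k n m) in
/-- `a ⊗ b ↦ φ^(r+i)(a) x_m^r τ_m x_(m+1)^i τ_m b`. -/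
noncomputable def doubleCrossing (r i : ℕ) :
    (ONH k n (m + 1)).carrier ⊗[k] (ONH k n (m + 1)).carrier →ₗ[k] (ONH k n (m + 2)).carrier :=
  sandwich k n (m + 1) (r + i)
    (up k n (m + 1) (xx k n m) ^ r * (tt k n m * xx k n (m + 1) ^ i * tt k n m))

theorem doubleCrossing_zero (r : ℕ)
    (z : (ONH k n (m + 1)).carrier ⊗[k] (ONH k n (m + 1)).carrier) :
    doubleCrossing k n m r 0 z = 0 := by
  rw [doubleCrossing, pow_zero, mul_one, tt_sq, mul_zero,
    ← sub_self (0 : (ONH k n (m + 2)).carrier), sandwich_sub, sub_self, sub_self]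

theorem up_xx_pow_mul_xx_pow (r i : ℕ) :
    up k n (m + 1) (xx k n m) ^ r * xx k n (m + 1) ^ i =
      (-1) ^ (i * r) * xx k n (m + 1) ^ i * up k n (m + 1) (xx k n m) ^ r := by
  rw [← map_pow, up_mul_xx_pow, inv_pow_of_odd (inv_xx m), map_mul, map_pow, map_neg, map_one]
  rw [← mul_assoc, ((Commute.neg_one_left (xx k n (m + 1) ^ i)).pow_left _).eq]

theorem doubleCrossing_succ (r i : ℕ)
    (z : (ONH k n (m + 1)).carrier ⊗[k] (ONH k n (m + 1)).carrier) :
    doubleCrossing k n m r (i + 1) z =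
      (-1) ^ (i * r) * xx k n (m + 1) ^ i * dottedCrossing k n m r z -
        doubleCrossing k n m (r + 1) i z := by
  have hs : (r + (i + 1 : ℕ) : ZMod 2) = i + (r + 1) := by push_cast; ring
  have hs' : ((r + 1 : ℕ) + i : ZMod 2) = i + (r + 1) := by push_cast; ring
  have hw : up k n (m + 1) (xx k n m) ^ r * (tt k n m * xx k n (m + 1) ^ (i + 1) * tt k n m) =
      (-1) ^ (i * r) * (xx k n (m + 1) ^ i * (up k n (m + 1) (xx k n m) ^ r * tt k n m)) -
        up k n (m + 1) (xx k n m) ^ (r + 1) * (tt k n m * xx k n (m + 1) ^ i * tt k n m) := by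
    rw [pow_succ' (xx k n (m + 1)), ← mul_assoc (tt k n m), tt_mul_xx, sub_mul, sub_mul, one_mul,
      mul_sub, ← mul_assoc, up_xx_pow_mul_xx_pow, pow_succ]
    simp only [mul_assoc]
  rw [doubleCrossing, hs, hw, sandwich_sub, sandwich_neg_one_pow_mul, ← up_xx_pow_mul,
    dottedCrossing, mul_assoc ((-1) ^ (i * r)), doubleCrossing, hs']

theorem doubleCrossing_eq_zero {L : ℕ} {z : (ONH k n (m + 1)).carrier ⊗[k] (ONH k n (m + 1)).carrier}
    (h : ∀ r < L, dottedCrossing k n m r z = 0) (r i : ℕ) (hri : r + i ≤ L) :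
    doubleCrossing k n m r i z = 0 := by
  induction i generalizing r with
  | zero => exact doubleCrossing_zero r z
  | succ i ih => rw [doubleCrossing_succ, h r (by lia), mul_zero, ih _ (by lia), sub_zero]

theorem doubleCrossing_eq {L : ℕ} {z : (ONH k n (m + 1)).carrier ⊗[k] (ONH k n (m + 1)).carrier}
    (h : ∀ r < L, dottedCrossing k n m r z = 0) (r i : ℕ) (hri : r + i = L) :
    doubleCrossing k n m r (i + 1) z = (-1) ^ i * dottedCrossing k n m L z := by
  induction i generalizing r with
  | zero =>
    obtain rfl : r = L := hri
    rw [doubleCrossing_succ, doubleCrossing_zero, sub_zero, zero_mul, pow_zero, pow_zero, mul_one]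
  | succ i ih =>
    rw [doubleCrossing_succ, h r (by lia), mul_zero, ih _ (by lia), zero_sub, pow_succ, mul_neg_one,
      neg_mul]

variable (k n m) in
/-- `a ⊗ b ↦ a τ_m ⊗ τ_m b`. -/
noncomputable def shift :
    (ONH k n (m + 1)).carrier ⊗[k] (ONH k n (m + 1)).carrier →ₗ[k]
      (ONH k n (m + 2)).carrier ⊗[k] (ONH k n (m + 2)).carrier :=
  TensorProduct.map ((LinearMap.mulRight k (tt k n m)).comp (up k n (m + 1)).toLinearMap)
    ((LinearMap.mulLeft k (tt k n m)).comp (up k n (m + 1)).toLinearMap)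

theorem dotted_shift (i : ℕ) (z : (ONH k n (m + 1)).carrier ⊗[k] (ONH k n (m + 1)).carrier) :
    dotted k n (m + 1) i (shift k n m z) = (-1) ^ i * doubleCrossing k n m 0 i z := by
  induction z using TensorProduct.induction_on with
  | zero => simp
  | tmul a b =>
    have h := inv_pow_of_odd (inv_tt (k := k) (n := n) m) i 1
    rw [pow_one, mul_one] at h
    change (ONH k n (m + 2)).inv i (up k n (m + 1) a * tt k n m) * xx k n (m + 1) ^ i *
      (tt k n m * up k n (m + 1) b) = _
    rw [doubleCrossing, sandwich_tmul, pow_zero, one_mul, Nat.cast_zero, zero_add, map_mul, h,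
      ← up_inv]
    have := ((Commute.neg_one_left (up k n (m + 1) ((ONH k n (m + 1)).inv i a))).pow_left i).eq
    simp only [← mul_assoc]
    rw [this]
  | add x y hx hy => rw [map_add, map_add, map_add, mul_add, hx, hy]

theorem crossing_shift (z : (ONH k n (m + 1)).carrier ⊗[k] (ONH k n (m + 1)).carrier) :
    crossing k n (m + 1) (shift k n m z) = tt k n (m + 1) *
      up k n (m + 2) ((ONH k n (m + 2)).inv 1 (crossing k n m z)) * tt k n (m + 1) := by
  induction z using TensorProduct.induction_on with
  | zero => simp
  | tmul a b =>
    change up k n (m + 2) ((ONH k n (m + 2)).inv 1 (up k n (m + 1) a * tt k n m)) * tt k n (m + 1) *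
      up k n (m + 2) (tt k n m * up k n (m + 1) b) = tt k n (m + 1) *
      up k n (m + 2) ((ONH k n (m + 2)).inv 1 (up k n (m + 1) ((ONH k n (m + 1)).inv 1 a) * tt k n m *
        up k n (m + 1) b)) * tt k n (m + 1)
    have h1 := tt_mul_up_up (k := k) (n := n) (m + 1) a
    have h2 : up k n (m + 2) (up k n (m + 1) ((ONH k n (m + 1)).inv 1 b)) * tt k n (m + 1) =
        tt k n (m + 1) * up k n (m + 2) (up k n (m + 1) b) := by
      rw [tt_mul_up_up]
    have h3 := conj_braid h1 h2 (braid (k := k) (n := n) m).symm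
    simp only [map_mul, ← up_inv, GSAlg.inv_self, inv_tt, map_neg, mul_neg, neg_mul, mul_assoc]
      at h3 ⊢
    rw [h3]
  | add x y hx hy => simp only [map_add, mul_add, add_mul, hx, hy]


/-! ### The identity in the image -/

theorem mem_polyLT_zero_iff {z : (ONH k n (m + 1)).carrier} : z ∈ polyLT k n m 0 ↔ z = 0 := by
  have : polyLT k n m 0 = ⊥ := by
    rw [polyLT, Submodule.span_eq_bot]
    rintro _ ⟨a, i, hi, _⟩
    exact absurd hi (by lia)
  rw [this, Submodule.mem_bot]

/-- `τ_m x_m^i τ_m` up to the span of the `a τ_m b`. -/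
theorem tt_xx_pow_tt (i : ℕ) : ∃ ε : k, (ε = 1 ∨ ε = -1) ∧
    tt k n m * up k n (m + 1) (xx k n m) ^ (i + 2) * tt k n m - ε • xx k n (m + 1) ^ i ∈
      crossRange k n m ⊔ polyLT k n (m + 1) i := by
  have hx : ∀ i, tt k n m * up k n (m + 1) (xx k n m) ^ (i + 1) * tt k n m =
      up k n (m + 1) (xx k n m) ^ i * tt k n m -
        xx k n (m + 1) * (tt k n m * up k n (m + 1) (xx k n m) ^ i * tt k n m) := by
    intro i
    rw [pow_succ', ← mul_assoc, tt_mul_x, sub_mul, sub_mul, one_mul]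
    simp only [mul_assoc]
  have hc : ∀ i, up k n (m + 1) (xx k n m) ^ i * tt k n m ∈ crossRange k n m := fun i => by
    rw [← map_pow]; exact up_mul_crossRange _ tt_mem_crossRange
  induction i with
  | zero =>
    refine ⟨-1, .inr rfl, ?_⟩
    have e : tt k n m * up k n (m + 1) (xx k n m) ^ (0 + 2) * tt k n m -
        (-1 : k) • xx k n (m + 1) ^ 0 = up k n (m + 1) (xx k n m) ^ 1 * tt k n m +
          tt k n m * up k n (m + 1) (xx k n m) := by
      rw [hx, hx, pow_zero, pow_zero, mul_one, one_mul, tt_sq, mul_zero, sub_zero, xx_mul_tt, neg_smul, one_smul]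
      abel
    rw [e]
    exact Submodule.mem_sup_left (add_mem (hc _) (crossRange_mul_up _ tt_mem_crossRange))
  | succ i ih =>
    obtain ⟨ε, hε, h⟩ := ih
    refine ⟨-ε, hε.symm.imp (by rintro rfl; rw [neg_neg]) (by rintro rfl; rfl), ?_⟩
    have e : tt k n m * up k n (m + 1) (xx k n m) ^ (i + 1 + 2) * tt k n m -
        (-ε) • xx k n (m + 1) ^ (i + 1) = up k n (m + 1) (xx k n m) ^ (i + 2) * tt k n m -
          xx k n (m + 1) * (tt k n m * up k n (m + 1) (xx k n m) ^ (i + 2) * tt k n m -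
            ε • xx k n (m + 1) ^ i) := by
      rw [show i + 1 + 2 = i + 2 + 1 by lia, hx, mul_sub, mul_smul_comm, ← pow_succ', neg_smul]
      abel
    rw [e]
    refine sub_mem (Submodule.mem_sup_left (hc _)) ?_
    obtain ⟨s, hs, p, hp, hsp⟩ := Submodule.mem_sup.1 h
    rw [← hsp, mul_add]
    refine add_mem ?_ (Submodule.mem_sup_right (xx_mul_polyLT hp))
    exact sup_le_sup_left (polyLT_mono (by lia)) _ (xx_mul_crossRange hs)

theorem tt_polyLT_tt {N : ℕ} {p : (ONH k n (m + 1)).carrier} (hp : p ∈ polyLT k n m (N + 2)) :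
    tt k n m * up k n (m + 1) p * tt k n m ∈ crossRange k n m ⊔ polyLT k n (m + 1) N := by
  have key : ∀ i < N + 2, tt k n m * up k n (m + 1) (xx k n m) ^ i * tt k n m ∈
      crossRange k n m ⊔ polyLT k n (m + 1) N := by
    intro i hi
    obtain _ | _ | i := i
    · rw [pow_zero, mul_one, tt_sq]; exact zero_mem _
    · rw [zero_add, pow_one, tt_mul_x, sub_mul, mul_assoc, tt_sq, mul_zero, sub_zero, one_mul]
      exact Submodule.mem_sup_left tt_mem_crossRange
    · obtain ⟨ε, -, h⟩ := tt_xx_pow_tt (k := k) (n := n) (m := m) i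
      rw [← sub_add_cancel (_ * _) (ε • xx k n (m + 1) ^ i)]
      refine add_mem (sup_le_sup_left (polyLT_mono (by lia)) _ h)
        (Submodule.mem_sup_right (Submodule.smul_mem _ _ ?_))
      have := mem_polyLT (k := k) (n := n) (m := m + 1) 1 (show i < N by lia)
      rwa [map_one, one_mul] at this
  have : polyLT k n m (N + 2) ≤ (crossRange k n m ⊔ polyLT k n (m + 1) N).comap
      ((LinearMap.mulLeftRight k (tt k n m, tt k n m)).comp (up k n (m + 1)).toLinearMap) := by
    refine Submodule.span_le.2 ?_
    rintro _ ⟨a, i, hi, rfl⟩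
    change tt k n m * up k n (m + 1) (up k n m a * xx k n m ^ i) * tt k n m ∈
      crossRange k n m ⊔ polyLT k n (m + 1) N
    rw [map_mul, map_pow, ← mul_assoc, tt_mul_up_up, mul_assoc, mul_assoc, ← mul_assoc (tt k n m)]
    obtain ⟨s, hs, p, hp, hsp⟩ := Submodule.mem_sup.1 (key i hi)
    rw [← hsp, mul_add]
    exact add_mem (Submodule.mem_sup_left (up_mul_crossRange _ hs))
      (Submodule.mem_sup_right (up_mul_polyLT _ hp))
  exact this hp

theorem tt_crossRange_tt {s : (ONH k n (m + 2)).carrier} (hs : s ∈ crossRange k n m) :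
    tt k n (m + 1) * up k n (m + 2) s * tt k n (m + 1) ∈ crossRange k n (m + 1) := by
  have : crossRange k n m ≤ (crossRange k n (m + 1)).comap
      ((LinearMap.mulLeftRight k (tt k n (m + 1), tt k n (m + 1))).comp
        (up k n (m + 2)).toLinearMap) := by
    rw [crossRange_eq]
    refine Submodule.span_le.2 ?_
    rintro _ ⟨a, b, rfl⟩
    change tt k n (m + 1) * up k n (m + 2) (up k n (m + 1) a * tt k n m * up k n (m + 1) b) *
      tt k n (m + 1) ∈ crossRange k n (m + 1)
    have h1 := tt_mul_up_up (k := k) (n := n) (m + 1) a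
    have h2 : up k n (m + 2) (up k n (m + 1) b) * tt k n (m + 1) =
        tt k n (m + 1) * up k n (m + 2) (up k n (m + 1) ((ONH k n (m + 1)).inv 1 b)) := by
      rw [tt_mul_up_up, GSAlg.inv_self]
    rw [map_mul, map_mul, mul_assoc (tt k n (m + 1)),
      conj_braid h1 h2 (braid (k := k) (n := n) m).symm]
    have := mem_crossRange (k := k) (n := n) (m := m + 1)
      (up k n (m + 1) ((ONH k n (m + 1)).inv 1 a) * tt k n m)
      (tt k n m * up k n (m + 1) ((ONH k n (m + 1)).inv 1 b))
    simpa only [map_mul, mul_assoc] using this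
  exact this hs

theorem xx_pow_mem_of_tt {N : ℕ} {W : Submodule k (ONH k n (m + 1)).carrier}
    (hW : ∀ s ∈ W, tt k n m * up k n (m + 1) s * tt k n m ∈ crossRange k n m)
    (h : xx k n m ^ (N + 2) ∈ W ⊔ polyLT k n m (N + 2)) :
    xx k n (m + 1) ^ N ∈ crossRange k n m ⊔ polyLT k n (m + 1) N := by
  obtain ⟨s, hs, p, hp, hsp⟩ := Submodule.mem_sup.1 h
  obtain ⟨ε, hε, hq⟩ := tt_xx_pow_tt (k := k) (n := n) (m := m) N
  have h1 : tt k n m * up k n (m + 1) (xx k n m) ^ (N + 2) * tt k n m ∈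
      crossRange k n m ⊔ polyLT k n (m + 1) N := by
    rw [← map_pow, ← hsp, map_add, mul_add, add_mul]
    exact add_mem (Submodule.mem_sup_left (hW s hs)) (tt_polyLT_tt hp)
  have h2 := Submodule.smul_mem _ ε (sub_mem h1 hq)
  rw [sub_sub_cancel, smul_smul] at h2
  obtain rfl | rfl := hε <;> simpa using h2

/-- The identity of `ONH_(m+1)^n` can be separated by the crossing and by the dotted caps. -/
def Separated (k : Type u) [Field k] (n m : ℕ) : ℕ → Prop
  | 0 => ∃ z, crossing k n m z = 1
  | L + 1 => ∃ z, crossing k n m z = 0 ∧ (∀ i < L, dotted k n m i z = 0) ∧ dotted k n m L z = 1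

theorem Separated.dottedCrossing {L : ℕ} (h : Separated k n m L) :
    ∃ z, (∀ r < L, dottedCrossing k n m r z = 0) ∧ dottedCrossing k n m L z = 1 ∧
      (∀ i, i + 1 = L → dotted k n m i z = 1) ∧ ∀ i, i + 1 < L → dotted k n m i z = 0 := by
  obtain _ | L := L
  · obtain ⟨z, hz⟩ := h
    exact ⟨z, fun r hr => absurd hr (by lia), by rw [dottedCrossing_zero, hz],
      fun i hi => absurd hi (by lia), fun i hi => absurd hi (by lia)⟩
  · obtain ⟨z, hz, hd, h1⟩ := h
    have h0 : ∀ r < L + 1, ONH.dottedCrossing k n m r z = 0 := by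
      intro r hr
      induction r with
      | zero => rw [dottedCrossing_zero, hz]
      | succ r ih =>
        rw [dottedCrossing_succ, ih (by lia), hd r (by lia)]
        simp
    refine ⟨z, h0, ?_, fun i hi => ?_, fun i hi => hd i (by lia)⟩
    · rw [dottedCrossing_succ, h0 L (by lia), h1]
      simp
    · obtain rfl : i = L := by lia
      exact h1

theorem Separated.step {L : ℕ} (h : Separated k n m L) : Separated k n (m + 1) (L + 2) := by
  obtain ⟨z, h0, h1, -⟩ := h.dottedCrossing
  refine ⟨-shift k n m z, ?_, fun i hi => ?_, ?_⟩
  · rw [map_neg, crossing_shift, neg_eq_zero, ← dottedCrossing_zero]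
    obtain _ | L := L
    · rw [h1, map_one, map_one, mul_one, tt_sq]
    · rw [h0 0 (by lia), map_zero, map_zero, mul_zero, zero_mul]
  · rw [map_neg, dotted_shift, doubleCrossing_eq_zero h0 0 i (by lia), mul_zero, neg_zero]
  · rw [map_neg, dotted_shift, doubleCrossing_eq h0 0 L (by lia), h1, ← mul_assoc, ← pow_add,
      mul_one, Odd.neg_one_pow ⟨L, by ring⟩, neg_neg]

theorem separated_one_of_mem (h : xx k n (m + 1) ^ 1 ∈ crossRange k n m ⊔ polyLT k n (m + 1) 1) :
    Separated k n (m + 1) 1 := by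
  obtain ⟨s, ⟨z, rfl⟩, p, hp, hsp⟩ := Submodule.mem_sup.1 h
  have hp' : ∃ e, p = up k n (m + 1) e := by
    have : polyLT k n (m + 1) 1 ≤ LinearMap.range (up k n (m + 1)).toLinearMap := by
      refine Submodule.span_le.2 ?_
      rintro _ ⟨a, i, hi, rfl⟩
      obtain rfl : i = 0 := by lia
      exact ⟨a, by rw [pow_zero, mul_one]; rfl⟩
    obtain ⟨e, he⟩ := this hp
    exact ⟨e, he.symm⟩
  obtain ⟨e, rfl⟩ := hp'
  rw [pow_one] at hsp
  have hz : crossing k n m z = xx k n (m + 1) - up k n (m + 1) e := eq_sub_of_add_eq hsp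
  refine ⟨shift k n m z + 1 ⊗ₜ 1, ?_, fun i hi => absurd hi (by lia), ?_⟩
  · rw [map_add, crossing_shift, hz, sandwich_tmul, map_sub, inv_xx, ← up_inv, map_sub, mul_sub,
      tt_mul_up_up, GSAlg.inv_self, sub_mul, mul_assoc (up k n _ _), tt_sq, mul_zero, sub_zero,
      map_neg, mul_neg, tt_mul_x, neg_mul, sub_mul, mul_assoc, tt_sq]
    simp
  · rw [map_add, dotted_shift, doubleCrossing_zero, dotted_tmul]
    simp

theorem xx_zero_pow_mem (k : Type u) [Field k] (n : ℕ) : xx k n 0 ^ n ∈ polyLT k n 0 n := by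
  have h := ONH.rel (ONHRel.cyc (k := k) (n := n) (m := 1) one_pos)
  have hc : ∀ i h, ∃ a, FreeAlgebra.lift k (ONH.gen k n 1) (fc k i h) = up k n 0 a := by
    intro i h
    have hchi : ∀ j h, FreeAlgebra.lift k (ONH.gen k n 1) (fchi k j h) =
        up k n 0 (FreeAlgebra.lift k (ONH.gen k n 0) (fchi k j h)) := by
      intro j h
      unfold fchi
      split_ifs
      · rw [FreeAlgebra.lift_ι_apply, FreeAlgebra.lift_ι_apply, up_gen]; rfl
      · simp only [map_one]
    unfold fc
    split_ifs
    · exact ⟨_, hchi _ _⟩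
    · exact ⟨ONH.gen k n 0 .d * FreeAlgebra.lift k (ONH.gen k n 0) (fchi k (i / 2) (by lia)), by
        rw [map_mul, hchi, map_mul, up_gen, fd, FreeAlgebra.lift_ι_apply]; rfl⟩
  have hc0 : FreeAlgebra.lift k (ONH.gen k n 1) (fc k (n - n) (Nat.sub_le n n)) = 1 := by
    unfold fc fchi
    simp
  rw [fcyc, map_sum, map_zero, Fin.sum_univ_castSucc] at h
  have h' := eq_neg_of_add_eq_zero_right h
  simp only [Fin.val_last, map_smul, map_mul, hc0, mul_one, map_pow, fx, FreeAlgebra.lift_ι_apply]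
    at h'
  have hx : xx k n 0 ^ n = (-1 : k) ^ n • ((-1 : k) ^ n • xx k n 0 ^ n) := by
    rw [smul_smul, ← mul_pow]; simp
  rw [hx]
  refine Submodule.smul_mem _ _ ?_
  have h'' : (-1 : k) ^ n • xx k n 0 ^ n = _ := h'
  rw [h'']
  refine neg_mem (sum_mem fun l _ => Submodule.smul_mem _ _ ?_)
  obtain ⟨a, ha⟩ := hc (n - (l.castSucc : ℕ)) (Nat.sub_le _ _)
  rw [ha]
  change xx k n 0 ^ (l : ℕ) * _ ∈ _
  rw [xx_pow_mul_up]
  exact mem_polyLT _ l.2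

theorem xx_pow_mem (k : Type u) [Field k] (n m N : ℕ) (hN : 2 * (m + 1) + N = n) :
    xx k n (m + 1) ^ N ∈ crossRange k n m ⊔ polyLT k n (m + 1) N := by
  induction m generalizing N with
  | zero =>
    refine xx_pow_mem_of_tt (W := ⊥) (fun s hs => ?_) ?_
    · rw [(Submodule.mem_bot k).1 hs, map_zero, mul_zero, zero_mul]; exact zero_mem _
    · obtain rfl : n = N + 2 := by lia
      exact Submodule.mem_sup_right (xx_zero_pow_mem k _)
  | succ m ih => exact xx_pow_mem_of_tt (fun s hs => tt_crossRange_tt hs) (ih (N + 2) (by lia))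

theorem separated (k : Type u) [Field k] (n m L : ℕ) (hL : 2 * (m + 1) = n + L) :
    Separated k n m L := by
  have hz : ∀ m, 2 * (m + 1) = n → Separated k n m 0 := by
    intro m hm
    obtain ⟨s, ⟨z, rfl⟩, p, hp, hsp⟩ := Submodule.mem_sup.1 (xx_pow_mem k n m 0 hm)
    rw [mem_polyLT_zero_iff.1 hp, add_zero, pow_zero] at hsp
    exact ⟨z, hsp⟩
  induction m generalizing L with
  | zero =>
    obtain rfl | rfl | h : n = 0 ∨ n = 1 ∨ n = 2 := by lia
    · obtain rfl : L = 2 := by lia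
      have h1 : (1 : (ONH k 0 1).carrier) = 0 := by
        have := xx_zero_pow_mem k 0
        rwa [mem_polyLT_zero_iff, pow_zero] at this
      have h2 : (1 : (ONH k 0 2).carrier) = 0 := by
        have := congrArg (up k 0 1) h1
        rwa [map_one, map_zero] at this
      exact ⟨0, map_zero _, fun i _ => map_zero _, by rw [map_zero]; exact h1.symm⟩
    · obtain rfl : L = 1 := by lia
      have hx := xx_zero_pow_mem k 1
      have ht : tt k 1 0 * up k 1 1 (xx k 1 0) * tt k 1 0 = 0 := by
        have : polyLT k 1 0 1 ≤ (⊥ : Submodule k (ONH k 1 2).carrier).comap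
            ((LinearMap.mulLeftRight k (tt k 1 0, tt k 1 0)).comp (up k 1 1).toLinearMap) := by
          refine Submodule.span_le.2 ?_
          rintro _ ⟨a, i, hi, rfl⟩
          obtain rfl : i = 0 := by lia
          change tt k 1 0 * up k 1 1 (up k 1 0 a * xx k 1 0 ^ 0) * tt k 1 0 = 0
          rw [pow_zero, mul_one, tt_mul_up_up, mul_assoc, tt_sq, mul_zero]
        rw [pow_one] at hx
        exact this hx
      rw [tt_mul_x, sub_mul, mul_assoc, tt_sq, mul_zero, sub_zero, one_mul] at ht
      refine ⟨1 ⊗ₜ 1, ?_, fun i hi => absurd hi (by lia), by simp⟩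
      rw [sandwich_tmul, ht]; simp
    · obtain rfl : L = 0 := by lia
      exact hz 0 (by lia)
  | succ m ih =>
    obtain _ | _ | L := L
    · exact hz _ (by lia)
    · exact separated_one_of_mem (xx_pow_mem k n m 1 (by lia))
    · exact (ih L (by lia)).step

/-! ### Surjectivity -/

theorem sup_polyLT_eq_top_of_mem {N : ℕ}
    (h : xx k n (m + 1) ^ N ∈ crossRange k n m ⊔ polyLT k n (m + 1) N) :
    crossRange k n m ⊔ polyLT k n (m + 1) N = ⊤ := by
  have hu : ∀ (a : (ONH k n (m + 1)).carrier), ∀ z ∈ crossRange k n m ⊔ polyLT k n (m + 1) N,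
      up k n (m + 1) a * z ∈ crossRange k n m ⊔ polyLT k n (m + 1) N := by
    intro a z hz
    obtain ⟨s, hs, p, hp, rfl⟩ := Submodule.mem_sup.1 hz
    rw [mul_add]
    exact add_mem (Submodule.mem_sup_left (up_mul_crossRange _ hs))
      (Submodule.mem_sup_right (up_mul_polyLT _ hp))
  have hl : polyLT k n (m + 1) (N + 1) ≤ crossRange k n m ⊔ polyLT k n (m + 1) N := by
    refine Submodule.span_le.2 ?_
    rintro _ ⟨a, i, hi, rfl⟩
    obtain hi | rfl := (Nat.lt_succ_iff_lt_or_eq.1 hi)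
    · exact Submodule.mem_sup_right (mem_polyLT _ hi)
    · exact hu a _ h
  have hx : ∀ z ∈ crossRange k n m ⊔ polyLT k n (m + 1) N,
      xx k n (m + 1) * z ∈ crossRange k n m ⊔ polyLT k n (m + 1) N := by
    intro z hz
    obtain ⟨s, hs, p, hp, rfl⟩ := Submodule.mem_sup.1 hz
    rw [mul_add]
    exact add_mem (sup_le le_sup_left ((polyLT_mono (by lia)).trans hl) (xx_mul_crossRange hs))
      (hl (xx_mul_polyLT hp))
  have hi : ∀ i, xx k n (m + 1) ^ i ∈ crossRange k n m ⊔ polyLT k n (m + 1) N := by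
    intro i
    induction i with
    | zero =>
      have := hl (mem_polyLT 1 (Nat.succ_pos N))
      rwa [map_one, one_mul] at this
    | succ i ih => rw [pow_succ']; exact hx _ ih
  rw [eq_top_iff, ← mackeySpan_eq_top m]
  refine sup_le le_sup_left (Submodule.span_le.2 ?_)
  rintro _ ⟨a, i, rfl⟩
  exact hu a _ (hi i)

theorem crossRange_sup_polyLT_eq_top {N : ℕ} (hN : 2 * (m + 1) + N = n) :
    crossRange k n m ⊔ polyLT k n (m + 1) N = ⊤ :=
  sup_polyLT_eq_top_of_mem (xx_pow_mem k n m N hN)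

variable (k n m) in
/-- `a ⊗ b ↦ φ^r(a) x_m^r ⊗ b c`. -/
noncomputable def dot (r : ℕ) (c : (ONH k n (m + 1)).carrier) :
    (ONH k n (m + 1)).carrier ⊗[k] (ONH k n (m + 1)).carrier →ₗ[k]
      (ONH k n (m + 1)).carrier ⊗[k] (ONH k n (m + 1)).carrier :=
  TensorProduct.map ((LinearMap.mulRight k (xx k n m ^ r)).comp
    ((ONH k n (m + 1)).inv r).toLinearMap) (LinearMap.mulRight k c)

theorem crossing_dot (r : ℕ) (c : (ONH k n (m + 1)).carrier)
    (z : (ONH k n (m + 1)).carrier ⊗[k] (ONH k n (m + 1)).carrier) :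
    crossing k n m (dot k n m r c z) =
      (-1) ^ r * dottedCrossing k n m r z * up k n (m + 1) c := by
  induction z using TensorProduct.induction_on with
  | zero => simp
  | tmul a b =>
    change up k n (m + 1) ((ONH k n (m + 1)).inv 1 ((ONH k n (m + 1)).inv r a * xx k n m ^ r)) *
      tt k n m * up k n (m + 1) (b * c) = _
    rw [dottedCrossing, sandwich_tmul, map_mul, ← inv_natCast_succ, map_pow, inv_xx, neg_pow,
      Nat.cast_succ]
    have := ((Commute.neg_one_left
      (up k n (m + 1) ((ONH k n (m + 1)).inv (r + 1) a))).pow_left r).eq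
    simp only [map_mul, map_pow, map_neg, map_one, ← mul_assoc, this]
  | add x y hx hy => simp only [map_add, mul_add, add_mul, hx, hy]

theorem dotted_dot (i r : ℕ) (c : (ONH k n (m + 1)).carrier)
    (z : (ONH k n (m + 1)).carrier ⊗[k] (ONH k n (m + 1)).carrier) :
    dotted k n m i (dot k n m r c z) = (-1) ^ (i * r) * dotted k n m (i + r) z * c := by
  induction z using TensorProduct.induction_on with
  | zero => simp
  | tmul a b =>
    change (ONH k n (m + 1)).inv i ((ONH k n (m + 1)).inv r a * xx k n m ^ r) *
      xx k n m ^ i * (b * c) = _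
    rw [dotted_tmul, map_mul, GSAlg.inv_inv, inv_pow_of_odd (inv_xx m), Nat.cast_add,
      add_comm i r, pow_add]
    have := ((Commute.neg_one_left ((ONH k n (m + 1)).inv (i + r) a)).pow_left (i * r)).eq
    simp only [← mul_assoc, this]
  | add x y hx hy => simp only [map_add, mul_add, add_mul, hx, hy]

theorem crossRange_eq_top {L : ℕ} (hL : 2 * (m + 1) = n + L) : crossRange k n m = ⊤ := by
  obtain ⟨z, -, h1, -⟩ := (separated k n m L hL).dottedCrossing
  have h : crossRange k n m ⊔ polyLT k n (m + 1) 0 = ⊤ := by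
    refine sup_polyLT_eq_top_of_mem (Submodule.mem_sup_left ⟨dot k n m L ((-1) ^ L) z, ?_⟩)
    rw [crossing_dot, h1, map_pow, map_neg, map_one, mul_one, ← pow_add, pow_zero]
    exact Even.neg_one_pow ⟨L, rfl⟩
  have h0 : polyLT k n (m + 1) 0 = ⊥ := by
    rw [eq_bot_iff]; intro z hz; exact mem_polyLT_zero_iff.1 hz
  rwa [h0, sup_bot_eq] at h

theorem exists_dotted_eq {L : ℕ} (hL : 2 * (m + 1) = n + L) (c : ℕ → (ONH k n (m + 1)).carrier) :
    ∃ z, crossing k n m z = 0 ∧ ∀ i < L, dotted k n m i z = c i := by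
  obtain ⟨z₀, h0, h1, hd1, hd⟩ := (separated k n m L hL).dottedCrossing
  have key : ∀ j < L, ∀ c, ∃ z, crossing k n m z = 0 ∧ (∀ i < j, dotted k n m i z = 0) ∧
      dotted k n m j z = c := by
    intro j hj c
    refine ⟨dot k n m (L - 1 - j) ((-1) ^ (j * (L - 1 - j)) * c) z₀, ?_, fun i hi => ?_, ?_⟩
    · rw [crossing_dot, h0 _ (by lia), mul_zero, zero_mul]
    · rw [dotted_dot, hd _ (by lia), mul_zero, zero_mul]
    · rw [dotted_dot, hd1 _ (by lia), mul_one, ← mul_assoc, ← pow_add, Even.neg_one_pow ⟨_, rfl⟩,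
        one_mul]
  have main : ∀ j ≤ L, ∃ z, crossing k n m z = 0 ∧ ∀ i < j, dotted k n m i z = c i := by
    intro j hj
    induction j with
    | zero => exact ⟨0, map_zero _, fun i hi => absurd hi (by lia)⟩
    | succ j ih =>
      obtain ⟨z, hz, hzi⟩ := ih (by lia)
      obtain ⟨z', hz', hzi', hzj⟩ := key j (by lia) (c j - dotted k n m j z)
      refine ⟨z + z', by rw [map_add, hz, hz', add_zero], fun i hi => ?_⟩
      obtain hi | rfl := Nat.lt_succ_iff_lt_or_eq.1 hi
      · rw [map_add, hzi i hi, hzi' i hi, add_zero]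
      · rw [map_add, hzj, add_sub_cancel]
  exact main L le_rfl

theorem exists_crossing_dotted_eq {L : ℕ} (hL : 2 * (m + 1) = n + L)
    (d : (ONH k n (m + 2)).carrier) (c : ℕ → (ONH k n (m + 1)).carrier) :
    ∃ z, crossing k n m z = d ∧ ∀ i < L, dotted k n m i z = c i := by
  obtain ⟨z, hz⟩ : d ∈ crossRange k n m := by rw [crossRange_eq_top hL]; trivial
  obtain ⟨z', hz', hd⟩ := exists_dotted_eq hL fun i => c i - dotted k n m i z
  exact ⟨z + z', by rw [map_add, hz, hz', add_zero], fun i hi => by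
    rw [map_add, hd i hi, add_sub_cancel]⟩

end

end ONH
end OddCat

namespace OddCat

/-! ## Skew polynomials and odd divided differences -/

/-- The generators of the skew polynomial ring. -/
inductive SkewGen : Type
  | x (i : ℕ)
  | chi (j : ℕ)
  | d

section
variable (k : Type u) [Field k] (n : ℕ)

/-- The relations of the skew polynomial ring over `A_n`. -/
inductive SkewRel : FreeAlgebra k SkewGen → FreeAlgebra k SkewGen → Prop
  | x_x (i j : ℕ) (h : i ≠ j) : SkewRel
      (FreeAlgebra.ι k (.x i) * FreeAlgebra.ι k (.x j) +
        FreeAlgebra.ι k (.x j) * FreeAlgebra.ι k (.x i)) 0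
  | chi_comm (j : ℕ) (g : SkewGen) : SkewRel (FreeAlgebra.ι k (.chi j) * FreeAlgebra.ι k g)
      (FreeAlgebra.ι k g * FreeAlgebra.ι k (.chi j))
  | chi_zero : SkewRel (FreeAlgebra.ι k (.chi 0)) 1
  | d_x (i : ℕ) : SkewRel (FreeAlgebra.ι k .d * FreeAlgebra.ι k (.x i) +
      FreeAlgebra.ι k (.x i) * FreeAlgebra.ι k .d) 0
  | d_sq : SkewRel (FreeAlgebra.ι k .d * FreeAlgebra.ι k .d) 0
  | d_chi (j : ℕ) (h : 2 * j = n) : SkewRel (FreeAlgebra.ι k .d * FreeAlgebra.ι k (.chi j)) 0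
  | chi_big (j : ℕ) (h : n < 2 * j) : SkewRel (FreeAlgebra.ι k (.chi j)) 0

/-- Polynomials over `A_n` in infinitely many anticommuting variables. -/
def Skew : Type u := RingQuot (SkewRel k n)

noncomputable instance : Ring (Skew k n) := inferInstanceAs (Ring (RingQuot (SkewRel k n)))
noncomputable instance : Algebra k (Skew k n) :=
  inferInstanceAs (Algebra k (RingQuot (SkewRel k n)))

namespace Skew

/-- The projection from the free algebra. -/
noncomputable def mk : FreeAlgebra k SkewGen →ₐ[k] Skew k n := RingQuot.mkAlgHom k (SkewRel k n)

/-- The generators. -/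
noncomputable def gen (g : SkewGen) : Skew k n := mk k n (FreeAlgebra.ι k g)

/-- The variables. -/
noncomputable abbrev X (i : ℕ) : Skew k n := gen k n (.x i)
/-- The generators `χ_j`. -/
noncomputable abbrev C (j : ℕ) : Skew k n := gen k n (.chi j)
/-- The generator `d`. -/
noncomputable abbrev D : Skew k n := gen k n .d

/-- Elements that satisfy the relations of the skew polynomial ring. -/
structure Model (R : Type v) [Ring R] where
  x : ℕ → R
  chi : ℕ → R
  d : R
  x_x : ∀ i j, i ≠ j → x i * x j + x j * x i = 0
  chi_x : ∀ j i, chi j * x i = x i * chi j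
  chi_chi : ∀ j i, chi j * chi i = chi i * chi j
  chi_d : ∀ j, chi j * d = d * chi j
  chi_zero : chi 0 = 1
  d_x : ∀ i, d * x i + x i * d = 0
  d_sq : d * d = 0
  d_chi : ∀ j, 2 * j = n → d * chi j = 0
  chi_big : ∀ j, n < 2 * j → chi j = 0

variable {k n}

/-- The values on generators. -/
def Model.val {R : Type v} [Ring R] (M : Model n R) : SkewGen → R
  | .x i => M.x i
  | .chi j => M.chi j
  | .d => M.d

/-- The homomorphism given by elements that satisfy the relations. -/
noncomputable def Model.lift {R : Type v} [Ring R] [Algebra k R] (M : Model n R) : Skew k n →ₐ[k] R :=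
  RingQuot.liftAlgHom k ⟨FreeAlgebra.lift k M.val, by
    intro a b h
    cases h with
    | x_x i j h =>
      simp only [map_add, map_mul, map_zero, FreeAlgebra.lift_ι_apply]; exact M.x_x i j h
    | chi_comm j g =>
      simp only [map_mul, FreeAlgebra.lift_ι_apply]
      cases g with
      | x i => exact M.chi_x j i
      | chi i => exact M.chi_chi j i
      | d => exact M.chi_d j
    | chi_zero => simp only [map_one, FreeAlgebra.lift_ι_apply]; exact M.chi_zero
    | d_x i =>
      simp only [map_add, map_mul, map_zero, FreeAlgebra.lift_ι_apply]; exact M.d_x i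
    | d_sq => simp only [map_mul, map_zero, FreeAlgebra.lift_ι_apply]; exact M.d_sq
    | d_chi j h => simp only [map_mul, map_zero, FreeAlgebra.lift_ι_apply]; exact M.d_chi j h
    | chi_big j h => rw [FreeAlgebra.lift_ι_apply, map_zero]; exact M.chi_big j h⟩

theorem Model.lift_gen {R : Type v} [Ring R] [Algebra k R] (M : Model n R) (g : SkewGen) :
    M.lift (k := k) (gen k n g) = M.val g := by
  rw [Model.lift, gen]
  erw [RingQuot.liftAlgHom_mkAlgHom_apply]
  exact FreeAlgebra.lift_ι_apply _ _

theorem mk_surjective : Function.Surjective (mk k n) := RingQuot.mkAlgHom_surjective k _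

theorem mk_rel {a b : FreeAlgebra k SkewGen} (h : SkewRel k n a b) : mk k n a = mk k n b :=
  RingQuot.mkAlgHom_rel k h

theorem X_X {i j : ℕ} (h : i ≠ j) : X k n i * X k n j = -(X k n j * X k n i) := by
  have := mk_rel (SkewRel.x_x (k := k) (n := n) i j h)
  rw [map_add, map_mul, map_mul, map_zero] at this
  exact eq_neg_of_add_eq_zero_left this

theorem C_gen (j : ℕ) (g : SkewGen) : C k n j * gen k n g = gen k n g * C k n j := by
  have := mk_rel (SkewRel.chi_comm (k := k) (n := n) j g)
  rw [map_mul, map_mul] at this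
  exact this

theorem C_zero : C k n 0 = 1 := by
  have := mk_rel (SkewRel.chi_zero (k := k) (n := n))
  rw [map_one] at this
  exact this

theorem D_X (i : ℕ) : D k n * X k n i = -(X k n i * D k n) := by
  have := mk_rel (SkewRel.d_x (k := k) (n := n) i)
  rw [map_add, map_mul, map_mul, map_zero] at this
  exact eq_neg_of_add_eq_zero_left this

theorem D_sq : D k n * D k n = 0 := by
  have := mk_rel (SkewRel.d_sq (k := k) (n := n))
  rw [map_mul, map_zero] at this
  exact this

theorem C_big {j : ℕ} (h : n < 2 * j) : C k n j = 0 := by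
  have := mk_rel (SkewRel.chi_big (k := k) (n := n) j h)
  rw [map_zero] at this
  exact this

theorem D_C {j : ℕ} (h : 2 * j = n) : D k n * C k n j = 0 := by
  have := mk_rel (SkewRel.d_chi (k := k) (n := n) j h)
  rw [map_mul, map_zero] at this
  exact this

theorem eq_top_of_gen (W : Submodule k (Skew k n)) (h1 : (1 : Skew k n) ∈ W)
    (h : ∀ g, ∀ z ∈ W, gen k n g * z ∈ W) : W = ⊤ := by
  have key : ∀ a : FreeAlgebra k SkewGen, ∀ z ∈ W,
      mk k n a * z ∈ W := by
    intro a
    induction a using FreeAlgebra.induction with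
    | grade0 c =>
      intro z hz
      rw [AlgHom.commutes, ← Algebra.smul_def]
      exact W.smul_mem _ hz
    | grade1 g => exact h g
    | mul a b ha hb => intro z hz; rw [map_mul, mul_assoc]; exact ha _ (hb _ hz)
    | add a b ha hb => intro z hz; rw [map_add, add_mul]; exact add_mem (ha _ hz) (hb _ hz)
  refine eq_top_iff.2 fun a _ => ?_
  obtain ⟨a, rfl⟩ := mk_surjective a
  have := key a 1 h1
  rwa [mul_one] at this

/-- Induction along left multiplication by generators, for equalities of linear maps. -/
theorem linearMap_ext {M : Type v} [AddCommGroup M] [Module k M] {f g : Skew k n →ₗ[k] M}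
    (h1 : f 1 = g 1) (h : ∀ s z, f z = g z → f (gen k n s * z) = g (gen k n s * z)) : f = g := by
  have : LinearMap.eqLocus f g = ⊤ := eq_top_of_gen _ h1 h
  ext z
  have hz : z ∈ LinearMap.eqLocus f g := by rw [this]; trivial
  exact hz

/-! ### Divided differences -/

/-- An upper triangular matrix. -/
noncomputable def tri (a b c : Skew k n) : Matrix (Fin 2) (Fin 2) (Skew k n) := !![a, b; 0, c]

theorem tri_mul (a b c a' b' c' : Skew k n) :
    tri a b c * tri a' b' c' = tri (a * a') (a * b' + b * c') (c * c') := by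
  ext i j; fin_cases i <;> fin_cases j <;> simp [tri, Matrix.mul_apply, Fin.sum_univ_two]

theorem tri_add (a b c a' b' c' : Skew k n) :
    tri a b c + tri a' b' c' = tri (a + a') (b + b') (c + c') := by
  ext i j; fin_cases i <;> fin_cases j <;> simp [tri]

theorem tri_zero : tri (0 : Skew k n) 0 0 = 0 := by
  ext i j; fin_cases i <;> fin_cases j <;> simp [tri]

theorem tri_one : tri (1 : Skew k n) 0 1 = 1 := by
  ext i j; fin_cases i <;> fin_cases j <;> simp [tri]

/-- The parity of generators, as a sign. -/
def sg : SkewGen → ℤ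
  | .chi _ => 1
  | _ => -1

/-- The action of the `i`-th transposition on generators. -/
def swapGen (i : ℕ) : SkewGen → SkewGen
  | .x j => .x (Equiv.swap i (i + 1) j)
  | .chi j => .chi j
  | .d => .d

variable (k n) in
/-- The divided difference on generators. -/
noncomputable def dGen (i : ℕ) : SkewGen → Skew k n
  | .x j => if j = i ∨ j = i + 1 then 1 else 0
  | _ => 0

theorem neg_tri_x (i j l : ℕ) (h : j ≠ l) :
    -X k n (Equiv.swap i (i + 1) j) * dGen k n i (.x l) + dGen k n i (.x j) * X k n l +
      (-X k n (Equiv.swap i (i + 1) l) * dGen k n i (.x j) + dGen k n i (.x l) * X k n j) = 0 := by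
  simp only [dGen]
  by_cases h1 : j = i
  · subst h1
    by_cases h2 : l = j + 1
    · subst h2; simp
    · have : l ≠ j := h.symm
      simp [h2, this, Equiv.swap_apply_of_ne_of_ne this h2]
  · by_cases h1' : j = i + 1
    · subst h1'
      by_cases h2 : l = i
      · subst h2; simp
      · have : l ≠ i + 1 := h.symm
        simp [h2, this, Equiv.swap_apply_of_ne_of_ne h2 this]
    · rw [Equiv.swap_apply_of_ne_of_ne h1 h1']
      simp only [h1, h1', or_self, if_false, mul_zero, zero_mul, add_zero, zero_add]
      split_ifs <;> simp

variable (k n) in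
/-- The matrices that represent the generators. -/
noncomputable def triModel (i : ℕ) : Model n (Matrix (Fin 2) (Fin 2) (Skew k n)) where
  x j := tri (-X k n (Equiv.swap i (i + 1) j)) (dGen k n i (.x j)) (X k n j)
  chi j := tri (C k n j) 0 (C k n j)
  d := tri (-D k n) 0 (D k n)
  x_x j l h := by
    rw [tri_mul, tri_mul, tri_add, neg_tri_x i j l h, neg_mul_neg, neg_mul_neg, X_X h,
      X_X ((Equiv.swap i (i + 1)).injective.ne h), neg_add_cancel, neg_add_cancel, tri_zero]
  chi_x j l := by
    rw [tri_mul, tri_mul, mul_neg, neg_mul, C_gen, C_gen]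
    congr 1
    simp only [dGen]; split_ifs <;> simp
  chi_chi j l := by rw [tri_mul, tri_mul, C_gen]; simp
  chi_d j := by rw [tri_mul, tri_mul, mul_neg, neg_mul, C_gen]; simp
  chi_zero := by rw [C_zero, tri_one]
  d_x j := by
    rw [tri_mul, tri_mul, tri_add, neg_mul_neg, neg_mul_neg, D_X, D_X, neg_add_cancel, neg_add_cancel,
      ← tri_zero]
    congr 1
    simp only [dGen]; split_ifs <;> simp
  d_sq := by rw [tri_mul, neg_mul_neg, D_sq]; simp [tri_zero]
  d_chi j h := by rw [tri_mul, neg_mul, D_C h]; simp [tri_zero]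
  chi_big j h := by rw [C_big h, tri_zero]

theorem triModel_val (i : ℕ) (g : SkewGen) :
    (triModel k n i).val g = tri (sg g • gen k n (swapGen i g)) (dGen k n i g) (gen k n g) := by
  cases g <;> simp [triModel, Model.val, sg, swapGen, dGen]

variable (k n) in
/-- The odd divided difference `∂_i`. -/
noncomputable def dd (i : ℕ) : Skew k n →ₗ[k] Skew k n :=
  (Matrix.entryLinearMap k (Skew k n) 0 1).comp (triModel k n i).lift.toLinearMap

theorem tri_entry (i : ℕ) (f : Skew k n) :
    (triModel k n i).lift (k := k) f 1 0 = 0 ∧ (triModel k n i).lift (k := k) f 1 1 = f := by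
  let ρ : Skew k n →ₐ[k] Matrix (Fin 2) (Fin 2) (Skew k n) := (triModel k n i).lift
  have h : ∀ g z, ρ (gen k n g * z) = tri (sg g • gen k n (swapGen i g)) (dGen k n i g) (gen k n g) * ρ z := by
    intro g z; rw [map_mul, Model.lift_gen, triModel_val]
  have h0 : (Matrix.entryLinearMap k (Skew k n) 1 0).comp ρ.toLinearMap = 0 := by
    refine linearMap_ext ?_ fun g z hz => ?_
    · simp
    · have hz : ρ z 1 0 = 0 := hz
      change ρ (gen k n g * z) 1 0 = 0
      rw [h, Matrix.mul_apply, Fin.sum_univ_two, hz]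
      simp [tri]
  have h1 : (Matrix.entryLinearMap k (Skew k n) 1 1).comp ρ.toLinearMap = LinearMap.id := by
    refine linearMap_ext ?_ fun g z hz => ?_
    · simp
    · have hz : ρ z 1 1 = z := hz
      change ρ (gen k n g * z) 1 1 = gen k n g * z
      rw [h, Matrix.mul_apply, Fin.sum_univ_two, hz]
      simp [tri]
  exact ⟨LinearMap.congr_fun h0 f, LinearMap.congr_fun h1 f⟩

theorem dd_one (i : ℕ) : dd k n i 1 = 0 := by simp [dd]

theorem dd_gen_mul (i : ℕ) (g : SkewGen) (f : Skew k n) :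
    dd k n i (gen k n g * f) =
      dGen k n i g * f + sg g • (gen k n (swapGen i g) * dd k n i f) := by
  change (triModel k n i).lift (k := k) (gen k n g * f) 0 1 = _
  rw [map_mul, Model.lift_gen, triModel_val, Matrix.mul_apply, Fin.sum_univ_two, (tri_entry i f).2,
    add_comm, ← smul_mul_assoc]
  rfl

variable (k n) in
/-- The twist that belongs to `∂_i`. -/
noncomputable def twist (i : ℕ) (f : Skew k n) : Skew k n := (triModel k n i).lift (k := k) f 0 0

theorem dd_mul (i : ℕ) (f g : Skew k n) :
    dd k n i (f * g) = dd k n i f * g + twist k n i f * dd k n i g := by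
  change (triModel k n i).lift (k := k) (f * g) 0 1 = _
  rw [map_mul, Matrix.mul_apply, Fin.sum_univ_two, (tri_entry i g).2, add_comm]
  rfl

theorem dd_X_self_mul (i : ℕ) (f : Skew k n) :
    dd k n i (X k n i * f) = f - X k n (i + 1) * dd k n i f := by
  rw [dd_gen_mul]; simp [dGen, sg, swapGen, sub_eq_add_neg]

theorem dd_X_succ_mul (i : ℕ) (f : Skew k n) :
    dd k n i (X k n (i + 1) * f) = f - X k n i * dd k n i f := by
  rw [dd_gen_mul]; simp [dGen, sg, swapGen, sub_eq_add_neg]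

theorem dd_X_mul_of_ne {i j : ℕ} (h : j ≠ i) (h' : j ≠ i + 1) (f : Skew k n) :
    dd k n i (X k n j * f) = -(X k n j * dd k n i f) := by
  rw [dd_gen_mul]; simp [dGen, sg, swapGen, h, h', Equiv.swap_apply_of_ne_of_ne h h']

theorem dd_C_mul (i j : ℕ) (f : Skew k n) :
    dd k n i (C k n j * f) = C k n j * dd k n i f := by
  rw [dd_gen_mul]; simp [dGen, sg, swapGen]

theorem dd_D_mul (i : ℕ) (f : Skew k n) :
    dd k n i (D k n * f) = -(D k n * dd k n i f) := by
  rw [dd_gen_mul]; simp [dGen, sg, swapGen]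

theorem dd_dd (i : ℕ) (f : Skew k n) : dd k n i (dd k n i f) = 0 := by
  refine LinearMap.congr_fun (f := (dd k n i).comp (dd k n i)) (g := 0) ?_ f
  refine linearMap_ext (by simp [dd_one]) fun g z hz => ?_
  have hz : dd k n i (dd k n i z) = 0 := hz
  change dd k n i (dd k n i (gen k n g * z)) = 0
  cases g with
  | x j =>
    by_cases h : j = i
    · subst h; rw [dd_X_self_mul, map_sub, dd_X_succ_mul, hz]; simp
    · by_cases h' : j = i + 1
      · subst h'; rw [dd_X_succ_mul, map_sub, dd_X_self_mul, hz]; simp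
      · rw [dd_X_mul_of_ne h h', map_neg, dd_X_mul_of_ne h h', hz]; simp
  | chi j => rw [dd_C_mul, dd_C_mul, hz, mul_zero]
  | d => rw [dd_D_mul, map_neg, dd_D_mul, hz]; simp

theorem dd_far {i j : ℕ} (h : i + 1 < j) (f : Skew k n) :
    dd k n i (dd k n j f) = -dd k n j (dd k n i f) := by
  refine LinearMap.congr_fun (f := (dd k n i).comp (dd k n j))
    (g := -(dd k n j).comp (dd k n i)) ?_ f
  refine linearMap_ext (by simp [dd_one]) fun g z hz => ?_
  have hz : dd k n i (dd k n j z) = -dd k n j (dd k n i z) := hz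
  change dd k n i (dd k n j (gen k n g * z)) = -dd k n j (dd k n i (gen k n g * z))
  cases g with
  | x l =>
    by_cases h1 : l = i
    · subst h1
      rw [dd_X_self_mul, dd_X_mul_of_ne (by lia) (by lia), map_neg, dd_X_self_mul, map_sub,
        dd_X_mul_of_ne (by lia) (by lia), hz]
      simp
    by_cases h2 : l = i + 1
    · subst h2
      rw [dd_X_succ_mul, dd_X_mul_of_ne (by lia) (by lia), map_neg, dd_X_succ_mul, map_sub,
        dd_X_mul_of_ne (by lia) (by lia), hz]
      simp
    by_cases h3 : l = j
    · subst h3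
      rw [dd_X_self_mul, dd_X_mul_of_ne (by lia) (by lia), map_neg, dd_X_self_mul, map_sub,
        dd_X_mul_of_ne (by lia) (by lia), hz]
      simp
    by_cases h4 : l = j + 1
    · subst h4
      rw [dd_X_succ_mul, dd_X_mul_of_ne (by lia) (by lia), map_neg, dd_X_succ_mul, map_sub,
        dd_X_mul_of_ne (by lia) (by lia), hz]
      simp
    rw [dd_X_mul_of_ne h1 h2, dd_X_mul_of_ne h3 h4, map_neg, map_neg, dd_X_mul_of_ne h1 h2,
      dd_X_mul_of_ne h3 h4, hz]
    simp
  | chi l => rw [dd_C_mul, dd_C_mul, dd_C_mul, dd_C_mul, hz, mul_neg]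
  | d => rw [dd_D_mul, dd_D_mul, map_neg, map_neg, dd_D_mul, dd_D_mul, hz]; simp

theorem dd_braid (i : ℕ) (f : Skew k n) :
    dd k n i (dd k n (i + 1) (dd k n i f)) = dd k n (i + 1) (dd k n i (dd k n (i + 1) f)) := by
  refine LinearMap.congr_fun (f := (dd k n i).comp ((dd k n (i + 1)).comp (dd k n i)))
    (g := (dd k n (i + 1)).comp ((dd k n i).comp (dd k n (i + 1)))) ?_ f
  refine linearMap_ext (by simp [dd_one]) fun g z hz => ?_
  have hz : dd k n i (dd k n (i + 1) (dd k n i z)) = dd k n (i + 1) (dd k n i (dd k n (i + 1) z)) :=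
    hz
  change dd k n i (dd k n (i + 1) (dd k n i (gen k n g * z))) =
    dd k n (i + 1) (dd k n i (dd k n (i + 1) (gen k n g * z)))
  have h0 : ∀ f : Skew k n, dd k n (i + 1) (X k n i * f) = -(X k n i * dd k n (i + 1) f) :=
    fun f => dd_X_mul_of_ne (by lia) (by lia) f
  have h2 : ∀ f : Skew k n, dd k n i (X k n (i + 1 + 1) * f) = -(X k n (i + 1 + 1) * dd k n i f) :=
    fun f => dd_X_mul_of_ne (by lia) (by lia) f
  cases g with
  | x l =>
    by_cases e0 : l = i
    · subst e0
      simp only [dd_X_self_mul, h0, h2, map_sub, map_neg, hz, dd_dd]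
      abel
    by_cases e1 : l = i + 1
    · subst e1
      simp only [dd_X_self_mul, dd_X_succ_mul, h0, h2, map_sub, map_neg, hz]
      abel
    by_cases e2 : l = i + 1 + 1
    · subst e2
      simp only [dd_X_succ_mul, h0, h2, map_sub, map_neg, hz, dd_dd]
      abel
    simp only [dd_X_mul_of_ne e0 e1, dd_X_mul_of_ne e1 e2, map_neg, hz]
  | chi l => simp only [dd_C_mul, hz]
  | d => simp only [dd_D_mul, map_neg, hz]

end Skew

end

end OddCat

namespace OddCat

/-! ## The cyclotomic left ideals -/

namespace Skew

section
variable (k : Type u) [Field k] (n : ℕ)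

/-- The coefficients `c_i`. -/
noncomputable def coef (i : ℕ) : Skew k n := if Even i then C k n (i / 2) else D k n * C k n (i / 2)

/-- The Horner polynomials of the cyclotomic polynomial in the first variable. -/
noncomputable def horner : ℕ → Skew k n
  | 0 => 0
  | t + 1 => X k n 0 * horner t + (-1) ^ t * coef k n t

/-- The composite `∂_(m-1) ⋯ ∂_0`. -/
noncomputable def ddIter : ℕ → (Skew k n →ₗ[k] Skew k n)
  | 0 => LinearMap.id
  | m + 1 => (dd k n m).comp (ddIter m)

/-- The divided differences of the Horner polynomials. -/
noncomputable def ddHorner (m t : ℕ) : Skew k n := ddIter k n m (horner k n t)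

/-- The constant terms in the recursion for `ddHorner`. -/
noncomputable def tailCoef : ℕ → ℕ → Skew k n
  | 0, t => (-1) ^ t * coef k n t
  | m + 1, t => (-1) ^ m * ddHorner k n m t

variable {k n}

theorem neg_one_pow_mul_comm (i : ℕ) (a : Skew k n) : a * (-1) ^ i = (-1) ^ i * a :=
  (((Commute.neg_one_left a).pow_left i).eq).symm

theorem neg_one_pow_mul_self (i : ℕ) (a : Skew k n) : (-1) ^ i * ((-1) ^ i * a) = a := by
  rw [← mul_assoc, ← pow_add, Even.neg_one_pow ⟨i, rfl⟩, one_mul]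

theorem map_neg_one_pow_mul {M : Type v} [Ring M] [Algebra k M] (f : Skew k n →ₗ[k] M) (i : ℕ)
    (a : Skew k n) : f ((-1) ^ i * a) = (-1) ^ i * f a := by
  obtain h | h := Nat.even_or_odd i
  · rw [h.neg_one_pow, h.neg_one_pow, one_mul, one_mul]
  · rw [h.neg_one_pow, h.neg_one_pow, neg_one_mul, neg_one_mul, map_neg]

theorem coef_zero : coef k n 0 = 1 := by simp [coef, C_zero]

theorem coef_cases (i : ℕ) : (Even i ∧ coef k n i = C k n (i / 2)) ∨
    (Odd i ∧ coef k n i = D k n * C k n (i / 2)) := by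
  unfold coef
  split_ifs with h
  · exact .inl ⟨h, rfl⟩
  · exact .inr ⟨Nat.not_even_iff_odd.1 h, rfl⟩

theorem coef_mul_X (i j : ℕ) : coef k n i * X k n j = (-1) ^ i * (X k n j * coef k n i) := by
  obtain ⟨h, e⟩ | ⟨h, e⟩ := coef_cases (k := k) (n := n) i
  · rw [e, h.neg_one_pow, one_mul, C_gen]
  · rw [e, h.neg_one_pow, mul_assoc, C_gen, ← mul_assoc, D_X, neg_one_mul, neg_mul, mul_assoc]

theorem D_mul_coef (i : ℕ) : D k n * coef k n i = if Even i then coef k n (i + 1) else 0 := by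
  obtain ⟨h, e⟩ | ⟨h, e⟩ := coef_cases (k := k) (n := n) i
  · rw [if_pos h, e, coef, if_neg (by simpa using h.add_one)]
    obtain ⟨j, rfl⟩ := h
    rw [show (j + j + 1) / 2 = (j + j) / 2 by lia]
  · rw [if_neg (by simpa using h), e, ← mul_assoc, D_sq, zero_mul]

theorem coef_mul_D (i : ℕ) : coef k n i * D k n = (-1) ^ i * (D k n * coef k n i) := by
  obtain ⟨h, e⟩ | ⟨h, e⟩ := coef_cases (k := k) (n := n) i
  · rw [e, h.neg_one_pow, one_mul, C_gen]
  · rw [e, mul_assoc, C_gen, ← mul_assoc, ← mul_assoc, D_sq, zero_mul, mul_zero, zero_mul]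

theorem coef_mul_C (i j : ℕ) : coef k n i * C k n j = C k n j * coef k n i := by
  obtain ⟨h, e⟩ | ⟨h, e⟩ := coef_cases (k := k) (n := n) i
  · rw [e, C_gen]
  · rw [e, mul_assoc, C_gen, ← mul_assoc, ← C_gen, mul_assoc]

theorem dd_coef (i t : ℕ) : dd k n i (coef k n t) = 0 := by
  have hC : ∀ j, dd k n i (C k n j) = 0 := fun j => by
    rw [← mul_one (C k n j), dd_C_mul, dd_one, mul_zero]
  obtain ⟨h, e⟩ | ⟨h, e⟩ := coef_cases (k := k) (n := n) t
  · rw [e, hC]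
  · rw [e, dd_D_mul, hC, mul_zero, neg_zero]

theorem coef_succ_self : Even n → coef k n (n + 1) = 0 := by
  intro h
  have := D_mul_coef (k := k) (n := n) n
  rw [if_pos h] at this
  rw [← this, coef, if_pos h, D_C (Nat.mul_div_cancel' h.two_dvd)]

theorem dd_horner {i : ℕ} (hi : i ≠ 0) (t : ℕ) : dd k n i (horner k n t) = 0 := by
  induction t with
  | zero => exact map_zero _
  | succ t ih =>
    rw [horner, map_add, dd_X_mul_of_ne hi.symm (by lia), ih, map_neg_one_pow_mul, dd_coef]; simp

theorem horner_mul_X {j : ℕ} (hj : j ≠ 0) (t : ℕ) :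
    horner k n t * X k n j = (-1) ^ (t + 1) * (X k n j * horner k n t) := by
  induction t with
  | zero => simp [horner]
  | succ t ih =>
    rw [horner, add_mul, mul_assoc, ih, ← mul_assoc (X k n 0), neg_one_pow_mul_comm, mul_assoc,
      ← mul_assoc (X k n 0), X_X hj.symm, mul_assoc _ (coef k n t), coef_mul_X, mul_add,
      ← mul_assoc (X k n j) ((-1) ^ t), neg_one_pow_mul_comm]
    simp only [pow_succ, mul_add]
    noncomm_ring

theorem horner_mul_D (t : ℕ) :
    horner k n t * D k n = (-1) ^ (t + 1) * (D k n * horner k n t) := by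
  induction t with
  | zero => simp [horner]
  | succ t ih =>
    have hx : X k n 0 * D k n = -(D k n * X k n 0) := by rw [D_X, neg_neg]
    rw [horner, add_mul, mul_assoc, ih, ← mul_assoc (X k n 0), neg_one_pow_mul_comm, mul_assoc,
      ← mul_assoc (X k n 0), hx, mul_assoc _ (coef k n t), coef_mul_D, mul_add,
      ← mul_assoc (D k n) ((-1) ^ t), neg_one_pow_mul_comm]
    simp only [pow_succ, mul_add]
    noncomm_ring

theorem horner_mul_C (t j : ℕ) : horner k n t * C k n j = C k n j * horner k n t := by
  induction t with
  | zero => simp [horner]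
  | succ t ih =>
    rw [horner, add_mul, mul_add, mul_assoc, ih, ← mul_assoc, ← C_gen, mul_assoc, mul_assoc,
      coef_mul_C, ← mul_assoc (C k n j) ((-1) ^ t), neg_one_pow_mul_comm, mul_assoc]

theorem horner_mul_X_zero (t : ℕ) : horner k n t * X k n 0 =
    X k n 0 * horner k n t + 2 * ((-1) ^ (t + 1) * (D k n * horner k n t) -
      if Odd t then coef k n t else 0) := by
  induction t with
  | zero => simp [horner]
  | succ t ih =>
    rw [horner, add_mul, mul_assoc, ih, mul_assoc _ (coef k n t), coef_mul_X, neg_one_pow_mul_self]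
    have hd : D k n * (X k n 0 * horner k n t) = -(X k n 0 * (D k n * horner k n t)) := by
      rw [← mul_assoc, D_X, neg_mul, mul_assoc]
    have hd' : D k n * ((-1) ^ t * coef k n t) = (-1) ^ t * if Even t then coef k n (t + 1) else 0 := by
      rw [← mul_assoc, neg_one_pow_mul_comm, mul_assoc, D_mul_coef]
    rw [mul_add (D k n), hd, hd']
    obtain h | h := Nat.even_or_odd t
    · rw [if_neg (Nat.not_odd_iff_even.2 h), if_pos h, if_pos h.add_one]
      simp only [pow_succ, h.neg_one_pow]
      noncomm_ring
    · rw [if_pos h, if_neg (Nat.not_even_iff_odd.2 h), if_neg (Nat.not_odd_iff_even.2 h.add_one)]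
      simp only [pow_succ, h.neg_one_pow]
      noncomm_ring

/-- The cyclotomic polynomial is normal. -/
theorem horner_normal (f : Skew k n) :
    ∃ f', horner k n (n + 1) * f = f' * horner k n (n + 1) := by
  let W : Submodule k (Skew k n) :=
    { carrier := {f | ∃ f', horner k n (n + 1) * f = f' * horner k n (n + 1)}
      zero_mem' := ⟨0, by simp⟩
      add_mem' := by
        rintro a b ⟨a', ha⟩ ⟨b', hb⟩
        exact ⟨a' + b', by rw [mul_add, ha, hb, add_mul]⟩
      smul_mem' := by
        rintro c a ⟨a', ha⟩
        exact ⟨c • a', by rw [mul_smul_comm, ha, smul_mul_assoc]⟩ }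
  have hg : ∀ g, ∃ g', horner k n (n + 1) * gen k n g = g' * horner k n (n + 1) := by
    intro g
    cases g with
    | x j =>
      by_cases hj : j = 0
      · subst hj
        have h0 : (if Odd (n + 1) then coef k n (n + 1) else 0) = 0 := by
          split_ifs with h
          · exact coef_succ_self (by
              rw [← Nat.not_odd_iff_even]
              exact fun h' => Nat.not_even_iff_odd.2 h h'.add_one)
          · rfl
        refine ⟨X k n 0 + 2 * ((-1) ^ (n + 1 + 1) * D k n), ?_⟩
        rw [horner_mul_X_zero, h0]
        noncomm_ring
      · exact ⟨(-1) ^ (n + 1 + 1) * X k n j, by rw [horner_mul_X hj, mul_assoc]⟩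
    | chi j => exact ⟨C k n j, horner_mul_C _ j⟩
    | d => exact ⟨(-1) ^ (n + 1 + 1) * D k n, by rw [horner_mul_D, mul_assoc]⟩
  have hW : W = ⊤ := by
    refine eq_top_of_gen W ⟨1, by simp⟩ ?_
    rintro g z ⟨z', hz⟩
    obtain ⟨g', hg⟩ := hg g
    exact ⟨g' * z', by rw [← mul_assoc, hg, mul_assoc, hz, mul_assoc]⟩
  have : f ∈ W := by rw [hW]; trivial
  exact this

/-! ### Divided differences of the Horner polynomials -/

theorem dd_ddIter {f : Skew k n} (hf : ∀ i, i ≠ 0 → dd k n i f = 0) (m i : ℕ) (h : i ≠ m) :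
    dd k n i (ddIter k n m f) = 0 := by
  induction m using Nat.strong_induction_on generalizing i with
  | _ m ih =>
    obtain _ | m := m
    · exact hf i h
    · change dd k n i (dd k n m (ddIter k n m f)) = 0
      obtain hi | hi | hi | hi : i = m ∨ i + 1 = m ∨ i + 1 < m ∨ m + 1 < i := by lia
      · subst hi; exact dd_dd _ _
      · subst hi
        change dd k n i (dd k n (i + 1) (dd k n i (ddIter k n i f))) = 0
        rw [dd_braid, ih i (by lia) (i + 1) (by lia), map_zero, map_zero]
      · rw [dd_far hi, ih m (by lia) i (by lia), map_zero, neg_zero]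
      · have := dd_far hi (ddIter k n m f)
        rw [ih m (by lia) i (by lia), map_zero] at this
        exact neg_eq_zero.1 this.symm

theorem dd_ddHorner {m i : ℕ} (t : ℕ) (h : i ≠ m) : dd k n i (ddHorner k n m t) = 0 :=
  dd_ddIter (fun _ hi => dd_horner hi t) m i h

theorem ddIter_X_mul {f : Skew k n} (hf : ∀ i, i ≠ 0 → dd k n i f = 0) (m : ℕ) :
    ddIter k n (m + 1) (X k n 0 * f) = (-1) ^ (m + 1) * (X k n (m + 1) * ddIter k n (m + 1) f) +
      (-1) ^ m * ddIter k n m f := by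
  induction m with
  | zero =>
    change dd k n 0 (X k n 0 * f) = (-1) ^ (0 + 1) * (X k n (0 + 1) * dd k n 0 f) + (-1) ^ 0 * f
    rw [dd_X_self_mul]; simp; abel
  | succ m ih =>
    change dd k n (m + 1) (ddIter k n (m + 1) (X k n 0 * f)) = _
    rw [ih, map_add, map_neg_one_pow_mul, map_neg_one_pow_mul, dd_ddIter hf m (m + 1) (by lia),
      dd_X_self_mul]
    change _ = (-1) ^ (m + 1 + 1) * (X k n (m + 1 + 1) * dd k n (m + 1) (ddIter k n (m + 1) f)) + _
    rw [pow_succ (-1 : Skew k n) (m + 1)]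
    noncomm_ring

theorem ddHorner_succ (m t : ℕ) : ddHorner k n m (t + 1) =
    (-1) ^ m * (X k n m * ddHorner k n m t) + tailCoef k n m t := by
  obtain _ | m := m
  · rw [pow_zero, one_mul]; rfl
  · have hc : ∀ m, ddIter k n (m + 1) (coef k n t) = 0 := by
      intro m
      induction m with
      | zero => exact dd_coef 0 t
      | succ m ih => exact (congrArg (dd k n (m + 1)) ih).trans (map_zero _)
    rw [ddHorner, horner, map_add, map_neg_one_pow_mul, hc, mul_zero, add_zero,
      ddIter_X_mul (fun _ hi => dd_horner hi t)]
    rfl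

theorem ddHorner_zero (m : ℕ) : ddHorner k n m 0 = 0 := map_zero _

theorem ddHorner_eq_zero {m t : ℕ} (h : t ≤ m) : ddHorner k n m t = 0 := by
  induction t generalizing m with
  | zero => exact ddHorner_zero m
  | succ t ih =>
    obtain ⟨m, rfl⟩ : ∃ l, m = l + 1 := ⟨m - 1, by lia⟩
    rw [ddHorner_succ, ih (by lia), tailCoef, ih (by lia)]; simp

theorem ddHorner_lead (m : ℕ) : ∃ e : ℕ, ddHorner k n m (m + 1) = (-1) ^ e := by
  induction m with
  | zero =>
    refine ⟨0, ?_⟩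
    rw [ddHorner_succ, ddHorner_zero, tailCoef, coef_zero]; simp
  | succ m ih =>
    obtain ⟨e, he⟩ := ih
    refine ⟨m + e, ?_⟩
    rw [ddHorner_succ, ddHorner_eq_zero le_rfl, tailCoef, he]; simp [pow_add]

theorem dd_tailCoef {m i : ℕ} (t : ℕ) (h : i + 1 < m) : dd k n i (tailCoef k n m t) = 0 := by
  obtain ⟨m, rfl⟩ : ∃ l, m = l + 1 := ⟨m - 1, by lia⟩
  rw [tailCoef, map_neg_one_pow_mul, dd_ddHorner t (by lia), mul_zero]

variable (k n) in
/-- The polynomials in the first `m` variables. -/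
noncomputable def firstVars (m : ℕ) : Subalgebra k (Skew k n) :=
  Algebra.adjoin k {z | ∃ g, (∀ i, g = .x i → i < m) ∧ z = gen k n g}

theorem gen_mem_firstVars {m : ℕ} {g : SkewGen} (h : ∀ i, g = .x i → i < m) :
    gen k n g ∈ firstVars k n m := Algebra.subset_adjoin ⟨g, h, rfl⟩

theorem firstVars_mono {m m' : ℕ} (h : m ≤ m') : firstVars k n m ≤ firstVars k n m' :=
  Algebra.adjoin_mono fun _ ⟨g, hg, e⟩ => ⟨g, fun i hi => (hg i hi).trans_le h, e⟩

theorem neg_one_pow_mul_mem {m i : ℕ} {f : Skew k n} (hf : f ∈ firstVars k n m) :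
    (-1) ^ i * f ∈ firstVars k n m :=
  mul_mem (pow_mem (neg_mem (one_mem _)) _) hf

theorem coef_mem (m t : ℕ) : coef k n t ∈ firstVars k n m := by
  have hC := gen_mem_firstVars (k := k) (n := n) (m := m) (g := .chi (t / 2)) (by simp)
  obtain ⟨h, e⟩ | ⟨h, e⟩ := coef_cases (k := k) (n := n) t
  · rw [e]; exact hC
  · rw [e]; exact mul_mem (gen_mem_firstVars (by simp)) hC

theorem ddHorner_mem (m t : ℕ) : ddHorner k n m t ∈ firstVars k n (m + 1) := by
  induction m generalizing t with
  | zero =>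
    induction t with
    | zero => rw [ddHorner_zero]; exact zero_mem _
    | succ t ih =>
      rw [ddHorner_succ]
      exact add_mem (neg_one_pow_mul_mem (mul_mem (gen_mem_firstVars (by rintro i ⟨⟩; lia)) ih))
        (neg_one_pow_mul_mem (coef_mem _ _))
  | succ m ihm =>
    induction t with
    | zero => rw [ddHorner_zero]; exact zero_mem _
    | succ t ih =>
      rw [ddHorner_succ]
      exact add_mem (neg_one_pow_mul_mem (mul_mem (gen_mem_firstVars (by rintro i ⟨⟩; lia)) ih))
        (neg_one_pow_mul_mem (firstVars_mono (by lia) (ihm t)))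

theorem tailCoef_mem (m t : ℕ) : tailCoef k n m t ∈ firstVars k n m := by
  obtain _ | m := m
  · exact neg_one_pow_mul_mem (coef_mem _ _)
  · exact neg_one_pow_mul_mem (ddHorner_mem _ _)

theorem X_mul_firstVars {m i : ℕ} (hi : m ≤ i) {f : Skew k n} (hf : f ∈ firstVars k n m) :
    ∃ f', X k n i * f = f' * X k n i := by
  induction hf using Algebra.adjoin_induction with
  | mem z hz =>
    obtain ⟨g, hg, rfl⟩ := hz
    cases g with
    | x j =>
      have := hg j rfl
      exact ⟨-X k n j, by rw [X_X (by lia), neg_mul]⟩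
    | chi j => exact ⟨C k n j, (C_gen _ _).symm⟩
    | d => exact ⟨-D k n, by rw [neg_mul, D_X, neg_neg]⟩
  | algebraMap r => exact ⟨_, (Algebra.commutes r _).symm⟩
  | add a b _ _ ha hb =>
    obtain ⟨a', ha⟩ := ha
    obtain ⟨b', hb⟩ := hb
    exact ⟨a' + b', by rw [mul_add, ha, hb, add_mul]⟩
  | mul a b _ _ ha hb =>
    obtain ⟨a', ha⟩ := ha
    obtain ⟨b', hb⟩ := hb
    exact ⟨a' * b', by rw [← mul_assoc, ha, mul_assoc, hb, mul_assoc]⟩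

/-! ### The cyclotomic left ideals -/

variable (k n) in
/-- The left ideal that defines the polynomial representation of `ONH_m^n`. -/
noncomputable def cycIdeal (m : ℕ) : Submodule (Skew k n) (Skew k n) :=
  Submodule.span (Skew k n)
    ({z | ∃ j < m, z = ddHorner k n j (n + 1)} ∪ {z | ∃ i, m ≤ i ∧ z = X k n i})

theorem ddHorner_mem_cycIdeal {m j : ℕ} (h : j < m) : ddHorner k n j (n + 1) ∈ cycIdeal k n m :=
  Submodule.subset_span (.inl ⟨j, h, rfl⟩)

theorem X_mem_cycIdeal {m i : ℕ} (h : m ≤ i) : X k n i ∈ cycIdeal k n m :=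
  Submodule.subset_span (.inr ⟨i, h, rfl⟩)

theorem mul_mem_cycIdeal {m : ℕ} (f : Skew k n) {z : Skew k n} (hz : z ∈ cycIdeal k n m) :
    f * z ∈ cycIdeal k n m := Submodule.smul_mem _ f hz

theorem dd_mem_cycIdeal {m i : ℕ} (h : i + 1 < m) {z : Skew k n} (hz : z ∈ cycIdeal k n m) :
    dd k n i z ∈ cycIdeal k n m := by
  induction hz using Submodule.span_induction with
  | mem z hz =>
    obtain ⟨j, hj, rfl⟩ | ⟨j, hj, rfl⟩ := hz
    · by_cases hij : i = j
      · subst hij; exact ddHorner_mem_cycIdeal (j := i + 1) h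
      · rw [dd_ddHorner _ hij]; exact zero_mem _
    · rw [← mul_one (X k n j), dd_X_mul_of_ne (by lia) (by lia), dd_one, mul_zero, neg_zero]
      exact zero_mem _
  | zero => rw [map_zero]; exact zero_mem _
  | add a b _ _ ha hb => rw [map_add]; exact add_mem ha hb
  | smul f z hz ih =>
    rw [smul_eq_mul, dd_mul]
    exact add_mem (mul_mem_cycIdeal _ hz) (mul_mem_cycIdeal _ ih)

theorem horner_mul_mem_cycIdeal {m : ℕ} (h : 0 < m) (f : Skew k n) :
    horner k n (n + 1) * f ∈ cycIdeal k n m := by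
  obtain ⟨f', hf⟩ := horner_normal f
  rw [hf]
  exact mul_mem_cycIdeal _ (ddHorner_mem_cycIdeal (j := 0) h)

theorem mul_tailCoef_mem_cycIdeal {m : ℕ} (t : ℕ) {z : Skew k n} (hz : z ∈ cycIdeal k n m) :
    z * tailCoef k n m t ∈ cycIdeal k n m := by
  induction hz using Submodule.span_induction with
  | mem z hz =>
    obtain ⟨j, hj, rfl⟩ | ⟨j, hj, rfl⟩ := hz
    · have key : ∀ j < m, ∀ f, ddIter k n j f * tailCoef k n m t =
          ddIter k n j (f * tailCoef k n m t) := by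
        intro j hj f
        induction j with
        | zero => rfl
        | succ j ih =>
          change dd k n j _ * _ = dd k n j _
          rw [← ih (by lia), dd_mul, dd_tailCoef t hj, mul_zero, add_zero]
      have key' : ∀ j < m, ∀ f ∈ cycIdeal k n m, ddIter k n j f ∈ cycIdeal k n m := by
        intro j hj f hf
        induction j with
        | zero => exact hf
        | succ j ih => exact dd_mem_cycIdeal hj (ih (by lia))
      rw [ddHorner, key j hj]
      exact key' j hj _ (horner_mul_mem_cycIdeal (by lia) _)
    · obtain ⟨f', hf⟩ := X_mul_firstVars hj (tailCoef_mem (k := k) (n := n) m t)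
      rw [hf]
      exact mul_mem_cycIdeal _ (X_mem_cycIdeal hj)
  | zero => rw [zero_mul]; exact zero_mem _
  | add a b _ _ ha hb => rw [add_mul]; exact add_mem ha hb
  | smul f z hz ih => rw [smul_eq_mul, mul_assoc]; exact mul_mem_cycIdeal _ ih

theorem X_mul_mem_cycIdeal {m i : ℕ} (hi : m ≤ i) (f : Skew k n) : X k n i * f ∈ cycIdeal k n m := by
  have : ((cycIdeal k n m).restrictScalars k).comap (LinearMap.mulLeft k (X k n i)) = ⊤ := by
    refine eq_top_of_gen _ ?_ fun g z hz => ?_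
    · change X k n i * 1 ∈ cycIdeal k n m
      rw [mul_one]; exact X_mem_cycIdeal hi
    · have hz : X k n i * z ∈ cycIdeal k n m := hz
      change X k n i * (gen k n g * z) ∈ cycIdeal k n m
      rw [← mul_assoc]
      cases g with
      | x j =>
        by_cases hj : i = j
        · subst hj; rw [mul_assoc]; exact mul_mem_cycIdeal _ hz
        · rw [X_X hj, neg_mul, mul_assoc]; exact neg_mem (mul_mem_cycIdeal _ hz)
      | chi j => rw [← C_gen, mul_assoc]; exact mul_mem_cycIdeal _ hz
      | d => rw [← neg_neg (X k n i * _), ← D_X, neg_mul, mul_assoc]; exact neg_mem (mul_mem_cycIdeal _ hz)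
  have h : f ∈ ((cycIdeal k n m).restrictScalars k).comap (LinearMap.mulLeft k (X k n i)) := by
    rw [this]; trivial
  exact h

end

end Skew

end OddCat

namespace OddCat

/-! ## The tower of polynomial representations -/

namespace Skew

section
variable {k : Type u} [Field k] {n : ℕ}

variable (k n) in
/-- The polynomial representation of `ONH_m^n`, as a module over the skew polynomials. -/
abbrev PolyRep (m : ℕ) : Type u := Skew k n ⧸ cycIdeal k n m

/-- The class of a skew polynomial. -/
noncomputable abbrev cls (m : ℕ) (f : Skew k n) : PolyRep k n m := Submodule.Quotient.mk f

theorem cls_eq_zero {m : ℕ} {f : Skew k n} : cls m f = 0 ↔ f ∈ cycIdeal k n m :=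
  Submodule.Quotient.mk_eq_zero _

theorem cls_smul (m : ℕ) (f g : Skew k n) : f • cls m g = cls m (f * g) := rfl

theorem cls_surjective (m : ℕ) : Function.Surjective (cls (k := k) (n := n) m) :=
  Submodule.Quotient.mk_surjective _

/-- A linear map out of the polynomial representation. -/
noncomputable def descTo (m : ℕ) {M : Type v} [AddCommGroup M] [Module k M] (T : Skew k n →ₗ[k] M)
    (h : ∀ z ∈ cycIdeal k n m, T z = 0) : PolyRep k n m →ₗ[k] M :=
  (((cycIdeal k n m).restrictScalars k).liftQ T h).comp
    (Submodule.Quotient.restrictScalarsEquiv k (cycIdeal k n m)).symm.toLinearMap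

/-- The endomorphism of the polynomial representation induced by a linear map. -/
noncomputable def desc (m : ℕ) (T : Skew k n →ₗ[k] Skew k n)
    (h : ∀ z ∈ cycIdeal k n m, T z ∈ cycIdeal k n m) : PolyRep k n m →ₗ[k] PolyRep k n m :=
  descTo m (((cycIdeal k n m).mkQ.restrictScalars k).comp T) fun z hz => cls_eq_zero.2 (h z hz)

variable (k n) in
/-- The parity involution on generators. -/
noncomputable def parModel : Model n (Skew k n) where
  x i := -X k n i
  chi j := C k n j
  d := -D k n
  x_x i j h := by rw [neg_mul_neg, neg_mul_neg, X_X h, neg_add_cancel]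
  chi_x j i := by rw [mul_neg, neg_mul, C_gen]
  chi_chi j i := C_gen _ _
  chi_d j := by rw [mul_neg, neg_mul, C_gen]
  chi_zero := C_zero
  d_x i := by rw [neg_mul_neg, neg_mul_neg, D_X, neg_add_cancel]
  d_sq := by rw [neg_mul_neg, D_sq]
  d_chi j h := by rw [neg_mul, D_C h, neg_zero]
  chi_big _ := C_big

variable (k n) in
/-- The parity involution. -/
noncomputable def par : Skew k n →ₐ[k] Skew k n := (parModel k n).lift

theorem par_X (i : ℕ) : par k n (X k n i) = -X k n i := Model.lift_gen _ _
theorem par_C (i : ℕ) : par k n (C k n i) = C k n i := Model.lift_gen _ _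
theorem par_D : par k n (D k n) = -D k n := Model.lift_gen _ _

theorem par_dd (i : ℕ) (f : Skew k n) : par k n (dd k n i f) = -dd k n i (par k n f) := by
  refine LinearMap.congr_fun (f := (par k n).toLinearMap.comp (dd k n i))
    (g := -(dd k n i).comp (par k n).toLinearMap) ?_ f
  refine linearMap_ext (by simp [dd_one]) fun g z hz => ?_
  have hz : par k n (dd k n i z) = -dd k n i (par k n z) := hz
  change par k n (dd k n i (gen k n g * z)) = -dd k n i (par k n (gen k n g * z))
  cases g with
  | x j =>
    by_cases h : j = i
    · subst h
      rw [dd_X_self_mul, map_sub, map_mul, map_mul, par_X, par_X, neg_mul, neg_mul, map_neg,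
        dd_X_self_mul, hz]
      simp
    · by_cases h' : j = i + 1
      · subst h'
        rw [dd_X_succ_mul, map_sub, map_mul, map_mul, par_X, par_X, neg_mul, neg_mul, map_neg,
        dd_X_succ_mul, hz]
        simp
      · rw [dd_X_mul_of_ne h h', map_neg, map_mul, map_mul, par_X, neg_mul, neg_mul, map_neg,
          dd_X_mul_of_ne h h', hz]
        simp
  | chi j => rw [dd_C_mul, map_mul, map_mul, par_C, dd_C_mul, hz, mul_neg]
  | d => rw [dd_D_mul, map_neg, map_mul, map_mul, par_D, neg_mul, neg_mul, map_neg, dd_D_mul, hz]; simp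

theorem par_coef (t : ℕ) : par k n (coef k n t) = (-1) ^ t * coef k n t := by
  obtain ⟨h, e⟩ | ⟨h, e⟩ := coef_cases (k := k) (n := n) t
  · rw [e, par_C, h.neg_one_pow, one_mul]
  · rw [e, map_mul, par_C, par_D, h.neg_one_pow, neg_one_mul, neg_mul]

theorem par_horner (t : ℕ) : par k n (horner k n t) = (-1) ^ (t + 1) * horner k n t := by
  induction t with
  | zero => simp [horner]
  | succ t ih =>
    rw [horner, map_add, map_mul, map_mul, par_X, ih, par_coef, map_pow, map_neg, map_one]
    simp only [pow_succ, mul_add, neg_mul, ← mul_assoc, neg_one_pow_mul_comm]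
    noncomm_ring

theorem par_ddIter (m : ℕ) (f : Skew k n) :
    par k n (ddIter k n m f) = (-1) ^ m * ddIter k n m (par k n f) := by
  induction m with
  | zero => rw [pow_zero, one_mul]; rfl
  | succ m ih =>
    change par k n (dd k n m _) = (-1) ^ (m + 1) * dd k n m _
    rw [par_dd, ih, map_neg_one_pow_mul, pow_succ, mul_neg_one, neg_mul]

theorem par_mem_cycIdeal {m : ℕ} {z : Skew k n} (hz : z ∈ cycIdeal k n m) :
    par k n z ∈ cycIdeal k n m := by
  induction hz using Submodule.span_induction with
  | mem z hz =>
    obtain ⟨j, hj, rfl⟩ | ⟨j, hj, rfl⟩ := hz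
    · rw [ddHorner, par_ddIter, par_horner, map_neg_one_pow_mul]
      exact mul_mem_cycIdeal _ (mul_mem_cycIdeal _ (ddHorner_mem_cycIdeal hj))
    · rw [par_X]; exact neg_mem (X_mem_cycIdeal hj)
  | zero => rw [map_zero]; exact zero_mem _
  | add a b _ _ ha hb => rw [map_add]; exact add_mem ha hb
  | smul f z hz ih => rw [smul_eq_mul, map_mul]; exact mul_mem_cycIdeal _ ih

variable (k n) in
/-- The parity involution of the polynomial representation. -/
noncomputable def parRep (m : ℕ) : PolyRep k n m →ₗ[k] PolyRep k n m :=
  desc m (par k n).toLinearMap fun _ => par_mem_cycIdeal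

variable (k n) in
/-- Right multiplication by the constant terms of the recursion. -/
noncomputable def tailRep (m t : ℕ) : PolyRep k n m →ₗ[k] PolyRep k n m :=
  desc m (LinearMap.mulRight k (tailCoef k n m t)) fun _ => mul_tailCoef_mem_cycIdeal t

theorem parRep_smul (m : ℕ) (a : Skew k n) (v : PolyRep k n m) :
    parRep k n m (a • v) = par k n a • parRep k n m v := by
  obtain ⟨f, rfl⟩ := cls_surjective m v
  change cls m (par k n (a * f)) = cls m (par k n a * par k n f)
  rw [map_mul]

theorem tailRep_smul (m t : ℕ) (a : Skew k n) (v : PolyRep k n m) :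
    tailRep k n m t (a • v) = a • tailRep k n m t v := by
  obtain ⟨f, rfl⟩ := cls_surjective m v
  change cls m (a * f * tailCoef k n m t) = cls m (a * (f * tailCoef k n m t))
  rw [mul_assoc]

/-! ### The companion module -/

variable (k n) in
/-- The action of the new variable on the companion module. -/
noncomputable def companion (m N e : ℕ) :
    (Fin (N + 1) → PolyRep k n m) →ₗ[k] (Fin (N + 1) → PolyRep k n m) where
  toFun f := Fin.cons (-((-1 : k) ^ (m + e) • ∑ r : Fin (N + 1),
      tailRep k n m (m + 1 + r) (parRep k n m (f r))))
    fun r => (-1 : k) ^ m • parRep k n m (f r.castSucc)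
  map_add' f g := by
    ext r
    refine Fin.cases ?_ (fun r => ?_) r
    · simp only [Fin.cons_zero, Pi.add_apply, map_add, Finset.sum_add_distrib, smul_add, neg_add]
    · simp only [Fin.cons_succ, Pi.add_apply, map_add, smul_add]
  map_smul' c f := by
    ext r
    refine Fin.cases ?_ (fun r => ?_) r
    · simp only [Fin.cons_zero, Pi.smul_apply, map_smul, ← Finset.smul_sum, smul_neg,
        RingHom.id_apply, smul_comm c]
    · simp only [Fin.cons_succ, Pi.smul_apply, map_smul, RingHom.id_apply, smul_comm c]

theorem companion_smul (m N e : ℕ) {a : Skew k n} (ha : par k n a = -a)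
    (f : Fin (N + 1) → PolyRep k n m) :
    companion k n m N e (a • f) = -(a • companion k n m N e f) := by
  ext r
  refine Fin.cases ?_ (fun r => ?_) r
  · simp only [companion, LinearMap.coe_mk, AddHom.coe_mk, Fin.cons_zero, Pi.smul_apply, Pi.neg_apply,
      parRep_smul, ha, tailRep_smul, neg_smul, map_neg, Finset.sum_neg_distrib, smul_neg,
      ← Finset.smul_sum, neg_neg, smul_comm a]
  · simp only [companion, LinearMap.coe_mk, AddHom.coe_mk, Fin.cons_succ, Pi.smul_apply, Pi.neg_apply,
      parRep_smul, ha, neg_smul, smul_neg, smul_comm a]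

theorem companion_C_smul (m N e : ℕ) (j : ℕ) (f : Fin (N + 1) → PolyRep k n m) :
    companion k n m N e (C k n j • f) = C k n j • companion k n m N e f := by
  ext r
  refine Fin.cases ?_ (fun r => ?_) r
  · simp only [companion, LinearMap.coe_mk, AddHom.coe_mk, Fin.cons_zero, Pi.smul_apply,
      parRep_smul, par_C, tailRep_smul, smul_neg, ← Finset.smul_sum, smul_comm (C k n j)]
  · simp only [companion, LinearMap.coe_mk, AddHom.coe_mk, Fin.cons_succ, Pi.smul_apply,
      parRep_smul, par_C, smul_comm (C k n j)]

variable (k n) in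
/-- The diagonal action. -/
noncomputable abbrev diag (m N : ℕ) : Skew k n →ₐ[k] Module.End k (Fin (N + 1) → PolyRep k n m) :=
  Algebra.lsmul k k _

variable (k n) in
/-- The companion module. -/
noncomputable def companionModel (m N e : ℕ) :
    Model n (Module.End k (Fin (N + 1) → PolyRep k n m)) where
  x i := if i = m then companion k n m N e else diag k n m N (X k n i)
  chi j := diag k n m N (C k n j)
  d := diag k n m N (D k n)
  x_x i j h := by
    by_cases hi : i = m
    · rw [if_pos hi, if_neg (by lia)]
      refine LinearMap.ext fun f => ?_
      change companion k n m N e (X k n j • f) + X k n j • companion k n m N e f = 0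
      rw [companion_smul _ _ _ (par_X j), neg_add_cancel]
    · rw [if_neg hi]
      by_cases hj : j = m
      · rw [if_pos hj]
        refine LinearMap.ext fun f => ?_
        change X k n i • companion k n m N e f + companion k n m N e (X k n i • f) = 0
        rw [companion_smul _ _ _ (par_X i), add_neg_cancel]
      · rw [if_neg hj, ← map_mul, ← map_mul, X_X h, map_neg, neg_add_cancel]
  chi_x j i := by
    split_ifs
    · refine LinearMap.ext fun f => ?_
      exact (companion_C_smul _ _ _ j f).symm
    · rw [← map_mul, ← map_mul, C_gen]
  chi_chi j i := by rw [← map_mul, ← map_mul, C_gen]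
  chi_d j := by rw [← map_mul, ← map_mul, C_gen]
  chi_zero := by rw [C_zero, map_one]
  d_x i := by
    split_ifs
    · refine LinearMap.ext fun f => ?_
      change D k n • companion k n m N e f + companion k n m N e (D k n • f) = 0
      rw [companion_smul _ _ _ par_D, add_neg_cancel]
    · rw [← map_mul, ← map_mul, D_X, map_neg, neg_add_cancel]
  d_sq := by rw [← map_mul, D_sq, map_zero]
  d_chi j h := by rw [← map_mul, D_C h, map_zero]
  chi_big j h := by rw [C_big h, map_zero]

variable (k n) in
/-- The action on the companion module. -/
noncomputable def companionHom (m N e : ℕ) :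
    Skew k n →ₐ[k] Module.End k (Fin (N + 1) → PolyRep k n m) := (companionModel k n m N e).lift

theorem companionHom_X_self (m N e : ℕ) :
    companionHom k n m N e (X k n m) = companion k n m N e :=
  (Model.lift_gen _ _).trans (if_pos rfl)

theorem companionHom_gen (m N e : ℕ) {g : SkewGen} (hg : g ≠ .x m) :
    companionHom k n m N e (gen k n g) = diag k n m N (gen k n g) := by
  refine (Model.lift_gen _ _).trans ?_
  cases g with
  | x i => exact if_neg (fun h => hg (by rw [h]))
  | chi j => rfl
  | d => rfl

theorem companionHom_firstVars (m N e : ℕ) {f : Skew k n} (hf : f ∈ firstVars k n m) :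
    companionHom k n m N e f = diag k n m N f := by
  induction hf using Algebra.adjoin_induction with
  | mem z hz =>
    obtain ⟨g, hg, rfl⟩ := hz
    exact companionHom_gen m N e (fun h => lt_irrefl m (hg m h))
  | algebraMap r => rw [AlgHom.commutes, AlgHom.commutes]
  | add a b _ _ ha hb => rw [map_add, map_add, ha, hb]
  | mul a b _ _ ha hb => rw [map_mul, map_mul, ha, hb]

variable (n) in
/-- The vector with entry `v` in position `r` and `0` elsewhere. -/
noncomputable def slot {m : ℕ} (N : ℕ) (r : ℕ) (v : PolyRep k n m) : Fin (N + 1) → PolyRep k n m :=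
  fun s => if (s : ℕ) = r then v else 0

theorem smul_slot {m : ℕ} (N r : ℕ) (a : Skew k n) (v : PolyRep k n m) :
    a • slot n N r v = slot n N r (a • v) := by
  ext s; simp only [slot, Pi.smul_apply]; split_ifs <;> simp

theorem companion_slot {m N e r : ℕ} (hr : r < N + 1) :
    companion k n m N e (slot n N r (cls m 1)) = (-1 : k) ^ m • slot n N (r + 1) (cls m 1) -
      (-1 : k) ^ (m + e) • slot n N 0 (cls m (tailCoef k n m (m + 1 + r))) := by
  have h1 : parRep k n m (cls m 1) = cls m 1 := congrArg (cls m) (map_one (par k n))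
  ext s
  refine Fin.cases ?_ (fun s => ?_) s
  · have h0 : ∀ v : PolyRep k n m, slot n N (r + 1) v 0 = 0 :=
      fun v => if_neg (by rw [Fin.val_zero]; lia)
    have h0' : ∀ v : PolyRep k n m, slot n N 0 v 0 = v := fun v => if_pos rfl
    rw [Pi.sub_apply, Pi.smul_apply, Pi.smul_apply, h0, h0', smul_zero, zero_sub]
    change -((-1 : k) ^ (m + e) • ∑ s : Fin (N + 1),
      tailRep k n m (m + 1 + s) (parRep k n m (slot n N r (cls m 1) s))) = _
    congr 2
    simp only [slot]
    rw [Finset.sum_eq_single (⟨r, hr⟩ : Fin (N + 1))]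
    · simp only [if_true, h1]
      exact congrArg (cls m) (one_mul _)
    · intro s _ hs
      rw [if_neg (fun h => hs (Fin.ext h)), map_zero, map_zero]
    · intro h; exact absurd (Finset.mem_univ _) h
  · simp only [companion, LinearMap.coe_mk, AddHom.coe_mk, Fin.cons_succ, Pi.sub_apply, Pi.smul_apply,
      slot, Fin.val_castSucc, Fin.val_succ, Nat.succ_ne_zero, if_false, smul_zero, sub_zero,
      Nat.add_right_cancel_iff]
    split_ifs
    · rw [h1]
    · rw [map_zero]

theorem companionHom_ddHorner {m N e : ℕ} (he : ddHorner k n m (m + 1) = (-1) ^ e) {r : ℕ}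
    (hr : r ≤ N + 1) : companionHom k n m N e (ddHorner k n m (m + 1 + r))
      ((-1 : k) ^ e • slot n N 0 (cls m 1)) = slot n N r (cls m 1) := by
  have hs : ∀ i : ℕ, (-1 : Module.End k (Fin (N + 1) → PolyRep k n m)) ^ i =
      (-1 : k) ^ i • 1 := by
    intro i
    rw [← Algebra.algebraMap_eq_smul_one, map_pow, map_neg, map_one]
  induction r with
  | zero =>
    rw [add_zero, he, map_pow, map_neg, map_one, hs, LinearMap.smul_apply, Module.End.one_apply,
      smul_smul, ← mul_pow]
    simp
  | succ r ih =>
    rw [← add_assoc, ddHorner_succ, map_add, map_mul, map_mul, companionHom_X_self, map_pow, map_neg,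
      map_one, companionHom_firstVars _ _ _ (tailCoef_mem m _), hs, LinearMap.add_apply,
      Module.End.mul_apply, Module.End.mul_apply, ih (by lia), companion_slot (by lia),
      LinearMap.smul_apply, Module.End.one_apply, smul_sub, smul_smul, smul_smul, ← mul_pow, pow_add,
      ← mul_assoc, ← mul_pow, map_smul]
    have : diag k n m N (tailCoef k n m (m + 1 + r)) (slot n N 0 (cls m 1)) =
        slot n N 0 (cls m (tailCoef k n m (m + 1 + r))) := by
      refine (smul_slot N 0 _ _).trans ?_
      rw [cls_smul, mul_one]
    rw [this]
    simp

/-- The polynomial representations are iterated extensions of free modules. -/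
theorem exists_surjective_polyRep_succ {m N : ℕ} (hn : n = m + (N + 1)) :
    ∃ L : PolyRep k n (m + 1) →ₗ[k] (Fin (N + 1) → PolyRep k n m), Function.Surjective L ∧
      ∀ j v, L (C k n j • v) = C k n j • L v := by
  obtain ⟨e, he⟩ := ddHorner_lead (k := k) (n := n) m
  set e₀ : Fin (N + 1) → PolyRep k n m := (-1 : k) ^ e • slot n N 0 (cls m 1) with he₀
  have hd : ∀ f : Skew k n, f ∈ firstVars k n m → f ∈ cycIdeal k n m →
      companionHom k n m N e f e₀ = 0 := by
    intro f hf hf'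
    rw [companionHom_firstVars _ _ _ hf, he₀, map_smul]
    change (-1 : k) ^ e • (f • slot n N 0 (cls m 1)) = 0
    rw [smul_slot, cls_smul, mul_one, cls_eq_zero.2 hf']
    ext s; simp [slot]
  have hK : ∀ z ∈ cycIdeal k n (m + 1), companionHom k n m N e z e₀ = 0 := by
    intro z hz
    induction hz using Submodule.span_induction with
    | mem z hz =>
      obtain ⟨j, hj, rfl⟩ | ⟨i, hi, rfl⟩ := hz
      · obtain hj | rfl := Nat.lt_succ_iff_lt_or_eq.1 hj
        · exact hd _ (firstVars_mono hj (ddHorner_mem j _)) (ddHorner_mem_cycIdeal hj)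
        · have := companionHom_ddHorner (N := N) he le_rfl
          rw [← show n + 1 = j + 1 + (N + 1) by lia] at this
          rw [this]
          ext s
          have := s.2
          simp only [slot, Pi.zero_apply]
          rw [if_neg (by lia)]
      · rw [companionHom_gen _ _ _ (by rintro ⟨⟩; lia), he₀, map_smul]
        change (-1 : k) ^ e • (X k n i • slot n N 0 (cls m 1)) = 0
        rw [smul_slot, cls_smul, mul_one, cls_eq_zero.2 (X_mem_cycIdeal (by lia))]
        ext s; simp [slot]
    | zero => rw [map_zero]; rfl
    | add a b _ _ ha hb => rw [map_add, LinearMap.add_apply, ha, hb, add_zero]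
    | smul f z _ ih => rw [smul_eq_mul, map_mul, Module.End.mul_apply, ih, map_zero]
  let T : Skew k n →ₗ[k] (Fin (N + 1) → PolyRep k n m) :=
    (LinearMap.applyₗ e₀).comp (companionHom k n m N e).toLinearMap
  have hTm : ∀ f g, T (f * g) = companionHom k n m N e f (T g) := by
    intro f g
    change companionHom k n m N e (f * g) e₀ = _
    rw [map_mul]; rfl
  refine ⟨descTo (m + 1) T hK, ?_, ?_⟩
  · have hW : ∀ f : Skew k n, ∀ r ≤ N, slot n N r (cls m f) ∈ LinearMap.range T := by
      have : (⨅ r : {r // r ≤ N}, (LinearMap.range T).comap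
          ({ toFun := fun f => slot n N r (cls m f)
             map_add' := fun a b => by
              ext s; simp only [slot, Pi.add_apply]; split_ifs
              · rfl
              · rw [add_zero]
             map_smul' := fun c a => by
              ext s; simp only [slot, Pi.smul_apply]; split_ifs
              · rfl
              · rw [smul_zero] } : Skew k n →ₗ[k] (Fin (N + 1) → PolyRep k n m))) = ⊤ := by
        refine eq_top_of_gen _ ?_ ?_
        · refine (Submodule.mem_iInf _).2 fun r => ?_
          exact ⟨_, companionHom_ddHorner he (r.2.trans (Nat.le_succ N))⟩
        · intro g z hz
          refine (Submodule.mem_iInf _).2 fun r => ?_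
          obtain ⟨w, hw⟩ := (Submodule.mem_iInf _).1 hz r
          change slot n N r (cls m (gen k n g * z)) ∈ LinearMap.range T
          by_cases hg : g = .x m
          · subst hg
            rw [cls_eq_zero.2 (X_mul_mem_cycIdeal le_rfl z)]
            have : slot n N r (0 : PolyRep k n m) = 0 := by ext s; simp [slot]
            rw [this]; exact zero_mem _
          · refine ⟨gen k n g * w, ?_⟩
            rw [hTm, hw, companionHom_gen _ _ _ hg]
            exact smul_slot N r _ _
      intro f r hr
      have hf : f ∈ (⊤ : Submodule k (Skew k n)) := trivial
      rw [← this] at hf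
      exact (Submodule.mem_iInf _).1 hf ⟨r, hr⟩
    intro v
    have hv : v ∈ LinearMap.range T := by
      have : v = ∑ s : Fin (N + 1), slot n N s (v s) := by
        ext s
        rw [Finset.sum_apply, Finset.sum_eq_single s]
        · simp [slot]
        · intro t _ ht
          exact if_neg (fun h => ht (Fin.ext h.symm))
        · intro h; exact absurd (Finset.mem_univ _) h
      rw [this]
      refine sum_mem fun s _ => ?_
      obtain ⟨f, hf⟩ := cls_surjective m (v s)
      rw [← hf]
      exact hW f s (by lia)
    obtain ⟨f, hf⟩ := hv
    exact ⟨cls (m + 1) f, hf⟩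
  · intro j v
    obtain ⟨f, rfl⟩ := cls_surjective (m + 1) v
    change T (C k n j * f) = C k n j • T f
    rw [hTm, companionHom_gen _ _ _ (by rintro ⟨⟩)]
    rfl

end

end Skew

end OddCat

namespace OddCat

/-! ## The polynomial representations of the cyclotomic quotients -/

namespace Skew

section
variable {k : Type u} [Field k] {n : ℕ}

/-- The generators of `ONH_m^n` as operators on skew polynomials. -/
noncomputable def opGen (k : Type u) [Field k] {n m : ℕ} : Gen n m → Module.End k (Skew k n)
  | .x i _ => LinearMap.mulLeft k (X k n i)
  | .tau i _ => dd k n i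
  | .chi j _ _ => LinearMap.mulLeft k (C k n j)
  | .d => LinearMap.mulLeft k (D k n)

/-- The action of the free algebra on skew polynomials. -/
noncomputable def op {m : ℕ} : FreeAlgebra k (Gen n m) →ₐ[k] Module.End k (Skew k n) :=
  FreeAlgebra.lift k (opGen k)

theorem op_ι {m : ℕ} (g : Gen n m) (f : Skew k n) : op (FreeAlgebra.ι k g) f = opGen k g f := by
  rw [op, FreeAlgebra.lift_ι_apply]

theorem op_fx {m i : ℕ} (h : i < m) (f : Skew k n) : op (fx k i h) f = X k n i * f := op_ι _ _
theorem op_ftau {m i : ℕ} (h : i + 1 < m) (f : Skew k n) : op (ftau k i h) f = dd k n i f := op_ι _ _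
theorem op_fd {m : ℕ} (f : Skew k n) : op (fd k (m := m)) f = D k n * f := op_ι _ _

theorem op_fchi {m j : ℕ} (h : 2 * j ≤ n) (f : Skew k n) :
    op (fchi k j h : FreeAlgebra k (Gen n m)) f = C k n j * f := by
  unfold fchi
  split_ifs with h₀
  · exact op_ι _ _
  · obtain rfl : j = 0 := by lia
    rw [map_one, C_zero, one_mul]; rfl

theorem op_fc {m i : ℕ} (h : i ≤ n) (f : Skew k n) :
    op (fc k i h : FreeAlgebra k (Gen n m)) f = coef k n i * f := by
  unfold fc coef
  split_ifs
  · exact op_fchi _ _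
  · rw [map_mul, Module.End.mul_apply, op_fchi, op_fd, mul_assoc]

theorem sum_eq_horner (t : ℕ) : ∑ l ∈ Finset.range t, (-1 : k) ^ l • (X k n 0 ^ l * coef k n (t - 1 - l)) =
    (-1 : k) ^ (t + 1) • horner k n t := by
  induction t with
  | zero => simp [horner]
  | succ t ih =>
    have h : ∀ i : ℕ, ((-1) ^ i : Skew k n) = (-1 : k) ^ i • 1 := fun i => by
      rw [← Algebra.algebraMap_eq_smul_one, map_pow, map_neg, map_one]
    have h2 : ((-1 : k) ^ t) * (-1) ^ t = 1 := by rw [← mul_pow]; simp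
    rw [Finset.sum_range_succ']
    have : ∀ l ∈ Finset.range t, (-1 : k) ^ (l + 1) • (X k n 0 ^ (l + 1) * coef k n (t + 1 - 1 - (l + 1))) =
        -(X k n 0 * ((-1 : k) ^ l • (X k n 0 ^ l * coef k n (t - 1 - l)))) := by
      intro l _
      rw [show t + 1 - 1 - (l + 1) = t - 1 - l by lia, pow_succ, pow_succ', mul_neg_one, neg_smul,
        mul_smul_comm, mul_assoc]
    rw [Finset.sum_congr rfl this, Finset.sum_neg_distrib, ← Finset.mul_sum, ih, horner, h]
    simp only [pow_zero, one_smul, one_mul, Nat.add_sub_cancel, Nat.sub_zero, mul_smul_comm,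
      smul_mul_assoc, smul_add, smul_smul, pow_succ, mul_neg_one, neg_neg, h2]
    rw [neg_smul, neg_neg]

theorem op_fcyc {m : ℕ} (h : 0 < m) (f : Skew k n) :
    op (fcyc k h) f = (-1 : k) ^ n • (horner k n (n + 1) * f) := by
  have e := sum_eq_horner (k := k) (n := n) (n + 1)
  rw [pow_succ, pow_succ, mul_neg_one, mul_neg_one, neg_neg] at e
  rw [← smul_mul_assoc, ← e, fcyc, map_sum, LinearMap.sum_apply, Finset.sum_mul,
    Finset.sum_range]
  refine Finset.sum_congr rfl fun l _ => ?_
  have hp : ∀ (l : ℕ) (f : Skew k n), (op (fx k 0 h) ^ l) f = X k n 0 ^ l * f := by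
    intro l
    induction l with
    | zero => intro f; rw [pow_zero, pow_zero, one_mul]; rfl
    | succ l ih => intro f; rw [pow_succ, Module.End.mul_apply, ih, op_fx, pow_succ, mul_assoc]
  rw [map_smul, LinearMap.smul_apply, map_mul, Module.End.mul_apply, op_fc, map_pow, hp,
    smul_mul_assoc, mul_assoc, Nat.add_sub_cancel]

theorem op_rel {m : ℕ} {a b : FreeAlgebra k (Gen n m)} (h : ONHRel k n m a b) (f : Skew k n) :
    op a f - op b f ∈ cycIdeal k n m := by
  have hX : ∀ {i j : ℕ}, i ≠ j → ∀ f, X k n i * (X k n j * f) = -(X k n j * (X k n i * f)) := by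
    intro i j h f; rw [← mul_assoc, X_X h, neg_mul, mul_assoc]
  have hD : ∀ (i : ℕ) f, D k n * (X k n i * f) = -(X k n i * (D k n * f)) := by
    intro i f; rw [← mul_assoc, D_X, neg_mul, mul_assoc]
  have key : op a f = op b f → op a f - op b f ∈ cycIdeal k n m := fun e => by
    rw [e, sub_self]; exact zero_mem _
  cases h with
  | tau_sq i h =>
    refine key ?_
    rw [map_mul, Module.End.mul_apply, op_ftau, op_ftau, dd_dd, map_zero]; rfl
  | braid i h =>
    refine key ?_
    simp only [map_mul, Module.End.mul_apply, op_ftau]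
    exact dd_braid i f
  | x_tau i h =>
    refine key ?_
    simp only [map_mul, map_add, map_one, LinearMap.add_apply, Module.End.mul_apply, op_ftau, op_fx,
      dd_X_succ_mul, Module.End.one_apply, add_sub_cancel]
  | tau_x i h =>
    refine key ?_
    simp only [map_mul, map_add, map_one, LinearMap.add_apply, Module.End.mul_apply, op_ftau, op_fx,
      dd_X_self_mul, Module.End.one_apply, sub_add_cancel]
  | x_x i j hi hj hij =>
    refine key ?_
    simp only [map_mul, map_add, map_zero, LinearMap.add_apply, Module.End.mul_apply, op_fx,
      LinearMap.zero_apply, hX hij, neg_add_cancel]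
  | tau_tau i j hi hj hij =>
    refine key ?_
    simp only [map_mul, map_add, map_zero, LinearMap.add_apply, Module.End.mul_apply, op_ftau,
      LinearMap.zero_apply, dd_far hij, neg_add_cancel]
  | x_tau_far i j hi hj h₁ h₂ =>
    refine key ?_
    simp only [map_mul, map_add, map_zero, LinearMap.add_apply, Module.End.mul_apply, op_ftau, op_fx,
      LinearMap.zero_apply, dd_X_mul_of_ne h₁ h₂, add_neg_cancel]
  | chi_comm j h g =>
    refine key ?_
    simp only [map_mul, Module.End.mul_apply, op_fchi, op_ι]
    cases g with
    | x i _ => change C k n j * (X k n i * f) = X k n i * (C k n j * f); rw [← mul_assoc, C_gen, mul_assoc]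
    | tau i _ => exact (dd_C_mul i j f).symm
    | chi i _ _ => change C k n j * (C k n i * f) = C k n i * (C k n j * f); rw [← mul_assoc, C_gen, mul_assoc]
    | d => change C k n j * (D k n * f) = D k n * (C k n j * f); rw [← mul_assoc, C_gen, mul_assoc]
  | d_x i h =>
    refine key ?_
    simp only [map_mul, map_add, map_zero, LinearMap.add_apply, Module.End.mul_apply, op_fx, op_fd,
      LinearMap.zero_apply, hD, neg_add_cancel]
  | d_tau i h =>
    refine key ?_
    simp only [map_mul, map_add, map_zero, LinearMap.add_apply, Module.End.mul_apply, op_ftau, op_fd,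
      LinearMap.zero_apply, dd_D_mul, add_neg_cancel]
  | d_sq =>
    refine key ?_
    rw [map_mul, Module.End.mul_apply, op_fd, op_fd, ← mul_assoc, D_sq, zero_mul, map_zero]; rfl
  | d_chi j h =>
    refine key ?_
    rw [map_mul, Module.End.mul_apply, op_fd, op_fchi, ← mul_assoc, D_C h, zero_mul, map_zero]; rfl
  | cyc h =>
    rw [op_fcyc, map_zero, LinearMap.zero_apply, sub_zero]
    exact ((cycIdeal k n m).restrictScalars k).smul_mem _ (horner_mul_mem_cycIdeal h f)

theorem opGen_mem {m : ℕ} (g : Gen n m) {z : Skew k n} (hz : z ∈ cycIdeal k n m) :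
    opGen k g z ∈ cycIdeal k n m := by
  cases g with
  | x i h => exact mul_mem_cycIdeal _ hz
  | tau i h => exact dd_mem_cycIdeal h hz
  | chi j _ _ => exact mul_mem_cycIdeal _ hz
  | d => exact mul_mem_cycIdeal _ hz

/-- The action of the free algebra on the polynomial representation. -/
noncomputable def actFree (m : ℕ) : FreeAlgebra k (Gen n m) →ₐ[k] Module.End k (PolyRep k n m) :=
  FreeAlgebra.lift k fun g => desc m (opGen k g) fun _ => opGen_mem g

theorem actFree_cls {m : ℕ} (a : FreeAlgebra k (Gen n m)) (f : Skew k n) :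
    actFree m a (cls m f) = cls m (op a f) := by
  induction a using FreeAlgebra.induction generalizing f with
  | grade0 c => rw [AlgHom.commutes, AlgHom.commutes]; rfl
  | grade1 g => rw [actFree, FreeAlgebra.lift_ι_apply, op_ι]; rfl
  | mul a b ha hb => rw [map_mul, map_mul, Module.End.mul_apply, Module.End.mul_apply, hb, ha]
  | add a b ha hb => rw [map_add, map_add, LinearMap.add_apply, LinearMap.add_apply, hb, ha]; rfl

/-- The polynomial representation of `ONH_m^n`. -/
noncomputable def act (k : Type u) [Field k] (n m : ℕ) :
    (ONH k n m).carrier →ₐ[k] Module.End k (PolyRep k n m) :=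
  RingQuot.liftAlgHom k ⟨actFree m, fun a b h => LinearMap.ext fun v => by
    obtain ⟨f, rfl⟩ := cls_surjective m v
    rw [actFree_cls, actFree_cls]
    exact (Submodule.Quotient.eq _).2 (op_rel h f)⟩

/-- The projection of the free algebra to `ONH_m^n`. -/
noncomputable def _root_.OddCat.ONH.mk (k : Type u) [Field k] (n m : ℕ) :
    FreeAlgebra k (Gen n m) →ₐ[k] (ONH k n m).carrier := RingQuot.mkAlgHom k (ONHRel k n m)

theorem act_mk {m : ℕ} (a : FreeAlgebra k (Gen n m)) (f : Skew k n) :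
    act k n m (ONH.mk k n m a) (cls m f) = cls m (op a f) := by
  rw [← actFree_cls]
  congr 1
  exact RingQuot.liftAlgHom_mkAlgHom_apply _ _ _ _

/-! ### Dual families of operators -/

/-- The inclusion of free algebras. -/
noncomputable def freeIncl (k : Type u) [Field k] (n m : ℕ) :
    FreeAlgebra k (Gen n m) →ₐ[k] FreeAlgebra k (Gen n (m + 1)) :=
  FreeAlgebra.lift k fun g => FreeAlgebra.ι k (g.incl (Nat.le_succ m))

theorem op_freeIncl {m : ℕ} (a : FreeAlgebra k (Gen n m)) : op (freeIncl k n m a) = op a := by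
  have : op.comp (freeIncl k n m) = op (k := k) (n := n) := by
    apply FreeAlgebra.hom_ext
    funext g
    change op (freeIncl k n m (FreeAlgebra.ι k g)) = op (FreeAlgebra.ι k g)
    rw [freeIncl, FreeAlgebra.lift_ι_apply, op, op, FreeAlgebra.lift_ι_apply, FreeAlgebra.lift_ι_apply]
    cases g <;> rfl
  exact AlgHom.congr_fun this a

theorem op_mul_right {m : ℕ} {h : Skew k n} (hh : ∀ i, i + 1 < m → dd k n i h = 0)
    (a : FreeAlgebra k (Gen n m)) (f : Skew k n) : op a (f * h) = op a f * h := by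
  induction a using FreeAlgebra.induction generalizing f with
  | grade0 c =>
    rw [AlgHom.commutes, Module.algebraMap_end_apply, Module.algebraMap_end_apply, smul_mul_assoc]
  | grade1 g =>
    rw [op_ι, op_ι]
    cases g with
    | x i h => exact (mul_assoc _ _ _).symm
    | tau i hi =>
      change dd k n i (f * h) = dd k n i f * h
      rw [dd_mul, hh i hi, mul_zero, add_zero]
    | chi j _ _ => exact (mul_assoc _ _ _).symm
    | d => exact (mul_assoc _ _ _).symm
  | mul a b ha hb =>
    have e : op (a * b) = op (k := k) a * op b := map_mul _ _ _
    rw [e, Module.End.mul_apply, Module.End.mul_apply, hb, ha]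
  | add a b ha hb =>
    have e : op (a + b) = op (k := k) a + op b := map_add _ _ _
    rw [e, LinearMap.add_apply, LinearMap.add_apply, hb, ha, add_mul]

theorem dd_X_pow {i j : ℕ} (h : j ≠ i) (h' : j ≠ i + 1) (l : ℕ) : dd k n i (X k n j ^ l) = 0 := by
  induction l with
  | zero => rw [pow_zero]; exact dd_one i
  | succ l ih => rw [pow_succ', dd_X_mul_of_ne h h', ih, mul_zero, neg_zero]

theorem op_mul_X_pow {m : ℕ} (a : FreeAlgebra k (Gen n m)) (f : Skew k n) (l : ℕ) :
    op a (f * X k n m ^ l) = op a f * X k n m ^ l :=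
  op_mul_right (fun _ _ => dd_X_pow (by lia) (by lia) l) a f

theorem dd_X_succ_pow (i r : ℕ) : dd k n i (X k n (i + 1) ^ r) =
    ∑ s ∈ Finset.range r, (-1) ^ s * (X k n i ^ s * X k n (i + 1) ^ (r - 1 - s)) := by
  induction r with
  | zero => rw [pow_zero]; exact dd_one i
  | succ r ih =>
    rw [pow_succ', dd_X_succ_mul, ih, Finset.sum_range_succ', Finset.mul_sum]
    have : ∀ s ∈ Finset.range r, (-1) ^ (s + 1) * (X k n i ^ (s + 1) * X k n (i + 1) ^ (r + 1 - 1 - (s + 1))) =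
        -(X k n i * ((-1) ^ s * (X k n i ^ s * X k n (i + 1) ^ (r - 1 - s)))) := by
      intro s _
      rw [show r + 1 - 1 - (s + 1) = r - 1 - s by lia, ← mul_assoc (X k n i) ((-1) ^ s),
        neg_one_pow_mul_comm, pow_succ, pow_succ']
      simp only [mul_assoc, mul_neg, neg_mul, one_mul]
    rw [Finset.sum_congr rfl this, Finset.sum_neg_distrib]
    simp [sub_eq_neg_add]

/-- The word `τ_(m-l) ⋯ τ_(m-1)` in the free algebra. -/
noncomputable def stair (k : Type u) [Field k] (n : ℕ) : (m : ℕ) → ℕ → FreeAlgebra k (Gen n (m + 1))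
  | _, 0 => 1
  | 0, _ + 1 => 0
  | m + 1, l + 1 => freeIncl k n (m + 1) (stair k n m l) * ftau k m (by lia)

theorem op_stair {m l : ℕ} (hl : l ≤ m) : (∀ s < l, op (stair k n m l) (X k n m ^ s) = 0) ∧
    ∃ e, op (stair k n m l) (X k n m ^ l) = (-1) ^ e := by
  induction l generalizing m with
  | zero =>
    refine ⟨fun s hs => absurd hs (by lia), 0, ?_⟩
    have : stair k n m 0 = 1 := by cases m <;> rfl
    rw [this, map_one, pow_zero, pow_zero]; rfl
  | succ l ih =>
    obtain ⟨m, rfl⟩ : ∃ r, m = r + 1 := ⟨m - 1, by lia⟩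
    obtain ⟨h0, e, he⟩ := ih (show l ≤ m by lia)
    have key : ∀ r, op (stair k n (m + 1) (l + 1)) (X k n (m + 1) ^ r) = ∑ s ∈ Finset.range r,
        (-1) ^ s * (op (stair k n m l) (X k n m ^ s) * X k n (m + 1) ^ (r - 1 - s)) := by
      intro r
      rw [stair, map_mul, Module.End.mul_apply, op_ftau, dd_X_succ_pow, map_sum, op_freeIncl]
      refine Finset.sum_congr rfl fun s _ => ?_
      rw [map_neg_one_pow_mul (op _), op_mul_X_pow]
    refine ⟨fun r hr => ?_, l + e, ?_⟩
    · rw [key]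
      refine Finset.sum_eq_zero fun s hs => ?_
      have := Finset.mem_range.1 hs
      rw [h0 s (by lia), zero_mul, mul_zero]
    · rw [key, Finset.sum_eq_single l]
      · rw [he, pow_add]; simp
      · intro s hs hsl
        have := Finset.mem_range.1 hs
        rw [h0 s (by lia), zero_mul, mul_zero]
      · intro h; exact absurd (Finset.mem_range.2 (Nat.lt_succ_self l)) h

end

end Skew

end OddCat

namespace OddCat

namespace Skew

section
variable {k : Type u} [Field k] {n : ℕ}

theorem op_mul_apply {m : ℕ} (a b : FreeAlgebra k (Gen n m)) (f : Skew k n) :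
    op (a * b) f = op a (op b f) := by
  rw [map_mul, Module.End.mul_apply]

theorem op_fx_pow {m i : ℕ} (h : i < m) (l : ℕ) (f : Skew k n) :
    op (fx k i h ^ l) f = X k n i ^ l * f := by
  induction l generalizing f with
  | zero => rw [pow_zero, pow_zero, one_mul, map_one]; rfl
  | succ l ih => rw [pow_succ, op_mul_apply, ih, op_fx, pow_succ, mul_assoc]

/-- Operators with prescribed values on the powers of the last variable. -/
theorem exists_op_X_pow {m : ℕ} (g : ℕ → FreeAlgebra k (Gen n (m + 1))) (t : ℕ) (ht : t ≤ m + 1) :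
    ∃ a : FreeAlgebra k (Gen n (m + 1)), ∀ l < t, op a (X k n m ^ l) = op (g l) 1 := by
  induction t with
  | zero => exact ⟨0, fun l h => absurd h (by lia)⟩
  | succ t ih =>
    obtain ⟨a, ha⟩ := ih (by lia)
    obtain ⟨h0, e, he⟩ := op_stair (k := k) (n := n) (show t ≤ m by lia)
    refine ⟨a + (-1 : FreeAlgebra k (Gen n (m + 1))) ^ e * (g t - a * fx k m (Nat.lt_succ_self m) ^ t) *
      stair k n m t, fun l hl => ?_⟩
    rw [map_add, LinearMap.add_apply, op_mul_apply]
    rcases Nat.lt_succ_iff_lt_or_eq.1 hl with h | rfl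
    · rw [ha l h, h0 l h, map_zero, add_zero]
    · have hs : ∀ z : Skew k n, op ((-1 : FreeAlgebra k (Gen n (m + 1))) ^ e) z = (-1) ^ e * z := by
        intro z
        clear he
        induction e with
        | zero => rw [pow_zero, pow_zero, one_mul, map_one]; rfl
        | succ e ih =>
          rw [pow_succ', op_mul_apply, ih, map_neg, map_one, pow_succ']
          change -((-1) ^ e * z) = _
          simp
      have hz : ∀ b : FreeAlgebra k (Gen n (m + 1)), op b ((-1) ^ e) = (-1) ^ e * op b 1 := by
        intro b
        have := map_neg_one_pow_mul (op b) e 1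
        rwa [mul_one] at this
      rw [he, op_mul_apply, hz, hs, ← mul_assoc, ← pow_add, ← two_mul, pow_mul, neg_one_sq, one_pow,
        one_mul, map_sub, LinearMap.sub_apply, op_mul_apply, op_fx_pow, mul_one]
      abel

/-- A family of `m!` skew polynomials on which the operators take arbitrary values. -/
theorem exists_op_family (k : Type u) [Field k] (n m : ℕ) :
    ∃ v : Fin m.factorial → Skew k n, ∀ f : Fin m.factorial → FreeAlgebra k (Gen n m),
      ∃ a : FreeAlgebra k (Gen n m), ∀ i, op a (v i) = op (f i) 1 := by
  induction m with
  | zero =>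
    refine ⟨fun _ => 1, fun f => ⟨f (0 : Fin 1), fun i => ?_⟩⟩
    rw [show i = (0 : Fin 1) from Subsingleton.elim (α := Fin 1) _ _]
  | succ m ih =>
    obtain ⟨v, hv⟩ := ih
    let E : Fin (m + 1).factorial ≃ Fin (m + 1) × Fin m.factorial :=
      (finCongr (Nat.factorial_succ m)).trans finProdFinEquiv.symm
    choose b hb using fun i => hv fun j => if i = j then 1 else 0
    refine ⟨fun i => v (E i).2 * X k n m ^ ((E i).1 : ℕ), fun f => ?_⟩
    choose a ha using fun i => exists_op_X_pow
      (fun l => if h : l < m + 1 then f (E.symm (⟨l, h⟩, i)) else 0) (m + 1) le_rfl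
    refine ⟨∑ i, a i * freeIncl k n m (b i), fun i => ?_⟩
    rw [map_sum, LinearMap.sum_apply, Finset.sum_eq_single (E i).2]
    · rw [op_mul_apply, op_freeIncl, op_mul_X_pow, hb, if_pos rfl, map_one op]
      change op (a (E i).2) (1 * _) = _
      rw [one_mul, ha _ _ (E i).1.2, dif_pos (E i).1.2]
      simp
    · intro j _ hj
      rw [op_mul_apply, op_freeIncl, op_mul_X_pow, hb, if_neg hj, map_zero]
      change op (a j) (0 * _) = 0
      rw [zero_mul, map_zero]
    · intro h; exact absurd (Finset.mem_univ _) h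

theorem exists_cls_op (m : ℕ) (p : PolyRep k n m) :
    ∃ a : FreeAlgebra k (Gen n m), cls m (op a 1) = p := by
  obtain ⟨f, rfl⟩ := cls_surjective m p
  let T : FreeAlgebra k (Gen n m) →ₗ[k] PolyRep k n m :=
    (((cycIdeal k n m).mkQ).restrictScalars k).comp
      ((LinearMap.applyₗ (1 : Skew k n)).comp (op (k := k) (n := n) (m := m)).toLinearMap)
  have key : (LinearMap.range T).comap (((cycIdeal k n m).mkQ).restrictScalars k) = ⊤ := by
    refine eq_top_of_gen _ ⟨1, ?_⟩ ?_
    · change cls m (op 1 1) = cls m 1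
      rw [map_one op]; rfl
    · rintro g z ⟨a, ha⟩
      have ha : cls m (op a 1) = cls m z := ha
      have hg : ∀ w, cls m (gen k n g * w) = gen k n g • cls m w := fun w => rfl
      have hT : ∀ b, cls m (op b 1) = cls m (gen k n g * z) →
          gen k n g * z ∈ (LinearMap.range T).comap (((cycIdeal k n m).mkQ).restrictScalars k) :=
        fun b hb => ⟨b, hb⟩
      cases g with
      | x i =>
        by_cases hi : i < m
        · refine hT (fx k i hi * a) ?_
          rw [op_mul_apply, op_fx, hg, ha, hg]
        · refine hT 0 ?_
          rw [map_zero]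
          exact (cls_eq_zero.2 (X_mul_mem_cycIdeal (not_lt.1 hi) z)).symm
      | chi j =>
        by_cases hj : 2 * j ≤ n
        · refine hT (fchi k j hj * a) ?_
          rw [op_mul_apply, op_fchi, hg, ha, hg]
        · refine hT 0 ?_
          change _ = cls m (C k n j * z)
          rw [C_big (not_le.1 hj), zero_mul, map_zero]; rfl
      | d =>
        refine hT (fd k * a) ?_
        rw [op_mul_apply, op_fd, hg, ha, hg]
  have : f ∈ (LinearMap.range T).comap (((cycIdeal k n m).mkQ).restrictScalars k) := by
    rw [key]; trivial
  exact this

theorem mk_surjective' {m : ℕ} : Function.Surjective (ONH.mk k n m) :=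
  RingQuot.mkAlgHom_surjective k _

theorem mk_ι {m : ℕ} (g : Gen n m) : ONH.mk k n m (FreeAlgebra.ι k g) = ONH.gen k n m g := rfl

theorem exists_surjective_family (k : Type u) [Field k] (n m : ℕ) :
    ∃ L : (ONH k n m).carrier →ₗ[k] (Fin m.factorial → PolyRep k n m), Function.Surjective L ∧
      ∀ j h₀ h b, L (ONH.gen k n m (.chi j h₀ h) * b) = C k n j • L b := by
  obtain ⟨v, hv⟩ := exists_op_family k n m
  refine ⟨LinearMap.pi fun i => (LinearMap.applyₗ (cls m (v i))).comp (act k n m).toLinearMap,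
    fun p => ?_, fun j h₀ h b => ?_⟩
  · choose f hf using fun i => exists_cls_op m (p i)
    obtain ⟨a, ha⟩ := hv f
    refine ⟨ONH.mk k n m a, funext fun i => ?_⟩
    change act k n m (ONH.mk k n m a) (cls m (v i)) = p i
    rw [act_mk, ha, hf]
  · obtain ⟨a, rfl⟩ := mk_surjective' b
    funext i
    change act k n m (_ * ONH.mk k n m a) (cls m (v i)) =
      C k n j • act k n m (ONH.mk k n m a) (cls m (v i))
    rw [← mk_ι, ← map_mul, act_mk, act_mk, op_mul_apply, op_ι]
    rfl

theorem exists_surjective_polyRep_zero (k : Type u) [Field k] (n m : ℕ) :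
    ∃ L : PolyRep k n m →ₗ[k] (Fin (n.descFactorial m) → PolyRep k n 0), Function.Surjective L ∧
      ∀ j v, L (C k n j • v) = C k n j • L v := by
  induction m with
  | zero =>
    refine ⟨LinearMap.pi fun _ => LinearMap.id, fun p => ⟨p (0 : Fin 1), funext fun i => ?_⟩, fun _ _ => rfl⟩
    rw [show i = (0 : Fin 1) from Subsingleton.elim (α := Fin 1) _ _]; rfl
  | succ m ih =>
    by_cases hm : m < n
    · obtain ⟨L, hL, hL'⟩ := ih
      obtain ⟨L₁, hL₁, hL₁'⟩ := exists_surjective_polyRep_succ (k := k)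
        (show n = m + ((n - m - 1) + 1) by lia)
      let E : Fin (n.descFactorial (m + 1)) ≃ Fin (n - m - 1 + 1) × Fin (n.descFactorial m) :=
        (finCongr (by rw [Nat.descFactorial_succ]; congr 1; lia)).trans finProdFinEquiv.symm
      refine ⟨LinearMap.pi fun i => (LinearMap.proj (E i).2).comp
        (L.comp ((LinearMap.proj (E i).1).comp L₁)), fun p => ?_, fun j v => ?_⟩
      · choose q hq using fun s => hL fun t => p (E.symm (s, t))
        obtain ⟨r, hr⟩ := hL₁ q
        refine ⟨r, funext fun i => ?_⟩
        change L (L₁ r (E i).1) (E i).2 = p i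
        rw [hr, hq]
        exact congrArg p (E.symm_apply_apply i)
      · funext i
        change L (L₁ (C k n j • v) (E i).1) (E i).2 = C k n j • L (L₁ v (E i).1) (E i).2
        rw [hL₁', Pi.smul_apply, hL', Pi.smul_apply]
    · have h0 : n.descFactorial (m + 1) = 0 := Nat.descFactorial_eq_zero_iff_lt.2 (by lia)
      have : IsEmpty (Fin (n.descFactorial (m + 1))) := by rw [h0]; infer_instance
      exact ⟨0, fun p => ⟨0, Subsingleton.elim _ _⟩, fun _ _ => Subsingleton.elim _ _⟩

variable (k n) in
/-- The generators of `A_n` as values for the generators of the skew polynomial ring. -/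
noncomputable def coeffModel : Model n (ONH k n 0).carrier where
  x _ := 0
  chi j := if h : 2 * j ≤ n then ONH.mk k n 0 (fchi k j h) else 0
  d := ONH.mk k n 0 (fd k)
  x_x i j h := by simp
  chi_x j i := by simp
  chi_chi j i := by
    by_cases hj : 2 * j ≤ n
    · by_cases hi : 2 * i ≤ n
      · rw [dif_pos hj, dif_pos hi]
        by_cases h0 : 0 < i
        · rw [fchi.eq_def k i hi, dif_pos h0, ← map_mul, ← map_mul]
          exact RingQuot.mkAlgHom_rel k (ONHRel.chi_comm j hj _)
        · rw [fchi.eq_def k i hi, dif_neg h0, map_one, one_mul, mul_one]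
      · rw [dif_neg hi, mul_zero, zero_mul]
    · rw [dif_neg hj, mul_zero, zero_mul]
  chi_d j := by
    split_ifs with hj
    · rw [← map_mul, ← map_mul]
      exact RingQuot.mkAlgHom_rel k (ONHRel.chi_comm j hj _)
    · rw [mul_zero, zero_mul]
  chi_zero := by rw [dif_pos (by lia), fchi, dif_neg (by lia), map_one]
  d_x i := by simp
  d_sq := by
    rw [← map_mul]
    exact (RingQuot.mkAlgHom_rel k ONHRel.d_sq).trans (map_zero _)
  d_chi j h := by
    rw [dif_pos h.le, ← map_mul]
    exact (RingQuot.mkAlgHom_rel k (ONHRel.d_chi j h)).trans (map_zero _)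
  chi_big j h := dif_neg (by lia)

theorem exists_surjective_base (k : Type u) [Field k] (n : ℕ) :
    ∃ L : PolyRep k n 0 →ₗ[k] (ONH k n 0).carrier, Function.Surjective L ∧
      ∀ j h₀ h v, L (C k n j • v) = ONH.gen k n 0 (.chi j h₀ h) * L v := by
  have hc : ∀ j h₀ h, (coeffModel k n).lift (k := k) (C k n j) = ONH.gen k n 0 (.chi j h₀ h) := by
    intro j h₀ h
    rw [Model.lift_gen]
    change (if h : 2 * j ≤ n then ONH.mk k n 0 (fchi k j h) else 0) = _
    rw [dif_pos h, fchi, dif_pos h₀, mk_ι]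
  refine ⟨descTo 0 (coeffModel k n).lift.toLinearMap fun z hz => ?_, fun b => ?_, fun j h₀ h v => ?_⟩
  · induction hz using Submodule.span_induction with
    | mem z hz =>
      rcases hz with ⟨j, hj, _⟩ | ⟨i, _, rfl⟩
      · exact absurd hj (by lia)
      · exact Model.lift_gen _ _
    | zero => exact map_zero _
    | add a b _ _ ha hb => rw [map_add, ha, hb, add_zero]
    | smul a b _ hb =>
      change (coeffModel k n).lift (k := k) (a * b) = 0
      rw [map_mul]
      have hb : (coeffModel k n).lift (k := k) b = 0 := hb
      rw [hb, mul_zero]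
  · have : LinearMap.range ((coeffModel k n).lift (k := k)).toLinearMap = ⊤ := by
      refine ONH.eq_top_of_gen _ ⟨1, map_one ((coeffModel k n).lift (k := k))⟩ ?_
      rintro g z ⟨f, rfl⟩
      have : ∃ s, (coeffModel k n).lift (k := k) s = ONH.gen k n 0 g := by
        cases g with
        | x i h => exact absurd h (by lia)
        | tau i h => exact absurd h (by lia)
        | chi j h₀ h => exact ⟨_, hc j h₀ h⟩
        | d => exact ⟨D k n, Model.lift_gen _ _⟩
      obtain ⟨s, hs⟩ := this
      exact ⟨s * f, by rw [← hs]; exact map_mul ((coeffModel k n).lift (k := k)) _ _⟩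
    obtain ⟨f, hf⟩ : b ∈ LinearMap.range ((coeffModel k n).lift (k := k)).toLinearMap := by
      rw [this]; trivial
    exact ⟨cls 0 f, hf⟩
  · obtain ⟨f, rfl⟩ := cls_surjective 0 v
    change (coeffModel k n).lift (k := k) (C k n j * f) = _ * (coeffModel k n).lift (k := k) f
    rw [map_mul, hc j h₀ h]

end

end Skew

/-- The algebra `ONH_m^n` has a quotient that is free over `A_n` of the expected rank. -/
theorem ONH.exists_surjective_free (k : Type u) [Field k] (n m : ℕ) :
    ∃ L : (ONH k n m).carrier →ₗ[k] (Fin (m.factorial * n.descFactorial m) → (ONH k n 0).carrier),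
      Function.Surjective L ∧ ∀ j h₀ h b i, L (ONH.gen k n m (.chi j h₀ h) * b) i =
        ONH.gen k n 0 (.chi j h₀ h) * L b i := by
  obtain ⟨L₁, h₁, e₁⟩ := Skew.exists_surjective_family k n m
  obtain ⟨L₂, h₂, e₂⟩ := Skew.exists_surjective_polyRep_zero k n m
  obtain ⟨L₃, h₃, e₃⟩ := Skew.exists_surjective_base k n
  let E : Fin (m.factorial * n.descFactorial m) ≃ Fin m.factorial × Fin (n.descFactorial m) :=
    finProdFinEquiv.symm
  refine ⟨LinearMap.pi fun i => L₃.comp ((LinearMap.proj (E i).2).comp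
    (L₂.comp ((LinearMap.proj (E i).1).comp L₁))), fun p => ?_, fun j h₀ h b i => ?_⟩
  · choose p' hp' using fun i => h₃ (p i)
    choose q hq using fun s => h₂ fun t => p' (E.symm (s, t))
    obtain ⟨r, hr⟩ := h₁ q
    refine ⟨r, funext fun i => ?_⟩
    change L₃ (L₂ (L₁ r (E i).1) (E i).2) = p i
    rw [hr, hq, ← hp' i]
    simp
  · change L₃ (L₂ (L₁ _ (E i).1) (E i).2) = _ * L₃ (L₂ (L₁ b (E i).1) (E i).2)
    rw [e₁, Pi.smul_apply, e₂, Pi.smul_apply, e₃ j h₀ h]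

end OddCat

namespace OddCat

/-! ## Injectivity of the Mackey maps -/

namespace ONH

open TensorProduct

section
variable {k : Type u} [Field k] {n m : ℕ}

variable (k n) in
/-- The polynomial ring in the `χ_j`. -/
abbrev ChiRing : Type u := MvPolynomial {j : ℕ // 0 < j ∧ 2 * j ≤ n} k

theorem gen_chi_mem_center (j : ℕ) (h₀ : 0 < j) (h : 2 * j ≤ n) :
    gen k n m (.chi j h₀ h) ∈ Subalgebra.center k (ONH k n m).carrier := by
  rw [Subalgebra.mem_center_iff]
  intro b
  have : LinearMap.eqLocus (LinearMap.mulRight k (gen k n m (.chi j h₀ h)))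
      (LinearMap.mulLeft k (gen k n m (.chi j h₀ h))) = ⊤ := by
    refine eq_top_of_gen _ ?_ fun g z hz => ?_
    · change (1 : (ONH k n m).carrier) * gen k n m (.chi j h₀ h) = gen k n m (.chi j h₀ h) * 1
      rw [mul_one, one_mul]
    · have hz : z * gen k n m (.chi j h₀ h) = gen k n m (.chi j h₀ h) * z := hz
      change gen k n m g * z * _ = _ * (gen k n m g * z)
      rw [mul_assoc, hz, ← mul_assoc, gen_chi_comm, mul_assoc]
  have hb : b ∈ LinearMap.eqLocus (LinearMap.mulRight k (gen k n m (.chi j h₀ h)))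
      (LinearMap.mulLeft k (gen k n m (.chi j h₀ h))) := by rw [this]; trivial
  exact hb

variable (k n m) in
/-- The homomorphism from the polynomial ring in the `χ_j` to `ONH_m^n`. -/
noncomputable def chiHom : ChiRing k n →ₐ[k] (ONH k n m).carrier :=
  (Subalgebra.center k (ONH k n m).carrier).val.comp
    (MvPolynomial.aeval fun j => ⟨gen k n m (.chi j.1 j.2.1 j.2.2), gen_chi_mem_center _ _ _⟩)

theorem chiHom_X (j : {j : ℕ // 0 < j ∧ 2 * j ≤ n}) :
    chiHom k n m (MvPolynomial.X j) = gen k n m (.chi j.1 j.2.1 j.2.2) := by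
  rw [chiHom, AlgHom.comp_apply, MvPolynomial.aeval_X]; rfl

noncomputable instance : Module (ChiRing k n) (ONH k n m).carrier :=
  Module.compHom _ (chiHom k n m).toRingHom

theorem chi_smul (c : ChiRing k n) (b : (ONH k n m).carrier) : c • b = chiHom k n m c * b := rfl

instance : IsScalarTower k (ChiRing k n) (ONH k n m).carrier :=
  ⟨fun a c b => by rw [chi_smul, chi_smul, map_smul, smul_mul_assoc]⟩

/-- A map that commutes with the `χ_j` is linear over the polynomial ring in the `χ_j`. -/
noncomputable def chiLinear {V : Type v} {W : Type w} [AddCommGroup V] [Module k V] [Module (ChiRing k n) V]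
    [IsScalarTower k (ChiRing k n) V] [AddCommGroup W] [Module k W] [Module (ChiRing k n) W]
    [IsScalarTower k (ChiRing k n) W] (f : V →ₗ[k] W)
    (h : ∀ j v, f ((MvPolynomial.X j : ChiRing k n) • v) = (MvPolynomial.X j : ChiRing k n) • f v) :
    V →ₗ[ChiRing k n] W where
  __ := f
  map_smul' c v := by
    change f (c • v) = c • f v
    induction c using MvPolynomial.induction_on generalizing v with
    | C a =>
      rw [← MvPolynomial.algebraMap_eq, algebraMap_smul, algebraMap_smul, map_smul]
    | add p q hp hq => rw [add_smul, add_smul, map_add, hp, hq]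
    | mul_X p j hp => rw [mul_smul, mul_smul, hp, h]

instance : Module.Finite (ChiRing k n) (ONH k n 0).carrier := by
  classical
  refine ⟨⟨{1, gen k n 0 .d}, ?_⟩⟩
  set S := Submodule.span (ChiRing k n) ((({1, gen k n 0 .d} : Finset _) : Set (ONH k n 0).carrier)) with hS
  have h1 : (1 : (ONH k n 0).carrier) ∈ S := Submodule.subset_span (by simp)
  have h2 : gen k n 0 .d ∈ S := Submodule.subset_span (by simp)
  have key : ∀ g : Gen n 0, ∀ z ∈ S, gen k n 0 g * z ∈ S := by
    intro g z hz
    cases g with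
    | x i h => exact absurd h (by lia)
    | tau i h => exact absurd h (by lia)
    | chi j h₀ h =>
      rw [← chiHom_X ⟨j, h₀, h⟩]
      exact S.smul_mem _ hz
    | d =>
      induction hz using Submodule.span_induction with
      | mem z hz =>
        have hz : z = 1 ∨ z = gen k n 0 .d := by simpa using hz
        rcases hz with rfl | rfl
        · rw [mul_one]; exact h2
        · have := ONH.rel (ONHRel.d_sq (k := k) (n := n) (m := 0))
          rw [map_mul, fd, FreeAlgebra.lift_ι_apply, map_zero] at this
          rw [this]
          exact zero_mem _
      | zero => rw [mul_zero]; exact zero_mem _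
      | add a b _ _ ha hb => rw [mul_add]; exact add_mem ha hb
      | smul c a _ ha =>
        have hc : ∀ b : (ONH k n 0).carrier, b * chiHom k n 0 c = chiHom k n 0 c * b := fun b =>
          Subalgebra.mem_center_iff.1 (SetLike.coe_mem _) b
        rw [chi_smul, ← mul_assoc, hc, mul_assoc]
        exact S.smul_mem _ ha
  have : S.restrictScalars k = ⊤ := eq_top_of_gen _ h1 key
  rw [eq_top_iff]
  intro z _
  have : z ∈ S.restrictScalars k := by rw [this]; trivial
  exact this

theorem up_chiHom (c : ChiRing k n) : up k n m (chiHom k n m c) = chiHom k n (m + 1) c := by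
  have : (up k n m).comp (chiHom k n m) = chiHom k n (m + 1) := by
    apply MvPolynomial.algHom_ext
    intro j
    rw [AlgHom.comp_apply, chiHom_X, up_gen, chiHom_X]; rfl
  exact AlgHom.congr_fun this c

/-- `ONH_m^n` is free over `A_n` of the expected rank, as a module over the polynomial ring. -/
def IsFree (k : Type u) [Field k] (n m : ℕ) : Prop :=
  Nonempty ((ONH k n m).carrier ≃ₗ[ChiRing k n]
    (Fin (m.factorial * n.descFactorial m) → (ONH k n 0).carrier))

/-! ### Relations between adjacent levels -/

variable (k n m) in
/-- A surjection `B_m^ι → B_(m+1) × B_m^κ` of left modules, with indices such that the ranks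
over `A_n` agree. -/
structure Pres where
  ι : Type
  κ : Type
  [fι : Fintype ι]
  [fκ : Fintype κ]
  card : Fintype.card ι = Fintype.card κ + (m + 1) * (n - m)
  e : ι → (ONH k n (m + 1)).carrier
  g : ι → κ → (ONH k n m).carrier
  surj : ∀ (b : (ONH k n (m + 1)).carrier) (c : κ → (ONH k n m).carrier),
    ∃ γ : ι → (ONH k n m).carrier, ∑ i, up k n m (γ i) * e i = b ∧
      ∀ j, ∑ i, γ i * g i j = c j

attribute [instance] Pres.fι Pres.fκ

theorem exists_sum_of_mem_polyLT {N : ℕ} {z : (ONH k n (m + 1)).carrier} (h : z ∈ polyLT k n m N) :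
    ∃ t : Fin N → (ONH k n m).carrier, ∑ r, up k n m (t r) * xx k n m ^ (r : ℕ) = z := by
  classical
  induction h using Submodule.span_induction with
  | mem z hz =>
    obtain ⟨a, i, hi, rfl⟩ := hz
    refine ⟨Pi.single ⟨i, hi⟩ a, ?_⟩
    rw [Finset.sum_eq_single ⟨i, hi⟩]
    · rw [Pi.single_eq_same]
    · intro j _ hj; rw [Pi.single_eq_of_ne hj, map_zero, zero_mul]
    · intro h; exact absurd (Finset.mem_univ _) h
  | zero => exact ⟨0, by simp⟩
  | add a b _ _ ha hb =>
    obtain ⟨s, rfl⟩ := ha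
    obtain ⟨t, rfl⟩ := hb
    exact ⟨s + t, by simp only [Pi.add_apply, map_add, add_mul, Finset.sum_add_distrib]⟩
  | smul c a _ ha =>
    obtain ⟨s, rfl⟩ := ha
    exact ⟨c • s, by simp only [Pi.smul_apply, map_smul, smul_mul_assoc, Finset.smul_sum]⟩

theorem xx_pow_mul_polyLT {N : ℕ} (i : ℕ) {z : (ONH k n (m + 1)).carrier}
    (hx : xx k n m ^ N ∈ polyLT k n m N) (hz : z ∈ polyLT k n m N) :
    xx k n m ^ i * z ∈ polyLT k n m N := by
  induction i with
  | zero => rwa [pow_zero, one_mul]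
  | succ i ih =>
    rw [pow_succ', mul_assoc]
    have := xx_mul_polyLT ih
    obtain ⟨t, ht⟩ := exists_sum_of_mem_polyLT ih
    rw [← ht, Finset.mul_sum]
    refine sum_mem fun r _ => ?_
    rw [← mul_assoc, xx_mul_up, mul_assoc, ← pow_succ']
    by_cases hr : (r : ℕ) + 1 < N
    · exact mem_polyLT _ hr
    · rw [show (r : ℕ) + 1 = N by have := r.2; lia]
      exact up_mul_polyLT _ hx

theorem polyLT_zero_eq_top (k : Type u) [Field k] (n : ℕ) : polyLT k n 0 n = ⊤ := by
  rw [eq_top_iff, ← polyAll_zero, polyAll, Submodule.span_le]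
  rintro _ ⟨a, i, rfl⟩
  refine up_mul_polyLT a ?_
  by_cases hn : n = 0
  · subst hn
    have h1 : (1 : (ONH k 0 1).carrier) = 0 := by
      have := xx_zero_pow_mem k 0
      rw [pow_zero, mem_polyLT_zero_iff] at this
      exact this
    rw [← mul_one (_ ^ i), h1, mul_zero]
    exact zero_mem _
  · have h1 : (1 : (ONH k n 1).carrier) ∈ polyLT k n 0 n := by
      have := mem_polyLT (k := k) (n := n) (m := 0) (1 : (ONH k n 0).carrier) (Nat.pos_of_ne_zero hn)
      rwa [map_one, one_mul, pow_zero] at this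
    simpa using xx_pow_mul_polyLT i (xx_zero_pow_mem k n) h1

/-- The powers of `x_0` generate `ONH_1^n` over `A_n`. -/
noncomputable def Pres.zero (k : Type u) [Field k] (n : ℕ) : Pres k n 0 where
  ι := Fin n
  κ := Empty
  card := by simp
  e i := xx k n 0 ^ (i : ℕ)
  g _ := Empty.elim
  surj b _ := by
    obtain ⟨t, ht⟩ := exists_sum_of_mem_polyLT (z := b) (by rw [polyLT_zero_eq_top]; trivial)
    exact ⟨t, ht, fun j => j.elim⟩

variable (k n m) in
/-- The relations of the tensor product over `ONH_m^n`. -/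
noncomputable def balanced :
    Submodule k ((ONH k n (m + 1)).carrier ⊗[k] (ONH k n (m + 1)).carrier) :=
  Submodule.span k {z | ∃ a c b, z = (a * up k n m c) ⊗ₜ[k] b - a ⊗ₜ[k] (up k n m c * b)}

theorem map_eq_zero_of_mem_balanced {V : Type v} [AddCommGroup V] [Module k V]
    (F : (ONH k n (m + 1)).carrier ⊗[k] (ONH k n (m + 1)).carrier →ₗ[k] V)
    (hF : ∀ a c b, F ((a * up k n m c) ⊗ₜ[k] b) = F (a ⊗ₜ[k] (up k n m c * b)))
    {z : (ONH k n (m + 1)).carrier ⊗[k] (ONH k n (m + 1)).carrier} (hz : z ∈ balanced k n m) :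
    F z = 0 := by
  induction hz using Submodule.span_induction with
  | mem z hz => obtain ⟨a, c, b, rfl⟩ := hz; rw [map_sub, hF, sub_self]
  | zero => exact map_zero _
  | add a b _ _ ha hb => rw [map_add, ha, hb, add_zero]
  | smul c a _ ha => rw [map_smul, ha, smul_zero]

theorem crossing_balanced (a : (ONH k n (m + 1)).carrier) (c : (ONH k n m).carrier)
    (b : (ONH k n (m + 1)).carrier) :
    crossing k n m ((a * up k n m c) ⊗ₜ[k] b) = crossing k n m (a ⊗ₜ[k] (up k n m c * b)) := by
  rw [sandwich_tmul, sandwich_tmul, map_mul, map_mul, map_mul, mul_assoc _ _ (tt k n m), ← up_inv,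
    ← tt_mul_up_up]
  simp only [mul_assoc]

theorem dotted_balanced (i : ℕ) (a : (ONH k n (m + 1)).carrier) (c : (ONH k n m).carrier)
    (b : (ONH k n (m + 1)).carrier) :
    dotted k n m i ((a * up k n m c) ⊗ₜ[k] b) = dotted k n m i (a ⊗ₜ[k] (up k n m c * b)) := by
  rw [dotted_tmul, dotted_tmul, map_mul, mul_assoc _ _ (_ ^ i), ← up_inv, ← xx_pow_mul_up]
  simp only [mul_assoc]

namespace Pres

variable (P : Pres k n m)

/-- Tensors over `ONH_m^n` in terms of generators, with prescribed values on the relations. -/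
theorem exists_rep (z : (ONH k n (m + 1)).carrier ⊗[k] (ONH k n (m + 1)).carrier)
    (c : P.κ → (ONH k n (m + 1)).carrier) : ∃ β : P.ι → (ONH k n (m + 1)).carrier,
      z - ∑ i, β i ⊗ₜ[k] P.e i ∈ balanced k n m ∧ ∀ j, ∑ i, β i * up k n m (P.g i j) = c j := by
  classical
  induction z generalizing c with
  | zero =>
    choose γ hγ using fun j : P.κ => P.surj 0 (Pi.single j 1)
    refine ⟨fun i => ∑ j, c j * up k n m (γ j i), ?_, fun j => ?_⟩
    · have h0 : ∀ j, c j ⊗ₜ[k] (∑ i, up k n m (γ j i) * P.e i) = 0 := fun j => by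
        rw [(hγ j).1, tmul_zero]
      have : (0 : (ONH k n (m + 1)).carrier ⊗[k] (ONH k n (m + 1)).carrier) -
          ∑ i, (∑ j, c j * up k n m (γ j i)) ⊗ₜ[k] P.e i =
          -∑ i, ∑ j, ((c j * up k n m (γ j i)) ⊗ₜ[k] P.e i - c j ⊗ₜ[k] (up k n m (γ j i) * P.e i)) := by
        simp only [Finset.sum_sub_distrib]
        rw [Finset.sum_comm (f := fun i j => c j ⊗ₜ[k] (up k n m (γ j i) * P.e i))]
        simp only [← tmul_sum, h0, Finset.sum_const_zero, sub_zero, zero_sub, sum_tmul]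
      rw [this]
      exact neg_mem (sum_mem fun i _ => sum_mem fun j _ => Submodule.subset_span ⟨_, _, _, rfl⟩)
    · simp only [Finset.sum_mul]
      rw [Finset.sum_comm, Finset.sum_eq_single j]
      · have := (hγ j).2 j
        simp only [mul_assoc, ← Finset.mul_sum, ← map_mul, ← map_sum]
        rw [this, Pi.single_eq_same, map_one, mul_one]
      · intro j' _ hj'
        have := (hγ j').2 j
        simp only [mul_assoc, ← Finset.mul_sum, ← map_mul, ← map_sum]
        rw [this, Pi.single_eq_of_ne hj'.symm, map_zero, mul_zero]
      · intro h; exact absurd (Finset.mem_univ _) h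
  | tmul a b =>
    choose γ₀ hγ₀ using fun j : P.κ => P.surj 0 (Pi.single j 1)
    obtain ⟨γ, hγ, hγ'⟩ := P.surj b 0
    choose γ' hγ'' using P.surj 0
    refine ⟨fun i => a * up k n m (γ i) + ∑ j, c j * up k n m (γ₀ j i), ?_, fun j => ?_⟩
    · have h0 : ∀ j, c j ⊗ₜ[k] (∑ i, up k n m (γ₀ j i) * P.e i) = 0 := fun j => by
        rw [(hγ₀ j).1, tmul_zero]
      have : a ⊗ₜ[k] b - ∑ i, (a * up k n m (γ i) + ∑ j, c j * up k n m (γ₀ j i)) ⊗ₜ[k] P.e i =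
          -∑ i, ((a * up k n m (γ i)) ⊗ₜ[k] P.e i - a ⊗ₜ[k] (up k n m (γ i) * P.e i)) -
          ∑ i, ∑ j, ((c j * up k n m (γ₀ j i)) ⊗ₜ[k] P.e i - c j ⊗ₜ[k] (up k n m (γ₀ j i) * P.e i)) := by
        simp only [Finset.sum_sub_distrib]
        rw [Finset.sum_comm (f := fun i j => c j ⊗ₜ[k] (up k n m (γ₀ j i) * P.e i))]
        simp only [← tmul_sum, h0, Finset.sum_const_zero, sub_zero, sum_tmul, add_tmul,
          Finset.sum_add_distrib, hγ]
        abel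
      rw [this]
      exact sub_mem (neg_mem (sum_mem fun i _ => Submodule.subset_span ⟨_, _, _, rfl⟩))
        (sum_mem fun i _ => sum_mem fun j _ => Submodule.subset_span ⟨_, _, _, rfl⟩)
    · simp only [add_mul, Finset.sum_add_distrib, Finset.sum_mul]
      rw [Finset.sum_comm (f := fun i j' => c j' * up k n m (γ₀ j' i) * up k n m (P.g i j)),
        Finset.sum_eq_single (f := fun j' => ∑ i, c j' * up k n m (γ₀ j' i) * up k n m (P.g i j)) j]
      · have := (hγ₀ j).2 j
        have h' := hγ' j
        simp only [mul_assoc, ← Finset.mul_sum, ← map_mul, ← map_sum]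
        rw [this, h', Pi.single_eq_same, map_one, mul_one, Pi.zero_apply, map_zero, mul_zero, zero_add]
      · intro j' _ hj'
        have := (hγ₀ j').2 j
        simp only [mul_assoc, ← Finset.mul_sum, ← map_mul, ← map_sum]
        rw [this, Pi.single_eq_of_ne hj'.symm, map_zero, mul_zero]
      · intro h; exact absurd (Finset.mem_univ _) h
  | add z z' hz hz' =>
    obtain ⟨β, h, h'⟩ := hz c
    obtain ⟨β', h₁, h₁'⟩ := hz' 0
    refine ⟨β + β', ?_, fun j => ?_⟩
    · have : z + z' - ∑ i, (β + β') i ⊗ₜ[k] P.e i = (z - ∑ i, β i ⊗ₜ[k] P.e i) +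
          (z' - ∑ i, β' i ⊗ₜ[k] P.e i) := by
        simp only [Pi.add_apply, add_tmul, Finset.sum_add_distrib]
        abel
      rw [this]
      exact add_mem h h₁
    · simp only [Pi.add_apply, add_mul, Finset.sum_add_distrib, h', h₁', Pi.zero_apply, add_zero]

theorem crossing_rep {z : (ONH k n (m + 1)).carrier ⊗[k] (ONH k n (m + 1)).carrier}
    {β : P.ι → (ONH k n (m + 1)).carrier} (h : z - ∑ i, β i ⊗ₜ[k] P.e i ∈ balanced k n m) :
    crossing k n m z = ∑ i, up k n (m + 1) ((ONH k n (m + 1)).inv 1 (β i)) *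
      (tt k n m * up k n (m + 1) (P.e i)) := by
  have := map_eq_zero_of_mem_balanced (crossing k n m) crossing_balanced h
  rw [map_sub, sub_eq_zero] at this
  rw [this, map_sum]
  simp only [sandwich_tmul, mul_assoc]

theorem dotted_rep {z : (ONH k n (m + 1)).carrier ⊗[k] (ONH k n (m + 1)).carrier}
    {β : P.ι → (ONH k n (m + 1)).carrier} (h : z - ∑ i, β i ⊗ₜ[k] P.e i ∈ balanced k n m) (l : ℕ) :
    dotted k n m l z = ∑ i, (ONH k n (m + 1)).inv l (β i) * (xx k n m ^ l * P.e i) := by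
  have := map_eq_zero_of_mem_balanced (dotted k n m l) (dotted_balanced l) h
  rw [map_sub, sub_eq_zero] at this
  rw [this, map_sum]
  simp only [dotted_tmul, mul_assoc]

/-- The next level, for nonpositive weights. -/
noncomputable def succNeg {N : ℕ} (hN : 2 * (m + 1) + N = n) : Pres k n (m + 1) where
  ι := P.ι ⊕ Fin N
  κ := P.κ
  card := by
    rw [Fintype.card_sum, Fintype.card_fin, P.card]
    obtain ⟨r, rfl⟩ : ∃ r, n = m + 1 + r := ⟨n - (m + 1), by lia⟩
    rw [show m + 1 + r - m = r + 1 by lia, show m + 1 + r - (m + 1) = r by lia]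
    have : (m + 1) * (r + 1) + N = (m + 1 + 1) * r := by
      have : r = m + 1 + N := by lia
      rw [this]; ring
    lia
  e := Sum.elim (fun i => tt k n m * up k n (m + 1) (P.e i)) fun r => xx k n (m + 1) ^ (r : ℕ)
  g := Sum.elim (fun i j => (ONH k n (m + 1)).inv 1 (up k n m (P.g i j))) fun _ _ => 0
  surj d c := by
    have hd : d ∈ crossRange k n m ⊔ polyLT k n (m + 1) N := by
      rw [crossRange_sup_polyLT_eq_top hN]; trivial
    obtain ⟨_, ⟨z, rfl⟩, w, hw, rfl⟩ := Submodule.mem_sup.1 hd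
    obtain ⟨t, rfl⟩ := exists_sum_of_mem_polyLT hw
    obtain ⟨β, h, h'⟩ := P.exists_rep z fun j => (ONH k n (m + 1)).inv 1 (c j)
    refine ⟨Sum.elim (fun i => (ONH k n (m + 1)).inv 1 (β i)) t, ?_, fun j => ?_⟩
    · rw [Fintype.sum_sum_type, P.crossing_rep h]; rfl
    · rw [Fintype.sum_sum_type]
      simp only [Sum.elim_inl, Sum.elim_inr, mul_zero, Finset.sum_const_zero, add_zero, ← map_mul,
        ← map_sum, h']
      rw [GSAlg.inv_inv, CharTwo.add_self_eq_zero, GSAlg.inv_zero]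

/-- The next level, for nonnegative weights. -/
noncomputable def succPos {L : ℕ} (hL : 2 * (m + 1) = n + L) (hm : m + 1 ≤ n) : Pres k n (m + 1) where
  ι := P.ι
  κ := P.κ ⊕ Fin L
  card := by
    rw [Fintype.card_sum, Fintype.card_fin, P.card]
    obtain ⟨r, rfl⟩ : ∃ r, n = m + 1 + r := ⟨n - (m + 1), by lia⟩
    rw [show m + 1 + r - m = r + 1 by lia, show m + 1 + r - (m + 1) = r by lia]
    have : (m + 1) * (r + 1) = L + (m + 1 + 1) * r := by
      have : m + 1 = r + L := by lia
      rw [this]; ring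
    lia
  e i := tt k n m * up k n (m + 1) (P.e i)
  g i := Sum.elim (fun j => (ONH k n (m + 1)).inv 1 (up k n m (P.g i j)))
    fun l => (ONH k n (m + 1)).inv ((l : ℕ) + 1 : ℕ) (xx k n m ^ (l : ℕ) * P.e i)
  surj d c := by
    obtain ⟨z, hz, hz'⟩ := exists_crossing_dotted_eq hL d fun l =>
      if h : l < L then (ONH k n (m + 1)).inv (l + 1 : ℕ) (c (.inr ⟨l, h⟩)) else 0
    obtain ⟨β, h, h'⟩ := P.exists_rep z fun j => (ONH k n (m + 1)).inv 1 (c (.inl j))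
    have hinv : ∀ (s : ZMod 2) b, (ONH k n (m + 1)).inv s ((ONH k n (m + 1)).inv s b) = b := by
      intro s b
      rw [GSAlg.inv_inv, CharTwo.add_self_eq_zero, GSAlg.inv_zero]
    refine ⟨fun i => (ONH k n (m + 1)).inv 1 (β i), ?_, fun j => ?_⟩
    · rw [← hz, P.crossing_rep h]
    · rcases j with j | l
      · simp only [Sum.elim_inl, ← map_mul, ← map_sum, h']
        exact hinv _ _
      · have h₁ := hz' l l.2
        rw [dif_pos l.2, P.dotted_rep h] at h₁
        have h₂ := congrArg ((ONH k n (m + 1)).inv ((l : ℕ) + 1 : ℕ)) h₁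
        rw [hinv, map_sum] at h₂
        rw [← h₂]
        refine Finset.sum_congr rfl fun i _ => ?_
        rw [map_mul, GSAlg.inv_inv]
        congr 2
        push_cast
        rw [add_right_comm, CharTwo.add_self_eq_zero, zero_add]

/-- The surjection as a linear map. -/
noncomputable def map : (P.ι → (ONH k n m).carrier) →ₗ[ChiRing k n]
    (ONH k n (m + 1)).carrier × (P.κ → (ONH k n m).carrier) where
  toFun γ := (∑ i, up k n m (γ i) * P.e i, fun j => ∑ i, γ i * P.g i j)
  map_add' a b := by
    ext
    · simp [add_mul, Finset.sum_add_distrib]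
    · simp [add_mul, Finset.sum_add_distrib]
  map_smul' c a := by
    ext
    · simp only [Pi.smul_apply, chi_smul, map_mul, up_chiHom, RingHom.id_apply, Prod.smul_mk,
        Finset.mul_sum, mul_assoc]
    · simp only [Pi.smul_apply, chi_smul, RingHom.id_apply, Prod.smul_mk, Finset.mul_sum, mul_assoc]

theorem map_surjective : Function.Surjective P.map := by
  rintro ⟨b, c⟩
  obtain ⟨γ, h, h'⟩ := P.surj b c
  exact ⟨γ, Prod.ext h (funext h')⟩

theorem injective_and_isFree (h : IsFree k n m) : Function.Injective P.map ∧ IsFree k n (m + 1) := by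
  obtain ⟨φ⟩ := h
  obtain ⟨L, hL, hL'⟩ := exists_surjective_free k n (m + 1)
  let L' := chiLinear (n := n) L fun j v => funext fun i => by
    rw [chi_smul, chiHom_X, hL', Pi.smul_apply, chi_smul, chiHom_X]
  have hL' : Function.Surjective L' := hL
  let Φ : (P.ι → (ONH k n m).carrier) ≃ₗ[ChiRing k n]
      (P.ι × Fin (m.factorial * n.descFactorial m) → (ONH k n 0).carrier) :=
    (LinearEquiv.piCongrRight fun _ => φ).trans (LinearEquiv.curry _ _ _ _).symm
  let Ψ₁ : (P.κ → (ONH k n m).carrier) ≃ₗ[ChiRing k n]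
      (P.κ × Fin (m.factorial * n.descFactorial m) → (ONH k n 0).carrier) :=
    (LinearEquiv.piCongrRight fun _ => φ).trans (LinearEquiv.curry _ _ _ _).symm
  let Ψ := ((LinearEquiv.refl (ChiRing k n)
      (Fin ((m + 1).factorial * n.descFactorial (m + 1)) → (ONH k n 0).carrier)).prodCongr Ψ₁).trans
      (LinearEquiv.sumArrowLequivProdArrow (Fin ((m + 1).factorial * n.descFactorial (m + 1)))
        (P.κ × Fin (m.factorial * n.descFactorial m)) (ChiRing k n) (ONH k n 0).carrier).symm
  have hcard : Fintype.card (P.ι × Fin (m.factorial * n.descFactorial m)) =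
      Fintype.card (Fin ((m + 1).factorial * n.descFactorial (m + 1)) ⊕
        (P.κ × Fin (m.factorial * n.descFactorial m))) := by
    rw [Fintype.card_sum, Fintype.card_prod, Fintype.card_prod, Fintype.card_fin, Fintype.card_fin,
      P.card, Nat.factorial_succ, Nat.descFactorial_succ]
    ring
  let F : (Fin ((m + 1).factorial * n.descFactorial (m + 1)) ⊕
        (P.κ × Fin (m.factorial * n.descFactorial m)) → (ONH k n 0).carrier) ≃ₗ[ChiRing k n]
      (P.ι × Fin (m.factorial * n.descFactorial m) → (ONH k n 0).carrier) :=
    LinearEquiv.funCongrLeft _ _ (Fintype.equivOfCardEq hcard)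
  let T := ((L'.prodMap LinearMap.id).comp P.map)
  have hT : Function.Surjective T := by
    have hs : Function.Surjective (L'.prodMap
        (LinearMap.id (R := ChiRing k n) (M := P.κ → (ONH k n m).carrier))) := by
      rw [LinearMap.coe_prodMap]
      exact hL'.prodMap Function.surjective_id
    exact hs.comp P.map_surjective
  have hinj : Function.Injective T := by
    have key := OrzechProperty.injective_of_surjective_endomorphism
      (((F.toLinearMap.comp Ψ.toLinearMap).comp T).comp Φ.symm.toLinearMap)
      (((F.surjective.comp Ψ.surjective).comp hT).comp Φ.symm.surjective)
    intro a b hab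
    apply Φ.injective
    apply key
    change F (Ψ (T (Φ.symm (Φ a)))) = F (Ψ (T (Φ.symm (Φ b))))
    rw [Φ.symm_apply_apply, Φ.symm_apply_apply, hab]
  refine ⟨fun a b hab => hinj (congrArg (L'.prodMap LinearMap.id) hab), ⟨LinearEquiv.ofBijective L' ⟨?_, hL'⟩⟩⟩
  intro b b' hb
  obtain ⟨γ, hγ⟩ := P.map_surjective (b, 0)
  obtain ⟨γ', hγ'⟩ := P.map_surjective (b', 0)
  have : γ = γ' := hinj (by
    change (L'.prodMap LinearMap.id) (P.map γ) = (L'.prodMap LinearMap.id) (P.map γ')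
    rw [hγ, hγ']
    exact Prod.ext hb rfl)
  rw [this, hγ'] at hγ
  exact (congrArg Prod.fst hγ).symm

end Pres

theorem isFree_zero (k : Type u) [Field k] (n : ℕ) : IsFree k n 0 :=
  ⟨((LinearEquiv.funUnique (Fin 1) (ChiRing k n) (ONH k n 0).carrier).symm)⟩

theorem nonempty_pres (k : Type u) [Field k] {n m : ℕ} (hm : m ≤ n) : Nonempty (Pres k n m) := by
  induction m with
  | zero => exact ⟨.zero k n⟩
  | succ m ih =>
    obtain ⟨P⟩ := ih (by lia)
    rcases le_total (2 * (m + 1)) n with h | h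
    · exact ⟨P.succNeg (N := n - 2 * (m + 1)) (by lia)⟩
    · exact ⟨P.succPos (L := 2 * (m + 1) - n) (by lia) hm⟩

theorem isFree (k : Type u) [Field k] {n m : ℕ} (hm : m ≤ n + 1) : IsFree k n m := by
  induction m with
  | zero => exact isFree_zero k n
  | succ m ih =>
    obtain ⟨P⟩ := nonempty_pres k (show m ≤ n by lia)
    exact (P.injective_and_isFree (ih (by lia))).2

theorem Pres.map_injective (P : Pres k n m) (hm : m ≤ n) : Function.Injective P.map :=
  (P.injective_and_isFree (isFree k (by lia))).1

/-- `ONH_m^n` vanishes for `m > n`. -/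
theorem subsingleton_of_lt (k : Type u) [Field k] {n m : ℕ} (hm : n < m) :
    Subsingleton (ONH k n m).carrier := by
  obtain ⟨r, rfl⟩ : ∃ r, m = n + 1 + r := ⟨m - (n + 1), by lia⟩
  clear hm
  induction r with
  | zero =>
    obtain ⟨e⟩ := isFree k (n := n) le_rfl
    have : IsEmpty (Fin ((n + 1).factorial * n.descFactorial (n + 1))) := by
      rw [Nat.descFactorial_eq_zero_iff_lt.2 (Nat.lt_succ_self n), mul_zero]; infer_instance
    exact e.toEquiv.subsingleton
  | succ r ih =>
    refine subsingleton_of_zero_eq_one ?_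
    rw [← map_zero (up k n (n + 1 + r)), ← map_one (up k n (n + 1 + r))]
    exact congrArg _ (Subsingleton.elim _ _)

end

end ONH

end OddCat

namespace OddCat

/-! ## Strict 2-superfunctors and their extension to the envelope -/

namespace TwoSupercat

section
variable {k : Type u} [Field k] {C : Type v} [Category.{w} C] [TwoSupercat.{u, v, w, v'} k C]

variable (k) in
/-- The homogeneous 2-morphisms of all degrees. -/
abbrev HHom {a b : C} (f g : a ⟶ b) : Type v' := Σ p : Deg, Hom2 k p f g

/-- A 2-morphism, together with its degree. -/
def pk {p : Deg} {a b : C} {f g : a ⟶ b} (α : Hom2 k p f g) : HHom k f g := ⟨p, α⟩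

theorem pk_snd {a b : C} {f g : a ⟶ b} (α : HHom k f g) : pk α.2 = α := rfl

theorem pk_inj {p : Deg} {a b : C} {f g : a ⟶ b} {α β : Hom2 k p f g} (h : pk α = pk β) : α = β :=
  eq_of_heq (Sigma.mk.inj h).2

namespace HHom

/-- Vertical composition. -/
def cmp {a b : C} {f g h : a ⟶ b} (α : HHom k f g) (β : HHom k g h) : HHom k f h :=
  ⟨α.1 + β.1, comp2 rfl α.2 β.2⟩

/-- Scalar multiplication. -/
def sm {a b : C} {f g : a ⟶ b} (c : k) (α : HHom k f g) : HHom k f g := ⟨α.1, c • α.2⟩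

/-- Left whiskering. -/
def wl {a b c : C} (f : a ⟶ b) {g h : b ⟶ c} {s t : a ⟶ c} (α : HHom k g h) (hs : s = f ≫ g)
    (ht : t = f ≫ h) : HHom k s t := ⟨α.1, whL f α.2 hs ht⟩

/-- Right whiskering. -/
def wr {a b c : C} {f g : a ⟶ b} {s t : a ⟶ c} (α : HHom k f g) (h : b ⟶ c) (hs : s = f ≫ h)
    (ht : t = g ≫ h) : HHom k s t := ⟨α.1, whR α.2 h hs ht⟩

end HHom

open HHom

theorem pk_comp2 {p q r : Deg} {a b : C} {f g h : a ⟶ b} (e : p + q = r) (α : Hom2 k p f g)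
    (β : Hom2 k q g h) : pk (comp2 e α β) = cmp (pk α) (pk β) := by subst e; rfl

theorem pk_smul {p : Deg} {a b : C} {f g : a ⟶ b} (c : k) (α : Hom2 k p f g) :
    pk (c • α) = sm c (pk α) := rfl

theorem pk_whL {p : Deg} {a b c : C} (f : a ⟶ b) {g h : b ⟶ c} {s t : a ⟶ c} (α : Hom2 k p g h)
    (hs : s = f ≫ g) (ht : t = f ≫ h) : pk (whL f α hs ht) = wl f (pk α) hs ht := rfl

theorem pk_whR {p : Deg} {a b c : C} {f g : a ⟶ b} {s t : a ⟶ c} (α : Hom2 k p f g) (h : b ⟶ c)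
    (hs : s = f ≫ h) (ht : t = g ≫ h) : pk (whR α h hs ht) = wr (pk α) h hs ht := rfl

theorem pk_castDeg {p q : Deg} (e : p = q) {a b : C} {f g : a ⟶ b} (α : Hom2 k p f g) :
    pk (castDeg k e α) = pk α := by subst e; rfl

theorem pk_tw (c : k) {p q : Deg} (e : p = q) {a b : C} {f g : a ⟶ b} (α : Hom2 k p f g) :
    pk (tw c e α) = sm c (pk α) := by subst e; rfl

namespace HHom

theorem assoc {a b : C} {f g h i : a ⟶ b} (α : HHom k f g) (β : HHom k g h) (γ : HHom k h i) :
    cmp (cmp α β) γ = cmp α (cmp β γ) := by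
  change pk (comp2 (r := α.1 + β.1 + γ.1) rfl (comp2 rfl α.2 β.2) γ.2) = _
  rw [assoc2 rfl rfl rfl (add_assoc _ _ _).symm, pk_comp2]; rfl

theorem id_cmp {a b : C} {f g : a ⟶ b} (α : HHom k f g) : cmp (pk (id2 f)) α = α := by
  change cmp (pk (id2 f)) (pk α.2) = pk α.2
  rw [← pk_comp2 (zero_add _), id2_comp2]

theorem cmp_id {a b : C} {f g : a ⟶ b} (α : HHom k f g) : cmp α (pk (id2 g)) = α := by
  change cmp (pk α.2) (pk (id2 g)) = pk α.2
  rw [← pk_comp2 (add_zero _), comp2_id2]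

theorem sm_cmp {a b : C} {f g h : a ⟶ b} (c : k) (α : HHom k f g) (β : HHom k g h) :
    cmp (sm c α) β = sm c (cmp α β) := congrArg (Sigma.mk _) (smul_comp2 _ _ _ _)

theorem cmp_sm {a b : C} {f g h : a ⟶ b} (c : k) (α : HHom k f g) (β : HHom k g h) :
    cmp α (sm c β) = sm c (cmp α β) := congrArg (Sigma.mk _) (comp2_smul _ _ _ _)

theorem sm_sm {a b : C} {f g : a ⟶ b} (c d : k) (α : HHom k f g) :
    sm c (sm d α) = sm (c * d) α := congrArg (Sigma.mk _) (smul_smul _ _ _)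

theorem one_sm {a b : C} {f g : a ⟶ b} (α : HHom k f g) : sm 1 α = α :=
  congrArg (Sigma.mk _) (one_smul _ _)

theorem wl_cmp {a b c : C} (f : a ⟶ b) {g h i : b ⟶ c} {s t z : a ⟶ c} (α : HHom k g h)
    (β : HHom k h i) (hs : s = f ≫ g) (ht : t = f ≫ h) (hz : z = f ≫ i) :
    wl f (cmp α β) hs hz = cmp (wl f α hs ht) (wl f β ht hz) :=
  congrArg (Sigma.mk _) (whL_comp2 f rfl α.2 β.2 hs ht hz)

theorem wr_cmp {a b c : C} {f g i : a ⟶ b} (h : b ⟶ c) {s t z : a ⟶ c} (α : HHom k f g)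
    (β : HHom k g i) (hs : s = f ≫ h) (ht : t = g ≫ h) (hz : z = i ≫ h) :
    wr (cmp α β) h hs hz = cmp (wr α h hs ht) (wr β h ht hz) :=
  congrArg (Sigma.mk _) (whR_comp2 h rfl α.2 β.2 hs ht hz)

theorem wl_id {a b c : C} (f : a ⟶ b) (g : b ⟶ c) {s : a ⟶ c} (hs : s = f ≫ g) :
    wl f (pk (id2 (k := k) g)) hs hs = pk (id2 s) := congrArg (Sigma.mk _) (whL_id2 f g hs)

theorem wr_id {a b c : C} (f : a ⟶ b) (g : b ⟶ c) {s : a ⟶ c} (hs : s = f ≫ g) :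
    wr (pk (id2 (k := k) f)) g hs hs = pk (id2 s) := congrArg (Sigma.mk _) (whR_id2 f g hs)

theorem interchange' {a b c : C} {f f' : a ⟶ b} {g g' : b ⟶ c} {s t t' z : a ⟶ c}
    (α : HHom k f f') (β : HHom k g g') (hs : s = f ≫ g) (ht : t = f' ≫ g) (ht' : t' = f ≫ g')
    (hz : z = f' ≫ g') : cmp (wl f β hs ht') (wr α g' ht' hz) =
      sm (sgn k (α.1.2 * β.1.2)) (cmp (wr α g hs ht) (wl f' β ht hz)) := by
  change cmp (pk (whL f β.2 hs ht')) (pk (whR α.2 g' ht' hz)) =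
    sm _ (cmp (pk (whR α.2 g hs ht)) (pk (whL f' β.2 ht hz)))
  rw [← pk_comp2 (r := α.1 + β.1) (add_comm _ _), ← pk_comp2 rfl, ← pk_smul,
    interchange rfl _ _ _ hs ht ht' hz]

theorem interchange_symm {a b c : C} {f f' : a ⟶ b} {g g' : b ⟶ c} {s t t' z : a ⟶ c}
    (α : HHom k f f') (β : HHom k g g') (hs : s = f ≫ g) (ht : t = f' ≫ g) (ht' : t' = f ≫ g')
    (hz : z = f' ≫ g') : cmp (wr α g hs ht) (wl f' β ht hz) =
      sm (sgn k (α.1.2 * β.1.2)) (cmp (wl f β hs ht') (wr α g' ht' hz)) := by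
  rw [interchange' α β hs ht ht' hz, sm_sm, sgn_mul_self, one_sm]

theorem wl_wr {a b c d : C} (f : a ⟶ b) {g g' : b ⟶ c} (h : c ⟶ d) {s t : b ⟶ d}
    {s' t' : a ⟶ c} {y z : a ⟶ d} (α : HHom k g g') (hs : s = g ≫ h) (ht : t = g' ≫ h)
    (hs' : s' = f ≫ g) (ht' : t' = f ≫ g') (hy : y = f ≫ s) (hz : z = f ≫ t)
    (hy' : y = s' ≫ h) (hz' : z = t' ≫ h) :
    wl f (wr α h hs ht) hy hz = wr (wl f α hs' ht') h hy' hz' :=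
  congrArg (Sigma.mk _) (whL_whR f h α.2 hs ht hs' ht' hy hz hy' hz')

theorem comp_wl {a b c d : C} (f : a ⟶ b) (f' : b ⟶ c) {g h : c ⟶ d} {s t : b ⟶ d}
    {y z : a ⟶ d} (α : HHom k g h) (hs : s = f' ≫ g) (ht : t = f' ≫ h) (hy : y = f ≫ s)
    (hz : z = f ≫ t) (hy' : y = (f ≫ f') ≫ g) (hz' : z = (f ≫ f') ≫ h) :
    wl (f ≫ f') α hy' hz' = wl f (wl f' α hs ht) hy hz :=
  congrArg (Sigma.mk _) (comp_whL f f' α.2 hs ht hy hz hy' hz')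

theorem wr_comp {a b c d : C} {f g : a ⟶ b} (h : b ⟶ c) (h' : c ⟶ d) {s t : a ⟶ c}
    {y z : a ⟶ d} (α : HHom k f g) (hs : s = f ≫ h) (ht : t = g ≫ h) (hy : y = s ≫ h')
    (hz : z = t ≫ h') (hy' : y = f ≫ h ≫ h') (hz' : z = g ≫ h ≫ h') :
    wr α (h ≫ h') hy' hz' = wr (wr α h hs ht) h' hy hz :=
  congrArg (Sigma.mk _) (whR_comp h h' α.2 hs ht hy hz hy' hz')

theorem id_wl {a b : C} {g h : a ⟶ b} (α : HHom k g h) (hs : g = 𝟙 a ≫ g) (ht : h = 𝟙 a ≫ h) :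
    wl (𝟙 a) α hs ht = α := congrArg (Sigma.mk _) (id_whL α.2 hs ht)

theorem wr_one {a b : C} {f g : a ⟶ b} (α : HHom k f g) (hs : f = f ≫ 𝟙 b) (ht : g = g ≫ 𝟙 b) :
    wr α (𝟙 b) hs ht = α := congrArg (Sigma.mk _) (whR_id α.2 hs ht)

end HHom

end

end TwoSupercat

open TwoSupercat.HHom

section
variable (k : Type u) [Field k] (B : Type w) [Category.{w'} B] [TwoSupercat.{u, w, w'} k B]
  (C : Type v) [Category.{v'} C] [TwoSupercat.{u, v, v'} k C]

/-- Strict 2-superfunctors. -/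
structure StrictFun where
  fn : B ⥤ C
  map2 : ∀ {p : Deg} {a b : B} {f g : a ⟶ b}, Hom2 k p f g → Hom2 k p (fn.map f) (fn.map g)
  map2_add : ∀ {p : Deg} {a b : B} {f g : a ⟶ b} (α β : Hom2 k p f g),
    map2 (α + β) = map2 α + map2 β
  map2_smul : ∀ {p : Deg} {a b : B} {f g : a ⟶ b} (c : k) (α : Hom2 k p f g),
    map2 (c • α) = c • map2 α
  map2_id2 : ∀ {a b : B} (f : a ⟶ b), map2 (id2 f : Hom2 k 0 f f) = id2 (fn.map f)
  map2_comp2 : ∀ {p q r : Deg} {a b : B} {f g h : a ⟶ b} (e : p + q = r)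
    (α : Hom2 k p f g) (β : Hom2 k q g h), map2 (comp2 e α β) = comp2 e (map2 α) (map2 β)
  map2_whL : ∀ {p : Deg} {a b c : B} (f : a ⟶ b) {g h : b ⟶ c} {s t : a ⟶ c}
    (α : Hom2 k p g h) (hs : s = f ≫ g) (ht : t = f ≫ h),
    map2 (whL f α hs ht) = whL (fn.map f) (map2 α) (by rw [hs, fn.map_comp]) (by rw [ht, fn.map_comp])
  map2_whR : ∀ {p : Deg} {a b c : B} {f g : a ⟶ b} {s t : a ⟶ c}
    (α : Hom2 k p f g) (h : b ⟶ c) (hs : s = f ≫ h) (ht : t = g ≫ h),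
    map2 (whR α h hs ht) = whR (map2 α) (fn.map h) (by rw [hs, fn.map_comp]) (by rw [ht, fn.map_comp])

variable {k B C}

/-- Shifts on a family of objects: 1-morphisms that are isomorphic to identities through
homogeneous 2-morphisms. -/
structure ShiftData (k : Type u) [Field k] {B : Type w} {C : Type v} [Category.{v'} C]
    [TwoSupercat.{u, v, v'} k C] (obj : B → C) where
  sh : ∀ a : B, Deg → (obj a ⟶ obj a)
  j : ∀ (a : B) (s p : Deg), p = -s → Hom2 k p (sh a s) (𝟙 (obj a))
  ji : ∀ (a : B) (s p : Deg), p = s → Hom2 k p (𝟙 (obj a)) (sh a s)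
  j_ji : ∀ (a : B) (s p q : Deg) (hp : p = -s) (hq : q = s),
    comp2 (r := 0) (by rw [hp, hq, neg_add_cancel]) (j a s p hp) (ji a s q hq) = id2 (sh a s)
  ji_j : ∀ (a : B) (s p q : Deg) (hp : p = -s) (hq : q = s),
    comp2 (r := 0) (by rw [hp, hq, add_neg_cancel]) (ji a s q hq) (j a s p hp) = id2 (𝟙 (obj a))

namespace StrictFun

variable (G : StrictFun k B C) (S : ShiftData k G.fn.obj)

/-- The value of the extension on 1-morphisms. -/
def envObj {a b : Envelope B} (f : a ⟶ b) : G.fn.obj a.as ⟶ G.fn.obj b.as :=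
  G.fn.map (EnvHom.mor f) ≫ S.sh b.as (EnvHom.shift f)

theorem envObj_eq {a b : Envelope B} (f : a ⟶ b) :
    G.envObj S f = G.fn.map (EnvHom.mor f) ≫ S.sh b.as (EnvHom.shift f) := rfl

/-- The canonical 2-morphism from the extension. -/
def J {a b : Envelope B} (f : a ⟶ b) (p : Deg) (hp : p = -EnvHom.shift f) :
    Hom2 k p (G.envObj S f) (G.fn.map (EnvHom.mor f)) :=
  whL (G.fn.map (EnvHom.mor f)) (S.j b.as _ p hp) (G.envObj_eq S f) (Category.comp_id _).symm

/-- The inverse of `J`. -/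
def Ji {a b : Envelope B} (f : a ⟶ b) (p : Deg) (hp : p = EnvHom.shift f) :
    Hom2 k p (G.fn.map (EnvHom.mor f)) (G.envObj S f) :=
  whL (G.fn.map (EnvHom.mor f)) (S.ji b.as _ p hp) (Category.comp_id _).symm (G.envObj_eq S f)

theorem J_Ji {a b : Envelope B} (f : a ⟶ b) {p q : Deg} (hp : p = -EnvHom.shift f)
    (hq : q = EnvHom.shift f) : cmp (pk (G.J S f p hp)) (pk (G.Ji S f q hq)) = pk (id2 _) := by
  unfold J Ji
  rw [pk_whL, pk_whL, ← wl_cmp, ← pk_comp2 (r := 0) (by rw [hp, hq, neg_add_cancel]), S.j_ji, wl_id]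

theorem Ji_J {a b : Envelope B} (f : a ⟶ b) {p q : Deg} (hp : p = -EnvHom.shift f)
    (hq : q = EnvHom.shift f) : cmp (pk (G.Ji S f q hq)) (pk (G.J S f p hp)) = pk (id2 _) := by
  unfold J Ji
  rw [pk_whL, pk_whL, ← wl_cmp, ← pk_comp2 (r := 0) (by rw [hp, hq, add_neg_cancel]), S.ji_j, wl_id]

theorem Ji_J_assoc {a b : Envelope B} (f : a ⟶ b) {p q : Deg} (hp : p = -EnvHom.shift f)
    (hq : q = EnvHom.shift f) {h : G.fn.obj a.as ⟶ G.fn.obj b.as}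
    (γ : HHom k (G.fn.map (EnvHom.mor f)) h) :
    cmp (pk (G.Ji S f q hq)) (cmp (pk (G.J S f p hp)) γ) = γ := by
  rw [← HHom.assoc, Ji_J, id_cmp]

/-- The value of the extension on 2-morphisms. -/
def envMap2' {p : Deg} {a b : Envelope B} {f g : a ⟶ b} (α : Hom2 k p f g) :
    Hom2 k p (G.envObj S f) (G.envObj S g) :=
  comp2 (q := p + EnvHom.shift f) (by abel) (G.J S f _ rfl)
    (comp2 (p := p + EnvHom.shift f - EnvHom.shift g) (by abel)
      (G.map2 (f := EnvHom.mor f) (g := EnvHom.mor g) α) (G.Ji S g _ rfl))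

/-- The underlying 2-morphism of `B`. -/
def under {p : Deg} {a b : Envelope B} {f g : a ⟶ b} (α : Hom2 k p f g) :
    HHom k (EnvHom.mor f) (EnvHom.mor g) := pk (p := p + EnvHom.shift f - EnvHom.shift g) α

/-- The functor on homogeneous 2-morphisms. -/
def hmap {a b : B} {f g : a ⟶ b} (α : HHom k f g) : HHom k (G.fn.map f) (G.fn.map g) :=
  ⟨α.1, G.map2 α.2⟩

theorem pk_envMap2' {p : Deg} {a b : Envelope B} {f g : a ⟶ b} (α : Hom2 k p f g) :
    pk (G.envMap2' S α) =
      cmp (pk (G.J S f _ rfl)) (cmp (G.hmap (under α)) (pk (G.Ji S g _ rfl))) := by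
  unfold envMap2'
  rw [pk_comp2, pk_comp2]; rfl

theorem hmap_cmp {a b : B} {f g h : a ⟶ b} (α : HHom k f g) (β : HHom k g h) :
    G.hmap (cmp α β) = cmp (G.hmap α) (G.hmap β) := congrArg (Sigma.mk _) (G.map2_comp2 rfl α.2 β.2)

theorem hmap_id {a b : B} (f : a ⟶ b) : G.hmap (pk (id2 f)) = pk (id2 (k := k) (G.fn.map f)) :=
  congrArg (Sigma.mk _) (G.map2_id2 f)

theorem hmap_sm {a b : B} {f g : a ⟶ b} (c : k) (α : HHom k f g) :
    G.hmap (sm c α) = sm c (G.hmap α) := congrArg (Sigma.mk _) (G.map2_smul c α.2)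

theorem hmap_wl {a b c : B} (f : a ⟶ b) {g h : b ⟶ c} {s t : a ⟶ c} (α : HHom k g h)
    (hs : s = f ≫ g) (ht : t = f ≫ h) : G.hmap (wl f α hs ht) =
      wl (G.fn.map f) (G.hmap α) (by rw [hs, G.fn.map_comp]) (by rw [ht, G.fn.map_comp]) :=
  congrArg (Sigma.mk _) (G.map2_whL f α.2 hs ht)

theorem hmap_wr {a b c : B} {f g : a ⟶ b} {s t : a ⟶ c} (α : HHom k f g) (h : b ⟶ c)
    (hs : s = f ≫ h) (ht : t = g ≫ h) : G.hmap (wr α h hs ht) =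
      wr (G.hmap α) (G.fn.map h) (by rw [hs, G.fn.map_comp]) (by rw [ht, G.fn.map_comp]) :=
  congrArg (Sigma.mk _) (G.map2_whR α.2 h hs ht)

theorem under_comp2 {p q r : Deg} {a b : Envelope B} {f g h : a ⟶ b} (e : p + q = r)
    (α : Hom2 k p f g) (β : Hom2 k q g h) : under (comp2 e α β) = cmp (under α) (under β) :=
  pk_comp2 (f := EnvHom.mor f) (g := EnvHom.mor g) (h := EnvHom.mor h) _ α β

theorem under_id2 {a b : Envelope B} (f : a ⟶ b) :
    under (id2 (k := k) f) = pk (id2 (EnvHom.mor f)) := pk_castDeg _ _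

theorem under_whL {p : Deg} {a b c : Envelope B} (f : a ⟶ b) {g h : b ⟶ c} {s t : a ⟶ c}
    (α : Hom2 k p g h) (hs : s = f ≫ g) (ht : t = f ≫ h) : under (whL f α hs ht) =
      sm (sgn k ((EnvHom.shift f).2 * (p + EnvHom.shift g - EnvHom.shift h).2))
        (wl (EnvHom.mor f) (under α) (Envelope.mor_comp _ _ hs) (Envelope.mor_comp _ _ ht)) :=
  pk_tw _ _ _

theorem under_whR {p : Deg} {a b c : Envelope B} {f g : a ⟶ b} {s t : a ⟶ c}
    (α : Hom2 k p f g) (h : b ⟶ c) (hs : s = f ≫ h) (ht : t = g ≫ h) : under (whR α h hs ht) =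
      sm (sgn k ((EnvHom.shift h).2 * p.2))
        (wr (under α) (EnvHom.mor h) (Envelope.mor_comp _ _ hs) (Envelope.mor_comp _ _ ht)) :=
  pk_tw _ _ _

theorem map_mor_comp {a b c : Envelope B} {f : a ⟶ b} {g : b ⟶ c} {s : a ⟶ c} (hs : s = f ≫ g) :
    G.fn.map (EnvHom.mor s) = G.fn.map (EnvHom.mor f) ≫ G.fn.map (EnvHom.mor g) := by
  rw [Envelope.mor_comp f g hs, G.fn.map_comp]

/-- The horizontal composite of `J f` and `J g`. -/
def JJ {a b c : Envelope B} (f : a ⟶ b) (g : b ⟶ c) {fg : a ⟶ c} (hs : fg = f ≫ g) :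
    HHom k (G.envObj S f ≫ G.envObj S g) (G.fn.map (EnvHom.mor fg)) :=
  cmp (wl (G.envObj S f) (pk (G.J S g _ rfl)) rfl rfl)
    (wr (pk (G.J S f _ rfl)) (G.fn.map (EnvHom.mor g)) rfl (G.map_mor_comp hs))

/-- The inverse of `JJ`. -/
def JJi {a b c : Envelope B} (f : a ⟶ b) (g : b ⟶ c) {fg : a ⟶ c} (hs : fg = f ≫ g) :
    HHom k (G.fn.map (EnvHom.mor fg)) (G.envObj S f ≫ G.envObj S g) :=
  cmp (wr (pk (G.Ji S f _ rfl)) (G.fn.map (EnvHom.mor g)) (G.map_mor_comp hs) rfl)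
    (wl (G.envObj S f) (pk (G.Ji S g _ rfl)) rfl rfl)

theorem JJ_JJi {a b c : Envelope B} (f : a ⟶ b) (g : b ⟶ c) {fg : a ⟶ c} (hs : fg = f ≫ g) :
    cmp (G.JJ S f g hs) (G.JJi S f g hs) = pk (id2 _) := by
  unfold JJ JJi
  rw [HHom.assoc, ← HHom.assoc (wr _ _ _ _), ← wr_cmp, J_Ji, wr_id, id_cmp, ← wl_cmp, J_Ji, wl_id]

theorem JJi_JJ {a b c : Envelope B} (f : a ⟶ b) (g : b ⟶ c) {fg : a ⟶ c} (hs : fg = f ≫ g) :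
    cmp (G.JJi S f g hs) (G.JJ S f g hs) = pk (id2 _) := by
  unfold JJ JJi
  rw [HHom.assoc, ← HHom.assoc (wl _ _ _ _), ← wl_cmp, Ji_J, wl_id, id_cmp, ← wr_cmp, Ji_J, wr_id]

/-- The coherence isomorphism of the extension for compositions. -/
def envComp {a b c : Envelope B} (f : a ⟶ b) (g : b ⟶ c) {fg : a ⟶ c} (hs : fg = f ≫ g) :
    Iso2 k (G.envObj S f ≫ G.envObj S g) (G.envObj S fg) where
  hom := comp2 (p := -EnvHom.shift fg) (q := EnvHom.shift fg) (neg_add_cancel _)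
    (castDeg k (by rw [Envelope.shift_comp f g hs]; exact (neg_add_rev _ _).symm) (G.JJ S f g hs).2)
    (G.Ji S fg _ rfl)
  inv := comp2 (p := -EnvHom.shift fg) (q := EnvHom.shift fg) (neg_add_cancel _) (G.J S fg _ rfl)
    (castDeg k (by rw [Envelope.shift_comp f g hs]; rfl) (G.JJi S f g hs).2)
  hom_inv := pk_inj (by
    rw [pk_comp2, pk_comp2, pk_comp2, pk_castDeg, pk_castDeg, HHom.assoc, Ji_J_assoc]
    exact G.JJ_JJi S f g hs)
  inv_hom := pk_inj (by
    rw [pk_comp2, pk_comp2, pk_comp2, pk_castDeg, pk_castDeg, pk_snd, pk_snd, HHom.assoc,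
      ← HHom.assoc (G.JJi S f g hs) (G.JJ S f g hs), JJi_JJ, id_cmp, J_Ji])

theorem pk_envComp_hom {a b c : Envelope B} (f : a ⟶ b) (g : b ⟶ c) {fg : a ⟶ c} (hs : fg = f ≫ g) :
    pk (G.envComp S f g hs).hom = cmp (G.JJ S f g hs) (pk (G.Ji S fg _ rfl)) := by
  unfold envComp
  rw [pk_comp2, pk_castDeg]; rfl

theorem pk_envComp_inv {a b c : Envelope B} (f : a ⟶ b) (g : b ⟶ c) {fg : a ⟶ c} (hs : fg = f ≫ g) :
    pk (G.envComp S f g hs).inv = cmp (pk (G.J S fg _ rfl)) (G.JJi S f g hs) := by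
  unfold envComp
  rw [pk_comp2, pk_castDeg]; rfl

theorem map_one_eq (a : Envelope B) :
    𝟙 (G.fn.obj a.as) = G.fn.map (EnvHom.mor (𝟙 a)) ≫ 𝟙 (G.fn.obj a.as) :=
  (G.fn.map_id a.as).symm.trans (Category.comp_id _).symm

/-- The coherence isomorphism of the extension for identities. -/
def envId (a : Envelope B) : Iso2 k (𝟙 (G.fn.obj a.as)) (G.envObj S (𝟙 a)) where
  hom := whR (G.Ji S (𝟙 a) 0 rfl) (𝟙 _) (G.map_one_eq a) (Category.comp_id _).symm
  inv := whR (G.J S (𝟙 a) 0 neg_zero.symm) (𝟙 _) (Category.comp_id _).symm (G.map_one_eq a)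
  hom_inv := pk_inj (by rw [pk_comp2, pk_whR, pk_whR, ← wr_cmp, Ji_J, wr_id])
  inv_hom := pk_inj (by rw [pk_comp2, pk_whR, pk_whR, ← wr_cmp, J_Ji, wr_id])

theorem JJ_wl {a b c : Envelope B} (f : a ⟶ b) {g h : b ⟶ c} {s t : a ⟶ c} (hs : s = f ≫ g)
    (ht : t = f ≫ h) (A : HHom k (G.fn.map (EnvHom.mor g)) (G.fn.map (EnvHom.mor h))) :
    cmp (G.JJ S f g hs) (wl (G.fn.map (EnvHom.mor f)) A (G.map_mor_comp hs) (G.map_mor_comp ht)) =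
      sm (sgn k ((EnvHom.shift f).2 * A.1.2))
        (cmp (wl (G.envObj S f) (cmp (pk (G.J S g _ rfl)) A) rfl rfl)
          (wr (pk (G.J S f _ rfl)) (G.fn.map (EnvHom.mor h)) rfl (G.map_mor_comp ht))) := by
  unfold JJ
  rw [HHom.assoc, interchange_symm (pk (G.J S f _ rfl)) A rfl (G.map_mor_comp hs) rfl
    (G.map_mor_comp ht), cmp_sm, ← HHom.assoc, ← wl_cmp]
  congr 2
  change (-EnvHom.shift f).2 * _ = _
  rw [Prod.snd_neg, CharTwo.neg_eq]

theorem JJ_wr {a b c : Envelope B} {f g : a ⟶ b} (h : b ⟶ c) {s t : a ⟶ c} (hs : s = f ≫ h)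
    (ht : t = g ≫ h) (A : HHom k (G.fn.map (EnvHom.mor f)) (G.fn.map (EnvHom.mor g))) :
    cmp (G.JJ S f h hs) (wr A (G.fn.map (EnvHom.mor h)) (G.map_mor_comp hs) (G.map_mor_comp ht)) =
      cmp (wl (G.envObj S f) (pk (G.J S h _ rfl)) rfl rfl)
        (wr (cmp (pk (G.J S f _ rfl)) A) (G.fn.map (EnvHom.mor h)) rfl (G.map_mor_comp ht)) := by
  unfold JJ
  rw [HHom.assoc, ← wr_cmp]

theorem wl_wr_congr {a b c d : C} {f f' : a ⟶ b} {g g' : b ⟶ c} {h : c ⟶ d} {m : b ⟶ d}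
    {z : a ⟶ d} (e : m = g' ≫ h) (α : HHom k f f') (β : HHom k g g') (hz : z = f' ≫ g' ≫ h)
    (hz' : z = f' ≫ m) :
    cmp (wl f (wr β h rfl rfl) rfl rfl) (wr α (g' ≫ h) rfl hz) =
      cmp (wl f (wr β h rfl e) rfl rfl) (wr α m rfl hz') := by subst e; rfl

theorem wl_wr_wr_id {a b : C} {u : a ⟶ a} {f f' t : a ⟶ b} (hs : 𝟙 a = u ≫ 𝟙 a)
    (ht : u = u ≫ 𝟙 a) (α : HHom k f f') (h₁ : f = 𝟙 a ≫ f) (h₂ : t = 𝟙 a ≫ f')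
    (h₃ : f' = u ≫ f') :
    cmp (wl (𝟙 a) α h₁ h₂) (wr (wr (pk (id2 (k := k) u)) (𝟙 a) hs ht) f' h₂ h₃) = α := by
  obtain rfl : u = 𝟙 a := (hs.trans (Category.comp_id u)).symm
  obtain rfl : t = f' := h₂.trans (Category.id_comp f')
  rw [wr_id, wr_id, cmp_id, id_wl]

theorem wl_wr_wr {a b : C} {u : b ⟶ b} {f f' t : a ⟶ b} (hs : 𝟙 b = u ≫ 𝟙 b) (ht : u = u ≫ 𝟙 b)
    (α : HHom k f f') (h₁ : f = f ≫ 𝟙 b) (h : t = f ≫ u) (h₂ : f' = f' ≫ u) :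
    cmp (wl f (wr (pk (id2 (k := k) u)) (𝟙 b) hs ht) h₁ h) (wr α u h h₂) = α := by
  obtain rfl : u = 𝟙 b := (hs.trans (Category.comp_id u)).symm
  obtain rfl : t = f := h.trans (Category.comp_id f)
  rw [wr_id, wl_id, id_cmp, wr_one]

/-- The horizontal composite of `J f`, `J g` and `J h`, associated to the right. -/
theorem JJ_assoc {a b c d : Envelope B} (f : a ⟶ b) (g : b ⟶ c) (h : c ⟶ d) {fg : a ⟶ c}
    {gh : b ⟶ d} {fgh : a ⟶ d} (e₁ : fg = f ≫ g) (e₂ : gh = g ≫ h) (e₃ : fgh = fg ≫ h)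
    (e₄ : fgh = f ≫ gh) :
    cmp (wl (G.envObj S f ≫ G.envObj S g) (pk (G.J S h _ rfl)) (Category.assoc _ _ _).symm
        (Category.assoc _ _ _).symm)
      (wr (G.JJ S f g e₁) (G.fn.map (EnvHom.mor h)) (Category.assoc _ _ _).symm
        (G.map_mor_comp e₃)) =
    cmp (wl (G.envObj S f) (G.JJ S g h e₂) rfl rfl)
      (wr (pk (G.J S f _ rfl)) (G.fn.map (EnvHom.mor gh)) rfl (G.map_mor_comp e₄)) := by
  unfold JJ
  rw [wl_cmp (t := G.envObj S f ≫ G.envObj S g ≫ G.fn.map (EnvHom.mor h)) _ _ _ rfl rfl rfl,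
    wr_cmp (t := G.envObj S f ≫ G.fn.map (EnvHom.mor g) ≫ G.fn.map (EnvHom.mor h)) _ _ _
      (Category.assoc _ _ _).symm (Category.assoc _ _ _).symm
      (G.map_mor_comp e₃), ← HHom.assoc,
    comp_wl (hs := rfl) (ht := rfl) (hy := rfl) (hz := rfl),
    ← wl_wr (hs := rfl) (ht := rfl) (hy := rfl) (hz := rfl),
    ← wr_comp (hy' := rfl)
      (hz' := (G.map_mor_comp e₃).trans ((congrArg (· ≫ _) (G.map_mor_comp e₁)).trans
        (Category.assoc _ _ _)))]
  rw [HHom.assoc, HHom.assoc, wl_wr_congr (G.map_mor_comp e₂)]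

/-- The extension of a strict 2-superfunctor to the envelope. -/
def envelope : TwoSuperfunctor k (fun a : Envelope B => G.fn.obj a.as) where
  map := G.envObj S
  map2 := G.envMap2' S
  map2_add {p a b f g} α β := by
    unfold envMap2'
    rw [show G.map2 (f := EnvHom.mor f) (g := EnvHom.mor g) (α + β) =
      G.map2 (f := EnvHom.mor f) (g := EnvHom.mor g) α + G.map2 (f := EnvHom.mor f) (g := EnvHom.mor g) β
      from G.map2_add _ _,
      add_comp2, comp2_add]
  map2_smul {p a b f g} c α := by
    unfold envMap2'
    rw [show G.map2 (f := EnvHom.mor f) (g := EnvHom.mor g) (c • α) =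
      c • G.map2 (f := EnvHom.mor f) (g := EnvHom.mor g) α from G.map2_smul _ _,
      smul_comp2, comp2_smul]
  map2_id2 f := pk_inj (by rw [pk_envMap2', under_id2, hmap_id, id_cmp, J_Ji])
  map2_comp2 {p q r a b f g h} e α β := pk_inj (by
    rw [pk_comp2, pk_envMap2', pk_envMap2', pk_envMap2', under_comp2, hmap_cmp]
    simp only [HHom.assoc]
    rw [Ji_J_assoc])
  mapId := G.envId S
  mapComp := G.envComp S
  mapComp_whL {p a b c} f g h s t α hs ht := pk_inj (by
    rw [pk_comp2, pk_comp2, pk_envComp_hom, pk_envComp_hom, pk_envMap2', HHom.assoc, Ji_J_assoc,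
      under_whL, hmap_sm, hmap_wl, pk_whL, pk_envMap2', sm_cmp, cmp_sm, ← HHom.assoc (G.JJ S f g hs),
      JJ_wl (ht := ht), sm_cmp, sm_sm,
      show (G.hmap (under α)).1 = p + EnvHom.shift g - EnvHom.shift h from rfl,
      sgn_mul_self, one_sm, ← HHom.assoc (wl (G.envObj S f) _ _ _) (G.JJ S f h ht)]
    unfold JJ
    rw [← HHom.assoc (wl (G.envObj S f) _ _ _) (wl (G.envObj S f) _ _ _), ← wl_cmp, HHom.assoc,
      HHom.assoc (pk (G.J S g _ _)), HHom.assoc (G.hmap _), Ji_J, cmp_id, HHom.assoc])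
  mapComp_whR {p a b c} f g h s t α hs ht := pk_inj (by
    rw [pk_comp2, pk_comp2, pk_envComp_hom, pk_envComp_hom, pk_envMap2', HHom.assoc, Ji_J_assoc,
      under_whR, hmap_sm, hmap_wr, pk_whR, sm_cmp, cmp_sm, ← HHom.assoc (G.JJ S f h hs),
      JJ_wr (ht := ht), ← HHom.assoc _ (G.JJ S g h ht)]
    unfold JJ
    rw [← HHom.assoc (wr _ _ _ _) (wl (G.envObj S g) _ _ _),
      interchange_symm (pk (G.envMap2' S α)) (pk (G.J S h _ rfl)) rfl rfl rfl rfl, sm_cmp,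
      sm_cmp, HHom.assoc (wl (G.envObj S f) _ _ _) (wr _ _ _ _) (wr _ _ _ _), ← wr_cmp,
      pk_envMap2', HHom.assoc (pk (G.J S f _ _)), HHom.assoc (G.hmap _), Ji_J, cmp_id, HHom.assoc]
    congr 2
    rw [← pk_envMap2']
    change _ = p.2 * (-EnvHom.shift h).2
    rw [Prod.snd_neg, CharTwo.neg_eq, mul_comm])
  mapComp_assoc f g h fg gh fgh e₁ e₂ e₃ e₄ := pk_inj (by
    rw [pk_comp2, pk_comp2, pk_envComp_hom, pk_envComp_hom, pk_whL, pk_whR, pk_envComp_hom, pk_envComp_hom,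
       ← HHom.assoc _ (G.JJ S fg h e₃),  ← HHom.assoc _ (G.JJ S f gh e₄)]
    congr 1
    have h₁ : G.JJ S fg h e₃ = cmp (wl (G.envObj S fg) (pk (G.J S h _ rfl)) rfl rfl)
      (wr (pk (G.J S fg _ rfl)) (G.fn.map (EnvHom.mor h)) rfl (G.map_mor_comp e₃)) := rfl
    have h₂ : G.JJ S f gh e₄ = cmp (wl (G.envObj S f) (pk (G.J S gh _ rfl)) rfl rfl)
      (wr (pk (G.J S f _ rfl)) (G.fn.map (EnvHom.mor gh)) rfl (G.map_mor_comp e₄)) := rfl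
    rw [h₁, h₂, ← HHom.assoc (wl _ _ _ _), ← wl_cmp, HHom.assoc (G.JJ S g h e₂), Ji_J, cmp_id,
      ← G.JJ_assoc S f g h e₁ e₂ e₃ e₄, ← HHom.assoc (wr _ _ _ _),
      interchange_symm (cmp (G.JJ S f g e₁) (pk (G.Ji S fg _ rfl))) (pk (G.J S h _ rfl))
        (Category.assoc _ _ _).symm rfl (Category.assoc _ _ _).symm rfl,
      sm_cmp, HHom.assoc, ← wr_cmp, HHom.assoc (G.JJ S f g e₁), Ji_J, cmp_id]
    convert one_sm _ using 2
    change sgn k ((-EnvHom.shift g + -EnvHom.shift f + EnvHom.shift fg).2 * _) = 1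
    rw [Envelope.shift_comp f g e₁]
    simp [sgn_zero])
  mapComp_id_left {a b} f e := pk_inj (by
    have h₁ : G.JJ S (𝟙 a) f e = cmp (wl (G.envObj S (𝟙 a)) (pk (G.J S f _ rfl)) rfl rfl)
      (wr (pk (G.J S (𝟙 a) _ rfl)) (G.fn.map (EnvHom.mor f)) rfl (G.map_mor_comp e)) := rfl
    rw [pk_comp2, pk_envComp_hom, pk_whR, h₁, HHom.assoc, ← HHom.assoc (wr _ _ _ _),
      interchange_symm (pk (G.envId S a).hom) (pk (G.J S f _ rfl)) (Category.id_comp _).symm rfl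
        (Category.id_comp _).symm rfl]
    have h₂ : pk (G.J S (𝟙 a) _ rfl) = wr (pk (G.J S (𝟙 a) _ rfl)) (𝟙 _) (Category.comp_id _).symm
      (Category.comp_id _).symm := (wr_one _ _ _).symm
    have h₃ : pk (G.envId S a).hom = wr (pk (G.Ji S (𝟙 a) 0 rfl)) (𝟙 _) (G.map_one_eq a)
      (Category.comp_id _).symm := rfl
    have h₄ : (pk (G.envId S a).hom).1.2 = 0 := rfl
    rw [h₄, zero_mul, sgn_zero, one_sm, HHom.assoc, ← HHom.assoc (wr _ _ _ _), ← wr_cmp, h₃, h₂,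
      ← wr_cmp, Ji_J, ← HHom.assoc, wl_wr_wr_id, J_Ji])
  mapComp_id_right {a b} f e := pk_inj (by
    have h₁ : G.JJ S f (𝟙 b) e = cmp (wl (G.envObj S f) (pk (G.J S (𝟙 b) _ rfl)) rfl rfl)
      (wr (pk (G.J S f _ rfl)) (G.fn.map (EnvHom.mor (𝟙 b))) rfl (G.map_mor_comp e)) := rfl
    have h₂ : pk (G.J S (𝟙 b) _ rfl) = wr (pk (G.J S (𝟙 b) _ rfl)) (𝟙 _) (Category.comp_id _).symm
      (Category.comp_id _).symm := (wr_one _ _ _).symm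
    rw [pk_comp2, pk_envComp_hom, pk_whL, h₁, HHom.assoc, ← HHom.assoc (wl _ _ _ _), ← wl_cmp, h₂]
    change cmp (wl _ (cmp (wr (pk (G.Ji S (𝟙 b) 0 rfl)) (𝟙 _) (G.map_one_eq b) _) _) _ _) _ = _
    rw [← wr_cmp, Ji_J, ← HHom.assoc, wl_wr_wr, J_Ji])

end StrictFun

end

end OddCat

namespace OddCat

/-! ## Representations of the odd 2-category from generators -/

section
variable (k : Type u) [Field k] {C : Type v} [Category.{w} C] [TwoSupercat.{u, v, w, v'} k C]

variable {k} in
/-- Powers of an odd 2-endomorphism of degree `2`. -/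
def xpowOf {a b : C} {f : a ⟶ b} (x : Hom2 k (2, 1) f f) :
    (j : ℕ) → Hom2 k (2 * (j : ℤ), (j : ZMod 2)) f f
  | 0 => castDeg k (by ext <;> simp) (id2 f)
  | j + 1 => comp2 (by ext <;> simp; ring) (xpowOf x j) x

variable {k} in
/-- The crossing `E F ⇒ F E` obtained from `τ` by rotation. -/
def crossOf {a b c : C} {e : a ⟶ b} {f : b ⟶ a} {e' : b ⟶ c} {f' : c ⟶ b} {l : ℤ}
    (τ : Hom2 k (-2, 1) (e ≫ e') (e ≫ e')) (η : Hom2 k (1 + l, 0) (𝟙 b) (e' ≫ f'))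
    (ε : Hom2 k (1 - l, 0) (f ≫ e) (𝟙 b)) : Hom2 k (0, 1) (f ≫ e) (e' ≫ f') :=
  comp2 (p := (1 + l - 2, 1)) (q := (1 - l, 0)) (by ext <;> simp; ring)
    (comp2 (p := (1 + l, 0)) (q := (-2, 1)) (g := f ≫ e ≫ e' ≫ f') (by ext <;> simp; ring)
      (whL (f ≫ e) η (Category.comp_id _).symm (Category.assoc _ _ _).symm)
      (whL f (whR τ f' (Category.assoc _ _ _).symm (Category.assoc _ _ _).symm) rfl rfl))
    (whR ε (e' ≫ f') (Category.assoc _ _ _).symm (Category.id_comp _).symm)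

variable {k} in
/-- The cap with `j` dots. -/
def capOf {a b : C} {e : a ⟶ b} {f : b ⟶ a} {l : ℤ} (x : Hom2 k (2, 1) e e)
    (ε : Hom2 k (1 - l, 0) (f ≫ e) (𝟙 b)) (j : ℕ) :
    Hom2 k (2 * (j : ℤ) + (1 - l), (j : ZMod 2)) (f ≫ e) (𝟙 b) :=
  comp2 (by ext <;> simp) (whL f (xpowOf x j) rfl rfl) ε

variable {k} in
/-- The cup with `j` dots. -/
def cupOf {b c : C} {e : b ⟶ c} {f : c ⟶ b} {l : ℤ} (x : Hom2 k (2, 1) e e)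
    (η : Hom2 k (1 + l, 0) (𝟙 b) (e ≫ f)) (j : ℕ) :
    Hom2 k (1 + l + 2 * (j : ℤ), (j : ZMod 2)) (𝟙 b) (e ≫ f) :=
  comp2 (by ext <;> simp) η (whR (xpowOf x j) f rfl rfl)

/-- The matrix entries of inverses of the odd `sl₂`-isomorphisms. -/
structure SlInverse {b : C} {s t : b ⟶ b} (l : ℤ) (σ : Hom2 k (0, 1) s t)
    (cap : (j : ℕ) → Hom2 k (2 * (j : ℤ) + (1 - l), (j : ZMod 2)) s (𝟙 b))
    (cup : (j : ℕ) → Hom2 k (1 + l + 2 * (j : ℤ), (j : ZMod 2)) (𝟙 b) t) where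
  inv : Hom2 k (0, 1) t s
  toEF (j : ℕ) (h : (j : ℤ) < l) : Hom2 k (l - 1 - 2 * j, (j : ZMod 2)) (𝟙 b) s
  ofFE (j : ℕ) (h : (j : ℤ) < -l) : Hom2 k (-l - 1 - 2 * j, (j : ZMod 2)) t (𝟙 b)
  iso_EF : comp2 (r := 0) rfl σ inv + ∑ j : Fin l.toNat, comp2 (r := 0)
    (by ext <;> simp [CharTwo.add_self_eq_zero]; ring) (cap j) (toEF j (by have := j.2; lia)) = id2 s
  iso_FE : comp2 (r := 0) rfl inv σ + ∑ j : Fin (-l).toNat, comp2 (r := 0)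
    (by ext <;> simp [CharTwo.add_self_eq_zero]; ring) (ofFE j (by have := j.2; lia)) (cup j) = id2 t
  inv_cap (j : ℕ) (h : (j : ℤ) < l) : comp2 rfl inv (cap j) = 0
  toEF_cross (j : ℕ) (h : (j : ℤ) < l) : comp2 rfl (toEF j h) σ = 0
  toEF_cap (j : ℕ) (h : (j : ℤ) < l) : comp2 (r := 0)
    (by ext <;> simp [CharTwo.add_self_eq_zero]; ring) (toEF j h) (cap j) = id2 (𝟙 b)
  toEF_cap_ne (i j : ℕ) (hi : (i : ℤ) < l) (hj : (j : ℤ) < l) (hij : i ≠ j) :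
    comp2 rfl (toEF i hi) (cap j) = 0
  cup_inv (j : ℕ) (h : (j : ℤ) < -l) : comp2 rfl (cup j) inv = 0
  cross_ofFE (j : ℕ) (h : (j : ℤ) < -l) : comp2 rfl σ (ofFE j h) = 0
  cup_ofFE (j : ℕ) (h : (j : ℤ) < -l) : comp2 (r := 0)
    (by ext <;> simp [CharTwo.add_self_eq_zero]; ring) (cup j) (ofFE j h) = id2 (𝟙 b)
  cup_ofFE_ne (i j : ℕ) (hi : (i : ℤ) < -l) (hj : (j : ℤ) < -l) (hij : i ≠ j) :
    comp2 rfl (cup i) (ofFE j hj) = 0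

variable (C) in
/-- The data that determine a strict 2-superfunctor from the odd 2-category. -/
structure OddModel where
  obj : UObj → C
  E : ∀ {a b : UObj}, a.wt + 2 = b.wt → (obj a ⟶ obj b)
  F : ∀ {a b : UObj}, a.wt + 2 = b.wt → (obj b ⟶ obj a)
  x : ∀ {a b : UObj} (h : a.wt + 2 = b.wt), Hom2 k (2, 1) (E h) (E h)
  τ : ∀ {a b c : UObj} (h : a.wt + 2 = b.wt) (h' : b.wt + 2 = c.wt),
    Hom2 k (-2, 1) (E h ≫ E h') (E h ≫ E h')
  η : ∀ {a b : UObj} (h : a.wt + 2 = b.wt), Hom2 k (1 + a.wt, 0) (𝟙 (obj a)) (E h ≫ F h)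
  ε : ∀ {a b : UObj} (h : a.wt + 2 = b.wt), Hom2 k (1 - b.wt, 0) (F h ≫ E h) (𝟙 (obj b))
  τ_sq : ∀ {a b c : UObj} (h : a.wt + 2 = b.wt) (h' : b.wt + 2 = c.wt),
    comp2 (r := (-4, 0)) rfl (τ h h') (τ h h') = 0
  x_τ : ∀ {a b c : UObj} (h : a.wt + 2 = b.wt) (h' : b.wt + 2 = c.wt),
    comp2 (r := 0) rfl (whR (x h) (E h') rfl rfl) (τ h h') +
      comp2 (r := 0) rfl (τ h h') (whL (E h) (x h') rfl rfl) = id2 _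
  τ_x : ∀ {a b c : UObj} (h : a.wt + 2 = b.wt) (h' : b.wt + 2 = c.wt),
    comp2 (r := 0) rfl (τ h h') (whR (x h) (E h') rfl rfl) +
      comp2 (r := 0) rfl (whL (E h) (x h') rfl rfl) (τ h h') = id2 _
  braid : ∀ {a b c d : UObj} (h : a.wt + 2 = b.wt) (h' : b.wt + 2 = c.wt) (h'' : c.wt + 2 = d.wt),
    comp2 (r := (-6, 1)) rfl (whL (E h) (τ h' h'') rfl rfl)
      (comp2 (r := (-4, 0)) rfl
        (whR (τ h h') (E h'') (Category.assoc _ _ _).symm (Category.assoc _ _ _).symm)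
        (whL (E h) (τ h' h'') rfl rfl)) =
    comp2 (r := (-6, 1)) rfl
      (whR (τ h h') (E h'') (Category.assoc _ _ _).symm (Category.assoc _ _ _).symm)
      (comp2 (r := (-4, 0)) rfl (whL (E h) (τ h' h'') rfl rfl)
        (whR (τ h h') (E h'') (Category.assoc _ _ _).symm (Category.assoc _ _ _).symm))
  zigzag_E : ∀ {a b : UObj} (h : a.wt + 2 = b.wt), comp2 (r := 0) (by ext <;> simp; lia)
    (whR (η h) (E h) (Category.id_comp _).symm (Category.assoc _ _ _).symm)
    (whL (E h) (ε h) rfl (Category.comp_id _).symm) = id2 (E h)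
  zigzag_F : ∀ {a b : UObj} (h : a.wt + 2 = b.wt), comp2 (r := 0) (by ext <;> simp; lia)
    (whL (F h) (η h) (Category.comp_id _).symm rfl)
    (whR (ε h) (F h) (Category.assoc _ _ _).symm (Category.id_comp _).symm) = id2 (F h)
  sl : ∀ {a b c : UObj} (h : a.wt + 2 = b.wt) (h' : b.wt + 2 = c.wt),
    SlInverse k b.wt (crossOf (τ h h') (η h') (ε h)) (capOf (x h) (ε h)) (cupOf (x h') (η h'))

namespace OddModel

variable {k} (R : OddModel k C)

/-- The value on a letter. -/
def letter : (l : Letter) → {a b : UObj} → a.wt + l.weight = b.wt → (R.obj a ⟶ R.obj b)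
  | .E, _, _, h => R.E h
  | .F, a, b, h => R.F (show b.wt + 2 = a.wt by simp only [Letter.weight] at h; lia)

theorem eq_of_wt {a b : UObj} (h : a.wt + wordWeight [] = b.wt) : a = b :=
  UObj.ext (by simpa [wordWeight] using h)

/-- The value on a word. -/
def word : (w : List Letter) → {a b : UObj} → a.wt + wordWeight w = b.wt → (R.obj a ⟶ R.obj b)
  | [], _, _, h => eqToHom (congrArg R.obj (eq_of_wt h))
  | [l], _, _, h => R.letter l (by simpa [wordWeight] using h)
  | l :: l' :: w, a, b, h => R.letter l (b := ⟨a.wt + l.weight⟩) rfl ≫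
      word (l' :: w) (by rw [← h]; simp [wordWeight]; ring)

theorem word_append : ∀ (w w' : List Letter) {a b c : UObj} (h : a.wt + wordWeight w = b.wt)
    (h' : b.wt + wordWeight w' = c.wt) (h'' : a.wt + wordWeight (w ++ w') = c.wt),
    R.word (w ++ w') h'' = R.word w h ≫ R.word w' h'
  | [], w', a, b, c, h, h', h'' => by
    obtain rfl := eq_of_wt h
    exact (Category.id_comp _).symm
  | [l], [], a, b, c, h, h', h'' => by
    obtain rfl := eq_of_wt h'
    exact (Category.comp_id _).symm
  | [l], l' :: w', a, b, c, h, h', h'' => by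
    obtain rfl : b = ⟨a.wt + l.weight⟩ := UObj.ext (by rw [← h]; simp [wordWeight])
    rfl
  | l :: l' :: w, w', a, b, c, h, h', h'' => by
    have := word_append (l' :: w) w' (a := ⟨a.wt + l.weight⟩) (b := b) (c := c)
      (by rw [← h]; simp [wordWeight]; ring) h' (by rw [← h'']; simp [wordWeight]; ring)
    change R.letter l _ ≫ R.word ((l' :: w) ++ w') _ = (R.letter l _ ≫ R.word (l' :: w) _) ≫ _
    rw [this, Category.assoc]

/-- The functor on 1-morphisms. -/
def fn : UObj ⥤ C where
  obj := R.obj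
  map f := R.word (UHom.word f) (UHom.target f)
  map_id _ := rfl
  map_comp _ _ := R.word_append _ _ _ _ _

/-- The inverses in the weight of `a`. -/
def slAt (a : UObj) : SlInverse k a.wt
    (crossOf (R.τ (a := ⟨a.wt + -2⟩) (b := a) (c := ⟨a.wt + 2⟩) (by simp) rfl) (R.η rfl)
      (R.ε (by simp)))
    (capOf (R.x (a := ⟨a.wt + -2⟩) (b := a) (by simp)) (R.ε (by simp)))
    (cupOf (R.x (a := a) (b := ⟨a.wt + 2⟩) rfl) (R.η rfl)) :=
  R.sl (a := ⟨a.wt + -2⟩) (b := a) (c := ⟨a.wt + 2⟩) (by simp) rfl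

/-- The value on the formal 2-morphisms. -/
def interp : ∀ {p : Deg} {a b : UObj} {f g : a ⟶ b}, Term k p f g →
    Hom2 k p (R.fn.map f) (R.fn.map g)
  | _, _, _, _, _, .zero _ _ _ => 0
  | _, _, _, _, _, .add s t => interp s + interp t
  | _, _, _, _, _, .smul c t => c • interp t
  | _, _, _, _, _, .id _ e => castDeg k e.symm (id2 _)
  | _, _, _, _, _, .comp e s t => comp2 e (interp s) (interp t)
  | _, _, _, _, _, .whL f t hy hz => whL (R.fn.map f) (interp t) (by rw [hy, R.fn.map_comp])
      (by rw [hz, R.fn.map_comp])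
  | _, _, _, _, _, .whR t h hy hz => whR (interp t) (R.fn.map h) (by rw [hy, R.fn.map_comp])
      (by rw [hz, R.fn.map_comp])
  | _, _, _, _, _, .x h => R.x h
  | _, _, _, _, _, @Term.τ _ a b h => R.τ (a := a) (b := ⟨a.wt + 2⟩) (c := b) rfl (by rw [← h]; ring)
  | _, _, _, _, _, .η a => R.η (a := a) (b := ⟨a.wt + 2⟩) rfl
  | _, _, _, _, _, .ε a => R.ε (a := ⟨a.wt + -2⟩) (b := a) (by simp)
  | _, _, _, _, _, .crossInv a => (R.slAt a).inv
  | _, _, _, _, _, .toEF a j h => (R.slAt a).toEF j h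
  | _, _, _, _, _, .ofFE a j h => (R.slAt a).ofFE j h

theorem interp_xpow {a b : UObj} (h : a.wt + 2 = b.wt) (j : ℕ) :
    R.interp (.xpow h j) = xpowOf (R.x h) j := by
  induction j with
  | zero => rfl
  | succ j ih => exact congrArg (fun y => comp2 _ y (R.x h)) ih

theorem crossOf_eq {a b b' c : UObj} (h : a.wt + 2 = b.wt) (h' : b.wt + 2 = c.wt)
    (h₁ : a.wt + 2 = b'.wt) (h₂ : b'.wt + 2 = c.wt) {g g' : R.obj b ⟶ R.obj b} {y : R.obj a ⟶ R.obj b}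
    (hy : y = (R.E h₁ ≫ R.E h₂) ≫ R.F h') (hg : g = (R.F h ≫ R.E h) ≫ R.E h' ≫ R.F h')
    (hg₁ : g = R.F h ≫ y) (hg₂ : g' = R.F h ≫ y) (hg' : g' = (R.F h ≫ R.E h) ≫ R.E h' ≫ R.F h')
    (e₁ : (1 + b.wt - 2, (1 : ZMod 2)) + (1 - b.wt, 0) = (0, 1))
    (e₂ : (1 + b.wt, (0 : ZMod 2)) + (-2, 1) = (1 + b.wt - 2, 1)) :
    comp2 e₁ (comp2 e₂ (whL (R.F h ≫ R.E h) (R.η h') (Category.comp_id _).symm hg)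
      (whL (R.F h) (whR (R.τ h₁ h₂) (R.F h') hy hy) hg₁ hg₂))
      (whR (R.ε h) (R.E h' ≫ R.F h') hg' (Category.id_comp _).symm) =
    crossOf (R.τ h h') (R.η h') (R.ε h) := by
  obtain rfl : b = b' := UObj.ext (by lia)
  have hy' : y = R.E h₁ ≫ R.E h₂ ≫ R.F h' := hy.trans (Category.assoc _ _ _)
  subst hy' hg₁ hg₂
  rfl

theorem interp_cross (a : UObj) : R.interp (.cross a) =
    crossOf (R.τ (a := ⟨a.wt + -2⟩) (b := a) (c := ⟨a.wt + 2⟩) (by simp) rfl) (R.η rfl)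
      (R.ε (by simp)) :=
  R.crossOf_eq (a := ⟨a.wt + -2⟩) (b := a) (b' := ⟨a.wt + -2 + 2⟩) (c := ⟨a.wt + 2⟩) (by simp) rfl
    rfl (by simp)
    (R.fn.map_comp (oneEE (by simp; ring)) (oneF (by simp))) (R.fn.map_comp (oneEF a) (oneFE a)) rfl rfl
    (R.fn.map_comp (oneEF a) (oneFE a)) _ _

theorem interp_cap (a : UObj) (j : ℕ) : R.interp (.cap a j) =
    capOf (R.x (a := ⟨a.wt + -2⟩) (b := a) (by simp)) (R.ε (by simp)) j := by
  unfold capOf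
  rw [← interp_xpow]
  rfl

theorem interp_cup (a : UObj) (j : ℕ) : R.interp (.cup a j) =
    cupOf (R.x (a := a) (b := ⟨a.wt + 2⟩) rfl) (R.η rfl) j := by
  unfold cupOf
  rw [← interp_xpow]
  rfl

theorem interp_sum {p : Deg} {a b : UObj} {f g : a ⟶ b} (N : ℕ)
    (t : (j : ℕ) → j < N → Term k p f g) :
    R.interp (.sum N t) = ∑ j : Fin N, R.interp (t j j.2) := by
  induction N with
  | zero => rfl
  | succ N ih =>
    rw [Fin.sum_univ_castSucc]
    exact congrArg (· + _) (ih fun j h => t j (by lia))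


theorem zigzag_E_interp {a a' b : UObj} (h : a.wt + 2 = b.wt) (h' : a'.wt + 2 = b.wt)
    {y : R.obj a ⟶ R.obj b} (hy : y = R.E h ≫ R.F h' ≫ R.E h') (hy' : y = (R.E h ≫ R.F h) ≫ R.E h)
    (e : (1 + a.wt, (0 : ZMod 2)) + (1 - b.wt, (0 : ZMod 2)) = 0) :
    comp2 e (whR (R.η h) (R.E h) (Category.id_comp _).symm hy')
      (whL (R.E h) (R.ε h') hy (Category.comp_id _).symm) = id2 (R.E h) := by
  obtain rfl : a = a' := UObj.ext (by lia)
  subst hy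
  exact R.zigzag_E h

theorem zigzag_F_interp {a b c : UObj} (h : a.wt + 2 = b.wt) (h' : a.wt + 2 = c.wt)
    {y : R.obj b ⟶ R.obj a} (hy : y = R.F h ≫ R.E h' ≫ R.F h') (hy' : y = (R.F h ≫ R.E h) ≫ R.F h)
    (e : (1 + a.wt, (0 : ZMod 2)) + (1 - b.wt, (0 : ZMod 2)) = 0) :
    comp2 e (whL (R.F h) (R.η h') (Category.comp_id _).symm hy)
      (whR (R.ε h) (R.F h) hy' (Category.id_comp _).symm) = id2 (R.F h) := by
  obtain rfl : b = c := UObj.ext (by lia)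
  subst hy
  exact R.zigzag_F h

theorem comp_whL_interp {p : Deg} {a b c d : C} {F : a ⟶ c} {f : a ⟶ b} {f' : b ⟶ c}
    (hF : F = f ≫ f') {g h : c ⟶ d} {s t : b ⟶ d} {y z : a ⟶ d} (α : Hom2 k p g h)
    (hs : s = f' ≫ g) (ht : t = f' ≫ h) (hy : y = f ≫ s) (hz : z = f ≫ t) (hy' : y = F ≫ g)
    (hz' : z = F ≫ h) : whL F α hy' hz' = whL f (whL f' α hs ht) hy hz := by
  subst hF; exact comp_whL _ _ _ _ _ _ _ _ _

theorem whR_comp_interp {p : Deg} {a b c d : C} {f g : a ⟶ b} {H : b ⟶ d} {h : b ⟶ c} {h' : c ⟶ d}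
    (hH : H = h ≫ h') {s t : a ⟶ c} {y z : a ⟶ d} (α : Hom2 k p f g) (hs : s = f ≫ h)
    (ht : t = g ≫ h) (hy : y = s ≫ h') (hz : z = t ≫ h') (hy' : y = f ≫ H) (hz' : z = g ≫ H) :
    whR α H hy' hz' = whR (whR α h hs ht) h' hy hz := by
  subst hH; exact whR_comp _ _ _ _ _ _ _ _ _

theorem interp_rel {p : Deg} {a b : UObj} {f g : a ⟶ b} {s t : Term k p f g} (h : Rel k s t) :
    R.interp s = R.interp t := by
  induction h with
  | add_left t _ ih => exact congrArg (· + _) ih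
  | add_right s _ ih => exact congrArg (_ + ·) ih
  | smul_congr c _ ih => exact congrArg (c • ·) ih
  | comp_left e t _ ih => exact congrArg (fun y => comp2 e y _) ih
  | comp_right e t _ ih => exact congrArg (fun y => comp2 e _ y) ih
  | whL_congr f hy hz _ ih => exact congrArg (fun y => whL _ y _ _) ih
  | whR_congr f hy hz _ ih => exact congrArg (fun y => whR y _ _ _) ih
  | add_assoc => exact add_assoc _ _ _
  | add_comm => exact add_comm _ _
  | zero_add => exact zero_add _
  | zero_smul => exact zero_smul _ _
  | one_smul => exact one_smul _ _
  | mul_smul => exact mul_smul _ _ _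
  | add_smul => exact add_smul _ _ _
  | smul_add => exact smul_add _ _ _
  | add_comp => exact add_comp2 _ _ _ _
  | comp_add => exact comp2_add _ _ _ _
  | smul_comp => exact smul_comp2 _ _ _ _
  | comp_smul => exact comp2_smul _ _ _ _
  | id_comp e₀ e t => exact tw_id2_comp2 _ _ _
  | comp_id e₀ e t => exact tw_comp2_id2 _ _ _
  | assoc => exact assoc2 _ _ _ _ _ _ _
  | whL_add => exact whL_add _ _ _ _ _
  | whL_smul => exact whL_smul _ _ _ _ _
  | whL_id f g e hy => subst e; exact whL_id2 _ _ _
  | whL_comp => exact whL_comp2 _ _ _ _ _ _ _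
  | id_whL => exact id_whL _ _ _
  | comp_whL => exact comp_whL_interp (R.fn.map_comp _ _) _ _ _ _ _ _ _
  | whR_add => exact whR_add _ _ _ _ _
  | whR_smul => exact whR_smul _ _ _ _ _
  | whR_id f g e hy => subst e; exact whR_id2 _ _ _
  | whR_comp => exact whR_comp2 _ _ _ _ _ _ _
  | whR_one => exact whR_id _ _ _
  | whR_whR => exact whR_comp_interp (R.fn.map_comp _ _) _ _ _ _ _ _ _
  | whL_whR => exact whL_whR _ _ _ _ _ _ _ _ _ _ _
  | interchange e e' s t => exact interchange _ _ _ _ _ _ _ _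
  | τ_sq h => exact R.τ_sq _ _
  | x_τ h h₁ h₂ =>
    obtain rfl : _ = (⟨_ + 2⟩ : UObj) := UObj.ext h₁.symm
    exact R.x_τ _ _
  | τ_x h h₁ h₂ =>
    obtain rfl : _ = (⟨_ + 2⟩ : UObj) := UObj.ext h₁.symm
    exact R.τ_x _ _
  | @braid a b c d h₁ h₂ h₃ h₄ f hf hf' =>
    obtain rfl : b = ⟨a.wt + 2⟩ := UObj.ext h₁.symm
    obtain rfl : c = ⟨a.wt + 2 + 2⟩ := UObj.ext (by simp only; lia)
    subst hf
    exact R.braid (a := a) (b := ⟨a.wt + 2⟩) (c := ⟨a.wt + 2 + 2⟩) rfl rfl h₄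
  | @zigzag_E a b h =>
    obtain rfl : b = ⟨a.wt + 2⟩ := UObj.ext h.symm
    exact R.zigzag_E_interp (a := a) (a' := ⟨a.wt + 2 + -2⟩) (b := ⟨a.wt + 2⟩) rfl (by simp)
      (R.fn.map_comp (oneE h) (oneEF _)) (R.fn.map_comp (oneFE a) (oneE h)) _
  | @zigzag_F a b h =>
    obtain rfl : b = ⟨a.wt + -2⟩ := UObj.ext (by lia)
    exact R.zigzag_F_interp (b := a) (a := ⟨a.wt + -2⟩) (c := ⟨a.wt + -2 + 2⟩) (by simp) rfl
      (R.fn.map_comp (oneF h) (oneFE _)) (R.fn.map_comp (oneEF a) (oneF h)) _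
  | iso_EF a =>
    change comp2 _ (R.interp (.cross a)) _ + R.interp (.sum _ _) = _
    rw [interp_cross, interp_sum]
    refine Eq.trans (congrArg (_ + ·) (Finset.sum_congr rfl fun j _ => ?_)) (R.slAt a).iso_EF
    exact congrArg (fun y => comp2 _ y _) (R.interp_cap a j)
  | iso_FE a =>
    change comp2 _ _ (R.interp (.cross a)) + R.interp (.sum _ _) = _
    rw [interp_cross, interp_sum]
    refine Eq.trans (congrArg (_ + ·) (Finset.sum_congr rfl fun j _ => ?_)) (R.slAt a).iso_FE
    exact congrArg (fun y => comp2 _ _ y) (R.interp_cup a j)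
  | crossInv_cap a j h =>
    exact (congrArg (fun y => comp2 _ _ y) (R.interp_cap a j)).trans ((R.slAt a).inv_cap j h)
  | toEF_cross a j h =>
    exact (congrArg (fun y => comp2 _ _ y) (R.interp_cross a)).trans ((R.slAt a).toEF_cross j h)
  | toEF_cap a j h =>
    exact (congrArg (fun y => comp2 _ _ y) (R.interp_cap a j)).trans ((R.slAt a).toEF_cap j h)
  | toEF_cap_ne a i j hi hj hij =>
    exact (congrArg (fun y => comp2 _ _ y) (R.interp_cap a j)).trans
      ((R.slAt a).toEF_cap_ne i j hi hj hij)
  | cup_crossInv a j h =>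
    exact (congrArg (fun y => comp2 _ y _) (R.interp_cup a j)).trans ((R.slAt a).cup_inv j h)
  | cross_ofFE a j h =>
    exact (congrArg (fun y => comp2 _ y _) (R.interp_cross a)).trans ((R.slAt a).cross_ofFE j h)
  | cup_ofFE a j h =>
    exact (congrArg (fun y => comp2 _ y _) (R.interp_cup a j)).trans ((R.slAt a).cup_ofFE j h)
  | cup_ofFE_ne a i j hi hj hij =>
    exact (congrArg (fun y => comp2 _ y _) (R.interp_cup a i)).trans
      ((R.slAt a).cup_ofFE_ne i j hi hj hij)

/-- The strict 2-superfunctor defined by a model. -/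
def strictFun : StrictFun k UObj C where
  fn := R.fn
  map2 α := Quot.lift R.interp (fun _ _ h => R.interp_rel h) (show UHom2 k _ _ _ from α)
  map2_add := by rintro _ _ _ _ _ ⟨s⟩ ⟨t⟩; rfl
  map2_smul := by rintro _ _ _ _ _ c ⟨t⟩; rfl
  map2_id2 f := rfl
  map2_comp2 := by rintro _ _ _ _ _ _ _ _ e ⟨s⟩ ⟨t⟩; rfl
  map2_whL := by rintro _ _ _ _ f _ _ _ _ ⟨t⟩ hs ht; rfl
  map2_whR := by rintro _ _ _ _ _ _ _ _ ⟨t⟩ h hs ht; rfl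

end OddModel

end

end OddCat

namespace OddCat

open TwoSupercat.HHom

namespace StrictFun

section
variable {k : Type u} [Field k] {B : Type w} [Category.{w'} B] [TwoSupercat.{u, w, w'} k B]
  {C : Type v} [Category.{v'} C] [TwoSupercat.{u, v, v'} k C]
  (G : StrictFun k B C) (S : ShiftData k G.fn.obj)

/-- The extension to the envelope is isomorphic to the given 2-superfunctor on `B`. -/
def envMapIso {a b : B} (f : a ⟶ b) : Iso2 k ((G.envelope S).map (envMap f)) (G.fn.map f) where
  hom := G.J S (envMap f) 0 neg_zero.symm
  inv := G.Ji S (envMap f) 0 rfl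
  hom_inv := pk_inj ((pk_comp2 _ _ _).trans (G.J_Ji S (envMap f) _ _))
  inv_hom := pk_inj ((pk_comp2 _ _ _).trans (G.Ji_J S (envMap f) _ _))

theorem pk_J {a b : Envelope B} (f : a ⟶ b) {p q : Deg} (hp : p = -EnvHom.shift f)
    (hq : q = -EnvHom.shift f) : pk (G.J S f p hp) = pk (G.J S f q hq) := by subst hp hq; rfl

theorem wl_cmp_JJi {a b c : C} {f f' : a ⟶ b} {g g' : b ⟶ c} {m s : a ⟶ c} {σ : c ⟶ c}
    (hm : m = f ≫ g) (α : HHom k f' f) (αi : HHom k f f') (β : HHom k g' g) (βi : HHom k g g')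
    (hα : cmp αi α = pk (id2 f)) (hβ : cmp βi β = pk (id2 g)) (h0 : α.1.2 = 0)
    (γ : HHom k σ (𝟙 c)) (hs : s = m ≫ σ) (h : f ≫ g = m ≫ 𝟙 c) :
    cmp (cmp (wl m γ hs (Category.comp_id m).symm)
      (cmp (wr αi g hm rfl) (wl f' βi rfl rfl))) (cmp (wr α g' rfl rfl) (wl f β rfl rfl)) =
      wl m γ hs h := by
  subst hm
  rw [interchange_symm α β rfl rfl rfl rfl, h0, zero_mul, sgn_zero, one_sm, HHom.assoc, HHom.assoc,
    ← HHom.assoc (wl f' βi _ _), ← wl_cmp, hβ, wl_id, id_cmp, ← wr_cmp, hα, wr_id, cmp_id]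

theorem pk_pair {a b c : B} (f : a ⟶ b) (g : b ⟶ c) {fg : a ⟶ c} (e : fg = f ≫ g)
    (h : G.fn.map f ≫ G.fn.map g = G.fn.map fg ≫ 𝟙 _) :
    pk ((G.envelope S).pair (envMap_comp e) (G.envMapIso S f) (G.envMapIso S g)) =
      wl (G.fn.map fg) (pk (S.j c 0 0 neg_zero.symm)) rfl h := by
  unfold TwoSuperfunctor.pair
  rw [pk_comp2, pk_comp2]
  change cmp (pk (G.envComp S (envMap f) (envMap g) (envMap_comp e)).inv) _ = _
  rw [pk_envComp_inv]
  have hm : G.fn.map (EnvHom.mor (envMap fg)) = G.fn.map f ≫ G.fn.map g :=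
    (congrArg G.fn.map e).trans (G.fn.map_comp f g)
  have key := wl_cmp_JJi hm (pk (G.J S (envMap f) 0 neg_zero.symm)) (pk (G.Ji S (envMap f) 0 rfl))
    (pk (G.J S (envMap g) 0 neg_zero.symm)) (pk (G.Ji S (envMap g) 0 rfl))
    (G.Ji_J S (envMap f) neg_zero.symm rfl) (G.Ji_J S (envMap g) neg_zero.symm rfl) rfl
    (pk (S.j c 0 0 neg_zero.symm)) rfl h
  rw [G.pk_J S (envMap fg) rfl neg_zero.symm]
  exact key

theorem pk_map2_envMap2 {p : Deg} {a b : B} {f g : a ⟶ b} (α : Hom2 k p f g) :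
    pk ((G.envelope S).map2 (envMap2 α)) = cmp (pk (G.J S (envMap f) 0 neg_zero.symm))
      (cmp (pk (G.map2 α)) (pk (G.Ji S (envMap g) 0 rfl))) := by
  refine (G.pk_envMap2' S (envMap2 α)).trans ?_
  have : G.hmap (under (envMap2 α)) = pk (G.map2 α) :=
    congrArg G.hmap (pk_castDeg (k := k) _ α)
  rw [this, G.pk_J S (envMap f) rfl neg_zero.symm]
  rfl

theorem map2_envMap2_comp {p : Deg} {a b : B} {f g : a ⟶ b} (α : Hom2 k p f g) :
    cmp (pk ((G.envelope S).map2 (envMap2 α))) (pk (G.envMapIso S g).hom) =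
      cmp (pk (G.envMapIso S f).hom) (pk (G.map2 α)) := by
  rw [pk_map2_envMap2]
  refine (HHom.assoc _ _ _).trans (congrArg _ ((HHom.assoc _ _ _).trans
    ((congrArg _ ?_).trans (cmp_id _))))
  exact G.Ji_J S (envMap g) neg_zero.symm rfl

end

end StrictFun

namespace OddModel

variable {k : Type u} [Field k] {C : Type v} [Category.{w} C] [TwoSupercat.{u, v, w} k C]
  (R : OddModel k C)

theorem exists_twoSuperfunctor (S : ShiftData k R.strictFun.fn.obj) :
    ∃ (Φ : TwoSuperfunctor k (fun a : Envelope UObj => R.obj a.as))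
      (eE : ∀ (a b : UObj) (h : a.wt + 2 = b.wt), Iso2 k (Φ.map (envMap (oneE h))) (R.E h))
      (eF : ∀ (a b : UObj) (h : a.wt + 2 = b.wt), Iso2 k (Φ.map (envMap (oneF h))) (R.F h)),
      (∀ (a b : UObj) (h : a.wt + 2 = b.wt),
        comp2 (add_zero _) (Φ.map2 (envMap2 (genX k h))) (eE a b h).hom =
          comp2 (zero_add _) (eE a b h).hom (R.x h)) ∧
      (∀ (a b c : UObj) (h : a.wt + 2 = b.wt) (h' : b.wt + 2 = c.wt) (h'' : a.wt + 4 = c.wt),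
        comp2 (add_zero _) (Φ.map2 (envMap2 (genTau k h'')))
            (Φ.pair (envMap_comp rfl) (eE a b h) (eE b c h')) =
          comp2 (zero_add _) (Φ.pair (envMap_comp rfl) (eE a b h) (eE b c h')) (R.τ h h')) ∧
      (∀ (a b : UObj) (h : a.wt + 2 = b.wt),
        comp2 (zero_add _) (Φ.mapId (Envelope.mk a)).hom
            (comp2 (add_zero _) (Φ.map2 (envMap2 (genEta k a)))
              (Φ.pair (envMap_comp rfl) (eE a b h) (eF a b h))) = R.η h) ∧
      (∀ (a b : UObj) (h : a.wt + 2 = b.wt),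
        comp2 (r := (1 - b.wt, 0)) (zero_add _)
            (Φ.pair (envMap_comp rfl) (eF a b h) (eE a b h)) (R.ε h) =
          comp2 (add_zero _) (Φ.map2 (envMap2 (genEps k b))) (Φ.mapId (Envelope.mk b)).inv) := by
  refine ⟨R.strictFun.envelope S, fun a b h => R.strictFun.envMapIso S (oneE h),
    fun a b h => R.strictFun.envMapIso S (oneF h), ?_, ?_, ?_, ?_⟩
  · intro a b h
    refine pk_inj ((pk_comp2 _ _ _).trans (Eq.trans ?_ (pk_comp2 _ _ _).symm))
    exact R.strictFun.map2_envMap2_comp S (genX k h)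
  · intro a b c h h' h''
    obtain rfl : b = ⟨a.wt + 2⟩ := UObj.ext h.symm
    refine pk_inj ((pk_comp2 _ _ _).trans (Eq.trans ?_ (pk_comp2 _ _ _).symm))
    have hp := R.strictFun.pk_pair S (oneE h) (oneE h') (fg := oneEE h'') rfl
      (Category.comp_id _).symm
    have key := R.strictFun.map2_envMap2_comp S (genTau k h'')
    exact (congrArg _ hp).trans (key.trans (congrArg (fun y => HHom.cmp y _) hp.symm))
  · intro a b h
    obtain rfl : b = ⟨a.wt + 2⟩ := UObj.ext h.symm
    refine pk_inj ((pk_comp2 _ _ _).trans ((congrArg _ (pk_comp2 _ _ _)).trans ?_))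
    have hp := R.strictFun.pk_pair S (oneE h) (oneF h) (fg := oneFE a) rfl
      (Category.comp_id _).symm
    have key := R.strictFun.map2_envMap2_comp S (genEta k a)
    refine (congrArg _ ((congrArg _ hp).trans key)).trans ?_
    refine (HHom.assoc _ _ _).symm.trans ((congrArg (fun y => HHom.cmp y _) ?_).trans (id_cmp _))
    exact (congrArg (fun y => HHom.cmp y _) (wr_one _ _ _)).trans
      (R.strictFun.Ji_J S (𝟙 (Envelope.mk a)) neg_zero.symm rfl)
  · intro a b h
    obtain rfl : a = ⟨b.wt + -2⟩ := UObj.ext (by simp only; lia)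
    refine pk_inj ((pk_comp2 _ _ _).trans (Eq.trans ?_ (pk_comp2 _ _ _).symm))
    have hp := R.strictFun.pk_pair S (oneF h) (oneE h) (fg := oneEF b) rfl
      (Category.comp_id _).symm
    have key := R.strictFun.map2_envMap2_comp S (genEps k b)
    refine ((congrArg (fun y => HHom.cmp y _) hp).trans key.symm).trans (congrArg _ ?_)
    exact (wr_one _ _ _).symm

end OddModel

end OddCat

namespace OddCat

/-! ## The Mackey decomposition -/

/-- Descent of an equivariant bijection `V ≃ W` of right modules along universal balanced maps
`V × M → X` and `W × M → Y`. -/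
theorem bijective_of_balanced {k : Type u} [Field k] {B V W M X Y : Type*} [AddCommGroup V]
    [Module k V] [AddCommGroup W] [Module k W] [AddCommGroup M] [Module k M] [AddCommGroup X]
    [Module k X] [AddCommGroup Y] [Module k Y] (act : B → M → M) (actV : B → V → V)
    (actW : B → W → W) (Θ : V ≃ₗ[k] W) (hΘ : ∀ b v, Θ (actV b v) = actW b (Θ v))
    (φ : V →ₗ[k] M →ₗ[k] X) (ψ : W →ₗ[k] M →ₗ[k] Y)
    (hφ : ∀ b v y, φ (actV b v) y = φ v (act b y))
    (span : ∀ S : Submodule k X, (∀ v y, φ v y ∈ S) → S = ⊤)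
    (span' : ∀ S : Submodule k Y, (∀ w y, ψ w y ∈ S) → S = ⊤)
    (univ : ∀ β : W →ₗ[k] M →ₗ[k] X, (∀ b w y, β (actW b w) y = β w (act b y)) →
      ∃ H : Y →ₗ[k] X, ∀ w y, H (ψ w y) = β w y)
    (G : X →ₗ[k] Y) (hG : ∀ v y, G (φ v y) = ψ (Θ v) y) : Function.Bijective G := by
  constructor
  · obtain ⟨H, hH⟩ := univ (φ ∘ₗ Θ.symm.toLinearMap) fun b w y => by
      have : Θ.symm (actW b w) = actV b (Θ.symm w) := by
        rw [LinearEquiv.symm_apply_eq, hΘ, Θ.apply_symm_apply]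
      change φ (Θ.symm (actW b w)) y = φ (Θ.symm w) (act b y)
      rw [this, hφ]
    have : LinearMap.eqLocus (H ∘ₗ G) LinearMap.id = ⊤ := span _ fun v y => by
      change H (G (φ v y)) = φ v y
      rw [hG, hH]
      change φ (Θ.symm (Θ v)) y = φ v y
      rw [Θ.symm_apply_apply]
    refine Function.LeftInverse.injective (g := H) fun x => ?_
    have hx : x ∈ LinearMap.eqLocus (H ∘ₗ G) LinearMap.id := by rw [this]; trivial
    exact hx
  · rw [← LinearMap.range_eq_top]
    refine span' _ fun w y => ⟨φ (Θ.symm w) y, ?_⟩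
    rw [hG, Θ.apply_symm_apply]

namespace ONH

open TensorProduct

section
variable {k : Type u} [Field k] {n m : ℕ}

variable (k n m) in
/-- The tensor square of `ONH_(m+1)^n` over `ONH_m^n`. -/
abbrev TensorSq : Type u :=
  ((ONH k n (m + 1)).carrier ⊗[k] (ONH k n (m + 1)).carrier) ⧸ balanced k n m

/-- A balanced map, on the tensor square. -/
noncomputable def TensorSq.lift {V : Type*} [AddCommGroup V] [Module k V]
    (F : (ONH k n (m + 1)).carrier ⊗[k] (ONH k n (m + 1)).carrier →ₗ[k] V)
    (hF : ∀ a c b, F ((a * up k n m c) ⊗ₜ[k] b) = F (a ⊗ₜ[k] (up k n m c * b))) :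
    TensorSq k n m →ₗ[k] V :=
  (balanced k n m).liftQ F fun _ hz => map_eq_zero_of_mem_balanced F hF hz

variable (k n m) in
/-- The Mackey map at the regular module. -/
noncomputable def mackeyMap (N L : ℕ) :
    TensorSq k n m × (Fin N → (ONH k n (m + 1)).carrier) →ₗ[k]
      (ONH k n (m + 2)).carrier × (Fin L → (ONH k n (m + 1)).carrier) :=
  LinearMap.prod
    (LinearMap.coprod (TensorSq.lift (crossing k n m) crossing_balanced)
      (∑ r : Fin N, (LinearMap.mulLeft k (xx k n (m + 1) ^ (r : ℕ))) ∘ₗ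
        (up k n (m + 1)).toLinearMap ∘ₗ LinearMap.proj r))
    ((LinearMap.pi fun l : Fin L => TensorSq.lift (dotted k n m l) (dotted_balanced l)) ∘ₗ
      LinearMap.fst k _ _)

theorem mackeyMap_apply (N L : ℕ)
    (z : (ONH k n (m + 1)).carrier ⊗[k] (ONH k n (m + 1)).carrier)
    (t : Fin N → (ONH k n (m + 1)).carrier) :
    mackeyMap k n m N L (Submodule.Quotient.mk z, t) =
      (crossing k n m z + ∑ r : Fin N, xx k n (m + 1) ^ (r : ℕ) * up k n (m + 1) (t r),
        fun l : Fin L => dotted k n m l z) := by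
  refine Prod.ext ?_ rfl
  change crossing k n m z + (∑ r : Fin N, (LinearMap.mulLeft k (xx k n (m + 1) ^ (r : ℕ))) ∘ₗ
        (up k n (m + 1)).toLinearMap ∘ₗ LinearMap.proj r) t = _
  rw [LinearMap.sum_apply]
  rfl

theorem inv_involutive (s : ZMod 2) (b : (ONH k n m).carrier) :
    (ONH k n m).inv s ((ONH k n m).inv s b) = b :=
  GSAlg.inv_self _ s b

theorem mackeyMap_surjective {N L : ℕ} (h : 2 * (m + 1) + N = n + L) (h0 : N = 0 ∨ L = 0) :
    Function.Surjective (mackeyMap k n m N L) := by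
  rintro ⟨d, c⟩
  rcases h0 with rfl | rfl
  · obtain ⟨z, hz, hz'⟩ := exists_crossing_dotted_eq h d fun l =>
      if h : l < L then c ⟨l, h⟩ else 0
    refine ⟨(Submodule.Quotient.mk z, 0), ?_⟩
    rw [mackeyMap_apply, hz]
    refine Prod.ext (by simp) (funext fun l => ?_)
    change dotted k n m l z = c l
    rw [hz' l l.2, dif_pos l.2]
  · have hd : d ∈ crossRange k n m ⊔ polyLT k n (m + 1) N := by
      rw [crossRange_sup_polyLT_eq_top (by lia)]; trivial
    obtain ⟨_, ⟨z, rfl⟩, w, hw, rfl⟩ := Submodule.mem_sup.1 hd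
    obtain ⟨t, rfl⟩ := exists_sum_of_mem_polyLT hw
    refine ⟨(Submodule.Quotient.mk z, fun r => (ONH k n (m + 1)).inv (r : ℕ) (t r)), ?_⟩
    rw [mackeyMap_apply]
    refine Prod.ext ?_ (funext fun l => l.elim0)
    simp only [xx_pow_mul_up, inv_involutive]

theorem mackeyMap_injective {N L : ℕ} (h : 2 * (m + 1) + N = n + L) (h0 : N = 0 ∨ L = 0)
    (hm : m + 1 ≤ n) : Function.Injective (mackeyMap k n m N L) := by
  rw [injective_iff_map_eq_zero]
  rintro ⟨q, t⟩ hqt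
  obtain ⟨z, rfl⟩ := Submodule.Quotient.mk_surjective _ q
  rw [mackeyMap_apply] at hqt
  have h₁ := congrArg Prod.fst hqt
  have h₂ := fun l => congrFun (congrArg Prod.snd hqt) l
  simp only [Prod.fst_zero, Prod.snd_zero, Pi.zero_apply] at h₁ h₂
  obtain ⟨P⟩ := nonempty_pres k (n := n) (m := m) (by lia)
  obtain ⟨β, hβ, hβ'⟩ := P.exists_rep z 0
  have hβ0 : (∀ i, β i = 0) → z ∈ balanced k n m := fun h => by
    simpa only [h, zero_tmul, Finset.sum_const_zero, sub_zero] using hβ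
  have hg : ∀ j, ∑ i, (ONH k n (m + 1)).inv 1 (β i) *
      (ONH k n (m + 1)).inv 1 (up k n m (P.g i j)) = 0 := fun j => by
    simp only [← map_mul, ← map_sum, hβ' j, Pi.zero_apply, map_zero]
  rcases h0 with rfl | rfl
  · have key := (P.succPos h hm).map_injective (by lia)
      (a₁ := fun i => (ONH k n (m + 1)).inv 1 (β i)) (a₂ := 0) (by
        rw [map_zero]
        refine Prod.ext ?_ (funext fun j => ?_)
        · change ∑ i, up k n (m + 1) ((ONH k n (m + 1)).inv 1 (β i)) *
            (tt k n m * up k n (m + 1) (P.e i)) = 0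
          rw [← P.crossing_rep hβ]
          simpa using h₁
        · rcases j with j | l
          · exact hg j
          · change ∑ i, (ONH k n (m + 1)).inv 1 (β i) *
              (ONH k n (m + 1)).inv ((l : ℕ) + 1 : ℕ) (xx k n m ^ (l : ℕ) * P.e i) = 0
            have h₃ := congrArg ((ONH k n (m + 1)).inv ((l : ℕ) + 1 : ℕ)) (h₂ l)
            rw [P.dotted_rep hβ, map_sum, map_zero] at h₃
            rw [← h₃]
            refine Finset.sum_congr rfl fun i _ => ?_
            refine Eq.symm ((map_mul _ _ _).trans ?_)
            rw [GSAlg.inv_inv]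
            congr 2
            push_cast
            rw [add_right_comm, CharTwo.add_self_eq_zero, zero_add])
    refine Prod.ext ((Submodule.Quotient.mk_eq_zero _).2 (hβ0 fun i => ?_)) (Subsingleton.elim _ _)
    have := congrFun key i
    rw [← inv_involutive 1 (β i)]
    exact (congrArg _ this).trans (map_zero _)
  · have key := (P.succNeg (N := N) (by lia)).map_injective (by lia)
      (a₁ := Sum.elim (fun i => (ONH k n (m + 1)).inv 1 (β i))
        fun r => (ONH k n (m + 1)).inv (r : ℕ) (t r)) (a₂ := 0) (by
        rw [map_zero]
        refine Prod.ext ?_ (funext fun j => ?_)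
        · refine (Fintype.sum_sum_type _).trans ?_
          change ∑ i, up k n (m + 1) ((ONH k n (m + 1)).inv 1 (β i)) *
            (tt k n m * up k n (m + 1) (P.e i)) +
            ∑ r : Fin N, up k n (m + 1) ((ONH k n (m + 1)).inv (r : ℕ) (t r)) *
              xx k n (m + 1) ^ (r : ℕ) = 0
          rw [← P.crossing_rep hβ]
          simpa only [xx_pow_mul_up] using h₁
        · refine (Fintype.sum_sum_type _).trans ?_
          change ∑ i, (ONH k n (m + 1)).inv 1 (β i) *
            (ONH k n (m + 1)).inv 1 (up k n m (P.g i j)) + ∑ r : Fin N, _ * 0 = 0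
          refine (congrArg₂ (· + ·) (hg j) (Finset.sum_eq_zero fun r _ => mul_zero _)).trans
            (add_zero 0))
    refine Prod.ext ((Submodule.Quotient.mk_eq_zero _).2 (hβ0 fun i => ?_)) (funext fun r => ?_)
    · have := congrFun key (.inl i)
      rw [← inv_involutive 1 (β i)]
      exact (congrArg _ this).trans (map_zero _)
    · have := congrFun key (.inr r)
      change t r = 0
      rw [← inv_involutive (r : ℕ) (t r)]
      exact (congrArg _ this).trans (map_zero _)

/-- The Mackey isomorphism at the regular module. -/
noncomputable def mackeyEquiv {N L : ℕ} (h : 2 * (m + 1) + N = n + L) (h0 : N = 0 ∨ L = 0)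
    (hm : m + 1 ≤ n) : (TensorSq k n m × (Fin N → (ONH k n (m + 1)).carrier)) ≃ₗ[k]
      (ONH k n (m + 2)).carrier × (Fin L → (ONH k n (m + 1)).carrier) :=
  LinearEquiv.ofBijective (mackeyMap k n m N L)
    ⟨mackeyMap_injective h h0 hm, mackeyMap_surjective h h0⟩

variable (k n m) in
/-- The right action on the tensor square. -/
noncomputable def TensorSq.mulRight (b : (ONH k n (m + 1)).carrier) :
    TensorSq k n m →ₗ[k] TensorSq k n m :=
  TensorSq.lift ((balanced k n m).mkQ ∘ₗ LinearMap.lTensor _ (LinearMap.mulRight k b))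
    fun a c b' => by
      refine (Submodule.Quotient.eq _).2 (Submodule.subset_span ⟨a, c, b' * b, ?_⟩)
      simp only [LinearMap.lTensor_tmul, LinearMap.mulRight_apply, mul_assoc]

theorem TensorSq.mulRight_mk (b : (ONH k n (m + 1)).carrier)
    (z : (ONH k n (m + 1)).carrier ⊗[k] (ONH k n (m + 1)).carrier) :
    TensorSq.mulRight k n m b (Submodule.Quotient.mk z) =
      Submodule.Quotient.mk (LinearMap.lTensor _ (LinearMap.mulRight k b) z) := rfl

theorem crossing_mulRight (b : (ONH k n (m + 1)).carrier)
    (z : (ONH k n (m + 1)).carrier ⊗[k] (ONH k n (m + 1)).carrier) :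
    crossing k n m (LinearMap.lTensor _ (LinearMap.mulRight k b) z) =
      crossing k n m z * up k n (m + 1) b := by
  induction z with
  | zero => simp
  | tmul a a' =>
    rw [LinearMap.lTensor_tmul, LinearMap.mulRight_apply, sandwich_tmul, sandwich_tmul, map_mul,
      mul_assoc _ _ (up k n (m + 1) b)]
  | add x y hx hy => rw [map_add, map_add, map_add, hx, hy, add_mul]

theorem dotted_mulRight (l : ℕ) (b : (ONH k n (m + 1)).carrier)
    (z : (ONH k n (m + 1)).carrier ⊗[k] (ONH k n (m + 1)).carrier) :
    dotted k n m l (LinearMap.lTensor _ (LinearMap.mulRight k b) z) = dotted k n m l z * b := by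
  induction z with
  | zero => simp
  | tmul a a' =>
    rw [LinearMap.lTensor_tmul, LinearMap.mulRight_apply, dotted_tmul, dotted_tmul, mul_assoc _ a']
  | add x y hx hy => rw [map_add, map_add, map_add, hx, hy, add_mul]

theorem mackeyMap_mulRight {N L : ℕ} (b : (ONH k n (m + 1)).carrier)
    (v : TensorSq k n m × (Fin N → (ONH k n (m + 1)).carrier)) :
    mackeyMap k n m N L (TensorSq.mulRight k n m b v.1, fun r => v.2 r * b) =
      ((mackeyMap k n m N L v).1 * up k n (m + 1) b, fun l => (mackeyMap k n m N L v).2 l * b) := by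
  obtain ⟨q, t⟩ := v
  obtain ⟨z, rfl⟩ := Submodule.Quotient.mk_surjective _ q
  simp only [TensorSq.mulRight_mk, mackeyMap_apply, crossing_mulRight, dotted_mulRight, map_mul,
    add_mul, Finset.sum_mul, mul_assoc]

end

end ONH

end OddCat

namespace OddCat

/-! ## Inverses of matrices of supernatural transformations -/

namespace SMod

variable {k : Type u} [Field k] {A : GSAlg k}

/-- The projection to a homogeneous component. -/
noncomputable def proj (M : SMod A) (r : Deg) : M.carrier →ₗ[k] M.carrier :=
  (M.gr r).subtype ∘ₗ DirectSum.component k Deg (fun r => M.gr r) r ∘ₗ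
    (LinearEquiv.ofBijective (DirectSum.coeLinearMap M.gr) M.internal).symm.toLinearMap

theorem proj_mem (M : SMod A) (r : Deg) (x : M.carrier) : M.proj r x ∈ M.gr r := Subtype.prop _

theorem proj_of_mem (M : SMod A) {r : Deg} (s : Deg) {x : M.carrier} (hx : x ∈ M.gr r) :
    M.proj s x = if r = s then x else 0 := by
  have h : (LinearEquiv.ofBijective (DirectSum.coeLinearMap M.gr) M.internal).symm x =
      DirectSum.lof k Deg (fun r => M.gr r) r ⟨x, hx⟩ := by
    rw [LinearEquiv.symm_apply_eq]
    exact (DirectSum.coeLinearMap_lof M.gr r ⟨x, hx⟩).symm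
  change ((DirectSum.component k Deg (fun r => M.gr r) s
    ((LinearEquiv.ofBijective (DirectSum.coeLinearMap M.gr) M.internal).symm x) : M.gr s) :
      M.carrier) = _
  rw [h, DirectSum.component.of]
  split_ifs with e
  · subst e; rfl
  · rfl

theorem proj_self (M : SMod A) {r : Deg} {x : M.carrier} (hx : x ∈ M.gr r) : M.proj r x = x := by
  rw [M.proj_of_mem r hx, if_pos rfl]

theorem Hom.map_proj {p : Deg} {M N : SMod A} (f : Hom p M N) (r : Deg) (x : M.carrier) :
    f.1 (M.proj r x) = N.proj (r + p) (f.1 x) := by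
  induction x using M.hom_induction with
  | h q a ha =>
    rw [M.proj_of_mem r ha, N.proj_of_mem (r + p) (f.2.1 q a ha)]
    by_cases h : q = r
    · rw [if_pos h, if_pos (by rw [h])]
    · rw [if_neg h, if_neg fun h' => h (add_right_cancel h'), map_zero]
  | h0 => simp only [map_zero]
  | hadd a b ha hb => simp only [map_add, ha, hb]

end SMod

section
variable {k : Type u} [Field k] {C : GSCat k} {A : GSAlg k} {P : SMod A → Prop}

/-- The module underlying a value of a superfunctor to supermodules. -/
abbrev GSFun.mod (F : GSFun C ((sMod A).full P)) (X : C.Obj) : Type u := (F.obj X).1.carrier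

/-- The linear map underlying a component of a supernatural transformation. -/
abbrev natLin {p : Deg} {F G : GSFun C ((sMod A).full P)} (α : GSNat p F G) (X : C.Obj) :
    F.mod X →ₗ[k] G.mod X :=
  (show SMod.Hom p (F.obj X).1 (G.obj X).1 from α.1 X).1

variable {I J : Type} [Fintype I] [Fintype J] [DecidableEq I] [DecidableEq J]
  {F : I → GSFun C ((sMod A).full P)} {G : J → GSFun C ((sMod A).full P)} {p : I → J → Deg}
  (f : ∀ i j, GSNat (p i j) (F i) (G j))

/-- The linear map underlying a matrix of supernatural transformations. -/
noncomputable def matLin (X : C.Obj) : (∀ i, (F i).mod X) →ₗ[k] ∀ j, (G j).mod X :=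
  LinearMap.pi fun j => ∑ i, natLin (f i j) X ∘ₗ LinearMap.proj i

theorem matLin_apply (X : C.Obj) (v : ∀ i, (F i).mod X) (j : J) :
    matLin f X v j = ∑ i, natLin (f i j) X (v i) := by
  rw [matLin, LinearMap.pi_apply, LinearMap.sum_apply]
  rfl

variable (hf : ∀ X, Function.Bijective (matLin f X))

/-- The entries of the inverse matrix, as linear maps. -/
noncomputable def matInvLin (X : C.Obj) (j : J) (i : I) : (G j).mod X →ₗ[k] (F i).mod X :=
  LinearMap.proj i ∘ₗ (LinearEquiv.ofBijective _ (hf X)).symm.toLinearMap ∘ₗ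
    LinearMap.single k (fun j => (G j).mod X) j

theorem matInvLin_eq {X : C.Obj} {j : J} {w : (G j).mod X} {v : ∀ i, (F i).mod X}
    (h : ∀ j', ∑ i, natLin (f i j') X (v i) = (Pi.single j w : ∀ j, (G j).mod X) j') (i : I) :
    matInvLin f hf X j i w = v i := by
  have : (LinearEquiv.ofBijective _ (hf X)).symm (Pi.single j w) = v := by
    rw [LinearEquiv.symm_apply_eq]
    exact (funext fun j' => (matLin_apply f X v j').trans (h j')).symm
  exact congrFun this i

theorem sum_matInvLin (X : C.Obj) (j : J) (w : (G j).mod X) (j' : J) :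
    ∑ i, natLin (f i j') X (matInvLin f hf X j i w) = (Pi.single j w : ∀ j, (G j).mod X) j' := by
  rw [← matLin_apply f X (fun i => matInvLin f hf X j i w)]
  exact congrFun ((LinearEquiv.ofBijective _ (hf X)).apply_symm_apply (Pi.single j w)) j'

variable {e : I → Deg} {d : J → Deg} (hp : ∀ i j, p i j + e i = d j) {r : J → I → Deg}
  (hr : ∀ j i, r j i + d j = e i)

include hp hr in
theorem matInvLin_mem (X : C.Obj) (j : J) (i : I) (q : Deg) (w : (G j).mod X)
    (hw : w ∈ ((G j).obj X).1.gr q) :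
    matInvLin f hf X j i w ∈ ((F i).obj X).1.gr (q + r j i) := by
  rw [matInvLin_eq f hf (v := fun i => ((F i).obj X).1.proj (q + r j i) (matInvLin f hf X j i w))]
  · exact SMod.proj_mem _ _ _
  · intro j'
    have h : ∀ i, natLin (f i j') X (((F i).obj X).1.proj (q + r j i) (matInvLin f hf X j i w)) =
        ((G j').obj X).1.proj (q + d j' - d j) (natLin (f i j') X (matInvLin f hf X j i w)) :=
      fun i => by
        refine (SMod.Hom.map_proj (show SMod.Hom _ ((F i).obj X).1 ((G j').obj X).1 from
          (f i j').1 X) _ _).trans ?_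
        rw [← hp i j', eq_sub_of_add_eq (hr j i)]
        congr 2
        abel
    rw [Finset.sum_congr rfl fun i _ => h i, ← map_sum, sum_matInvLin]
    by_cases hj : j' = j
    · subst hj
      rw [Pi.single_eq_same, add_sub_cancel_right, SMod.proj_self _ hw]
    · rw [Pi.single_eq_of_ne hj, map_zero]

theorem natLin_smul {p : Deg} {F G : GSFun C ((sMod A).full P)} (α : GSNat p F G) (X : C.Obj)
    (a : A.carrier) (x : F.mod X) : natLin α X (a • x) = A.inv p.2 a • natLin α X x :=
  (show SMod.Hom p (F.obj X).1 (G.obj X).1 from α.1 X).2.2 a x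

/-- The linear map underlying the value of a superfunctor on a morphism. -/
abbrev GSFun.lin (F : GSFun C ((sMod A).full P)) {q : Deg} {X Y : C.Obj} (φ : C.Hom q X Y) :
    F.mod X →ₗ[k] F.mod Y :=
  (show SMod.Hom q (F.obj X).1 (F.obj Y).1 from F.map φ).1

theorem natLin_naturality {p : Deg} {F G : GSFun C ((sMod A).full P)} (α : GSNat p F G)
    {q : Deg} {X Y : C.Obj} (φ : C.Hom q X Y) (x : F.mod X) :
    natLin α Y (F.lin φ x) = sgn k (p.2 * q.2) • G.lin φ (natLin α X x) :=
  congrArg (fun h : SMod.Hom (q + p) (F.obj X).1 (G.obj Y).1 => h.1 x)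
    (GSNat.naturality α rfl (add_comm p q) φ)

include hp hr in
theorem matInvLin_smul (X : C.Obj) (j : J) (i : I) (a : A.carrier) (w : (G j).mod X) :
    matInvLin f hf X j i (a • w) = A.inv (r j i).2 a • matInvLin f hf X j i w := by
  rw [matInvLin_eq f hf (v := fun i => A.inv (r j i).2 a • matInvLin f hf X j i w)]
  intro j'
  have h : ∀ i, natLin (f i j') X (A.inv (r j i).2 a • matInvLin f hf X j i w) =
      A.inv (d j' - d j).2 a • natLin (f i j') X (matInvLin f hf X j i w) := fun i => by
    rw [natLin_smul, A.inv_inv, ← Prod.snd_add, ← hp i j', eq_sub_of_add_eq (hr j i)]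
    congr 4
    abel
  rw [Finset.sum_congr rfl fun i _ => h i, ← Finset.smul_sum, sum_matInvLin]
  by_cases hj : j' = j
  · subst hj
    rw [Pi.single_eq_same, Pi.single_eq_same, sub_self, Prod.snd_zero, A.inv_zero]
  · rw [Pi.single_eq_of_ne hj, Pi.single_eq_of_ne hj, smul_zero]

include hp hr in
theorem matInvLin_naturality (j : J) (i : I) {q : Deg} {X Y : C.Obj} (φ : C.Hom q X Y)
    (w : (G j).mod X) : matInvLin f hf Y j i ((G j).lin φ w) =
      sgn k ((r j i).2 * q.2) • (F i).lin φ (matInvLin f hf X j i w) := by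
  rw [matInvLin_eq f hf
    (v := fun i => sgn k ((r j i).2 * q.2) • (F i).lin φ (matInvLin f hf X j i w))]
  intro j'
  have h : ∀ i, natLin (f i j') Y (sgn k ((r j i).2 * q.2) • (F i).lin φ (matInvLin f hf X j i w)) =
      sgn k ((d j' - d j).2 * q.2) • (G j').lin φ (natLin (f i j') X (matInvLin f hf X j i w)) :=
    fun i => by
      rw [map_smul, natLin_naturality, smul_smul, ← sgn_add, ← add_mul, ← Prod.snd_add,
        ← hp i j', eq_sub_of_add_eq (hr j i)]
      congr 4
      abel
  rw [Finset.sum_congr rfl fun i _ => h i, ← Finset.smul_sum, ← map_sum, sum_matInvLin]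
  by_cases hj : j' = j
  · subst hj
    rw [Pi.single_eq_same, Pi.single_eq_same, sub_self, Prod.snd_zero, zero_mul, sgn_zero, one_smul]
  · rw [Pi.single_eq_of_ne hj, Pi.single_eq_of_ne hj, map_zero, smul_zero]

/-- The entries of the inverse of a matrix of supernatural transformations. -/
noncomputable def matInv (j : J) (i : I) : GSNat (r j i) (G j) (F i) :=
  ⟨fun X => show SMod.Hom (r j i) ((G j).obj X).1 ((F i).obj X).1 from
    ⟨matInvLin f hf X j i, matInvLin_mem f hf hp hr X j i, matInvLin_smul f hf hp hr X j i⟩,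
    fun _ _ _ _ _ _ φ => Subtype.ext (LinearMap.ext fun w =>
      matInvLin_naturality f hf hp hr j i φ w)⟩

theorem lin_matInv (X : C.Obj) (j : J) (w : (G j).mod X) (j' : J) :
    ∑ i, natLin (f i j') X (natLin (matInv f hf hp hr j i) X w) =
      (Pi.single j w : ∀ j, (G j).mod X) j' :=
  sum_matInvLin f hf X j w j'

theorem matInv_lin (X : C.Obj) (i : I) (v : (F i).mod X) (i' : I) :
    ∑ j, natLin (matInv f hf hp hr j i') X (natLin (f i j) X v) =
      (Pi.single i v : ∀ i, (F i).mod X) i' := by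
  have h : ∑ j, (Pi.single j (natLin (f i j) X v) : ∀ j, (G j).mod X) =
      matLin f X (Pi.single i v) := by
    rw [Finset.univ_sum_single (fun j => natLin (f i j) X v)]
    funext j
    rw [matLin_apply, Finset.sum_eq_single i, Pi.single_eq_same]
    · intro i' _ h; rw [Pi.single_eq_of_ne h, map_zero]
    · intro h; exact absurd (Finset.mem_univ _) h
  have h' := congrArg (LinearEquiv.ofBijective _ (hf X)).symm h
  rw [map_sum] at h'
  have h'' := congrFun (h'.trans ((LinearEquiv.ofBijective _ (hf X)).symm_apply_apply
    (Pi.single i v))) i'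
  rw [Finset.sum_apply] at h''
  exact h''

end

end OddCat

namespace OddCat

/-! ## Inverses of the odd `sl₂`-maps from componentwise bijectivity -/

section
variable {k : Type u} [Field k] {fg : Prop} {A : GSAlg k}

/-- The linear map underlying a component of a 2-morphism. -/
abbrev compLin {B : QPCat k} {s t : B ⟶ sProj fg A} {p : Deg} (α : Hom2 k p s t) (X : B.cat.Obj) :
    GSFun.mod (C := B.cat) (P := IsProj fg A) s X →ₗ[k] GSFun.mod (C := B.cat) (P := IsProj fg A) t X :=
  natLin (C := B.cat) (P := IsProj fg A) (F := s) (G := t) α X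

theorem hom2_ext {B : QPCat k} {s t : B ⟶ sProj fg A} {p : Deg} {α β : Hom2 k p s t}
    (h : ∀ X v, compLin α X v = compLin β X v) : α = β :=
  Subtype.ext (funext fun X => Subtype.ext (LinearMap.ext (h X)))

theorem compLin_add {B : QPCat k} {s t : B ⟶ sProj fg A} {p : Deg} (α β : Hom2 k p s t)
    (X : B.cat.Obj) : compLin (α + β) X = compLin α X + compLin β X := rfl

theorem compLin_sum {B : QPCat k} {s t : B ⟶ sProj fg A} {p : Deg} {ι : Type} (S : Finset ι)
    (α : ι → Hom2 k p s t) (X : B.cat.Obj) :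
    compLin (∑ i ∈ S, α i) X = ∑ i ∈ S, compLin (α i) X :=
  map_sum (AddMonoidHom.mk' (fun α : Hom2 k p s t => compLin α X) fun _ _ => rfl) α S

theorem compLin_comp2_eq {B : QPCat k} {s t z : B ⟶ sProj fg A} {p q r : Deg} (e : p + q = r)
    {α : Hom2 k p s t} {β : Hom2 k q t z} {X : B.cat.Obj}
    {v : GSFun.mod (C := B.cat) (P := IsProj fg A) s X}
    {v₁ : GSFun.mod (C := B.cat) (P := IsProj fg A) t X}
    {v₂ : GSFun.mod (C := B.cat) (P := IsProj fg A) z X} (h₁ : compLin α X v = v₁)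
    (h₂ : compLin β X v₁ = v₂) : compLin (comp2 e α β) X v = v₂ :=
  (congrArg _ h₁).trans h₂

theorem compLin_add_eq {B : QPCat k} {s t : B ⟶ sProj fg A} {p : Deg} {α β : Hom2 k p s t}
    {X : B.cat.Obj} {v : GSFun.mod (C := B.cat) (P := IsProj fg A) s X}
    {v₁ v₂ : GSFun.mod (C := B.cat) (P := IsProj fg A) t X} (h₁ : compLin α X v = v₁)
    (h₂ : compLin β X v = v₂) : compLin (α + β) X v = v₁ + v₂ :=
  congrArg₂ (· + ·) h₁ h₂

theorem compLin_id2 {B : QPCat k} (s : B ⟶ sProj fg A) (X : B.cat.Obj) (v) :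
    compLin (id2 s : Hom2 k 0 s s) X v = v := rfl

namespace SlMatrix

variable {s t : sProj fg A ⟶ sProj fg A} (l : ℤ) (σ : Hom2 k (0, 1) s t)
  (cap : (j : ℕ) → Hom2 k (2 * (j : ℤ) + (1 - l), (j : ZMod 2)) s (𝟙 (sProj fg A)))
  (cup : (j : ℕ) → Hom2 k (1 + l + 2 * (j : ℤ), (j : ZMod 2)) (𝟙 (sProj fg A)) t)

/-- A 1-morphism, followed by copies of the identity. -/
noncomputable def funs (s : sProj fg A ⟶ sProj fg A) (N : ℕ) :
    Option (Fin N) → GSFun (sProj fg A).cat ((sMod A).full (IsProj fg A))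
  | none => s
  | some _ => GSFun.id _

/-- Degrees of the sources. -/
def srcDeg (N : ℕ) : Option (Fin N) → Deg
  | none => 0
  | some r => (0, 1) - (1 + l + 2 * ((r : ℕ) : ℤ), ((r : ℕ) : ZMod 2))

/-- Degrees of the targets. -/
def tgtDeg (N : ℕ) : Option (Fin N) → Deg
  | none => (0, 1)
  | some j => (2 * ((j : ℕ) : ℤ) + (1 - l), ((j : ℕ) : ZMod 2))

/-- Degrees of the matrix entries. -/
def deg (N L : ℕ) : Option (Fin N) → Option (Fin L) → Deg
  | none, none => (0, 1)
  | none, some j => (2 * ((j : ℕ) : ℤ) + (1 - l), ((j : ℕ) : ZMod 2))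
  | some r, none => (1 + l + 2 * ((r : ℕ) : ℤ), ((r : ℕ) : ZMod 2))
  | some r, some j => tgtDeg l L (some j) - srcDeg l N (some r)

/-- Degrees of the entries of the inverse. -/
def invDeg (N L : ℕ) : Option (Fin L) → Option (Fin N) → Deg
  | none, none => (0, 1)
  | some j, none => (l - 1 - 2 * ((j : ℕ) : ℤ), ((j : ℕ) : ZMod 2))
  | none, some r => (-l - 1 - 2 * ((r : ℕ) : ℤ), ((r : ℕ) : ZMod 2))
  | some j, some r => srcDeg l N (some r) - tgtDeg l L (some j)

theorem deg_add (N L : ℕ) (i : Option (Fin N)) (j : Option (Fin L)) :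
    deg l N L i j + srcDeg l N i = tgtDeg l L j := by
  rcases i with _ | r <;> rcases j with _ | j
  · exact add_zero _
  · exact add_zero _
  · exact add_sub_cancel _ _
  · exact sub_add_cancel _ _

theorem invDeg_add (N L : ℕ) (j : Option (Fin L)) (i : Option (Fin N)) :
    invDeg l N L j i + tgtDeg l L j = srcDeg l N i := by
  rcases i with _ | r <;> rcases j with _ | j
  · exact Prod.ext rfl (CharTwo.add_self_eq_zero (1 : ZMod 2))
  · ext
    · simp only [invDeg, tgtDeg, srcDeg, Prod.mk_add_mk, Prod.fst_zero]; ring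
    · simp only [invDeg, tgtDeg, srcDeg, Prod.mk_add_mk, Prod.snd_zero]
      exact CharTwo.add_self_eq_zero _
  · ext
    · simp only [invDeg, tgtDeg, srcDeg, Prod.mk_add_mk, Prod.mk_sub_mk]; ring
    · simp only [invDeg, tgtDeg, srcDeg, Prod.mk_add_mk, Prod.mk_sub_mk, CharTwo.sub_eq_add,
        add_comm]
  · exact sub_add_cancel _ _

/-- The matrix formed by the crossing, the caps and the cups. -/
noncomputable def mat (N L : ℕ) : ∀ (i : Option (Fin N)) (j : Option (Fin L)),
    GSNat (deg l N L i j) (funs s N i) (funs t L j)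
  | none, none => σ
  | none, some j => cap j
  | some r, none => cup r
  | some _, some _ => 0

/-- Bijectivity of the components of the odd `sl₂`-map. -/
def IsBijective (N L : ℕ) : Prop := ∀ X : (sProj fg A).cat.Obj, Function.Bijective
  (fun p : GSFun.mod (P := IsProj fg A) s X × (Fin N → (X.1 : SMod A).carrier) =>
    ((compLin σ X p.1 + ∑ r : Fin N, compLin (cup r) X (p.2 r), fun j : Fin L => compLin (cap j) X p.1) :
      GSFun.mod (P := IsProj fg A) t X × (Fin L → (X.1 : SMod A).carrier)))

variable {l σ cap cup}

theorem matLin_none {N L : ℕ} (X : (sProj fg A).cat.Obj)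
    (v : ∀ i, GSFun.mod (P := IsProj fg A) (funs s N i) X) :
    matLin (mat l σ cap cup N L) X v none = compLin σ X (v none) +
      ∑ r : Fin N, compLin (cup r) X (v (some r)) := by
  rw [matLin_apply, Fintype.sum_option]
  rfl

theorem matLin_some {N L : ℕ} (X : (sProj fg A).cat.Obj)
    (v : ∀ i, GSFun.mod (P := IsProj fg A) (funs s N i) X) (j : Fin L) :
    matLin (mat l σ cap cup N L) X v (some j) = compLin (cap j) X (v none) := by
  rw [matLin_apply, Fintype.sum_option]
  refine (congrArg₂ (· + ·) rfl (Finset.sum_eq_zero fun r _ => rfl)).trans (add_zero _)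

theorem IsBijective.matLin {N L : ℕ} (h : IsBijective l σ cap cup N L) (X : (sProj fg A).cat.Obj) :
    Function.Bijective (matLin (mat l σ cap cup N L) X) := by
  constructor
  · intro v v' hv
    have := (h X).1 (a₁ := (v none, fun r => v (some r))) (a₂ := (v' none, fun r => v' (some r))) (by
      refine Prod.ext ?_ (funext fun j => ?_)
      · have := congrFun hv none
        rw [matLin_none, matLin_none] at this
        exact this
      · have := congrFun hv (some j)
        rw [matLin_some, matLin_some] at this
        exact this)
    funext i
    rcases i with _ | r
    · exact congrArg Prod.fst this
    · exact congrFun (congrArg Prod.snd this) r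
  · intro w
    obtain ⟨p, hp⟩ := (h X).2 (w none, fun j => w (some j))
    refine ⟨fun | none => p.1 | some r => p.2 r, funext fun j => ?_⟩
    rcases j with _ | j
    · rw [matLin_none]
      exact congrArg Prod.fst hp
    · rw [matLin_some]
      exact congrFun (congrArg Prod.snd hp) j

theorem isEmpty_fin_of_eq_zero {N : ℕ} (h : N = 0) : IsEmpty (Fin N) := by
  subst h; infer_instance

/-- Componentwise bijectivity provides the inverses. -/
theorem IsBijective.nonempty_slInverse
    (h : IsBijective l σ cap cup (-l).toNat l.toNat) : Nonempty (SlInverse k l σ cap cup) := by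
  let g := matInv (mat l σ cap cup _ _) h.matLin (deg_add l _ _) (invDeg_add l _ _)
  have h₁ := matInv_lin (mat l σ cap cup _ _) h.matLin (deg_add l _ _) (invDeg_add l _ _)
  have h₂ := lin_matInv (mat l σ cap cup _ _) h.matLin (deg_add l _ _) (invDeg_add l _ _)
  simp only [Fintype.sum_option] at h₁ h₂
  have e₁ : ∀ j : ℕ, (j : ℤ) < l → j < l.toNat := fun j _ => by lia
  have e₂ : ∀ j : ℕ, (j : ℤ) < -l → j < (-l).toNat := fun j _ => by lia
  refine ⟨{
    inv := g none none
    toEF := fun j hj => g (some ⟨j, e₁ j hj⟩) none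
    ofFE := fun j hj => g none (some ⟨j, e₂ j hj⟩)
    iso_EF := hom2_ext fun X v => ?_
    iso_FE := hom2_ext fun X v => ?_
    inv_cap := fun j hj => hom2_ext fun X v => ?_
    toEF_cross := fun j hj => hom2_ext fun X v => ?_
    toEF_cap := fun j hj => hom2_ext fun X v => ?_
    toEF_cap_ne := fun i j hi hj hij => hom2_ext fun X v => ?_
    cup_inv := fun j hj => hom2_ext fun X v => ?_
    cross_ofFE := fun j hj => hom2_ext fun X v => ?_
    cup_ofFE := fun j hj => hom2_ext fun X v => ?_
    cup_ofFE_ne := fun i j hi hj hij => hom2_ext fun X v => ?_ }⟩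
  · refine Eq.trans ?_ ((h₁ X none v none).trans (Pi.single_eq_same _ _))
    rw [compLin_add, compLin_sum, LinearMap.add_apply, LinearMap.sum_apply]
    rfl
  · refine Eq.trans ?_ ((h₂ X none v none).trans (Pi.single_eq_same _ _))
    rw [compLin_add, compLin_sum, LinearMap.add_apply, LinearMap.sum_apply]
    rfl
  · refine Eq.trans ?_ ((h₂ X none v (some ⟨j, e₁ j hj⟩)).trans
      (Pi.single_eq_of_ne (Option.some_ne_none _) _))
    exact ((congrArg₂ (· + ·) rfl (Finset.sum_eq_zero fun r _ => rfl)).trans (add_zero _)).symm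
  · have := isEmpty_fin_of_eq_zero (N := (-l).toNat) (by lia)
    refine Eq.trans ?_ ((h₂ X (some ⟨j, e₁ j hj⟩) v none).trans
      (Pi.single_eq_of_ne (Option.some_ne_none _).symm _))
    exact ((congrArg₂ (· + ·) rfl (Fintype.sum_empty _)).trans (add_zero _)).symm
  · refine Eq.trans ?_ ((h₂ X (some ⟨j, e₁ j hj⟩) v (some ⟨j, e₁ j hj⟩)).trans
      (Pi.single_eq_same _ _))
    exact ((congrArg₂ (· + ·) rfl (Finset.sum_eq_zero fun r _ => rfl)).trans (add_zero _)).symm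
  · refine Eq.trans ?_ ((h₂ X (some ⟨i, e₁ i hi⟩) v (some ⟨j, e₁ j hj⟩)).trans
      (Pi.single_eq_of_ne (fun h => hij ?_) _))
    · exact ((congrArg₂ (· + ·) rfl (Finset.sum_eq_zero fun r _ => rfl)).trans (add_zero _)).symm
    · exact (congrArg Fin.val (Option.some.inj h)).symm
  · refine Eq.trans ?_ ((h₁ X (some ⟨j, e₂ j hj⟩) v none).trans
      (Pi.single_eq_of_ne (Option.some_ne_none _).symm _))
    exact ((congrArg₂ (· + ·) rfl (Finset.sum_eq_zero fun r _ => map_zero _)).trans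
      (add_zero _)).symm
  · have := isEmpty_fin_of_eq_zero (N := l.toNat) (by lia)
    refine Eq.trans ?_ ((h₁ X none v (some ⟨j, e₂ j hj⟩)).trans
      (Pi.single_eq_of_ne (Option.some_ne_none _) _))
    exact ((congrArg₂ (· + ·) rfl (Fintype.sum_empty _)).trans (add_zero _)).symm
  · refine Eq.trans ?_ ((h₁ X (some ⟨j, e₂ j hj⟩) v (some ⟨j, e₂ j hj⟩)).trans
      (Pi.single_eq_same _ _))
    exact ((congrArg₂ (· + ·) rfl (Finset.sum_eq_zero fun r _ => map_zero _)).trans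
      (add_zero _)).symm
  · refine Eq.trans ?_ ((h₁ X (some ⟨i, e₂ i hi⟩) v (some ⟨j, e₂ j hj⟩)).trans
      (Pi.single_eq_of_ne (fun h => hij ?_) _))
    · exact ((congrArg₂ (· + ·) rfl (Finset.sum_eq_zero fun r _ => map_zero _)).trans
        (add_zero _)).symm
    · exact (congrArg Fin.val (Option.some.inj h)).symm

end SlMatrix

end

end OddCat

namespace OddCat

/-! ## Null 1-morphisms -/

section
variable {k : Type u} [Field k] {C : Type v} [Category.{w} C] [TwoSupercat.{u, v, w, v'} k C]

variable (k) in
/-- A 1-morphism is null if its identity 2-morphism vanishes. -/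
def IsNull {a b : C} (f : a ⟶ b) : Prop := (id2 f : Hom2 k 0 f f) = 0

theorem IsNull.subsingleton_left {a b : C} {f g : a ⟶ b} (h : IsNull k f) (p : Deg) :
    Subsingleton (Hom2 k p f g) := by
  have : ∀ α : Hom2 k p f g, α = 0 := fun α => by
    have h₁ := smul_comp2 (zero_add p) (0 : k) (id2 f) α
    rwa [zero_smul, zero_smul, ← (show id2 f = 0 from h), id2_comp2] at h₁
  exact ⟨fun α β => (this α).trans (this β).symm⟩

theorem IsNull.subsingleton_right {a b : C} {f g : a ⟶ b} (h : IsNull k g) (p : Deg) :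
    Subsingleton (Hom2 k p f g) := by
  have : ∀ α : Hom2 k p f g, α = 0 := fun α => by
    have h₁ := comp2_smul (add_zero p) (0 : k) α (id2 g)
    rwa [zero_smul, zero_smul, ← (show id2 g = 0 from h), comp2_id2] at h₁
  exact ⟨fun α β => (this α).trans (this β).symm⟩

theorem IsNull.comp_right {a b c : C} {f : a ⟶ b} (h : IsNull k f) (g : b ⟶ c) :
    IsNull k (f ≫ g) := by
  have h₁ := whR_smul (0 : k) (id2 f) g rfl rfl
  rw [zero_smul, zero_smul, ← (show id2 f = 0 from h), whR_id2] at h₁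
  exact h₁

theorem IsNull.comp_left {a b c : C} (f : a ⟶ b) {g : b ⟶ c} (h : IsNull k g) :
    IsNull k (f ≫ g) := by
  have h₁ := whL_smul f (0 : k) (id2 g) rfl rfl
  rw [zero_smul, zero_smul, ← (show id2 g = 0 from h), whL_id2] at h₁
  exact h₁

end

section
variable {k : Type u} [Field k] {fg : Prop} {n : ℕ}

theorem isNull_Efun_zero (hE : IndPres k fg n) (o o' : Option ℕ) :
    IsNull k (Efun hE (.zero o o')) :=
  Subtype.ext (funext fun _ => (weightZero k fg n o').2)

theorem isNull_Ffun_zero (hF : ResPres k fg n) (t : ℤ) (o o' : Option ℕ) :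
    IsNull k (Ffun hF t (.zero o o')) :=
  Subtype.ext (funext fun _ => (weightZero k fg n o).2)

theorem isNull_of_none {o : Option ℕ} (f : weightCat k fg n none ⟶ weightCat k fg n o) :
    IsNull k f := by
  have : IsNull k (𝟙 (weightCat k fg n none)) := rfl
  simpa using this.comp_right f

end

/-! ## Shifts of the weight categories -/

section
variable (k : Type u) [Field k] (fg : Prop) (n : ℕ)

/-- The shift of a weight category. -/
noncomputable def weightShift (s : Deg) : (o : Option ℕ) → (weightCat k fg n o ⟶ weightCat k fg n o)
  | none => 𝟙 (weightCat k fg n none)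
  | some m => (shiftFun (ONH k n m) s).restrict _ _ (IsProj.shift (fg := fg) s)

/-- The map from the shift to the identity. -/
noncomputable def weightOfShift (s p : Deg) (hp : p = -s) :
    (o : Option ℕ) → Hom2 k p (weightShift k fg n s o) (𝟙 (weightCat k fg n o))
  | none => 0
  | some m => ((shiftIso (ONH k n m) s p hp).restrict _ (IsProj.shift (fg := fg) s)).hom

/-- The map from the identity to the shift. -/
noncomputable def weightToShift (s p : Deg) (hp : p = s) :
    (o : Option ℕ) → Hom2 k p (𝟙 (weightCat k fg n o)) (weightShift k fg n s o)
  | none => 0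
  | some m => castDeg k (by rw [hp, neg_neg])
      (show Hom2 k (- -s) (𝟙 (weightCat k fg n (some m))) (weightShift k fg n s (some m)) from
        ((shiftIso (ONH k n m) s (-s) rfl).restrict _ (IsProj.shift (fg := fg) s)).inv)

theorem weight_of_to (s p q : Deg) (hp : p = -s) (hq : q = s) (o : Option ℕ) :
    comp2 (r := 0) (by rw [hp, hq, neg_add_cancel]) (weightOfShift k fg n s p hp o)
      (weightToShift k fg n s q hq o) = id2 (weightShift k fg n s o) := by
  rcases o with _ | m
  · rfl
  · subst hp
    obtain rfl : q = - -s := by rw [hq, neg_neg]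
    exact Subtype.ext (funext fun X =>
      ((shiftIso (ONH k n m) s (-s) rfl).restrict _ (IsProj.shift (fg := fg) s)).hom_inv X)

theorem weight_to_of (s p q : Deg) (hp : p = -s) (hq : q = s) (o : Option ℕ) :
    comp2 (r := 0) (by rw [hp, hq, add_neg_cancel]) (weightToShift k fg n s q hq o)
      (weightOfShift k fg n s p hp o) = id2 (𝟙 (weightCat k fg n o)) := by
  rcases o with _ | m
  · rfl
  · subst hp
    obtain rfl : q = - -s := by rw [hq, neg_neg]
    exact Subtype.ext (funext fun X =>
      ((shiftIso (ONH k n m) s (-s) rfl).restrict _ (IsProj.shift (fg := fg) s)).inv_hom X)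

/-- The shifts of the weight categories. -/
noncomputable def weightShiftData : ShiftData k (fun a : UObj => weightCat k fg n (strands n a.wt)) where
  sh a s := weightShift k fg n s (strands n a.wt)
  j a s p hp := weightOfShift k fg n s p hp (strands n a.wt)
  ji a s p hp := weightToShift k fg n s p hp (strands n a.wt)
  j_ji a s p q hp hq := weight_of_to k fg n s p q hp hq (strands n a.wt)
  ji_j a s p q hp hq := weight_to_of k fg n s p q hp hq (strands n a.wt)

end

/-! ## The relations between the natural transformations -/

namespace SMod

variable {k : Type u} [Field k] {A B C D : GSAlg k} {f : A.Hom B} {g : B.Hom C} {h : C.Hom D}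

theorem tmul_tmul {M : SMod A} (c : C.carrier) (b : B.carrier) (m : M.carrier) :
    tmul g (ind f M) c (tmul f M b m) = tmul g (ind f M) (c * g.map b) (tmul f M 1 m) := by
  have : tmul f M b m = b • tmul f M 1 m := by rw [smul_tmul, mul_one]
  rw [this]
  exact (indMk_mul_map (f := g) c b _).symm

theorem ind_ind_hom_ext {p : Deg} {M : SMod A} {N : SMod C} {φ ψ : Hom p (ind g (ind f M)) N}
    (e : ∀ m, φ.1 (tmul g _ 1 (tmul f M 1 m)) = ψ.1 (tmul g _ 1 (tmul f M 1 m))) : φ = ψ := by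
  refine ind_hom_ext fun y => ?_
  induction y using tmul_induction with
  | h0 => rw [show tmul g (ind f M) 1 0 = 0 from indMk_zero _, map_zero, map_zero]
  | hadd x y hx hy => rw [tmul_add, map_add, map_add, hx, hy]
  | hmk b m =>
    rw [tmul_tmul, one_mul, show tmul g (ind f M) (g.map b) (tmul f M 1 m) =
      g.map b • tmul g (ind f M) 1 (tmul f M 1 m) by rw [smul_tmul, mul_one], φ.2.2, ψ.2.2, e]

theorem ind_ind_ind_hom_ext {p : Deg} {M : SMod A} {N : SMod D}
    {φ ψ : Hom p (ind h (ind g (ind f M))) N}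
    (e : ∀ m, φ.1 (tmul h _ 1 (tmul g _ 1 (tmul f M 1 m))) =
      ψ.1 (tmul h _ 1 (tmul g _ 1 (tmul f M 1 m)))) : φ = ψ := by
  refine ind_ind_hom_ext fun y => ?_
  induction y using tmul_induction with
  | h0 => rw [show tmul g (ind f M) 1 0 = 0 from indMk_zero _,
      show tmul h (ind g (ind f M)) 1 0 = 0 from indMk_zero _, map_zero, map_zero]
  | hadd x y hx hy => rw [tmul_add, tmul_add, map_add, map_add, hx, hy]
  | hmk b m =>
    have h₁ : tmul h (ind g (ind f M)) 1 (tmul g (ind f M) 1 (tmul f M b m)) =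
        h.map (g.map b) • tmul h (ind g (ind f M)) 1 (tmul g (ind f M) 1 (tmul f M 1 m)) := by
      rw [tmul_tmul (f := f), one_mul, tmul_tmul (f := g), one_mul, smul_tmul, mul_one]
    rw [h₁, φ.2.2, ψ.2.2, e]

theorem mulHom₂_tmul_one {p : Deg} (z : C.carrier) (hz : z ∈ C.gr p)
    (hz' : ∀ a, z * g.map (f.map a) = g.map (f.map (A.inv p.2 a)) * z) (M : SMod A)
    (c : C.carrier) (m : M.carrier) :
    (mulHom₂ z hz hz' M).1 (tmul g (ind f M) c (tmul f M 1 m)) =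
      tmul g (ind f M) (C.inv p.2 c * z) (tmul f M 1 m) := by
  rw [mulHom₂_tmul, map_one, mul_one]

theorem indMap_mulHom_tmul {p : Deg} (x : B.carrier) (hx : x ∈ B.gr p)
    (hx' : ∀ a, x * f.map a = f.map (A.inv p.2 a) * x) (M : SMod A)
    (c : C.carrier) (m : M.carrier) :
    (indMap (f := g) (mulHom x hx hx' M)).1 (tmul g (ind f M) c (tmul f M 1 m)) =
      tmul g (ind f M) (C.inv p.2 c * g.map x) (tmul f M 1 m) := by
  rw [indMap_tmul, mulHom_tmul, map_one, one_mul, tmul_tmul]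

theorem indMap_mulHom₂_tmul {p : Deg} (z : C.carrier) (hz : z ∈ C.gr p)
    (hz' : ∀ a, z * g.map (f.map a) = g.map (f.map (A.inv p.2 a)) * z) (M : SMod A)
    (d : D.carrier) (m : M.carrier) :
    (indMap (f := h) (mulHom₂ z hz hz' M)).1
        (tmul h (ind g (ind f M)) d (tmul g (ind f M) 1 (tmul f M 1 m))) =
      tmul h (ind g (ind f M)) (D.inv p.2 d * h.map z) (tmul g (ind f M) 1 (tmul f M 1 m)) := by
  rw [indMap_tmul, mulHom₂_tmul_one, map_one, one_mul, tmul_tmul]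

theorem add_tmul {M : SMod A} (b b' : B.carrier) (m : M.carrier) :
    tmul f M (b + b') m = tmul f M b m + tmul f M b' m := add_indMk _ _ _

theorem zero_tmul {M : SMod A} (m : M.carrier) : tmul f M 0 m = 0 := zero_indMk _

end SMod

theorem GSAlg.inv_of_odd {k : Type u} [Field k] (A : GSAlg k) {p : Deg} {a : A.carrier}
    (ha : a ∈ A.gr p) (hp : p.2 = 1) : A.inv 1 a = -a := by
  rw [A.inv_of_mem 1 ha, hp, sgn_one_mul_one, neg_smul, one_smul]

section
variable {k : Type u} [Field k] {fg : Prop} {A B C D : GSAlg k} {f : A.Hom B} {g : B.Hom C}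
  {h : C.Hom D} (hf : PreservesInd fg f) (hg : PreservesInd fg g) (hh : PreservesInd fg h)

theorem compLin_mulProj₂ {p : Deg} (z : C.carrier) (hz : z ∈ C.gr p)
    (hz' : ∀ a, z * g.map (f.map a) = g.map (f.map (A.inv p.2 a)) * z) (X : (sProj fg A).cat.Obj)
    (c : C.carrier) (m : (X.1 : SMod A).carrier) :
    compLin (mulProj₂ hf hg z hz hz') X (SMod.tmul g (SMod.ind f X.1) c (SMod.tmul f X.1 1 m)) =
      SMod.tmul g (SMod.ind f X.1) (C.inv p.2 c * z) (SMod.tmul f X.1 1 m) :=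
  SMod.mulHom₂_tmul_one z hz hz' X.1 c m

theorem compLin_whR_mulProj {p : Deg} (x : B.carrier) (hx : x ∈ B.gr p)
    (hx' : ∀ a, x * f.map a = f.map (A.inv p.2 a) * x) (X : (sProj fg A).cat.Obj)
    (c : C.carrier) (m : (X.1 : SMod A).carrier) :
    compLin (whR (mulProj hf x hx hx') (indProj hg) rfl rfl) X
        (SMod.tmul g (SMod.ind f X.1) c (SMod.tmul f X.1 1 m)) =
      SMod.tmul g (SMod.ind f X.1) (C.inv p.2 c * g.map x) (SMod.tmul f X.1 1 m) :=
  SMod.indMap_mulHom_tmul x hx hx' X.1 c m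

theorem compLin_whL_mulProj {p : Deg} (x : C.carrier) (hx : x ∈ C.gr p)
    (hx' : ∀ b, x * g.map b = g.map (B.inv p.2 b) * x) (X : (sProj fg A).cat.Obj)
    (c : C.carrier) (y : (SMod.ind f X.1).carrier) :
    compLin (whL (indProj hf) (mulProj hg x hx hx') rfl rfl) X (SMod.tmul g (SMod.ind f X.1) c y) =
      SMod.tmul g (SMod.ind f X.1) (C.inv p.2 c * x) y :=
  SMod.mulHom_tmul x hx hx' (SMod.ind f X.1) c y

theorem compLin_whR_mulProj₂ {p : Deg} (z : C.carrier) (hz : z ∈ C.gr p)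
    (hz' : ∀ a, z * g.map (f.map a) = g.map (f.map (A.inv p.2 a)) * z) (X : (sProj fg A).cat.Obj)
    (d : D.carrier) (m : (X.1 : SMod A).carrier) :
    compLin (whR (mulProj₂ hf hg z hz hz') (indProj hh) (Category.assoc _ _ _).symm
          (Category.assoc _ _ _).symm) X (SMod.tmul h (SMod.ind g (SMod.ind f X.1)) d
            (SMod.tmul g (SMod.ind f X.1) 1 (SMod.tmul f X.1 1 m))) =
      SMod.tmul h (SMod.ind g (SMod.ind f X.1)) (D.inv p.2 d * h.map z)
        (SMod.tmul g (SMod.ind f X.1) 1 (SMod.tmul f X.1 1 m)) :=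
  SMod.indMap_mulHom₂_tmul z hz hz' X.1 d m

theorem compLin_whL_mulProj₂ {p : Deg} (z : D.carrier) (hz : z ∈ D.gr p)
    (hz' : ∀ b, z * h.map (g.map b) = h.map (g.map (B.inv p.2 b)) * z)
    (X : (sProj fg A).cat.Obj) (d : D.carrier) (y : (SMod.ind f X.1).carrier) :
    compLin (whL (indProj hf) (mulProj₂ hg hh z hz hz') rfl rfl) X
        (SMod.tmul h (SMod.ind g (SMod.ind f X.1)) d (SMod.tmul g (SMod.ind f X.1) 1 y)) =
      SMod.tmul h (SMod.ind g (SMod.ind f X.1)) (D.inv p.2 d * z)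
        (SMod.tmul g (SMod.ind f X.1) 1 y) :=
  SMod.mulHom₂_tmul_one z hz hz' (SMod.ind f X.1) d y

theorem mulProj₂_sq (z : C.carrier) (hz : z ∈ C.gr (-2, 1))
    (hz' : ∀ a, z * g.map (f.map a) = g.map (f.map (A.inv 1 a)) * z) (h0 : z * z = 0) :
    comp2 (r := (-4, 0)) rfl (mulProj₂ hf hg z hz hz') (mulProj₂ hf hg z hz hz') = 0 := by
  refine Subtype.ext (funext fun X => SMod.ind_ind_hom_ext fun y => ?_)
  refine (compLin_comp2_eq _ (compLin_mulProj₂ hf hg z hz hz' X 1 y)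
    (compLin_mulProj₂ hf hg z hz hz' X _ y)).trans ?_
  have e : C.inv 1 (C.inv 1 1 * z) * z = 0 := by
    rw [map_one, one_mul, C.inv_of_odd hz rfl, neg_mul, h0, neg_zero]
  exact (congrArg (fun c => SMod.tmul g (SMod.ind f X.1) c _) e).trans (SMod.zero_tmul _)

theorem mulProj_mulProj₂ (x : B.carrier) (hx : x ∈ B.gr (2, 1))
    (hx' : ∀ a, x * f.map a = f.map (A.inv 1 a) * x) (x' : C.carrier) (hx₁ : x' ∈ C.gr (2, 1))
    (hx₁' : ∀ b, x' * g.map b = g.map (B.inv 1 b) * x') (z : C.carrier) (hz : z ∈ C.gr (-2, 1))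
    (hz' : ∀ a, z * g.map (f.map a) = g.map (f.map (A.inv 1 a)) * z)
    (h0 : g.map x * z + z * x' = -1) :
    comp2 (r := 0) rfl (whR (mulProj hf x hx hx') (indProj hg) rfl rfl) (mulProj₂ hf hg z hz hz') +
      comp2 (r := 0) rfl (mulProj₂ hf hg z hz hz')
        (whL (indProj hf) (mulProj hg x' hx₁ hx₁') rfl rfl) = id2 (indProj hf ≫ indProj hg) := by
  refine Subtype.ext (funext fun X => SMod.ind_ind_hom_ext fun y => ?_)
  refine (compLin_add_eq (compLin_comp2_eq _ (compLin_whR_mulProj hf hg x hx hx' X 1 y)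
    (compLin_mulProj₂ hf hg z hz hz' X _ y)) (compLin_comp2_eq _
      (compLin_mulProj₂ hf hg z hz hz' X 1 y)
      (compLin_whL_mulProj hf hg x' hx₁ hx₁' X _ _))).trans ?_
  refine (SMod.add_tmul (f := g) (M := SMod.ind f X.1) _ _ (SMod.tmul f X.1 1 y)).symm.trans ?_
  have e : C.inv 1 (C.inv 1 1 * g.map x) * z + C.inv 1 (C.inv 1 1 * z) * x' = 1 := by
    rw [map_one, one_mul, one_mul, ← g.map_inv, B.inv_of_odd hx rfl, C.inv_of_odd hz rfl, map_neg,
      neg_mul, neg_mul, ← neg_add, h0, neg_neg]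
  exact (congrArg (fun c => SMod.tmul g (SMod.ind f X.1) c _) e).trans
    (compLin_id2 (indProj hf ≫ indProj hg) X _).symm

theorem mulProj₂_mulProj (x : B.carrier) (hx : x ∈ B.gr (2, 1))
    (hx' : ∀ a, x * f.map a = f.map (A.inv 1 a) * x) (x' : C.carrier) (hx₁ : x' ∈ C.gr (2, 1))
    (hx₁' : ∀ b, x' * g.map b = g.map (B.inv 1 b) * x') (z : C.carrier) (hz : z ∈ C.gr (-2, 1))
    (hz' : ∀ a, z * g.map (f.map a) = g.map (f.map (A.inv 1 a)) * z)
    (h0 : z * g.map x + x' * z = -1) :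
    comp2 (r := 0) rfl (mulProj₂ hf hg z hz hz') (whR (mulProj hf x hx hx') (indProj hg) rfl rfl) +
      comp2 (r := 0) rfl (whL (indProj hf) (mulProj hg x' hx₁ hx₁') rfl rfl)
        (mulProj₂ hf hg z hz hz') = id2 (indProj hf ≫ indProj hg) := by
  refine Subtype.ext (funext fun X => SMod.ind_ind_hom_ext fun y => ?_)
  refine (compLin_add_eq (compLin_comp2_eq _ (compLin_mulProj₂ hf hg z hz hz' X 1 y)
    (compLin_whR_mulProj hf hg x hx hx' X _ y)) (compLin_comp2_eq _
      (compLin_whL_mulProj hf hg x' hx₁ hx₁' X 1 _)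
      (compLin_mulProj₂ hf hg z hz hz' X _ y))).trans ?_
  refine (SMod.add_tmul (f := g) (M := SMod.ind f X.1) _ _ (SMod.tmul f X.1 1 y)).symm.trans ?_
  have e : C.inv 1 (C.inv 1 1 * z) * g.map x + C.inv 1 (C.inv 1 1 * x') * z = 1 := by
    rw [map_one, one_mul, one_mul, C.inv_of_odd hz rfl, C.inv_of_odd hx₁ rfl, neg_mul, neg_mul,
      ← neg_add, h0, neg_neg]
  exact (congrArg (fun c => SMod.tmul g (SMod.ind f X.1) c _) e).trans
    (compLin_id2 (indProj hf ≫ indProj hg) X _).symm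

theorem mulProj₂_braid (z : C.carrier) (hz : z ∈ C.gr (-2, 1))
    (hz' : ∀ a, z * g.map (f.map a) = g.map (f.map (A.inv 1 a)) * z) (z' : D.carrier)
    (hz₁ : z' ∈ D.gr (-2, 1))
    (hz₁' : ∀ b, z' * h.map (g.map b) = h.map (g.map (B.inv 1 b)) * z')
    (h0 : z' * h.map z * z' = h.map z * z' * h.map z) :
    comp2 (r := (-6, 1)) rfl (whL (indProj hf) (mulProj₂ hg hh z' hz₁ hz₁') rfl rfl)
      (comp2 (r := (-4, 0)) rfl
        (whR (mulProj₂ hf hg z hz hz') (indProj hh) (Category.assoc _ _ _).symm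
          (Category.assoc _ _ _).symm)
        (whL (indProj hf) (mulProj₂ hg hh z' hz₁ hz₁') rfl rfl)) =
    comp2 (r := (-6, 1)) rfl
      (whR (mulProj₂ hf hg z hz hz') (indProj hh) (Category.assoc _ _ _).symm
        (Category.assoc _ _ _).symm)
      (comp2 (r := (-4, 0)) rfl (whL (indProj hf) (mulProj₂ hg hh z' hz₁ hz₁') rfl rfl)
        (whR (mulProj₂ hf hg z hz hz') (indProj hh) (Category.assoc _ _ _).symm
          (Category.assoc _ _ _).symm)) := by
  refine Subtype.ext (funext fun X => SMod.ind_ind_ind_hom_ext fun y => ?_)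
  refine (compLin_comp2_eq _ (compLin_whL_mulProj₂ hf hg hh z' hz₁ hz₁' X 1 _) (compLin_comp2_eq _
    (compLin_whR_mulProj₂ hf hg hh z hz hz' X _ y)
    (compLin_whL_mulProj₂ hf hg hh z' hz₁ hz₁' X _ _))).trans ?_
  refine Eq.trans ?_ (compLin_comp2_eq _ (compLin_whR_mulProj₂ hf hg hh z hz hz' X 1 y)
    (compLin_comp2_eq _ (compLin_whL_mulProj₂ hf hg hh z' hz₁ hz₁' X _ _)
      (compLin_whR_mulProj₂ hf hg hh z hz hz' X _ y))).symm
  have e : D.inv 1 (D.inv 1 (D.inv 1 1 * z') * h.map z) * z' =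
      D.inv 1 (D.inv 1 (D.inv 1 1 * h.map z) * z') * h.map z := by
    have hz₂ : D.inv 1 (h.map z) = -h.map z := by
      rw [← h.map_inv, C.inv_of_odd hz rfl, map_neg]
    simp only [map_one, one_mul, map_mul, map_neg, D.inv_of_odd hz₁ rfl, hz₂, neg_mul, mul_neg,
      neg_neg, h0]
  exact congrArg (fun d => SMod.tmul h (SMod.ind g (SMod.ind f X.1)) d _) e

end

end OddCat

namespace OddCat

section
variable {k : Type u} [Field k] {C : Type v} [Category.{w} C] [TwoSupercat.{u, v, w, v'} k C]
  {a b c d : C}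

/-- The relation `τ² = 0`. -/
def SquareZero {f : a ⟶ b} (τ : Hom2 k (-2, 1) f f) : Prop :=
  comp2 (r := (-4, 0)) rfl τ τ = 0

/-- The odd nilHecke relation `xτ + τx = 1`. -/
def DotCross {e : a ⟶ b} {e' : b ⟶ c} (x : Hom2 k (2, 1) e e) (x' : Hom2 k (2, 1) e' e')
    (τ : Hom2 k (-2, 1) (e ≫ e') (e ≫ e')) : Prop :=
  comp2 (r := 0) rfl (whR x e' rfl rfl) τ + comp2 (r := 0) rfl τ (whL e x' rfl rfl) = id2 _

/-- The odd nilHecke relation `τx + xτ = 1`. -/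
def CrossDot {e : a ⟶ b} {e' : b ⟶ c} (x : Hom2 k (2, 1) e e) (x' : Hom2 k (2, 1) e' e')
    (τ : Hom2 k (-2, 1) (e ≫ e') (e ≫ e')) : Prop :=
  comp2 (r := 0) rfl τ (whR x e' rfl rfl) + comp2 (r := 0) rfl (whL e x' rfl rfl) τ = id2 _

/-- The braid relation. -/
def Braid {e : a ⟶ b} {e' : b ⟶ c} {e'' : c ⟶ d} (τ : Hom2 k (-2, 1) (e ≫ e') (e ≫ e'))
    (τ' : Hom2 k (-2, 1) (e' ≫ e'') (e' ≫ e'')) : Prop :=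
  comp2 (r := (-6, 1)) rfl (whL e τ' rfl rfl)
    (comp2 (r := (-4, 0)) rfl
      (whR τ e'' (Category.assoc _ _ _).symm (Category.assoc _ _ _).symm) (whL e τ' rfl rfl)) =
  comp2 (r := (-6, 1)) rfl
    (whR τ e'' (Category.assoc _ _ _).symm (Category.assoc _ _ _).symm)
    (comp2 (r := (-4, 0)) rfl (whL e τ' rfl rfl)
      (whR τ e'' (Category.assoc _ _ _).symm (Category.assoc _ _ _).symm))

/-- The zigzag relation for the left adjoint. -/
def ZigzagLeft {p q : Deg} (e : p + q = 0) {f : a ⟶ b} {g : b ⟶ a} (η : Hom2 k p (𝟙 a) (f ≫ g))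
    (ε : Hom2 k q (g ≫ f) (𝟙 b)) : Prop :=
  comp2 e (whR η f (Category.id_comp f).symm (Category.assoc f g f).symm)
    (whL f ε rfl (Category.comp_id f).symm) = id2 f

/-- The zigzag relation for the right adjoint. -/
def ZigzagRight {p q : Deg} (e : p + q = 0) {f : a ⟶ b} {g : b ⟶ a} (η : Hom2 k p (𝟙 a) (f ≫ g))
    (ε : Hom2 k q (g ≫ f) (𝟙 b)) : Prop :=
  comp2 e (whL g η (Category.comp_id g).symm rfl)
    (whR ε g (Category.assoc g f g).symm (Category.id_comp g).symm) = id2 g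

theorem ZigzagLeft.intro {p q : Deg} {e : p + q = 0} {f : a ⟶ b} {g : b ⟶ a}
    {η : Hom2 k p (𝟙 a) (f ≫ g)} {ε : Hom2 k q (g ≫ f) (𝟙 b)}
    (h : comp2 e (whR η f (Category.id_comp _).symm (Category.assoc _ _ _).symm)
      (whL f ε rfl (Category.comp_id _).symm) = id2 f) : ZigzagLeft e η ε := h

theorem ZigzagRight.intro {p q : Deg} {e : p + q = 0} {f : a ⟶ b} {g : b ⟶ a}
    {η : Hom2 k p (𝟙 a) (f ≫ g)} {ε : Hom2 k q (g ≫ f) (𝟙 b)}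
    (h : comp2 e (whL g η (Category.comp_id _).symm rfl)
      (whR ε g (Category.assoc _ _ _).symm (Category.id_comp _).symm) = id2 g) :
    ZigzagRight e η ε := h

theorem ZigzagLeft.isAdjunction {f : a ⟶ b} {g : b ⟶ a} {η : Hom2 k 0 (𝟙 a) (f ≫ g)}
    {ε : Hom2 k 0 (g ≫ f) (𝟙 b)} (h : ZigzagLeft (zero_add 0) η ε)
    (h' : ZigzagRight (zero_add 0) η ε) : IsAdjunction k f g η ε := ⟨h, h'⟩

end

section
variable {k : Type u} [Field k] {fg : Prop} {A B : GSAlg k} {f : A.Hom B} (hf : PreservesInd fg f)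

theorem compLin_whL {B' B₁ : QPCat k} (F : B' ⟶ B₁) {s t : B₁ ⟶ sProj fg A} {p : Deg}
    (α : Hom2 k p s t) (X : B'.cat.Obj)
    (v : GSFun.mod (C := B₁.cat) (P := IsProj fg A) s (GSFun.obj F X)) :
    compLin (whL F α rfl rfl) X v = compLin α (GSFun.obj F X) v := rfl

theorem compLin_whR_indProj_of_id {B₁ : QPCat k} {u : sProj fg A ⟶ B₁} {u' : B₁ ⟶ sProj fg A}
    {p : Deg} (α : Hom2 k p (𝟙 (sProj fg A)) (u ≫ u')) (X : (sProj fg A).cat.Obj) (b : B.carrier)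
    (m : (X.1 : SMod A).carrier) :
    compLin (whR α (indProj hf) (Category.id_comp _).symm (Category.assoc _ _ _).symm) X
        (SMod.tmul f X.1 b m) =
      SMod.tmul f (GSFun.obj (u ≫ u') X).1 (B.inv p.2 b) (compLin α X m) :=
  SMod.indMap_tmul (show SMod.Hom p X.1 (GSFun.obj (u ≫ u') X).1 from α.1 X) b m

theorem compLin_whL_of_id {B₁ : QPCat k} (F : sProj fg A ⟶ sProj fg B) {u' : sProj fg B ⟶ B₁}
    {u : B₁ ⟶ sProj fg B} {p : Deg}
    (α : Hom2 k p (u' ≫ u) (𝟙 (sProj fg B))) (X : (sProj fg A).cat.Obj)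
    (v : GSFun.mod (C := (sProj fg B).cat) (P := IsProj fg B) (u' ≫ u) (GSFun.obj F X)) :
    compLin (whL F α rfl (Category.comp_id _).symm) X v = compLin α (GSFun.obj F X) v := rfl

theorem compLin_whR_resProj (hf' : PreservesRes fg f) (t₀ : ℤ) {B₁ : QPCat k}
    {s t : B₁ ⟶ sProj fg B} {p : Deg} (α : Hom2 k p s t) (X : B₁.cat.Obj)
    (v : GSFun.mod (C := B₁.cat) (P := IsProj fg B) s X) :
    compLin (whR α (resProj hf' t₀) rfl rfl) X v = compLin α X v := by
  have h : sgn k (0 * p.2) • compLin α X v = compLin α X v := by rw [zero_mul, sgn_zero, one_smul]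
  exact h

theorem compLin_unitProj (hf' : PreservesRes fg f) (t : ℤ) (X : (sProj fg A).cat.Obj)
    (m : (X.1 : SMod A).carrier) :
    SMod.unres f (SMod.ind f X.1) (compLin (unitProj hf hf' t) X m) = SMod.tmul f X.1 1 m := rfl

theorem counitMap_ofShift_tmul (t : ℤ) (N : SMod B) (b : B.carrier)
    (y : (SMod.shift (t, 0) (SMod.res f N)).carrier) :
    (SMod.counitMap f N).1 ((SMod.indMap (f := f) (SMod.ofShift (t, 0) (-t, 0)
      (by ext <;> simp) (SMod.res f N))).1 (SMod.tmul f _ b y)) = b • SMod.unres f N y := by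
  rw [SMod.indMap_tmul, SMod.counitMap_tmul]
  exact congrArg (· • SMod.unres f N y) (B.inv_zero b)

theorem compLin_counitProj (hf' : PreservesRes fg f) (t : ℤ) (X : (sProj fg B).cat.Obj)
    (b : B.carrier) (y : (SMod.shift (t, 0) (SMod.res f X.1)).carrier) :
    compLin (counitProj hf hf' t) X (SMod.tmul f (SMod.shift (t, 0) (SMod.res f X.1)) b y) =
      b • SMod.unres f X.1 y :=
  counitMap_ofShift_tmul t X.1 b y

theorem compLin_whR_unitProj (hf' : PreservesRes fg f) (t : ℤ) (X : (sProj fg A).cat.Obj)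
    (m : (X.1 : SMod A).carrier) :
    compLin (whR (unitProj hf hf' t) (indProj hf) (Category.id_comp _).symm
        (Category.assoc _ _ _).symm) X (SMod.tmul f X.1 1 m) =
      SMod.tmul f (GSFun.obj (indProj hf ≫ resProj hf' t) X).1 1
        (compLin (unitProj hf hf' t) X m) := by
  have h₁ := compLin_whR_indProj_of_id hf (unitProj hf hf' t) X 1 m
  rw [map_one] at h₁
  exact h₁

theorem compLin_whL_counitProj (hf' : PreservesRes fg f) (t : ℤ) (X : (sProj fg A).cat.Obj)
    (m : (X.1 : SMod A).carrier) :
    compLin (whL (indProj hf) (counitProj hf hf' t) rfl (Category.comp_id _).symm) X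
        (SMod.tmul f (GSFun.obj (indProj hf ≫ resProj hf' t) X).1 1
          (compLin (unitProj hf hf' t) X m)) = SMod.tmul f X.1 1 m := by
  have h := compLin_counitProj hf hf' t ((indProj hf).obj X) 1 (compLin (unitProj hf hf' t) X m)
  rw [one_smul] at h
  exact ((compLin_whL_of_id (indProj hf) (counitProj hf hf' t) X _).trans h).trans
    (compLin_unitProj hf hf' t X m)

theorem zigzag_indProj (hf' : PreservesRes fg f) (t : ℤ) (e : ((t, 0) + (-t, 0) : Deg) = 0) :
    comp2 e
      (whR (unitProj hf hf' t) (indProj hf) (Category.id_comp _).symm (Category.assoc _ _ _).symm)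
      (whL (indProj hf) (counitProj hf hf' t) rfl (Category.comp_id _).symm) = id2 (indProj hf) :=
  Subtype.ext (funext fun X => SMod.ind_hom_ext fun m =>
    compLin_comp2_eq e (compLin_whR_unitProj hf hf' t X m)
      (compLin_whL_counitProj hf hf' t X m))

theorem zigzagLeft_indProj (hf' : PreservesRes fg f) (t : ℤ) :
    ZigzagLeft (by ext <;> simp) (unitProj hf hf' t) (counitProj hf hf' t) :=
  .intro (zigzag_indProj hf hf' t _)

theorem zigzag_resProj (hf' : PreservesRes fg f) (t : ℤ) (e : ((t, 0) + (-t, 0) : Deg) = 0) :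
    comp2 e
      (whL (resProj hf' t) (unitProj hf hf' t) (Category.comp_id _).symm rfl)
      (whR (counitProj hf hf' t) (resProj hf' t) (Category.assoc _ _ _).symm
        (Category.id_comp _).symm) = id2 (resProj hf' t) := by
  refine Subtype.ext (funext fun X => Subtype.ext (LinearMap.ext fun (y : X.1.carrier) => ?_))
  have h₁ := compLin_counitProj hf hf' t X 1 y
  rw [one_smul] at h₁
  have h₂ : sgn k (0 * 0) • y = y := by rw [mul_zero, sgn_zero, one_smul]
  exact (congrArg (fun z : X.1.carrier => sgn k (0 * 0) • z) h₁).trans h₂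

theorem zigzagRight_resProj (hf' : PreservesRes fg f) (t : ℤ) :
    ZigzagRight (by ext <;> simp) (unitProj hf hf' t) (counitProj hf hf' t) :=
  .intro (zigzag_resProj hf hf' t _)

end

section
variable {k : Type u} [Field k] {fg : Prop} {n : ℕ} (hE : IndPres k fg n) (hF : ResPres k fg n)
  {o o' o'' o''' : Option ℕ}

theorem squareZero_tauNat (s : Step o o') (s' : Step o' o'') : SquareZero (tauNat hE s s') := by
  rcases s with ⟨m, m', h⟩ | _
  · rcases s' with ⟨_, m'', h'⟩ | _
    · subst h h'
      have h₁ : SquareZero _ := mulProj₂_sq (hE m (m + 1) rfl)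
        (hE (m + 1) (m + 2) rfl) (-ONH.lastTau k n rfl rfl)
        (neg_mem (ONH.lastTau_mem rfl rfl)) (fun a => by
          rw [ONH.incl_incl, ONH.incl_incl, neg_mul, mul_neg, ONH.lastTau_supercomm])
        (by rw [neg_mul_neg]; exact ONH.tt_sq m)
      exact h₁
    · exact (((isNull_Efun_zero hE _ _).comp_left _).subsingleton_left _).elim _ _
  · exact (((isNull_Efun_zero hE _ _).comp_right _).subsingleton_left _).elim _ _

theorem dotCross_tauNat (s : Step o o') (s' : Step o' o'') :
    DotCross (xNat hE s) (xNat hE s') (tauNat hE s s') := by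
  rcases s with ⟨m, m', h⟩ | _
  · rcases s' with ⟨_, m'', h'⟩ | _
    · subst h h'
      have h₁ : DotCross _ _ _ := mulProj_mulProj₂ (hE m (m + 1) rfl) (hE (m + 1) (m + 2) rfl)
        (ONH.lastX k n rfl) (ONH.lastX_mem rfl) (ONH.lastX_supercomm rfl _)
        (ONH.lastX k n rfl) (ONH.lastX_mem rfl) (ONH.lastX_supercomm rfl _)
        (-ONH.lastTau k n rfl rfl)
        (neg_mem (ONH.lastTau_mem rfl rfl)) (fun a => by
          rw [ONH.incl_incl, ONH.incl_incl, neg_mul, mul_neg, ONH.lastTau_supercomm])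
        (by rw [mul_neg, neg_mul, ← neg_add]; exact congrArg Neg.neg (ONH.x_tt m))
      exact h₁
    · exact (((isNull_Efun_zero hE _ _).comp_left _).subsingleton_left _).elim _ _
  · exact (((isNull_Efun_zero hE _ _).comp_right _).subsingleton_left _).elim _ _

theorem crossDot_tauNat (s : Step o o') (s' : Step o' o'') :
    CrossDot (xNat hE s) (xNat hE s') (tauNat hE s s') := by
  rcases s with ⟨m, m', h⟩ | _
  · rcases s' with ⟨_, m'', h'⟩ | _
    · subst h h'
      have h₁ : CrossDot _ _ _ := mulProj₂_mulProj (hE m (m + 1) rfl) (hE (m + 1) (m + 2) rfl)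
        (ONH.lastX k n rfl) (ONH.lastX_mem rfl) (ONH.lastX_supercomm rfl _)
        (ONH.lastX k n rfl) (ONH.lastX_mem rfl) (ONH.lastX_supercomm rfl _)
        (-ONH.lastTau k n rfl rfl)
        (neg_mem (ONH.lastTau_mem rfl rfl)) (fun a => by
          rw [ONH.incl_incl, ONH.incl_incl, neg_mul, mul_neg, ONH.lastTau_supercomm])
        (by rw [mul_neg, neg_mul, ← neg_add]; exact congrArg Neg.neg (ONH.tt_x m))
      exact h₁
    · exact (((isNull_Efun_zero hE _ _).comp_left _).subsingleton_left _).elim _ _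
  · exact (((isNull_Efun_zero hE _ _).comp_right _).subsingleton_left _).elim _ _

theorem neg_tt_braid (m : ℕ) :
    -ONH.tt k n (m + 1) * ONH.up k n (m + 2) (-ONH.tt k n m) * -ONH.tt k n (m + 1) =
      ONH.up k n (m + 2) (-ONH.tt k n m) * -ONH.tt k n (m + 1) *
        ONH.up k n (m + 2) (-ONH.tt k n m) := by
  simp only [map_neg, neg_mul, mul_neg, neg_neg, ONH.braid]

theorem braid_tauNat (s : Step o o') (s' : Step o' o'') (s'' : Step o'' o''') :
    Braid (tauNat hE s s') (tauNat hE s' s'') := by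
  rcases s with ⟨m, m', h⟩ | _
  · rcases s' with ⟨_, m'', h'⟩ | _
    · rcases s'' with ⟨_, m''', h''⟩ | _
      · subst h h' h''
        have h₁ : Braid _ _ := mulProj₂_braid (hE m (m + 1) rfl) (hE (m + 1) (m + 2) rfl)
          (hE (m + 2) (m + 3) rfl) (-ONH.lastTau k n rfl rfl)
          (neg_mem (ONH.lastTau_mem rfl rfl)) (fun a => by
            rw [ONH.incl_incl, ONH.incl_incl, neg_mul, mul_neg, ONH.lastTau_supercomm])
          (-ONH.lastTau k n rfl rfl)
          (neg_mem (ONH.lastTau_mem rfl rfl)) (fun a => by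
            rw [ONH.incl_incl, ONH.incl_incl, neg_mul, mul_neg, ONH.lastTau_supercomm])
          (neg_tt_braid m)
        exact h₁
      · exact ((((isNull_Efun_zero hE _ _).comp_left _).comp_left _).subsingleton_left _).elim _ _
    · exact ((((isNull_Efun_zero hE _ _).comp_right _).comp_left _).subsingleton_left _).elim _ _
  · exact (((isNull_Efun_zero hE _ _).comp_right _).subsingleton_left _).elim _ _

theorem zigzagLeft_Efun (t : ℤ) (s : Step o o') :
    ZigzagLeft (by ext <;> simp) (etaNat hE hF t s) (epsNat hE hF t s) := by
  rcases s with ⟨m, m', h⟩ | _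
  · exact zigzagLeft_indProj (hE m m' h) (hF m m' h) t
  · exact ((isNull_Efun_zero hE _ _).subsingleton_left _).elim _ _

theorem zigzagRight_Efun (t : ℤ) (s : Step o o') :
    ZigzagRight (by ext <;> simp) (etaNat hE hF t s) (epsNat hE hF t s) := by
  rcases s with ⟨m, m', h⟩ | _
  · exact zigzagRight_resProj (hE m m' h) (hF m m' h) t
  · exact ((isNull_Ffun_zero hF t _ _).subsingleton_left _).elim _ _

theorem isAdjunction_Efun (s : Step o o') :
    IsAdjunction k (Efun hE s) (Ffun hF 0 s) (etaNat hE hF 0 s) (epsNat hE hF 0 s) := by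
  have h₁ : ZigzagLeft (k := k) (p := 0) (q := 0) (zero_add 0) (f := Efun hE s) (g := Ffun hF 0 s)
    (etaNat hE hF 0 s) (epsNat hE hF 0 s) := zigzagLeft_Efun hE hF 0 s
  have h₂ : ZigzagRight (k := k) (p := 0) (q := 0) (zero_add 0) (f := Efun hE s) (g := Ffun hF 0 s)
    (etaNat hE hF 0 s) (epsNat hE hF 0 s) := zigzagRight_Efun hE hF 0 s
  exact h₁.isAdjunction h₂

end

end OddCat

namespace OddCat

/-! ## The components of the crossing, the cups and the caps -/

/-- The sign of the `j`-th power of an odd endomorphism. -/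
def dotSign (k : Type u) [Field k] : ℕ → k
  | 0 => 1
  | j + 1 => sgn k (j : ZMod 2) * dotSign k j

theorem dotSign_mul_self (k : Type u) [Field k] : ∀ j, dotSign k j * dotSign k j = 1
  | 0 => one_mul 1
  | j + 1 => by
    rw [dotSign, mul_mul_mul_comm, sgn_mul_self, dotSign_mul_self k j, one_mul]

section
variable {k : Type u} [Field k] {fg : Prop} {A B C : GSAlg k} {f : A.Hom B} {g : B.Hom C}

/-- An element, as an element of the shifted restriction. -/
def SMod.rise (f : A.Hom B) (t : ℤ) (N : SMod B) :
    N.carrier →ₗ[k] (SMod.shift (t, 0) (SMod.res f N)).carrier where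
  toFun x := x
  map_add' _ _ := rfl
  map_smul' _ _ := rfl

theorem compLin_castDeg {B₁ : QPCat k} {s t : B₁ ⟶ sProj fg A} {p q : Deg} (e : p = q)
    (α : Hom2 k p s t) (X : B₁.cat.Obj) (v : GSFun.mod (C := B₁.cat) (P := IsProj fg A) s X) :
    compLin (castDeg k e α) X v = compLin α X v := by subst e; rfl

theorem GSAlg.inv_pow_of_odd (A : GSAlg k) {p : Deg} {a : A.carrier} (ha : a ∈ A.gr p)
    (hp : p.2 = 1) (j : ℕ) : A.inv 1 (a ^ j) = sgn k (j : ZMod 2) • a ^ j := by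
  induction j with
  | zero => rw [pow_zero, map_one, Nat.cast_zero, sgn_zero, one_smul]
  | succ j ih =>
    rw [pow_succ, map_mul, ih, A.inv_of_odd ha hp, mul_neg, Nat.cast_succ, sgn_add,
      show sgn k (1 : ZMod 2) = -1 by simpa using sgn_one_mul_one (k := k), mul_neg_one, neg_smul,
      smul_mul_assoc]

variable (hf : PreservesInd fg f) (hg : PreservesInd fg g)

theorem compLin_xpowOf_mulProj (x : B.carrier) (hx : x ∈ B.gr (2, 1))
    (hx' : ∀ a, x * f.map a = f.map (A.inv 1 a) * x) (X : (sProj fg A).cat.Obj) (b : B.carrier)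
    (m : (X.1 : SMod A).carrier) : ∀ j : ℕ,
    compLin (xpowOf (mulProj hf x hx hx') j) X (SMod.tmul f X.1 b m) =
      SMod.tmul f X.1 (dotSign k j • (B.inv (j : ZMod 2) b * x ^ j)) m
  | 0 => by
    refine (compLin_castDeg _ _ _ _).trans ?_
    rw [dotSign, one_smul, Nat.cast_zero, B.inv_zero, pow_zero, mul_one]
    rfl
  | j + 1 => by
    refine (compLin_comp2_eq _ (compLin_xpowOf_mulProj x hx hx' X b m j)
      (SMod.mulHom_tmul x hx hx' X.1 _ m)).trans ?_
    refine congrArg (fun c => SMod.tmul f X.1 c m) ?_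
    rw [map_smul, map_mul, GSAlg.inv_inv, B.inv_pow_of_odd hx rfl, mul_smul_comm, smul_smul,
      smul_mul_assoc, mul_assoc, ← pow_succ, dotSign, Nat.cast_succ, add_comm (1 : ZMod 2),
      mul_comm (dotSign k j)]

theorem compLin_capOf (hf' : PreservesRes fg f) (t l : ℤ)
    (e : ((-t, 0) : Deg) = (1 - l, 0)) (x : B.carrier) (hx : x ∈ B.gr (2, 1))
    (hx' : ∀ a, x * f.map a = f.map (A.inv 1 a) * x) (j : ℕ) (X : (sProj fg B).cat.Obj)
    (b : B.carrier) (y : (SMod.shift (t, 0) (SMod.res f X.1)).carrier) :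
    compLin (capOf (mulProj hf x hx hx') (castDeg k e (counitProj hf hf' t)) j) X
        (SMod.tmul f (SMod.shift (t, 0) (SMod.res f X.1)) b y) =
      (dotSign k j • (B.inv (j : ZMod 2) b * x ^ j)) • SMod.unres f X.1 y :=
  compLin_comp2_eq _ ((compLin_whL (resProj hf' t) (xpowOf (mulProj hf x hx hx') j) X _).trans
    (compLin_xpowOf_mulProj hf x hx hx' ((resProj hf' t).obj X) b y j))
    ((compLin_castDeg e _ _ _).trans (compLin_counitProj hf hf' t X _ y))

theorem compLin_whR_resProj_rise (hf' : PreservesRes fg f) (t₀ : ℤ) {B₁ : QPCat k}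
    {s t : B₁ ⟶ sProj fg B} {p : Deg} (α : Hom2 k p s t) (X : B₁.cat.Obj)
    (v : GSFun.mod (C := B₁.cat) (P := IsProj fg B) s X) :
    compLin (whR α (resProj hf' t₀) rfl rfl) X (SMod.rise f t₀ _ v) =
      SMod.rise f t₀ _ (compLin α X v) :=
  compLin_whR_resProj hf' t₀ α X v

theorem compLin_cupOf (hf' : PreservesRes fg f) (l : ℤ) (x : B.carrier) (hx : x ∈ B.gr (2, 1))
    (hx' : ∀ a, x * f.map a = f.map (A.inv 1 a) * x) (j : ℕ) (X : (sProj fg A).cat.Obj)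
    (m : (X.1 : SMod A).carrier) :
    compLin (cupOf (l := l) (mulProj hf x hx hx') (unitProj hf hf' (1 + l)) j) X m =
      SMod.rise f (1 + l) (SMod.ind f X.1) (SMod.tmul f X.1 (dotSign k j • x ^ j) m) := by
  refine compLin_comp2_eq _ (rfl : compLin (unitProj hf hf' (1 + l)) X m =
    SMod.rise f (1 + l) (SMod.ind f X.1) (SMod.tmul f X.1 1 m)) ?_
  refine (compLin_whR_resProj_rise hf' (1 + l) (xpowOf (mulProj hf x hx hx') j) X _).trans ?_
  refine congrArg (SMod.rise f (1 + l) (SMod.ind f X.1)) ?_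
  refine (compLin_xpowOf_mulProj hf x hx hx' X 1 m j).trans ?_
  rw [map_one, one_mul]

end

section
variable {k : Type u} [Field k] {fg : Prop} {A B C : GSAlg k} {f : A.Hom B} {g : B.Hom C}
  (hf : PreservesInd fg f) (hg : PreservesInd fg g)

theorem compLin_whL_cup {B₁ : QPCat k} {u : B₁ ⟶ sProj fg A} {u' : sProj fg A ⟶ sProj fg B}
    {s : sProj fg B ⟶ sProj fg C} {s' : sProj fg C ⟶ sProj fg B} {p : Deg}
    (α : Hom2 k p (𝟙 (sProj fg B)) (s ≫ s')) (X : B₁.cat.Obj)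
    (v : GSFun.mod (C := B₁.cat) (P := IsProj fg B) (u ≫ u') X) :
    compLin (t := u ≫ u' ≫ s ≫ s') (whL (u ≫ u') α (Category.comp_id _).symm
      (Category.assoc _ _ _).symm) X v = compLin α (GSFun.obj (u ≫ u') X) v := rfl

theorem compLin_whL_whR_resProj (hg' : PreservesRes fg g) (t : ℤ) {B₁ : QPCat k}
    {u : B₁ ⟶ sProj fg A} {s : sProj fg A ⟶ sProj fg B} {s' : sProj fg B ⟶ sProj fg C} {p : Deg}
    (α : Hom2 k p (s ≫ s') (s ≫ s')) (X : B₁.cat.Obj)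
    (v : GSFun.mod (C := (sProj fg A).cat) (P := IsProj fg C) (s ≫ s') (GSFun.obj u X)) :
    compLin (whL u (whR α (resProj hg' t) (Category.assoc _ _ _).symm (Category.assoc _ _ _).symm)
      rfl rfl) X (SMod.rise g t _ v) = SMod.rise g t _ (compLin α (GSFun.obj u X) v) :=
  compLin_whR_resProj hg' t α (GSFun.obj u X) v

theorem compLin_whR_indProj_resProj (hg' : PreservesRes fg g) (t : ℤ) {B₁ : QPCat k}
    {u : sProj fg B ⟶ B₁} {u' : B₁ ⟶ sProj fg B} {p : Deg}
    (α : Hom2 k p (u ≫ u') (𝟙 (sProj fg B))) (X : (sProj fg B).cat.Obj) (c : C.carrier)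
    (m : GSFun.mod (C := (sProj fg B).cat) (P := IsProj fg B) (u ≫ u') X) :
    compLin (whR α (indProj hg ≫ resProj hg' t) (Category.assoc _ _ _).symm
        (Category.id_comp _).symm) X
      (SMod.rise g t _ (SMod.tmul g (GSFun.obj (u ≫ u') X).1 c m)) =
    SMod.rise g t _ (SMod.tmul g X.1 (C.inv p.2 c) (compLin α X m)) := by
  have h : sgn k (0 * p.2) • SMod.rise g t (SMod.ind g X.1)
      ((SMod.indMap (f := g) (show SMod.Hom p (GSFun.obj (u ≫ u') X).1 X.1 from α.1 X)).1
        (SMod.tmul g (GSFun.obj (u ≫ u') X).1 c m)) =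
      SMod.rise g t _ (SMod.tmul g X.1 (C.inv p.2 c) (compLin α X m)) := by
    rw [zero_mul, sgn_zero, one_smul, SMod.indMap_tmul]
    rfl
  exact h

theorem compLin_crossOf (hf' : PreservesRes fg f) (hg' : PreservesRes fg g) (t l : ℤ)
    (e : ((-t, 0) : Deg) = (1 - l, 0)) (z : C.carrier) (hz : z ∈ C.gr (-2, 1))
    (hz' : ∀ a, z * g.map (f.map a) = g.map (f.map (A.inv 1 a)) * z) (X : (sProj fg B).cat.Obj)
    (b : B.carrier) (y : (SMod.shift (t, 0) (SMod.res f X.1)).carrier) :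
    compLin (crossOf (mulProj₂ hf hg z hz hz') (unitProj hg hg' (1 + l))
        (castDeg k e (counitProj hf hf' t))) X
      (SMod.tmul f (SMod.shift (t, 0) (SMod.res f X.1)) b y) =
    SMod.rise g (1 + l) (SMod.ind g X.1)
      (SMod.tmul g X.1 (C.inv 1 (g.map b) * z) (SMod.unres f X.1 y)) := by
  refine compLin_comp2_eq _ (compLin_comp2_eq _
    (compLin_whL_cup (u := resProj hf' t) (u' := indProj hf) (unitProj hg hg' (1 + l)) X
      (SMod.tmul f (SMod.shift (t, 0) (SMod.res f X.1)) b y))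
    ((compLin_whL_whR_resProj hg' (1 + l) (u := resProj hf' t) (mulProj₂ hf hg z hz hz') X
      (SMod.tmul g _ 1 (SMod.tmul f _ b y))).trans
      (congrArg (SMod.rise g (1 + l) _) ((SMod.mulHom₂_tmul z hz hz' _ 1 b y).trans
        (congrArg (fun c => SMod.tmul g _ c _) (by rw [one_mul])))))) ?_
  refine (compLin_whR_indProj_resProj hg hg' (1 + l) (castDeg k e (counitProj hf hf' t)) X _
    (SMod.tmul f (SMod.shift (t, 0) (SMod.res f X.1)) 1 y)).trans ?_
  refine congrArg (SMod.rise g (1 + l) _) ?_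
  rw [C.inv_zero]
  refine congrArg (SMod.tmul g X.1 _) ((compLin_castDeg e _ _ _).trans
    ((compLin_counitProj hf hf' t X 1 y).trans (one_smul _ _)))

end

end OddCat

namespace OddCat

/-! ## The Mackey decomposition for supermodules -/

section
variable {k : Type u} [Field k] {B D : GSAlg k} (g : B.Hom D) (M : SMod B)

theorem SMod.balanced_tmul (c : D.carrier) (b : B.carrier) (y : M.carrier) :
    SMod.tmul g M (c * g.map b) y = SMod.tmul g M c (b • y) := by
  have h : ∀ y : M.carrier, SMod.tmul g M c y = c • SMod.tmul g M 1 y := fun y => by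
    rw [SMod.smul_tmul, mul_one]
  rw [h (b • y), ← SMod.map_smul_tmul, smul_smul, SMod.smul_tmul, mul_one]

/-- Passage from an isomorphism of right modules `Q ⊕ B^N ≃ D ⊕ B^L` to a bijection
`Q ⊗_B M ⊕ M^N ≃ D ⊗_B M ⊕ M^L`. -/
theorem bijective_of_rightLinear {Q X : Type u} [AddCommGroup Q] [Module k Q] [AddCommGroup X]
    [Module k X] (actQ : B.carrier → Q → Q) (T : Q →ₗ[k] M.carrier →ₗ[k] X)
    (hT : ∀ b q y, T (actQ b q) y = T q (b • y))
    (spanT : ∀ S : Submodule k X, (∀ q y, T q y ∈ S) → S = ⊤) {N L : ℕ}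
    (Θ : (Q × (Fin N → B.carrier)) ≃ₗ[k] D.carrier × (Fin L → B.carrier))
    (hΘ : ∀ b v, Θ (actQ b v.1, fun r => v.2 r * b) =
      ((Θ v).1 * g.map b, fun l => (Θ v).2 l * b))
    (a : Fin N → k) (c : Fin L → k) (ha : ∀ r, a r * a r = 1) (hc : ∀ l, c l * c l = 1)
    (G : X × (Fin N → M.carrier) →ₗ[k] (SMod.ind g M).carrier × (Fin L → M.carrier))
    (hG : ∀ q t y, G (T q y, fun r => a r • t r • y) =
      (SMod.tmul g M (Θ (q, t)).1 y, fun l => c l • (Θ (q, t)).2 l • y)) :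
    Function.Bijective G := by
  let φ : (Q × (Fin N → B.carrier)) →ₗ[k] M.carrier →ₗ[k] X × (Fin N → M.carrier) :=
    LinearMap.mk₂ k (fun v y => (T v.1 y, fun r => a r • v.2 r • y))
      (fun v v' y => by ext <;> simp [add_smul])
      (fun s v y => by ext <;> simp [smul_comm s])
      (fun v y y' => by ext <;> simp)
      (fun s v y => by ext <;> simp [smul_comm s])
  let ψ : (D.carrier × (Fin L → B.carrier)) →ₗ[k] M.carrier →ₗ[k]
      (SMod.ind g M).carrier × (Fin L → M.carrier) :=
    LinearMap.mk₂ k (fun v y => (SMod.tmul g M v.1 y, fun l => c l • v.2 l • y))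
      (fun v v' y => by ext <;> simp [add_smul, SMod.add_tmul])
      (fun s v y => by ext <;> simp [smul_comm s, SMod.smul_left_tmul])
      (fun v y y' => by ext <;> simp [SMod.tmul_add])
      (fun s v y => by ext <;> simp [smul_comm s, SMod.tmul_smul])
  refine bijective_of_balanced (fun b y => b • y)
    (fun b (v : Q × (Fin N → B.carrier)) => (actQ b v.1, fun r => v.2 r * b))
    (fun b (w : D.carrier × (Fin L → B.carrier)) => (w.1 * g.map b, fun l => w.2 l * b)) Θ hΘ φ ψ ?_ ?_ ?_ ?_ G ?_
  · intro b v y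
    refine Prod.ext (hT b v.1 y) (funext fun r => ?_)
    change a r • (v.2 r * b) • y = a r • v.2 r • b • y
    rw [mul_smul]
  · intro S hS
    rw [eq_top_iff]
    rintro ⟨x, t⟩ -
    have h₁ : S.comap (LinearMap.inl k X (Fin N → M.carrier)) = ⊤ := spanT _ fun q y => by
      have := hS (q, 0) y
      have e : φ (q, 0) y = LinearMap.inl k X (Fin N → M.carrier) (T q y) := by
        refine Prod.ext rfl (funext fun r => ?_)
        change a r • (0 : B.carrier) • y = 0
        rw [zero_smul, smul_zero]
      rwa [e] at this
    have h₂ : (x, 0) ∈ S := by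
      have : x ∈ S.comap (LinearMap.inl k X (Fin N → M.carrier)) := by rw [h₁]; trivial
      exact this
    have h₃ : ∀ r, (0, Pi.single r (t r)) ∈ S := fun r => by
      have := hS (0, Pi.single r (a r • 1)) (t r)
      have e : φ (0, Pi.single r (a r • 1)) (t r) = (0, Pi.single r (t r)) := by
        refine Prod.ext ?_ (funext fun r' => ?_)
        · change T 0 (t r) = 0
          rw [map_zero, LinearMap.zero_apply]
        · change a r' • (Pi.single r (a r • (1 : B.carrier)) : Fin N → B.carrier) r' • t r =
            (Pi.single r (t r) : Fin N → M.carrier) r'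
          by_cases h : r' = r
          · subst h
            rw [Pi.single_eq_same, Pi.single_eq_same, smul_assoc, one_smul, smul_smul, ha,
              one_smul]
          · rw [Pi.single_eq_of_ne h, Pi.single_eq_of_ne h, zero_smul, smul_zero]
      rwa [e] at this
    have e : (x, t) = (x, 0) + ∑ r, ((0, Pi.single r (t r)) : X × (Fin N → M.carrier)) := by
      refine Prod.ext ?_ ?_
      · rw [Prod.fst_add, Prod.fst_sum, Finset.sum_const_zero, add_zero]
      · rw [Prod.snd_add, Prod.snd_sum, zero_add, Finset.univ_sum_single]
    rw [e]
    exact add_mem h₂ (sum_mem fun r _ => h₃ r)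
  · intro S hS
    rw [eq_top_iff]
    rintro ⟨x, t⟩ -
    have h₂ : (x, 0) ∈ S := by
      induction x using SMod.tmul_induction with
      | h0 => exact zero_mem S
      | hadd x y hx hy =>
        have := add_mem hx hy
        rwa [Prod.mk_add_mk, add_zero] at this
      | hmk d y =>
        have := hS (d, 0) y
        have e : ψ (d, 0) y = (SMod.tmul g M d y, 0) := by
          refine Prod.ext rfl (funext fun l => ?_)
          change c l • (0 : B.carrier) • y = 0
          rw [zero_smul, smul_zero]
        rwa [e] at this
    have h₃ : ∀ l, (0, Pi.single l (t l)) ∈ S := fun l => by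
      have := hS (0, Pi.single l (c l • 1)) (t l)
      have e : ψ (0, Pi.single l (c l • 1)) (t l) = (0, Pi.single l (t l)) := by
        refine Prod.ext (SMod.zero_tmul _) (funext fun l' => ?_)
        change c l' • (Pi.single l (c l • (1 : B.carrier)) : Fin L → B.carrier) l' • t l =
          (Pi.single l (t l) : Fin L → M.carrier) l'
        by_cases h : l' = l
        · subst h
          rw [Pi.single_eq_same, Pi.single_eq_same, smul_assoc, one_smul, smul_smul, hc, one_smul]
        · rw [Pi.single_eq_of_ne h, Pi.single_eq_of_ne h, zero_smul, smul_zero]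
      rwa [e] at this
    have e : (x, t) = (x, 0) + ∑ l,
        ((0, Pi.single l (t l)) : (SMod.ind g M).carrier × (Fin L → M.carrier)) := by
      refine Prod.ext ?_ ?_
      · rw [Prod.fst_add, Prod.fst_sum, Finset.sum_const_zero, add_zero]
      · rw [Prod.snd_add, Prod.snd_sum, zero_add, Finset.univ_sum_single]
    rw [e]
    exact add_mem h₂ (sum_mem fun l _ => h₃ l)
  · intro β hβ
    let H₁ : (SMod.ind g M).carrier →ₗ[k] X × (Fin N → M.carrier) :=
      SMod.indLift g (β ∘ₗ LinearMap.inl k _ _) fun d b y => by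
        have := hβ b (d, 0) y
        refine Eq.trans ?_ this
        change β (d * g.map b, 0) y = β (d * g.map b, fun l => 0 * b) y
        congr 3
        funext l
        exact (zero_mul b).symm
    let H₂ : (Fin L → M.carrier) →ₗ[k] X × (Fin N → M.carrier) :=
      ∑ l, (β (0, Pi.single l (c l • 1))) ∘ₗ LinearMap.proj l
    refine ⟨LinearMap.coprod H₁ H₂, fun w y => ?_⟩
    have e₁ : H₁ (SMod.tmul g M w.1 y) = β (w.1, 0) y := rfl
    have e₂ : H₂ (fun l => c l • w.2 l • y) = β (0, w.2) y := by
      have h : ∀ l, β (0, Pi.single l (c l • 1)) (c l • w.2 l • y) = β (0, Pi.single l (w.2 l)) y :=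
          fun l => by
        have h₁ := hβ (w.2 l) (0, Pi.single l 1) y
        have h₂ : ((0, Pi.single l (c l • 1)) : D.carrier × (Fin L → B.carrier)) =
            c l • (0, Pi.single l 1) := by
          rw [Prod.smul_mk, smul_zero, ← Pi.single_smul]
        rw [h₂, (β _).map_smul, β.map_smul, LinearMap.smul_apply, smul_smul, hc, one_smul, ← h₁]
        congr 3
        · exact zero_mul _
        · funext l'
          change (Pi.single l (1 : B.carrier) : Fin L → B.carrier) l' * w.2 l =
            (Pi.single l (w.2 l) : Fin L → B.carrier) l'
          by_cases h : l' = l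
          · subst h
            rw [Pi.single_eq_same, Pi.single_eq_same, one_mul]
          · rw [Pi.single_eq_of_ne h, Pi.single_eq_of_ne h, zero_mul]
      have e : ((0, w.2) : D.carrier × (Fin L → B.carrier)) = ∑ l, (0, Pi.single l (w.2 l)) := by
        refine Prod.ext ?_ ?_
        · rw [Prod.fst_sum, Finset.sum_const_zero]
        · rw [Prod.snd_sum, Finset.univ_sum_single]
      rw [e, map_sum, LinearMap.sum_apply, LinearMap.sum_apply]
      exact Finset.sum_congr rfl fun l _ => h l
    change H₁ (SMod.tmul g M w.1 y) + H₂ (fun l => c l • w.2 l • y) = β w y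
    rw [e₁, e₂, ← LinearMap.add_apply, ← map_add, Prod.mk_add_mk, add_zero, zero_add]
  · intro v y
    exact hG v.1 v.2 y

end

end OddCat

namespace OddCat

section
variable {k : Type u} [Field k] {fg : Prop} {A : GSAlg k} {s t : sProj fg A ⟶ sProj fg A} {l : ℤ}
  {σ : Hom2 k (0, 1) s t}
  {cap : (j : ℕ) → Hom2 k (2 * (j : ℤ) + (1 - l), (j : ZMod 2)) s (𝟙 (sProj fg A))}
  {cup : (j : ℕ) → Hom2 k (1 + l + 2 * (j : ℤ), (j : ZMod 2)) (𝟙 (sProj fg A)) t}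

/-- Componentwise bijectivity, in terms of linear maps with prescribed values. -/
theorem SlMatrix.IsBijective.of_linearMap {N L : ℕ}
    (h : ∀ X : (sProj fg A).cat.Obj, ∀ G : GSFun.mod (P := IsProj fg A) s X ×
        (Fin N → (X.1 : SMod A).carrier) →ₗ[k]
        GSFun.mod (P := IsProj fg A) t X × (Fin L → (X.1 : SMod A).carrier),
      (∀ v w, (G (v, w)).1 = compLin σ X v + ∑ r : Fin N, compLin (cup r) X (w r)) →
      (∀ v w (j : Fin L), (G (v, w)).2 j = compLin (cap j) X v) → Function.Bijective G) :
    SlMatrix.IsBijective l σ cap cup N L := fun X => by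
  let G : GSFun.mod (P := IsProj fg A) s X × (Fin N → (X.1 : SMod A).carrier) →ₗ[k]
        GSFun.mod (P := IsProj fg A) t X × (Fin L → (X.1 : SMod A).carrier) :=
    LinearMap.prod (LinearMap.coprod (compLin σ X)
      (∑ r : Fin N, compLin (cup r) X ∘ₗ LinearMap.proj r))
      (LinearMap.pi (fun j : Fin L => compLin (cap j) X) ∘ₗ LinearMap.fst k _ _)
  have h₁ : ∀ v w, (G (v, w)).1 = compLin σ X v + ∑ r : Fin N, compLin (cup r) X (w r) :=
    fun v w => congrArg (compLin σ X v + ·) (LinearMap.sum_apply _ _ _)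
  have h₂ : ∀ v w (j : Fin L), (G (v, w)).2 j = compLin (cap j) X v := fun _ _ _ => rfl
  convert h X G h₁ h₂ using 1
  funext p
  exact Prod.ext (h₁ p.1 p.2).symm rfl

end

section
variable {k : Type u} [Field k] {A B : GSAlg k} {f : A.Hom B}

theorem SMod.smul_rise (t : ℤ) (N : SMod B) (a : A.carrier) (x : N.carrier) :
    a • SMod.rise f t N x = SMod.rise f t N (f.map a • x) := by
  change f.map (A.inv 0 a) • x = f.map a • x
  rw [A.inv_zero]

end

namespace ONH

open TensorProduct

section
variable {k : Type u} [Field k] {n m : ℕ}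

/-- The inclusion of `ONH_m^n` into `ONH_(m+1)^n`, as a homomorphism of graded superalgebras. -/
noncomputable abbrev upHom (k : Type u) [Field k] (n m : ℕ) : (ONH k n m).Hom (ONH k n (m + 1)) :=
  incl (Nat.le_succ m)

/-- The map `(b ⊗ b', y) ↦ b ⊗ b' y`. -/
noncomputable def TensorSq.act (t : ℤ) (M : SMod (ONH k n (m + 1))) :
    TensorSq k n m →ₗ[k] M.carrier →ₗ[k]
      (SMod.ind (upHom k n m) (SMod.shift (t, 0) (SMod.res (upHom k n m) M))).carrier :=
  TensorSq.lift (TensorProduct.lift (LinearMap.mk₂ k (fun b b' =>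
    ({ toFun := fun y => SMod.tmul (upHom k n m) _ b (SMod.rise (upHom k n m) t M (b' • y))
       map_add' := fun y y' => by rw [smul_add, map_add, SMod.tmul_add]
       map_smul' := fun c y => by
        rw [smul_comm, map_smul, SMod.tmul_smul, RingHom.id_apply] } :
      M.carrier →ₗ[k] (SMod.ind (upHom k n m)
        (SMod.shift (t, 0) (SMod.res (upHom k n m) M))).carrier))
    (fun b₁ b₂ b' => LinearMap.ext fun y => SMod.add_tmul _ _ _)
    (fun c b b' => LinearMap.ext fun y => SMod.smul_left_tmul _ _ _)
    (fun b b₁ b₂ => LinearMap.ext fun y => by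
      change SMod.tmul _ _ b (SMod.rise _ t M ((b₁ + b₂) • y)) = _
      rw [add_smul, map_add, SMod.tmul_add]
      rfl)
    (fun c b b' => LinearMap.ext fun y => by
      change SMod.tmul _ _ b (SMod.rise _ t M ((c • b') • y)) = _
      rw [smul_assoc, map_smul, SMod.tmul_smul]
      rfl))) fun a c b => LinearMap.ext fun y => by
    change SMod.tmul _ _ (a * up k n m c) (SMod.rise _ t M (b • y)) =
      SMod.tmul _ _ a (SMod.rise _ t M ((up k n m c * b) • y))
    rw [mul_smul]
    refine (SMod.balanced_tmul _ _ a c _).trans ?_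
    rw [SMod.smul_rise]

theorem TensorSq.act_mk (t : ℤ) (M : SMod (ONH k n (m + 1)))
    (b b' : (ONH k n (m + 1)).carrier) (y : M.carrier) :
    TensorSq.act t M (Submodule.Quotient.mk (b ⊗ₜ[k] b')) y =
      SMod.tmul (upHom k n m) _ b (SMod.rise (upHom k n m) t M (b' • y)) := rfl

theorem TensorSq.induction {motive : TensorSq k n m → Prop} (h0 : motive 0)
    (hmk : ∀ b b', motive (Submodule.Quotient.mk (b ⊗ₜ[k] b')))
    (hadd : ∀ q q', motive q → motive q' → motive (q + q')) (q : TensorSq k n m) : motive q := by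
  obtain ⟨z, rfl⟩ := Submodule.Quotient.mk_surjective _ q
  induction z with
  | zero => exact h0
  | tmul b b' => exact hmk b b'
  | add z z' hz hz' => exact hadd _ _ hz hz'

theorem TensorSq.act_mulRight (t : ℤ) (M : SMod (ONH k n (m + 1)))
    (b : (ONH k n (m + 1)).carrier) (q : TensorSq k n m) (y : M.carrier) :
    TensorSq.act t M (TensorSq.mulRight k n m b q) y = TensorSq.act t M q (b • y) := by
  induction q using TensorSq.induction with
  | h0 => simp only [map_zero, LinearMap.zero_apply]
  | hmk a a' =>
    rw [TensorSq.mulRight_mk, LinearMap.lTensor_tmul, LinearMap.mulRight_apply, act_mk, act_mk,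
      mul_smul]
  | hadd q q' hq hq' =>
    simp only [map_add, LinearMap.add_apply, hq, hq']

theorem TensorSq.act_span (t : ℤ) (M : SMod (ONH k n (m + 1)))
    (S : Submodule k (SMod.ind (upHom k n m)
      (SMod.shift (t, 0) (SMod.res (upHom k n m) M))).carrier)
    (hS : ∀ q y, TensorSq.act t M q y ∈ S) : S = ⊤ := by
  rw [eq_top_iff]
  rintro x -
  induction x using SMod.tmul_induction with
  | h0 => exact zero_mem S
  | hadd x y hx hy => exact add_mem hx hy
  | hmk b y =>
    have h := hS (Submodule.Quotient.mk (b ⊗ₜ[k] 1)) (SMod.unres (upHom k n m) M y)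
    rw [act_mk, one_smul] at h
    exact h

end

end ONH

end OddCat

namespace OddCat

namespace ONH

open TensorProduct

section
variable {k : Type u} [Field k] {n m : ℕ}

theorem act_crossing (t : ℤ) (M : SMod (ONH k n (m + 1)))
    (S : (SMod.ind (upHom k n m) (SMod.shift (t, 0) (SMod.res (upHom k n m) M))).carrier →ₗ[k]
      (SMod.ind (upHom k n (m + 1)) M).carrier)
    (hS : ∀ b y, S (SMod.tmul _ _ b y) = SMod.tmul (upHom k n (m + 1)) M
      ((ONH k n (m + 2)).inv 1 (up k n (m + 1) b) * -tt k n m) (SMod.unres (upHom k n m) M y))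
    (z : (ONH k n (m + 1)).carrier ⊗[k] (ONH k n (m + 1)).carrier) (y : M.carrier) :
    S (TensorSq.act t M (Submodule.Quotient.mk z) y) =
      -SMod.tmul (upHom k n (m + 1)) M (crossing k n m z) y := by
  induction z with
  | zero =>
    rw [Submodule.Quotient.mk_zero, map_zero, map_zero, LinearMap.zero_apply, map_zero,
      SMod.zero_tmul, neg_zero]
  | add z z' hz hz' =>
    rw [Submodule.Quotient.mk_add, map_add, map_add, LinearMap.add_apply, map_add, hz, hz',
      SMod.add_tmul, neg_add]
  | tmul b b' =>
    rw [TensorSq.act_mk, hS, sandwich_tmul, up_inv, mul_neg]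
    have h := SMod.balanced_tmul (upHom k n (m + 1)) M
      ((ONH k n (m + 2)).inv 1 (up k n (m + 1) b) * tt k n m) b' y
    rw [h, ← neg_one_smul k (_ * _), SMod.smul_left_tmul, neg_one_smul]
    rfl

theorem act_dotted (t : ℤ) (M : SMod (ONH k n (m + 1))) (l : ℕ) (c : k)
    (S : (SMod.ind (upHom k n m) (SMod.shift (t, 0) (SMod.res (upHom k n m) M))).carrier →ₗ[k]
      M.carrier)
    (hS : ∀ b y, S (SMod.tmul _ _ b y) =
      (c • ((ONH k n (m + 1)).inv (l : ZMod 2) b * xx k n m ^ l)) • SMod.unres (upHom k n m) M y)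
    (z : (ONH k n (m + 1)).carrier ⊗[k] (ONH k n (m + 1)).carrier) (y : M.carrier) :
    S (TensorSq.act t M (Submodule.Quotient.mk z) y) = c • dotted k n m l z • y := by
  induction z with
  | zero =>
    rw [Submodule.Quotient.mk_zero, map_zero, map_zero, LinearMap.zero_apply, map_zero,
      zero_smul, smul_zero]
  | add z z' hz hz' =>
    rw [Submodule.Quotient.mk_add, map_add, map_add, LinearMap.add_apply, map_add, hz, hz',
      add_smul, smul_add]
  | tmul b b' =>
    rw [TensorSq.act_mk, hS, dotted_tmul, smul_assoc]
    exact congrArg (c • ·) (mul_smul _ _ _).symm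

theorem sum_dotSign_tmul (M : SMod (ONH k n m)) {N : ℕ} (w : Fin N → (ONH k n m).carrier)
    (y : M.carrier) :
    ∑ r : Fin N, SMod.tmul (upHom k n m) M (dotSign k r • xx k n m ^ (r : ℕ))
      (dotSign k r • w r • y) =
    SMod.tmul (upHom k n m) M (∑ r : Fin N, xx k n m ^ (r : ℕ) * up k n m (w r)) y := by
  have h : ∀ S : Finset (Fin N), ∑ r ∈ S, SMod.tmul (upHom k n m) M
      (dotSign k r • xx k n m ^ (r : ℕ)) (dotSign k r • w r • y) =
      SMod.tmul (upHom k n m) M (∑ r ∈ S, xx k n m ^ (r : ℕ) * up k n m (w r)) y := fun S => by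
    classical
    induction S using Finset.induction_on with
    | empty => rw [Finset.sum_empty, Finset.sum_empty, SMod.zero_tmul]
    | insert r S hr ih =>
      rw [Finset.sum_insert hr, Finset.sum_insert hr, SMod.add_tmul, ih, SMod.tmul_smul,
        SMod.smul_left_tmul, smul_smul, dotSign_mul_self, one_smul,
        SMod.balanced_tmul (upHom k n m) M]
  exact h _

/-- The Mackey decomposition for supermodules. -/
theorem mackey_bijective {N L : ℕ} (h : 2 * (m + 1) + N = n + L) (h0 : N = 0 ∨ L = 0)
    (hm : m + 1 ≤ n) (t : ℤ) (M : SMod (ONH k n (m + 1)))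
    (G : (SMod.ind (upHom k n m) (SMod.shift (t, 0) (SMod.res (upHom k n m) M))).carrier ×
        (Fin N → M.carrier) →ₗ[k] (SMod.ind (upHom k n (m + 1)) M).carrier × (Fin L → M.carrier))
    (hcross : ∀ b y, (G (SMod.tmul _ _ b y, 0)).1 = SMod.tmul (upHom k n (m + 1)) M
      ((ONH k n (m + 2)).inv 1 (up k n (m + 1) b) * -tt k n m) (SMod.unres (upHom k n m) M y))
    (hcap : ∀ b y (l : Fin L), (G (SMod.tmul _ _ b y, 0)).2 l =
      (dotSign k l • ((ONH k n (m + 1)).inv ((l : ℕ) : ZMod 2) b * xx k n m ^ (l : ℕ))) •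
        SMod.unres (upHom k n m) M y)
    (hcup : ∀ w, G (0, w) = (∑ r : Fin N, SMod.tmul (upHom k n (m + 1)) M
      (dotSign k r • xx k n (m + 1) ^ (r : ℕ)) (w r), 0)) : Function.Bijective G := by
  have key : ∀ (q : TensorSq k n m) y, G (TensorSq.act t M (-q) y, 0) =
      (SMod.tmul (upHom k n (m + 1)) M (mackeyMap k n m N L (q, 0)).1 y,
        fun l : Fin L => -dotSign k l • (mackeyMap k n m N L (q, 0)).2 l • y) := fun q y => by
    obtain ⟨z, rfl⟩ := Submodule.Quotient.mk_surjective _ q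
    rw [mackeyMap_apply, map_neg, LinearMap.neg_apply]
    have h₁ := act_crossing t M (LinearMap.fst k _ _ ∘ₗ G ∘ₗ LinearMap.inl k _ _) hcross z y
    have h₂ := fun l : Fin L => act_dotted t M l (dotSign k l)
      (LinearMap.proj l ∘ₗ LinearMap.snd k _ _ ∘ₗ G ∘ₗ LinearMap.inl k _ _)
      (fun b y => hcap b y l) z y
    have h₃ : ∀ x, G (-x, 0) = -G (x, 0) := fun x => by
      rw [← map_neg, Prod.neg_mk, neg_zero]
    rw [h₃]
    refine Prod.ext ?_ (funext fun l => ?_)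
    · refine (congrArg Neg.neg h₁).trans ?_
      rw [neg_neg]
      simp only [Pi.zero_apply, map_zero, mul_zero, Finset.sum_const_zero, add_zero]
    · refine (congrArg Neg.neg (h₂ l)).trans ?_
      exact (neg_smul _ _).symm
  refine bijective_of_rightLinear (upHom k n (m + 1)) M (TensorSq.mulRight k n m ·)
    (-TensorSq.act t M)
    (fun b q y => by
      rw [LinearMap.neg_apply, LinearMap.neg_apply, LinearMap.neg_apply, LinearMap.neg_apply,
        TensorSq.act_mulRight])
    (fun S hS => TensorSq.act_span t M S fun q y => by
      have := hS (-q) y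
      rwa [LinearMap.neg_apply, map_neg, neg_neg] at this)
    (mackeyEquiv h h0 hm) (fun b v => mackeyMap_mulRight b v) (fun r => dotSign k r)
    (fun l => -dotSign k l) (fun r => dotSign_mul_self k r)
    (fun l => by rw [neg_mul_neg, dotSign_mul_self]) G fun q w y => ?_
  have e : ((-TensorSq.act t M) q y, fun r : Fin N => dotSign k r • w r • y) =
      (TensorSq.act t M (-q) y, 0) + (0, fun r : Fin N => dotSign k r • w r • y) := by
    rw [Prod.mk_add_mk, add_zero, zero_add, map_neg, LinearMap.neg_apply]
  have e' : mackeyMap k n m N L (q, w) = mackeyMap k n m N L (q, 0) +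
      (∑ r : Fin N, xx k n (m + 1) ^ (r : ℕ) * up k n (m + 1) (w r), 0) := by
    obtain ⟨z, rfl⟩ := Submodule.Quotient.mk_surjective _ q
    rw [mackeyMap_apply, mackeyMap_apply, Prod.mk_add_mk, add_zero]
    simp only [Pi.zero_apply, map_zero, mul_zero, Finset.sum_const_zero, add_zero]
  have e'' := sum_dotSign_tmul M w y
  rw [e, map_add, key, hcup]
  change _ = (SMod.tmul (upHom k n (m + 1)) M (mackeyMap k n m N L (q, w)).1 y,
    fun l : Fin L => -dotSign k l • (mackeyMap k n m N L (q, w)).2 l • y)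
  rw [e', e'']
  refine Prod.ext (SMod.add_tmul _ _ _).symm (funext fun l => ?_)
  change _ + 0 = -dotSign k l • ((mackeyMap k n m N L (q, 0)).2 l + 0) • y
  rw [add_zero, add_zero]

/-- The Mackey decomposition at the lowest weight. -/
theorem cups_bijective (M : SMod (ONH k n 0)) {N L : ℕ} (hN : N = n) (hL : L = 0) {X : Type u}
    [AddCommGroup X] [Module k X] [Subsingleton X]
    (G : X × (Fin N → M.carrier) →ₗ[k] (SMod.ind (upHom k n 0) M).carrier × (Fin L → M.carrier))
    (hcup : ∀ w, (G (0, w)).1 = ∑ r : Fin N, SMod.tmul (upHom k n 0) M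
      (dotSign k r • xx k n 0 ^ (r : ℕ)) (w r)) : Function.Bijective G := by
  obtain rfl := hN.symm
  subst hL
  let θ : (PUnit.{u + 1} × (Fin n → (ONH k n 0).carrier)) →ₗ[k]
      (ONH k n 1).carrier × (Fin 0 → (ONH k n 0).carrier) :=
    LinearMap.prod ((∑ r : Fin n, LinearMap.mulLeft k (xx k n 0 ^ (r : ℕ)) ∘ₗ
      (up k n 0).toLinearMap ∘ₗ LinearMap.proj r) ∘ₗ LinearMap.snd k _ _) 0
  have hθ : ∀ v, θ v = (∑ r : Fin n, xx k n 0 ^ (r : ℕ) * up k n 0 (v.2 r), 0) := fun v => by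
    refine Prod.ext ?_ rfl
    change (∑ r : Fin n, LinearMap.mulLeft k (xx k n 0 ^ (r : ℕ)) ∘ₗ
      (up k n 0).toLinearMap ∘ₗ LinearMap.proj r) v.2 = _
    rw [LinearMap.sum_apply]
    rfl
  have hθ' : Function.Bijective θ := by
    constructor
    · rw [injective_iff_map_eq_zero]
      rintro ⟨q, t⟩ ht
      rw [hθ] at ht
      have h₁ := (Pres.zero k n).map_injective (Nat.zero_le n)
        (a₁ := fun r : Fin n => (ONH k n 0).inv ((r : ℕ) : ZMod 2) (t r)) (a₂ := 0) (by
          rw [map_zero]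
          refine Prod.ext ?_ (funext fun j => j.elim)
          change ∑ r : Fin n, up k n 0 ((ONH k n 0).inv ((r : ℕ) : ZMod 2) (t r)) *
            xx k n 0 ^ (r : ℕ) = 0
          have : ∑ r : Fin n, xx k n 0 ^ (r : ℕ) * up k n 0 (t r) = 0 := congrArg Prod.fst ht
          simpa only [xx_pow_mul_up] using this)
      refine Prod.ext rfl (funext fun r => ?_)
      have h₂ := congrFun h₁ r
      change t r = 0
      rw [← inv_involutive ((r : ℕ) : ZMod 2) (t r)]
      exact (congrArg _ h₂).trans (map_zero _)
    · rintro ⟨d, c⟩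
      obtain ⟨t, ht⟩ := exists_sum_of_mem_polyLT (z := d) (by rw [polyLT_zero_eq_top]; trivial)
      refine ⟨(PUnit.unit, fun r => (ONH k n 0).inv ((r : ℕ) : ZMod 2) (t r)), ?_⟩
      rw [hθ]
      refine Prod.ext ?_ (funext fun l => l.elim0)
      rw [← ht]
      simp only [xx_pow_mul_up, inv_involutive]
  refine bijective_of_rightLinear (upHom k n 0) M (fun _ q => q) 0 (fun _ _ _ => rfl)
    (fun S _ => Subsingleton.elim _ _) (LinearEquiv.ofBijective θ hθ') (fun b v => ?_)
    (fun r => dotSign k r) (fun l => l.elim0) (fun r => dotSign_mul_self k r) (fun l => l.elim0) G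
    fun q w y => ?_
  · change θ _ = ((θ v).1 * up k n 0 b, _)
    rw [hθ, hθ, Finset.sum_mul]
    refine Prod.ext ?_ (funext fun l => l.elim0)
    change ∑ r : Fin n, xx k n 0 ^ (r : ℕ) * up k n 0 (v.2 r * b) =
      ∑ r : Fin n, xx k n 0 ^ (r : ℕ) * up k n 0 (v.2 r) * up k n 0 b
    simp only [map_mul, mul_assoc]
  · refine Prod.ext ?_ (funext fun l => l.elim0)
    refine (hcup _).trans ?_
    change _ = SMod.tmul (upHom k n 0) M (θ (q, w)).1 y
    rw [hθ]
    exact sum_dotSign_tmul M w y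

end

end ONH

end OddCat

namespace OddCat

/-! ## The odd `sl₂`-isomorphisms -/

section
variable {k : Type u} [Field k] {C : Type v} [Category.{w} C] [TwoSupercat.{u, v, w, v'} k C]

theorem SlInverse.nonempty_of_isNull {b : C} {s t : b ⟶ b} {l : ℤ} {σ : Hom2 k (0, 1) s t}
    {cap : (j : ℕ) → Hom2 k (2 * (j : ℤ) + (1 - l), (j : ZMod 2)) s (𝟙 b)}
    {cup : (j : ℕ) → Hom2 k (1 + l + 2 * (j : ℤ), (j : ZMod 2)) (𝟙 b) t}
    (h : IsNull k (𝟙 b)) (hs : IsNull k s) (ht : IsNull k t) :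
    Nonempty (SlInverse k l σ cap cup) :=
  ⟨{  inv := 0
      toEF := fun _ _ => 0
      ofFE := fun _ _ => 0
      iso_EF := (hs.subsingleton_left _).elim _ _
      iso_FE := (ht.subsingleton_left _).elim _ _
      inv_cap := fun _ _ => (ht.subsingleton_left _).elim _ _
      toEF_cross := fun _ _ => (ht.subsingleton_right _).elim _ _
      toEF_cap := fun _ _ => (h.subsingleton_right _).elim _ _
      toEF_cap_ne := fun _ _ _ _ _ => (h.subsingleton_right _).elim _ _
      cup_inv := fun _ _ => (hs.subsingleton_right _).elim _ _
      cross_ofFE := fun _ _ => (hs.subsingleton_left _).elim _ _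
      cup_ofFE := fun _ _ => (h.subsingleton_right _).elim _ _
      cup_ofFE_ne := fun _ _ _ _ _ => (h.subsingleton_right _).elim _ _ }⟩

variable (k) in
/-- The invertibility of the odd `sl₂`-map. -/
def HasSlInverse {a b c : C} {e : a ⟶ b} {f : b ⟶ a} {e' : b ⟶ c} {f' : c ⟶ b} (l : ℤ)
    (x : Hom2 k (2, 1) e e) (x' : Hom2 k (2, 1) e' e') (τ : Hom2 k (-2, 1) (e ≫ e') (e ≫ e'))
    (η : Hom2 k (1 + l, 0) (𝟙 b) (e' ≫ f')) (ε : Hom2 k (1 - l, 0) (f ≫ e) (𝟙 b)) : Prop :=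
  Nonempty (SlInverse k l (crossOf τ η ε) (capOf x ε) (cupOf x' η))

end

section
variable {k : Type u} [Field k] {fg : Prop} {n m : ℕ}

theorem bijective_of_subsingleton_fst {V Y Y' Z : Type*} [Subsingleton Y] [Subsingleton Y']
    [Nonempty Y'] (G : V → Y × Z) (G' : V → Y' × Z) (h : Function.Bijective G')
    (hG : ∀ v, (G v).2 = (G' v).2) : Function.Bijective G := by
  constructor
  · intro v v' hv
    refine h.1 (Prod.ext (Subsingleton.elim _ _) ?_)
    rw [← hG, ← hG, hv]
  · rintro ⟨y, z⟩
    obtain ⟨v, hv⟩ := h.2 (Classical.arbitrary Y', z)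
    exact ⟨v, Prod.ext (Subsingleton.elim _ _) (by rw [hG, hv])⟩

theorem hasSlInverse_indProj {l : ℤ} (hl : l = 2 * (m + 1) - n) (hm : m + 1 ≤ n)
    (hf : PreservesInd fg (ONH.upHom k n m)) (hf' : PreservesRes fg (ONH.upHom k n m))
    (hg : PreservesInd fg (ONH.upHom k n (m + 1))) (hg' : PreservesRes fg (ONH.upHom k n (m + 1)))
    (t : ℤ) (e : ((-t, 0) : Deg) = (1 - l, 0))
    (hx : ONH.xx k n m ∈ (ONH k n (m + 1)).gr (2, 1))
    (hx' : ∀ a, ONH.xx k n m * (ONH.upHom k n m).map a =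
      (ONH.upHom k n m).map ((ONH k n m).inv 1 a) * ONH.xx k n m)
    (hx₁ : ONH.xx k n (m + 1) ∈ (ONH k n (m + 2)).gr (2, 1))
    (hx₁' : ∀ a, ONH.xx k n (m + 1) * (ONH.upHom k n (m + 1)).map a =
      (ONH.upHom k n (m + 1)).map ((ONH k n (m + 1)).inv 1 a) * ONH.xx k n (m + 1))
    (hz : -ONH.tt k n m ∈ (ONH k n (m + 2)).gr (-2, 1))
    (hz' : ∀ a, -ONH.tt k n m * (ONH.upHom k n (m + 1)).map ((ONH.upHom k n m).map a) =
      (ONH.upHom k n (m + 1)).map ((ONH.upHom k n m).map ((ONH k n m).inv 1 a)) * -ONH.tt k n m) :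
    HasSlInverse k l (mulProj hf (ONH.xx k n m) hx hx') (mulProj hg (ONH.xx k n (m + 1)) hx₁ hx₁')
      (mulProj₂ hf hg (-ONH.tt k n m) hz hz') (unitProj hg hg' (1 + l))
      (castDeg k e (counitProj hf hf' t)) := by
  refine SlMatrix.IsBijective.nonempty_slInverse (SlMatrix.IsBijective.of_linearMap
    fun X G h₁ h₂ => ?_)
  refine ONH.mackey_bijective (by lia) (by lia) hm t X.1 G ?_ ?_ ?_
  · intro b y
    refine (h₁ _ _).trans ?_
    refine (congrArg₂ (· + ·) (compLin_crossOf hf hg hf' hg' t l e _ hz hz' X b y)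
      (Finset.sum_eq_zero fun r _ => map_zero _)).trans (add_zero _)
  · intro b y j
    exact (h₂ _ _ j).trans (compLin_capOf hf hf' t l e _ hx hx' j X b y)
  · intro w
    refine Prod.ext ?_ (funext fun j => ?_)
    · refine (h₁ _ _).trans ?_
      refine (congrArg₂ (· + ·) (map_zero _) (Finset.sum_congr rfl fun (r : Fin _) _ =>
        compLin_cupOf hg hg' l _ hx₁ hx₁' r X (w r))).trans (zero_add _)
    · exact (h₂ _ _ j).trans (map_zero _)

theorem hasSlInverse_indProj_right {a₀ : QPCat k} {c : a₀ ⟶ sProj fg (ONH k n 0)}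
    {d : sProj fg (ONH k n 0) ⟶ a₀} {l : ℤ} (hl : l = -n)
    (hcd : ∀ X, Subsingleton (GSFun.mod (C := (sProj fg (ONH k n 0)).cat)
      (P := IsProj fg (ONH k n 0)) (d ≫ c) X))
    (hg : PreservesInd fg (ONH.upHom k n 0)) (hg' : PreservesRes fg (ONH.upHom k n 0))
    (hx₁ : ONH.xx k n 0 ∈ (ONH k n 1).gr (2, 1))
    (hx₁' : ∀ a, ONH.xx k n 0 * (ONH.upHom k n 0).map a =
      (ONH.upHom k n 0).map ((ONH k n 0).inv 1 a) * ONH.xx k n 0)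
    (x : Hom2 k (2, 1) c c) (τ : Hom2 k (-2, 1) (c ≫ indProj hg) (c ≫ indProj hg))
    (ε : Hom2 k (1 - l, 0) (d ≫ c) (𝟙 (sProj fg (ONH k n 0)))) :
    HasSlInverse k l x (mulProj hg (ONH.xx k n 0) hx₁ hx₁') τ (unitProj hg hg' (1 + l)) ε := by
  have hN : (-l).toNat = n := by rw [hl, neg_neg, Int.toNat_natCast]
  have hL : l.toNat = 0 := by rw [hl]; exact Int.toNat_neg_natCast n
  refine SlMatrix.IsBijective.nonempty_slInverse (SlMatrix.IsBijective.of_linearMap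
    fun X G h₁ h₂ => ?_)
  have := hcd X
  refine ONH.cups_bijective X.1 hN hL G fun w => (h₁ _ _).trans ?_
  exact (congrArg₂ (· + ·) (map_zero _) (Finset.sum_congr rfl fun (r : Fin _) _ =>
    compLin_cupOf hg hg' l _ hx₁ hx₁' r X (w r))).trans (zero_add _)

theorem hasSlInverse_indProj_left {c₀ : QPCat k} {c : sProj fg (ONH k n (m + 1)) ⟶ c₀}
    {d : c₀ ⟶ sProj fg (ONH k n (m + 1))} {l : ℤ} (hl : l = n) (hm : m + 1 = n)
    (hcd : ∀ X, Subsingleton (GSFun.mod (C := (sProj fg (ONH k n (m + 1))).cat)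
      (P := IsProj fg (ONH k n (m + 1))) (c ≫ d) X))
    (hf : PreservesInd fg (ONH.upHom k n m)) (hf' : PreservesRes fg (ONH.upHom k n m))
    (t : ℤ) (e : ((-t, 0) : Deg) = (1 - l, 0))
    (hx : ONH.xx k n m ∈ (ONH k n (m + 1)).gr (2, 1))
    (hx' : ∀ a, ONH.xx k n m * (ONH.upHom k n m).map a =
      (ONH.upHom k n m).map ((ONH k n m).inv 1 a) * ONH.xx k n m)
    (x : Hom2 k (2, 1) c c) (τ : Hom2 k (-2, 1) (indProj hf ≫ c) (indProj hf ≫ c))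
    (η : Hom2 k (1 + l, 0) (𝟙 (sProj fg (ONH k n (m + 1)))) (c ≫ d)) :
    HasSlInverse k l (mulProj hf (ONH.xx k n m) hx hx') x τ η
      (castDeg k e (counitProj hf hf' t)) := by
  have hN : (-l).toNat = 0 := by rw [hl]; exact Int.toNat_neg_natCast n
  have hL : 2 * (m + 1) + (-l).toNat = n + l.toNat := by
    rw [hN, hl, Int.toNat_natCast, hm]; ring
  refine SlMatrix.IsBijective.nonempty_slInverse (SlMatrix.IsBijective.of_linearMap
    fun X G h₁ h₂ => ?_)
  have := hcd X
  have := ONH.subsingleton_of_lt k (n := n) (m := m + 1 + 1) (by lia)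
  have hD : Subsingleton (SMod.ind (ONH.upHom k n (m + 1)) X.1).carrier :=
    Module.subsingleton (ONH k n (m + 1 + 1)).carrier _
  have : IsEmpty (Fin (-l).toNat) := by rw [hN]; infer_instance
  let G' : (SMod.ind (ONH.upHom k n m) (SMod.shift (t, 0) (SMod.res (ONH.upHom k n m) X.1))).carrier ×
      (Fin (-l).toNat → X.1.carrier) →ₗ[k]
      (SMod.ind (ONH.upHom k n (m + 1)) X.1).carrier × (Fin l.toNat → X.1.carrier) :=
    LinearMap.prod 0 (LinearMap.snd k _ _ ∘ₗ G)
  refine bijective_of_subsingleton_fst _ G' (ONH.mackey_bijective hL (Or.inl hN) hm.le t X.1 G'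
    (fun b y => Subsingleton.elim _ _) (fun b y j => ?_) (fun w => ?_)) (fun v => rfl)
  · exact (h₂ _ _ j).trans (compLin_capOf hf hf' t l e _ hx hx' j X b y)
  · refine Prod.ext (Subsingleton.elim _ _) ?_
    have hw : w = 0 := Subsingleton.elim _ _
    exact (congrArg (fun y => (G (0, y)).2) hw).trans (congrArg Prod.snd (map_zero G))

/-- The invertibility of the odd `sl₂`-map between objects all of whose components vanish. -/
theorem hasSlInverse_of_subsingleton {A : GSAlg k} {a₀ c₀ : QPCat k} {c : a₀ ⟶ sProj fg A}
    {d : sProj fg A ⟶ a₀} {c' : sProj fg A ⟶ c₀} {d' : c₀ ⟶ sProj fg A} {l : ℤ} (hl : l = 0)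
    (hcd : ∀ X, Subsingleton (GSFun.mod (C := (sProj fg A).cat) (P := IsProj fg A) (d ≫ c) X))
    (hcd' : ∀ X, Subsingleton (GSFun.mod (C := (sProj fg A).cat) (P := IsProj fg A) (c' ≫ d') X))
    (x : Hom2 k (2, 1) c c) (x' : Hom2 k (2, 1) c' c') (τ : Hom2 k (-2, 1) (c ≫ c') (c ≫ c'))
    (η : Hom2 k (1 + l, 0) (𝟙 (sProj fg A)) (c' ≫ d'))
    (ε : Hom2 k (1 - l, 0) (d ≫ c) (𝟙 (sProj fg A))) : HasSlInverse k l x x' τ η ε := by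
  refine SlMatrix.IsBijective.nonempty_slInverse (SlMatrix.IsBijective.of_linearMap
    fun X G _ _ => ?_)
  have := hcd X
  have := hcd' X
  have : IsEmpty (Fin (-l).toNat) := by rw [hl]; exact Fin.isEmpty
  have : IsEmpty (Fin l.toNat) := by rw [hl]; exact Fin.isEmpty
  exact ⟨fun _ _ _ => Subsingleton.elim _ _, fun y => ⟨0, Subsingleton.elim _ _⟩⟩

end

end OddCat

namespace OddCat

/-! ## The odd `sl₂`-isomorphisms between the weight categories -/

theorem strands_eq_some {n : ℕ} {l : ℤ} {m : ℕ} (h : strands n l = some m) :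
    l = 2 * m - n ∧ m ≤ n := by
  unfold strands at h
  split_ifs at h with h'
  obtain ⟨⟨r, hr⟩, h₁, h₂⟩ := h'
  have := Option.some.inj h
  lia

theorem strands_two_mul_sub {n m : ℕ} (h : m ≤ n) : strands n (2 * m - n) = some m := by
  unfold strands
  rw [if_pos ⟨⟨m, by ring⟩, by lia, by lia⟩]
  exact congrArg some (by lia)

theorem strands_eq_none {n : ℕ} {l : ℤ} (h : l < -n ∨ n < l) : strands n l = none := by
  unfold strands
  rw [if_neg (by lia)]

section
variable {k : Type u} [Field k] {fg : Prop} {n : ℕ} (hE : IndPres k fg n) (hF : ResPres k fg n)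

theorem hasSlInverse_up_up {m : ℕ} {l t : ℤ} (e : ((-t, 0) : Deg) = (1 - l, 0))
    (hl : l = 2 * (m + 1) - n) (hm : m + 1 ≤ n) :
    HasSlInverse k l (xNat hE (.up m (m + 1) rfl)) (xNat hE (.up (m + 1) (m + 2) rfl))
      (tauNat hE (.up m (m + 1) rfl) (.up (m + 1) (m + 2) rfl))
      (etaNat hE hF (1 + l) (.up (m + 1) (m + 2) rfl))
      (castDeg k e (epsNat hE hF t (.up m (m + 1) rfl))) := by
  have h₁ : HasSlInverse k l _ _ _ _ _ := hasSlInverse_indProj hl hm (hE m (m + 1) rfl)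
    (hF m (m + 1) rfl) (hE (m + 1) (m + 2) rfl) (hF (m + 1) (m + 2) rfl) t e
    (ONH.lastX_mem rfl) (ONH.lastX_supercomm rfl _) (ONH.lastX_mem rfl)
    (ONH.lastX_supercomm rfl _) (neg_mem (ONH.lastTau_mem rfl rfl)) (fun a => by
      rw [ONH.incl_incl, ONH.incl_incl, neg_mul, mul_neg]
      exact congrArg Neg.neg (ONH.lastTau_supercomm rfl rfl _ a))
  exact h₁

theorem hasSlInverse_up_zero {m : ℕ} {l t : ℤ} (e : ((-t, 0) : Deg) = (1 - l, 0)) (hl : l = n)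
    (hm : m + 1 = n) :
    HasSlInverse k l (xNat hE (.up m (m + 1) rfl)) (xNat hE (.zero (some (m + 1)) none))
      (tauNat hE (.up m (m + 1) rfl) (.zero (some (m + 1)) none))
      (etaNat hE hF (1 + l) (.zero (some (m + 1)) none))
      (castDeg k e (epsNat hE hF t (.up m (m + 1) rfl))) := by
  have h₁ : HasSlInverse k l _ _ _ _ _ := hasSlInverse_indProj_left hl hm
    (fun _ => inferInstanceAs (Subsingleton PUnit)) (hE m (m + 1) rfl)
    (hF m (m + 1) rfl) t e (ONH.lastX_mem rfl) (ONH.lastX_supercomm rfl _)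
    (xNat hE (.zero (some (m + 1)) none))
    (tauNat hE (.up m (m + 1) rfl) (.zero (some (m + 1)) none))
    (etaNat hE hF (1 + l) (.zero (some (m + 1)) none))
  exact h₁

theorem hasSlInverse_zero_up {l t : ℤ} (e : ((-t, 0) : Deg) = (1 - l, 0)) (hl : l = -n) :
    HasSlInverse k l (xNat hE (.zero none (some 0))) (xNat hE (.up 0 1 rfl))
      (tauNat hE (.zero none (some 0)) (.up 0 1 rfl)) (etaNat hE hF (1 + l) (.up 0 1 rfl))
      (castDeg k e (epsNat hE hF t (.zero none (some 0)))) := by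
  have h₁ : HasSlInverse k l _ _ _ _ _ := hasSlInverse_indProj_right hl
    (fun _ => inferInstanceAs (Subsingleton PUnit)) (hE 0 1 rfl) (hF 0 1 rfl)
    (ONH.lastX_mem rfl) (ONH.lastX_supercomm rfl _) (xNat hE (.zero none (some 0)))
    (tauNat hE (.zero none (some 0)) (.up 0 1 rfl))
    (castDeg k e (epsNat hE hF t (.zero none (some 0))))
  exact h₁

theorem hasSlInverse_zero_zero {l t : ℤ} (e : ((-t, 0) : Deg) = (1 - l, 0)) (hl : l = 0) (m : ℕ) :
    HasSlInverse k l (xNat hE (.zero none (some m))) (xNat hE (.zero (some m) none))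
      (tauNat hE (.zero none (some m)) (.zero (some m) none))
      (etaNat hE hF (1 + l) (.zero (some m) none))
      (castDeg k e (epsNat hE hF t (.zero none (some m)))) := by
  have h₁ : HasSlInverse k l _ _ _ _ _ := hasSlInverse_of_subsingleton hl
    (fun _ => inferInstanceAs (Subsingleton PUnit)) (fun _ => inferInstanceAs (Subsingleton PUnit))
    (xNat hE (.zero none (some m))) (xNat hE (.zero (some m) none))
    (tauNat hE (.zero none (some m)) (.zero (some m) none))
    (etaNat hE hF (1 + l) (.zero (some m) none))
    (castDeg k e (epsNat hE hF t (.zero none (some m))))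
  exact h₁

theorem stepOf_succ (m : ℕ) : stepOf (some m) (some (m + 1)) = .up m (m + 1) rfl := dif_pos rfl

theorem hasSlInverse_stepOf {o o' o'' : Option ℕ} {l t : ℤ} (e : ((-t, 0) : Deg) = (1 - l, 0))
    (ho : strands n (l - 2) = o) (ho' : strands n l = o') (ho'' : strands n (l + 2) = o'') :
    HasSlInverse k l (xNat hE (stepOf o o')) (xNat hE (stepOf o' o''))
      (tauNat hE (stepOf o o') (stepOf o' o'')) (etaNat hE hF (1 + l) (stepOf o' o''))
      (castDeg k e (epsNat hE hF t (stepOf o o'))) := by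
  rcases o' with _ | m
  · exact SlInverse.nonempty_of_isNull (isNull_of_none _) (isNull_of_none _) (isNull_of_none _)
  obtain ⟨hl, hm⟩ := strands_eq_some ho'
  rcases m with _ | m
  · rw [strands_eq_none (by lia)] at ho
    subst ho
    rcases n.eq_zero_or_pos with hn | hn
    · rw [strands_eq_none (by lia)] at ho''
      subst ho''
      exact hasSlInverse_zero_zero hE hF e (by lia) 0
    · obtain rfl : some 1 = o'' := ho'' ▸ (strands_two_mul_sub hn).symm.trans
        (congrArg _ (by push_cast; lia))
      rw [stepOf_succ]
      exact hasSlInverse_zero_up hE hF e (by lia)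
  · obtain rfl : some m = o := ho ▸ (strands_two_mul_sub (m.le_succ.trans hm)).symm.trans
      (congrArg _ (by push_cast at hl; lia))
    rw [stepOf_succ]
    rcases hm.eq_or_lt with hn | hn
    · rw [strands_eq_none (by lia)] at ho''
      subst ho''
      exact hasSlInverse_up_zero hE hF e (by lia) hn
    · obtain rfl : some (m + 2) = o'' := ho'' ▸ (strands_two_mul_sub hn).symm.trans
        (congrArg _ (by push_cast at hl ⊢; lia))
      rw [stepOf_succ]
      exact hasSlInverse_up_up hE hF e (by push_cast at hl; exact hl) hm

end

end OddCat

namespace OddCat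

/-! ## Induction and restriction preserve projective supermodules -/

section
variable {k : Type u} [Field k]

theorem preservesInd (fg : Prop) {A B : GSAlg k} (f : A.Hom B) : PreservesInd fg f := by
  intro M hM
  have := hM.1
  refine ⟨?_, fun h => ?_⟩
  · obtain ⟨s, hs⟩ := Module.projective_def.1 hM.1
    let θ : M.carrier →ₗ[k] (M.carrier →₀ B.carrier) :=
      Finsupp.mapRange.linearMap f.map.toLinearMap ∘ₗ s.restrictScalars k
    have hθ : ∀ (a : A.carrier) (m : M.carrier), θ (a • m) = f.map a • θ m := fun a m => by
      ext x
      change f.map (s (a • m) x) = f.map a * f.map (s m x)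
      rw [map_smul, Finsupp.smul_apply, smul_eq_mul, map_mul]
    let i₀ := SMod.indLift f (LinearMap.lcomp k (M.carrier →₀ B.carrier) θ ∘ₗ
      (Algebra.lsmul k k (M.carrier →₀ B.carrier)).toLinearMap)
      (fun b a m => by
        change (b * f.map a) • θ m = b • θ (a • m)
        rw [hθ, mul_smul])
    let i : (SMod.ind f M).carrier →ₗ[B.carrier] (M.carrier →₀ B.carrier) :=
      { i₀ with
        map_smul' := fun b x => by
          refine SMod.ind_induction (f := f) (motive := fun x => i₀ (b • x) = b • i₀ x) ?_ ?_ ?_ x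
          · rw [smul_zero, map_zero, smul_zero]
          · exact fun b' m => mul_smul b b' (θ m)
          · intro x y hx hy
            rw [smul_add, map_add, map_add, smul_add, hx, hy] }
    have hLC : ∀ v : M.carrier →₀ A.carrier, Finsupp.linearCombination B.carrier
        (fun m => SMod.tmul f M 1 m) (Finsupp.mapRange.linearMap f.map.toLinearMap v) =
        SMod.tmul f M 1 (Finsupp.linearCombination A.carrier id v) := fun v => by
      induction v using Finsupp.induction_linear with
      | zero => simp only [map_zero]; exact (SMod.indMk_zero 1).symm
      | add v w hv hw =>
        simp only [map_add, hv, hw]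
        exact (SMod.indMk_add 1 _ _).symm
      | single m a =>
        rw [Finsupp.mapRange.linearMap_apply, Finsupp.mapRange_single,
          Finsupp.linearCombination_single, Finsupp.linearCombination_single]
        exact (SMod.mul_indMk _ 1 m).trans ((congrArg (SMod.indMk f M · m)
          (by rw [mul_one]; exact (one_mul _).symm)).trans (SMod.indMk_mul_map 1 a m))
    let LC := Finsupp.linearCombination B.carrier (fun m => SMod.tmul f M 1 m)
    refine Module.Projective.of_split i LC (LinearMap.ext fun x => ?_)
    refine SMod.ind_induction (f := f) (motive := fun x => LC (i x) = x)
      ((congrArg LC (map_zero i)).trans (map_zero LC)) (fun b m => ?_) (fun x y hx hy => ?_) x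
    · exact ((map_smul LC b (θ m)).trans (congrArg (b • ·) ((hLC (s m)).trans
        (congrArg (SMod.tmul f M 1) (hs m))))).trans
        ((SMod.mul_indMk b 1 m).trans (congrArg (SMod.indMk f M · m) (mul_one b)))
    · exact (congrArg LC (map_add i x y)).trans ((map_add LC _ _).trans (congrArg₂ (· + ·) hx hy))
  · have := hM.2 h
    obtain ⟨S, hS⟩ := this.fg_top
    have key : ∀ m, SMod.tmul f M 1 m ∈ Submodule.span B.carrier (SMod.tmul f M 1 '' S) := fun m => by
      have hm : m ∈ Submodule.span A.carrier (S : Set M.carrier) := hS ▸ Submodule.mem_top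
      induction hm using Submodule.span_induction with
      | mem x hx => exact Submodule.subset_span ⟨x, hx, rfl⟩
      | zero =>
        rw [show SMod.tmul f M 1 0 = 0 from SMod.indMk_zero 1]
        exact zero_mem _
      | add x y _ _ hx hy =>
        rw [show SMod.tmul f M 1 (x + y) = _ from SMod.indMk_add 1 x y]
        exact add_mem hx hy
      | smul a x _ hx =>
        have : SMod.tmul f M 1 (a • x) = f.map a • SMod.tmul f M 1 x :=
          (SMod.indMk_mul_map 1 a x).symm.trans (((congrArg (SMod.indMk f M · x)
            (by rw [one_mul]; exact (mul_one _).symm)).trans (SMod.mul_indMk _ 1 x).symm))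
        rw [this]
        exact Submodule.smul_mem _ _ hx
    refine Module.Finite.of_fg_top (Submodule.fg_def.2 ⟨_, S.finite_toSet.image (SMod.tmul f M 1), ?_⟩)
    refine Submodule.eq_top_iff'.2 fun x => SMod.ind_induction (f := f) (motive := fun x =>
      x ∈ Submodule.span B.carrier (SMod.tmul f M 1 '' S)) (zero_mem _) (fun b m => ?_)
      (fun x y hx hy => add_mem hx hy) x
    have : SMod.indMk f M b m = b • SMod.tmul f M 1 m :=
      (congrArg (SMod.indMk f M · m) (mul_one b).symm).trans (SMod.mul_indMk b 1 m).symm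
    rw [this]
    exact Submodule.smul_mem _ _ (key m)

end

section
variable {A B N : Type*} [Ring A] [Ring B] [AddCommGroup N] [Module A B] [Module B N] [Module A N]
  [IsScalarTower A B N]

theorem projective_trans [IsScalarTower A B B] [Module.Projective A B] [Module.Projective B N] :
    Module.Projective A N := by
  obtain ⟨s, hs⟩ := Module.projective_def.1 (inferInstance : Module.Projective B N)
  classical
  have : Module.Projective A (N →₀ B) := .of_equiv' (finsuppLequivDFinsupp A).symm
  exact Module.Projective.of_split (s.restrictScalars A)
    ((Finsupp.linearCombination B id).restrictScalars A) (LinearMap.ext hs)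

end

section
variable {k : Type u} [Field k]

theorem preservesRes (fg : Prop) {A B : GSAlg k} (f : A.Hom B) (ι V : Type*) [Fintype ι] [AddCommGroup V]
    [Module A.carrier V] (θ : (ι → A.carrier) →+ B.carrier × V) (hθ : Function.Bijective θ)
    (h₁ : ∀ (a : A.carrier) (γ : ι → A.carrier), (θ (a • γ)).1 = f.map a * (θ γ).1)
    (h₂ : ∀ (a : A.carrier) (γ : ι → A.carrier), (θ (a • γ)).2 = a • (θ γ).2) :
    PreservesRes fg f := by
  intro N hN
  let _ : Module A.carrier B.carrier := Module.compHom B.carrier f.map.toRingHom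
  let _ : Module A.carrier N.carrier := Module.compHom N.carrier f.map.toRingHom
  have : IsScalarTower A.carrier B.carrier B.carrier := ⟨fun a b n => mul_assoc (f.map a) b n⟩
  have : IsScalarTower A.carrier B.carrier N.carrier := ⟨fun a b n => mul_smul (f.map a) b n⟩
  let e := LinearEquiv.ofBijective ({ θ with map_smul' := fun a γ => Prod.ext (h₁ a γ) (h₂ a γ) } :
    (ι → A.carrier) →ₗ[A.carrier] B.carrier × V) hθ
  have hB : Module.Projective A.carrier B.carrier :=
    Module.Projective.of_split (e.symm.toLinearMap ∘ₗ LinearMap.inl _ _ _)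
      (LinearMap.fst _ _ _ ∘ₗ e.toLinearMap) (LinearMap.ext fun b => by simp)
  have := hN.1
  refine ⟨projective_trans (A := A.carrier) (B := B.carrier) (N := N.carrier), fun h => ?_⟩
  have := hN.2 h
  have : Module.Finite A.carrier B.carrier :=
    Module.Finite.of_surjective (LinearMap.fst _ _ _ ∘ₗ e.toLinearMap)
      (Prod.fst_surjective.comp e.surjective)
  exact Module.Finite.trans (R := A.carrier) B.carrier N.carrier

theorem preservesRes_of_subsingleton (fg : Prop) {A B : GSAlg k} (f : A.Hom B)
    [Subsingleton B.carrier] : PreservesRes fg f := by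
  intro N _
  have : Subsingleton (SMod.res f N).carrier := Module.subsingleton B.carrier N.carrier
  exact ⟨inferInstance, fun _ => inferInstance⟩

theorem indPres (fg : Prop) (n : ℕ) : IndPres k fg n := fun _ _ _ => preservesInd fg _

theorem resPres (fg : Prop) (n : ℕ) : ResPres k fg n := by
  intro m m' h
  subst h
  rcases le_or_gt m n with hm | hm
  · obtain ⟨P⟩ := ONH.nonempty_pres k hm
    refine preservesRes fg _ P.ι (P.κ → (ONH k n m).carrier) P.map.toAddMonoidHom
      ⟨P.map_injective hm, P.map_surjective⟩ (fun a γ => ?_) (fun a γ => funext fun j => ?_)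
    · change ∑ i, ONH.up k n m (a * γ i) * P.e i =
        ONH.up k n m a * ∑ i, ONH.up k n m (γ i) * P.e i
      simp only [Finset.mul_sum, map_mul, mul_assoc]
    · change ∑ i, a * γ i * P.g i j = a * ∑ i, γ i * P.g i j
      simp only [Finset.mul_sum, mul_assoc]
  · have := ONH.subsingleton_of_lt k (n := n) (m := m + 1) (by lia)
    exact preservesRes_of_subsingleton fg _

end

end OddCat

namespace OddCat

/-! ## The representation on the weight categories -/

section
variable {k : Type u} [Field k] {C : Type v} [Category.{w} C] [TwoSupercat.{u, v, w, v'} k C]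

theorem ZigzagLeft.castDeg {a b : C} {p q q' : Deg} {f : a ⟶ b} {g : b ⟶ a}
    {η : Hom2 k p (𝟙 a) (f ≫ g)} {ε : Hom2 k q (g ≫ f) (𝟙 b)} {e : p + q = 0}
    (h : ZigzagLeft e η ε) (e' : q = q') (e'' : p + q' = 0) :
    comp2 e'' (whR η f (Category.id_comp f).symm (Category.assoc f g f).symm)
      (whL f (castDeg k e' ε) rfl (Category.comp_id f).symm) = id2 f := by
  subst e'
  exact h

theorem ZigzagRight.castDeg {a b : C} {p q q' : Deg} {f : a ⟶ b} {g : b ⟶ a}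
    {η : Hom2 k p (𝟙 a) (f ≫ g)} {ε : Hom2 k q (g ≫ f) (𝟙 b)} {e : p + q = 0}
    (h : ZigzagRight e η ε) (e' : q = q') (e'' : p + q' = 0) :
    comp2 e'' (whL g η (Category.comp_id g).symm rfl)
      (whR (castDeg k e' ε) g (Category.assoc g f g).symm (Category.id_comp g).symm) = id2 g := by
  subst e'
  exact h

theorem comp2_castDeg {a b : C} {p q q' r : Deg} {f g h : a ⟶ b} (α : Hom2 k p f g)
    (β : Hom2 k q g h) (e : q = q') (h₁ : p + q = r) (h₂ : p + q' = r) :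
    comp2 h₂ α (castDeg k e β) = comp2 h₁ α β := by
  subst e
  rfl

theorem neg_one_add_wt {a b : UObj} (h : a.wt + 2 = b.wt) :
    ((-(1 + a.wt), 0) : Deg) = (1 - b.wt, 0) :=
  Prod.ext (by simp only; lia) rfl

theorem exists_twoSuperfunctor_of_relations (obj : UObj → C)
    (E : ∀ {a b : UObj}, a.wt + 2 = b.wt → (obj a ⟶ obj b))
    (F : ∀ {a b : UObj}, a.wt + 2 = b.wt → (obj b ⟶ obj a))
    (x : ∀ {a b : UObj} (h : a.wt + 2 = b.wt), Hom2 k (2, 1) (E h) (E h))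
    (τ : ∀ {a b c : UObj} (h : a.wt + 2 = b.wt) (h' : b.wt + 2 = c.wt),
      Hom2 k (-2, 1) (E h ≫ E h') (E h ≫ E h'))
    (η : ∀ {a b : UObj} (h : a.wt + 2 = b.wt), Hom2 k (1 + a.wt, 0) (𝟙 (obj a)) (E h ≫ F h))
    (ε : ∀ {a b : UObj} (h : a.wt + 2 = b.wt),
      Hom2 k (-(1 + a.wt), 0) (F h ≫ E h) (𝟙 (obj b)))
    (hτ : ∀ {a b c : UObj} (h : a.wt + 2 = b.wt) (h' : b.wt + 2 = c.wt), SquareZero (τ h h'))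
    (hxτ : ∀ {a b c : UObj} (h : a.wt + 2 = b.wt) (h' : b.wt + 2 = c.wt),
      DotCross (x h) (x h') (τ h h'))
    (hτx : ∀ {a b c : UObj} (h : a.wt + 2 = b.wt) (h' : b.wt + 2 = c.wt),
      CrossDot (x h) (x h') (τ h h'))
    (hbr : ∀ {a b c d : UObj} (h : a.wt + 2 = b.wt) (h' : b.wt + 2 = c.wt)
      (h'' : c.wt + 2 = d.wt), Braid (τ h h') (τ h' h''))
    (hzE : ∀ {a b : UObj} (h : a.wt + 2 = b.wt), ZigzagLeft (by ext <;> simp) (η h) (ε h))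
    (hzF : ∀ {a b : UObj} (h : a.wt + 2 = b.wt), ZigzagRight (by ext <;> simp) (η h) (ε h))
    (hsl : ∀ {a b c : UObj} (h : a.wt + 2 = b.wt) (h' : b.wt + 2 = c.wt),
      HasSlInverse k b.wt (x h) (x h') (τ h h') (η h') (castDeg k (neg_one_add_wt h) (ε h)))
    (S : ShiftData k obj) :
    ∃ (Φ : TwoSuperfunctor k (fun a : Envelope UObj => obj a.as))
      (eE : ∀ (a b : UObj) (h : a.wt + 2 = b.wt), Iso2 k (Φ.map (envMap (oneE h))) (E h))
      (eF : ∀ (a b : UObj) (h : a.wt + 2 = b.wt), Iso2 k (Φ.map (envMap (oneF h))) (F h)),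
      (∀ (a b : UObj) (h : a.wt + 2 = b.wt),
        comp2 (add_zero _) (Φ.map2 (envMap2 (genX k h))) (eE a b h).hom =
          comp2 (zero_add _) (eE a b h).hom (x h)) ∧
      (∀ (a b c : UObj) (h : a.wt + 2 = b.wt) (h' : b.wt + 2 = c.wt) (h'' : a.wt + 4 = c.wt),
        comp2 (add_zero _) (Φ.map2 (envMap2 (genTau k h'')))
            (Φ.pair (envMap_comp rfl) (eE a b h) (eE b c h')) =
          comp2 (zero_add _) (Φ.pair (envMap_comp rfl) (eE a b h) (eE b c h')) (τ h h')) ∧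
      (∀ (a b : UObj) (h : a.wt + 2 = b.wt),
        comp2 (zero_add _) (Φ.mapId (Envelope.mk a)).hom
            (comp2 (add_zero _) (Φ.map2 (envMap2 (genEta k a)))
              (Φ.pair (envMap_comp rfl) (eE a b h) (eF a b h))) = η h) ∧
      (∀ (a b : UObj) (h : a.wt + 2 = b.wt)
          (e : (0 : Deg) + (-(1 + a.wt), 0) = (1 - b.wt, 0)),
        comp2 e (Φ.pair (envMap_comp rfl) (eF a b h) (eE a b h)) (ε h) =
          comp2 (add_zero _) (Φ.map2 (envMap2 (genEps k b))) (Φ.mapId (Envelope.mk b)).inv) := by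
  let R : OddModel k C :=
    { obj := obj
      E := E
      F := F
      x := x
      τ := τ
      η := η
      ε := fun h => castDeg k (neg_one_add_wt h) (ε h)
      τ_sq := hτ
      x_τ := hxτ
      τ_x := hτx
      braid := hbr
      zigzag_E := fun h => (hzE h).castDeg _ _
      zigzag_F := fun h => (hzF h).castDeg _ _
      sl := fun h h' => Classical.choice (hsl h h') }
  obtain ⟨Φ, eE, eF, h₁, h₂, h₃, h₄⟩ := R.exists_twoSuperfunctor S
  exact ⟨Φ, eE, eF, h₁, h₂, h₃, fun a b h e =>
    (comp2_castDeg _ _ (neg_one_add_wt h) e (zero_add _)).symm.trans (h₄ a b h)⟩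

end

end OddCat

theorem mainTheorem8 {𝕜 : Type u} [Field 𝕜] (h2 : (2 : 𝕜) ≠ 0) (fg : Prop) (n : ℕ) :
    (∀ m, n < m → Subsingleton (ONH 𝕜 n m).carrier) ∧
    ∃ (hE : IndPres 𝕜 fg n) (hF : ResPres 𝕜 fg n),
      (∀ (o o' : Option ℕ) (s : Step o o'),
        IsAdjunction 𝕜 (Efun hE s) (Ffun hF 0 s) (etaNat hE hF 0 s) (epsNat hE hF 0 s)) ∧
      ∃ (Φ : TwoSuperfunctor 𝕜
            (fun a : Envelope UObj => weightCat 𝕜 fg n (strands n a.as.wt)))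
        (eE : ∀ (a b : UObj) (h : a.wt + 2 = b.wt), Iso2 𝕜 (Φ.map (envMap (oneE h)))
          (Efun hE (stepOf (strands n a.wt) (strands n b.wt))))
        (eF : ∀ (a b : UObj) (h : a.wt + 2 = b.wt), Iso2 𝕜 (Φ.map (envMap (oneF h)))
          (Ffun hF (1 + a.wt) (stepOf (strands n a.wt) (strands n b.wt)))),
        (∀ (a b : UObj) (h : a.wt + 2 = b.wt),
          comp2 (add_zero _) (Φ.map2 (envMap2 (genX 𝕜 h))) (eE a b h).hom =
            comp2 (zero_add _) (eE a b h).hom (xNat hE _)) ∧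
        (∀ (a b c : UObj) (h : a.wt + 2 = b.wt) (h' : b.wt + 2 = c.wt) (h'' : a.wt + 4 = c.wt),
          comp2 (add_zero _) (Φ.map2 (envMap2 (genTau 𝕜 h'')))
              (Φ.pair (envMap_comp rfl) (eE a b h) (eE b c h')) =
            comp2 (zero_add _) (Φ.pair (envMap_comp rfl) (eE a b h) (eE b c h'))
              (tauNat hE _ _)) ∧
        (∀ (a b : UObj) (h : a.wt + 2 = b.wt),
          comp2 (zero_add _) (Φ.mapId (Envelope.mk a)).hom
              (comp2 (add_zero _) (Φ.map2 (envMap2 (genEta 𝕜 a)))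
                (Φ.pair (envMap_comp rfl) (eE a b h) (eF a b h))) =
            etaNat hE hF (1 + a.wt) _) ∧
        (∀ (a b : UObj) (h : a.wt + 2 = b.wt),
          comp2 (r := (1 - b.wt, 0)) (by ext <;> simp; lia)
              (Φ.pair (envMap_comp rfl) (eF a b h) (eE a b h)) (epsNat hE hF (1 + a.wt) _) =
            comp2 (add_zero _) (Φ.map2 (envMap2 (genEps 𝕜 b)))
              (Φ.mapId (Envelope.mk b)).inv) := by
  refine ⟨fun m hm => ONH.subsingleton_of_lt 𝕜 hm, indPres fg n, resPres fg n,
    fun o o' s => isAdjunction_Efun _ _ s, ?_⟩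
  obtain ⟨Φ, eE, eF, h₁, h₂, h₃, h₄⟩ := exists_twoSuperfunctor_of_relations
    (fun a => weightCat 𝕜 fg n (strands n a.wt))
    (fun {a b} _ => Efun (indPres fg n) (stepOf (strands n a.wt) (strands n b.wt)))
    (fun {a b} _ => Ffun (resPres fg n) (1 + a.wt) (stepOf (strands n a.wt) (strands n b.wt)))
    (fun _ => xNat _ _) (fun _ _ => tauNat _ _ _) (fun {a _} _ => etaNat _ _ (1 + a.wt) _)
    (fun {a _} _ => epsNat _ _ (1 + a.wt) _)
    (fun _ _ => squareZero_tauNat _ _ _) (fun _ _ => dotCross_tauNat _ _ _)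
    (fun _ _ => crossDot_tauNat _ _ _) (fun _ _ _ => braid_tauNat _ _ _ _)
    (fun _ => zigzagLeft_Efun _ _ _ _) (fun _ => zigzagRight_Efun _ _ _ _)
    (fun h h' => hasSlInverse_stepOf _ _ _ (congrArg (strands n) (by lia)) rfl
      (congrArg (strands n) h'))
    (weightShiftData 𝕜 fg n)
  exact ⟨Φ, eE, eF, h₁, h₂, h₃, fun a b h => h₄ a b h _⟩
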